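/- Let $(\mathcal M,\otimes,\mathbf 1)$ be a symmetric monoidal closed category with all small limits and colimits, and let $\mathfrak C$ be a set of colors with $c\in\mathfrak C$. A *profile* is a finite sequence $\underline a=(a_1,\dots,a_m)$ of colors. Profiles and permutations form a groupoid $\Sigma_{\mathfrak C}$; for $X\in\mathcal M^{\mathfrak C}$ put $X^{\underline a}=X_{a_1}\otimes\cdots\otimes X_{a_m}$. For a groupoid $D$ and functors $W:D^{op}\to\mathcal M$, $Z:D\to\mathcal M$, write $W\otimes_D Z$ for the colimit over $D$ of $W(x)\otimes Z(x)$ (using $D\cong D^{op}$); for $D=\Sigma_t$ write $\otimes_{\Sigma_t}$. Let $\mathsf O$ be a $\mathfrak C$-colored operad in $\mathcal M$, with objects $\mathsf O(d;\underline a)$, a right action of permutations of $\underline a$, equivariant associative compositions and colored units. Then $(\mathsf O\circ X)_d=\mathsf O(d;-)\otimes_{\Sigma_{\mathfrak C}}X^{(-)}$ defines a monad on $\mathcal M^{\mathfrak C}$, whose algebras are the $\mathsf O$-algebras. For an $\mathsf O$-algebra $A$, let $\mathsf O_A(d;\underline c)$ be the coequalizer of $$\mathsf O(d;-,\underline c)\otimes_{\Sigma_{\mathfrak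 C}}(\mathsf O\circ A)^{(-)}\rightrightarrows \mathsf O(d;-,\underline c)\otimes_{\Sigma_{\mathfrak C}}A^{(-)},$$ where one map is the operadic composition (with units inserted at the entries of $\underline c$) and the other is the action on $A$. It has a right action of permutations of $\underline c$. Write $tc=(c,\dots,c)$ ($t$ entries). Let $i:X\to Y$ be a map in $\mathcal M^{\mathfrak C}$ that is concentrated in the color $c$, i.e. $X_d$ and $Y_d$ are initial for $d\neq c$. For $0\le q\le t$ let $Q^t_q$ be the colimit of the subdiagram of the cube $(X_c\to Y_c)^{\otimes t}$ on those vertices with at most $q$ factors $Y_c$; it carries a $\Sigma_t$-action, and $i^{\square t}:Q^t_{t-1}\to Y^{\otimes t}$ (with $Y^{\otimes t}=Y_c^{\otimes t}$) is the induced map. Let $$\begin{array}{ccc}\mathsf O\circ X&\xrightarrow{\ f\ }&A\\ {\scriptstyle \mathrm{id}\circ i}\downarrow&&\downarrow{\scriptstyle j}\\ \mathsf O\circ Y&\xrightarrow{\ g\ }&P\end{array}$$ be a pushout square of $\mathsf O$-algebras, and let $\hat f:X_c\to A_c$ and $\hat g:Y_c\to P_c$ be the maps corresponding to $f$ and $g$.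 Then there is a sequence $A_0\xrightarrow{j_1}A_1\xrightarrow{j_2}A_2\to\cdots$ in $\mathcal M^{\mathfrak C}$ with $A_0=A$, together with maps $\iota_t:A_t\to P$ in $\mathcal M^{\mathfrak C}$ that make $P$ the colimit of the sequence, with $\iota_0=j$, and for each $d\in\mathfrak C$ and $t\ge1$ a pushout square in $\mathcal M$ $$\begin{array}{ccc}\mathsf O_A(d;tc)\otimes_{\Sigma_t}Q^t_{t-1}&\xrightarrow{\ f_*^{t-1}\ }&(A_{t-1})_d\\ {\scriptstyle \mathrm{id}\otimes_{\Sigma_t}i^{\square t}}\downarrow&&\downarrow{\scriptstyle j_t}\\ \mathsf O_A(d;tc)\otimes_{\Sigma_t}Y^{\otimes t}&\xrightarrow{\ \xi_t\ }&(A_t)_d\end{array}$$ in which $f_*^{t-1}$ is induced by $f$. Precisely, with $\xi_0:\mathsf O_A(d;\varnothing)\otimes_{\Sigma_0}\mathbf 1\to A_d$ given by the action of $\mathsf O$ on $A$: * on $\mathsf O(d;\underline a,tc)\otimes A^{\underline a}\otimes X_c\otimes Y_c^{\otimes(t-1)}$ with $t\geq 1$, $f_*^{t-1}$ is the map to $\mathsf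 O(d;(\underline a,c),(t-1)c)\otimes A^{(\underline a,c)}\otimes Y_c^{\otimes(t-1)}$ given by $\hat f$, followed by $\xi_{t-1}$; * on $\mathsf O(d;\underline a,tc)\otimes A^{\underline a}\otimes Y_c^{\otimes t}$ with $t\geq 0$, $\iota_t\xi_t$ is given by $j$ and $\hat g$ on the factors and then the action of $\mathsf O$ on $P$. This is natural: suppose given a second diagram of this kind (same $\mathsf O$ and $c$; data marked with $'$) and maps $\alpha:A\to A'$ of $\mathsf O$-algebras, $x:X\to X'$ and $y:Y\to Y'$ compatible with $i,i'$ and $f,f'$, and let $p:P\to P'$ be the induced map. Then for any two filtrations as above, of $P$ and of $P'$, there are unique maps $\varphi_t:A_t\to A'_t$ with $\varphi_0=\alpha$ that commute with the $j_t$, the $\xi_t$ (via $\alpha$ and $y$), and with the $\iota_t$ (via $p$). -/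

import Mathlib

open CategoryTheory MonoidalCategory Limits Opposite
universe w' w v u
set_option linter.unusedSectionVars false

namespace ColoredOperads
noncomputable section

section Tensor

variable {M : Type u} [Category.{v} M] [MonoidalCategory M]

/-- The tensor product of a finite sequence of objects. -/
def bigT : (n : ℕ) → (Fin n → M) → M
  | 0, _ => 𝟙_ M
  | n + 1, X => X 0 ⊗ bigT n (fun k => X k.succ)

/-- The tensor product of a finite sequence of morphisms. -/
def bigTMap : (n : ℕ) → {X Y : Fin n → M} → (∀ k, X k ⟶ Y k) → (bigT n X ⟶ bigT n Y)
  | 0, _, _, _ => 𝟙 (𝟙_ M)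
  | n + 1, _, _, f => f 0 ⊗ₘ bigTMap n (fun k => f k.succ)

theorem bigTMap_id : ∀ (n : ℕ) (X : Fin n → M), bigTMap n (fun k => 𝟙 (X k)) = 𝟙 (bigT n X)
  | 0, _ => rfl
  | n + 1, X => by
    have h := bigTMap_id n (fun k => X k.succ)
    simp only [bigTMap, bigT, h, id_tensorHom_id]

theorem bigTMap_comp : ∀ (n : ℕ) {X Y Z : Fin n → M} (f : ∀ k, X k ⟶ Y k) (g : ∀ k, Y k ⟶ Z k),
    bigTMap n f ≫ bigTMap n g = bigTMap n (fun k => f k ≫ g k)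
  | 0, _, _, _, _, _ => Category.comp_id _
  | n + 1, X, Y, Z, f, g => by
    have h := bigTMap_comp n (fun k => f k.succ) (fun k => g k.succ)
    simp only [bigTMap]
    exact (tensorHom_comp_tensorHom _ _ _ _).trans (by rw [h])

end Tensor

section Coherence

variable {M : Type u} [Category.{v} M] [MonoidalCategory M] [SymmetricCategory M]
variable {ι : Type w}

/-- The tensor product of the objects `F x`, for `x` in a list. -/
def tensL (F : ι → M) : List ι → M
  | [] => 𝟙_ M
  | x :: l => F x ⊗ tensL F l

def tensLMap {F G : ι → M} (θ : ∀ x, F x ⟶ G x) : (l : List ι) → (tensL F l ⟶ tensL G l)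
  | [] => 𝟙 (𝟙_ M)
  | x :: l => θ x ⊗ₘ tensLMap θ l

/-- `Ext x l m` witnesses that `l` is `m` with one more entry `x` inserted somewhere. -/
inductive Ext (x : ι) : List ι → List ι → Type w
  | here (l : List ι) : Ext x (x :: l) l
  | there {l m : List ι} (y : ι) (e : Ext x l m) : Ext x (y :: l) (y :: m)

/-- A certificate that the second list is a permutation of the first. -/
inductive PermCert : List ι → List ι → Type w
  | nil : PermCert [] []
  | cons {x : ι} {l l' m : List ι} (e : Ext x l' m) (p : PermCert l m) : PermCert (x :: l) l'

/-- Exchange the first two factors. -/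
def swap3 (a b r : M) : a ⊗ (b ⊗ r) ≅ b ⊗ (a ⊗ r) :=
  (α_ a b r).symm ≪≫ whiskerRightIso (β_ a b) r ≪≫ α_ b a r

theorem swap3_swap3 (a b r : M) : (swap3 a b r).hom ≫ (swap3 b a r).hom = 𝟙 _ := by
  simp [swap3, ← comp_whiskerRight_assoc]

theorem swap3_nat {a a' b b' r r' : M} (f : a ⟶ a') (g : b ⟶ b') (h : r ⟶ r') :
    (f ⊗ₘ (g ⊗ₘ h)) ≫ (swap3 a' b' r').hom = (swap3 a b r).hom ≫ (g ⊗ₘ (f ⊗ₘ h)) := by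
  simp only [swap3, Iso.trans_hom, Iso.symm_hom, whiskerRightIso_hom, Category.assoc]
  rw [associator_inv_naturality_assoc, ← associator_naturality, ← tensorHom_id, ← tensorHom_id,
    tensorHom_comp_tensorHom_assoc, tensorHom_comp_tensorHom_assoc,
    BraidedCategory.braiding_naturality, Category.comp_id, Category.id_comp]

theorem swap3_yb (x y z k : M) :
    z ◁ (swap3 y x k).hom ≫ (swap3 z x (y ⊗ k)).hom ≫ x ◁ (swap3 z y k).hom =
      (swap3 z y (x ⊗ k)).hom ≫ y ◁ (swap3 z x k).hom ≫ (swap3 y x (z ⊗ k)).hom := by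
  have h := congrArg (fun t => 𝟙 (z ⊗ y ⊗ x ⊗ k) ⊗≫ (t ▷ k) ⊗≫ 𝟙 (x ⊗ y ⊗ z ⊗ k))
    (BraidedCategory.yang_baxter' z y x)
  simp only [swap3, Iso.trans_hom, Iso.symm_hom, whiskerRightIso_hom]
  refine Eq.trans ?_ (h.symm.trans ?_) <;> monoidal

def Ext.iso (F : ι → M) : {x : ι} → {l m : List ι} → Ext x l m → (tensL F l ≅ F x ⊗ tensL F m)
  | _, _, _, .here _ => Iso.refl _
  | x, _, _, .there (m := m) y e => whiskerLeftIso (F y) (e.iso F) ≪≫ swap3 (F y) (F x) (tensL F m)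

def PermCert.hom (F : ι → M) : {l l' : List ι} → PermCert l l' → (tensL F l ⟶ tensL F l')
  | _, _, .nil => 𝟙 (𝟙_ M)
  | _, _, .cons (x := x) e p => F x ◁ p.hom F ≫ (e.iso F).inv

theorem Ext.iso_here_hom (F : ι → M) (x : ι) (l : List ι) :
    ((Ext.here (x := x) l).iso F).hom = 𝟙 (F x ⊗ tensL F l) := rfl

theorem Ext.iso_there_hom (F : ι → M) {x : ι} {l m : List ι} (y : ι) (e : Ext x l m) :
    ((Ext.there y e).iso F).hom =
      F y ◁ (e.iso F).hom ≫ (swap3 (F y) (F x) (tensL F m)).hom := rfl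

theorem PermCert.hom_cons (F : ι → M) {x : ι} {l l' m : List ι} (e : Ext x l' m)
    (p : PermCert l m) : (PermCert.cons e p).hom F = F x ◁ p.hom F ≫ (e.iso F).inv := rfl

theorem Ext.exchange {x y : ι} {l m k : List ι} (e : Ext x l m) (f : Ext y m k) :
    ∃ (m' : List ι) (f' : Ext y l m') (e' : Ext x m' k), ∀ F : ι → M,
      (e.iso F).hom ≫ F x ◁ (f.iso F).hom =
        (f'.iso F).hom ≫ F y ◁ (e'.iso F).hom ≫ (swap3 (F y) (F x) (tensL F k)).hom := by
  induction e generalizing k with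
  | here l =>
    refine ⟨_, .there x f, .here _, fun F => ?_⟩
    rw [Ext.iso_here_hom, Ext.iso_here_hom, Ext.iso_there_hom]
    dsimp only [tensL]
    simp only [Category.id_comp, MonoidalCategory.whiskerLeft_id, Category.assoc, swap3_swap3,
      Category.comp_id]
  | @there l m z e ih =>
    cases f with
    | here _ =>
      refine ⟨_, .here _, e, fun F => ?_⟩
      rw [Ext.iso_here_hom, Ext.iso_here_hom, Ext.iso_there_hom]
      dsimp only [tensL]
      simp only [Category.id_comp, MonoidalCategory.whiskerLeft_id, Category.comp_id]
    | @there _ k _ f =>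
      obtain ⟨m', f', e', h⟩ := ih f
      refine ⟨_, .there z f', .there z e', fun F => ?_⟩
      have h := congrArg (fun t => F z ◁ t) (h F)
      simp only [MonoidalCategory.whiskerLeft_comp] at h
      have n1 := swap3_nat (𝟙 (F z)) (𝟙 (F x)) (f.iso F).hom
      have n2 := swap3_nat (𝟙 (F z)) (𝟙 (F y)) (e'.iso F).hom
      simp only [id_tensorHom] at n1 n2
      have yb := swap3_yb (F x) (F y) (F z) (tensL F k)
      simp only [Ext.iso_there_hom]
      dsimp only [tensL] at n1 n2 yb h ⊢
      simp only [Category.assoc, MonoidalCategory.whiskerLeft_comp]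
      rw [← reassoc_of% n1, reassoc_of% h, yb, reassoc_of% n2]

theorem PermCert.exchange {x : ι} {l l' m : List ι} (e : Ext x l m) (p : PermCert l l') :
    ∃ (m' : List ι) (e' : Ext x l' m') (p' : PermCert m m'), ∀ F : ι → M,
      (e.iso F).hom ≫ F x ◁ p'.hom F = p.hom F ≫ (e'.iso F).hom := by
  induction p generalizing x m with
  | nil => cases e
  | @cons y l l' m0 e0 p0 ih =>
    cases e with
    | here _ =>
      refine ⟨_, e0, p0, fun F => ?_⟩
      rw [Ext.iso_here_hom, PermCert.hom_cons]
      dsimp only [tensL]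
      simp only [Category.assoc, Iso.inv_hom_id, Category.comp_id, Category.id_comp]
    | @there _ m1 _ e1 =>
      obtain ⟨m0', e0', p0', h⟩ := ih e1
      obtain ⟨m', f', g', h'⟩ := Ext.exchange (M := M) e0 e0'
      refine ⟨m', f', .cons g' p0', fun F => ?_⟩
      have h := congrArg (fun t => F y ◁ t) (h F)
      have h' := h' F
      simp only [MonoidalCategory.whiskerLeft_comp] at h
      have n1 := swap3_nat (𝟙 (F y)) (𝟙 (F x)) (p0'.hom F)
      simp only [id_tensorHom] at n1
      have h2 : (e0.iso F).inv ≫ (f'.iso F).hom = F y ◁ (e0'.iso F).hom ≫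
          (swap3 (F y) (F x) (tensL F m0')).hom ≫ F x ◁ (g'.iso F).inv := by
        rw [Iso.inv_comp_eq, reassoc_of% h', ← Category.assoc (swap3 _ _ _).hom,
          swap3_swap3]
        simp
      simp only [Ext.iso_there_hom, PermCert.hom_cons]
      dsimp only [tensL] at n1 h h2 ⊢
      simp only [Category.assoc, MonoidalCategory.whiskerLeft_comp]
      rw [h2, ← reassoc_of% n1, reassoc_of% h]

variable (M) in
theorem PermCert.comp {l l' l'' : List ι} (p : PermCert l l') (q : PermCert l' l'') :
    ∃ r : PermCert l l'', ∀ F : ι → M, r.hom F = p.hom F ≫ q.hom F := by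
  induction p generalizing l'' with
  | nil => exact ⟨q, fun F => (Category.id_comp _).symm⟩
  | cons e p ih =>
    obtain ⟨m', e', p', h⟩ := PermCert.exchange (M := M) e q
    obtain ⟨r, hr⟩ := ih p'
    refine ⟨.cons e' r, fun F => ?_⟩
    have h := h F
    rw [← Iso.eq_inv_comp, ← Category.assoc, ← Iso.comp_inv_eq] at h
    simp only [PermCert.hom_cons, hr, MonoidalCategory.whiskerLeft_comp] at h ⊢
    dsimp only [tensL] at h ⊢
    simp only [Category.assoc] at h ⊢
    rw [← h]

def PermCert.refl : (l : List ι) → PermCert l l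
  | [] => .nil
  | _ :: l => .cons (.here l) (PermCert.refl l)

theorem PermCert.refl_hom (F : ι → M) : ∀ l : List ι, (PermCert.refl l).hom F = 𝟙 _
  | [] => rfl
  | x :: l => by
    simp only [PermCert.refl, PermCert.hom, PermCert.refl_hom F l, Ext.iso]
    exact (Category.comp_id _).trans (MonoidalCategory.whiskerLeft_id _ _)

theorem Ext.perm {x : ι} {l m : List ι} (e : Ext x l m) : l.Perm (x :: m) := by
  induction e with
  | here l => exact List.Perm.refl _
  | there y e ih => exact (ih.cons y).trans (List.Perm.swap _ _ _)

theorem Ext.exists_of_mem {x : ι} {l : List ι} (h : x ∈ l) : ∃ m, Nonempty (Ext x l m) := by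
  induction l with
  | nil => simp at h
  | cons y l ih =>
    rcases List.mem_cons.1 h with rfl | h
    · exact ⟨l, ⟨.here _⟩⟩
    · obtain ⟨m, ⟨e⟩⟩ := ih h
      exact ⟨y :: m, ⟨.there y e⟩⟩

theorem PermCert.nonempty {l l' : List ι} (h : l.Perm l') : Nonempty (PermCert l l') := by
  induction l generalizing l' with
  | nil => rw [List.nil_perm.1 h]; exact ⟨.nil⟩
  | cons x l ih =>
    obtain ⟨m, ⟨e⟩⟩ := Ext.exists_of_mem (h.subset List.mem_cons_self)
    obtain ⟨p⟩ := ih ((List.perm_cons x).1 (h.trans e.perm))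
    exact ⟨.cons e p⟩

theorem Ext.unique {x : ι} {l m m' : List ι} (hl : l.Nodup) (e : Ext x l m) (e' : Ext x l m') :
    (⟨m, e⟩ : Σ m, Ext x l m) = ⟨m', e'⟩ := by
  induction e generalizing m' with
  | here l =>
    cases e' with
    | here _ => rfl
    | there y e' =>
      exact absurd (e'.perm.symm.subset List.mem_cons_self) (List.nodup_cons.1 hl).1
  | @there l m y e ih =>
    cases e' with
    | here _ =>
      exact absurd (e.perm.symm.subset List.mem_cons_self) (List.nodup_cons.1 hl).1
    | @there _ m' _ e' =>
      have := ih (List.nodup_cons.1 hl).2 e'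
      cases this
      rfl

theorem PermCert.unique {l l' : List ι} (hl : l'.Nodup) (p q : PermCert l l') : p = q := by
  induction p with
  | nil => cases q; rfl
  | @cons x l l' m e p ih =>
    cases q with
    | @cons _ _ _ m' e' q =>
      cases Ext.unique hl e e'
      rw [ih (List.nodup_cons.1 (e.perm.nodup_iff.1 hl)).2 q]

theorem Ext.nat {F G : ι → M} (θ : ∀ x, F x ⟶ G x) {x : ι} {l m : List ι} (e : Ext x l m) :
    tensLMap θ l ≫ (e.iso G).hom = (e.iso F).hom ≫ (θ x ⊗ₘ tensLMap θ m) := by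
  induction e with
  | here l => exact (Category.comp_id _).trans (Category.id_comp _).symm
  | @there l m y e ih =>
    have n1 := swap3_nat (θ y) (θ x) (tensLMap θ m)
    simp only [Ext.iso_there_hom]
    dsimp only [tensL, tensLMap] at n1 ih ⊢
    rw [Category.assoc, ← n1, ← id_tensorHom, ← id_tensorHom, tensorHom_comp_tensorHom_assoc,
      tensorHom_comp_tensorHom_assoc, ih, Category.comp_id, Category.id_comp]

theorem PermCert.nat {F G : ι → M} (θ : ∀ x, F x ⟶ G x) {l l' : List ι} (p : PermCert l l') :
    tensLMap θ l ≫ p.hom G = p.hom F ≫ tensLMap θ l' := by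
  induction p with
  | nil => rfl
  | @cons x l l' m e p ih =>
    have h := e.nat θ
    have h2 : (θ x ⊗ₘ tensLMap θ m) ≫ (e.iso G).inv = (e.iso F).inv ≫ tensLMap θ l' := by
      rw [Iso.comp_inv_eq, Category.assoc, h, Iso.inv_hom_id_assoc]
    simp only [PermCert.hom_cons]
    dsimp only [tensL, tensLMap] at ih h2 ⊢
    rw [Category.assoc, ← h2, ← id_tensorHom, ← id_tensorHom, tensorHom_comp_tensorHom_assoc,
      tensorHom_comp_tensorHom_assoc, ih, Category.comp_id, Category.id_comp]

end Coherence

section Coherence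
variable {M : Type u} [Category.{v} M] [MonoidalCategory M] [SymmetricCategory M]
variable {ι : Type w} {κ : Type w'}

def appIso (F : ι → M) : (l k : List ι) → (tensL F (l ++ k) ≅ tensL F l ⊗ tensL F k)
  | [], _ => (λ_ _).symm
  | x :: l, k => whiskerLeftIso (F x) (appIso F l k) ≪≫ (α_ _ _ _).symm

theorem appIso_nil_hom (F : ι → M) (k : List ι) :
    (appIso F [] k).hom = (λ_ (tensL F k)).inv := rfl

theorem appIso_cons_hom (F : ι → M) (x : ι) (l k : List ι) :
    (appIso F (x :: l) k).hom = F x ◁ (appIso F l k).hom ≫ (α_ _ _ _).inv := rfl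

theorem appIso_nil_inv (F : ι → M) (k : List ι) :
    (appIso F [] k).inv = (λ_ (tensL F k)).hom := rfl

theorem appIso_cons_inv (F : ι → M) (x : ι) (l k : List ι) :
    (appIso F (x :: l) k).inv = (α_ _ _ _).hom ≫ F x ◁ (appIso F l k).inv := rfl

theorem appIso_nat {F G : ι → M} (θ : ∀ x, F x ⟶ G x) (l k : List ι) :
    tensLMap θ (l ++ k) ≫ (appIso G l k).hom =
      (appIso F l k).hom ≫ (tensLMap θ l ⊗ₘ tensLMap θ k) := by
  induction l with
  | nil =>
    rw [appIso_nil_hom, appIso_nil_hom]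
    dsimp only [tensL, tensLMap, List.nil_append]
    rw [id_tensorHom, leftUnitor_inv_naturality]
  | cons x l ih =>
    rw [appIso_cons_hom, appIso_cons_hom]
    dsimp only [tensL, tensLMap, List.cons_append, List.append_eq] at ih ⊢
    rw [Category.assoc, ← associator_inv_naturality, ← id_tensorHom, ← id_tensorHom,
      tensorHom_comp_tensorHom_assoc, tensorHom_comp_tensorHom_assoc, ih, Category.comp_id,
      Category.id_comp]

theorem Ext.append {x : ι} {l m : List ι} (e : Ext x l m) (k : List ι) :
    ∃ e' : Ext x (l ++ k) (m ++ k), ∀ F : ι → M,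
      (e'.iso F).hom ≫ F x ◁ (appIso F m k).hom =
        (appIso F l k).hom ≫ (e.iso F).hom ▷ _ ≫ (α_ _ _ _).hom := by
  induction e with
  | here l =>
    refine ⟨.here (l ++ k), fun F => ?_⟩
    have h1 : ((Ext.here (x := x) (l ++ k)).iso F).hom = 𝟙 _ := rfl
    have h2 : ((Ext.here (x := x) l).iso F).hom = 𝟙 _ := rfl
    rw [h2, appIso_cons_hom]
    dsimp only [tensL, List.cons_append, List.append_eq] at h1 ⊢
    rw [h1]
    simp
  | @there l m y e ih =>
    obtain ⟨e', h⟩ := ih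
    refine ⟨.there y e', fun F => ?_⟩
    have h := congrArg (fun t => F y ◁ t) (h F)
    simp only [MonoidalCategory.whiskerLeft_comp] at h
    have n1 := swap3_nat (𝟙 (F y)) (𝟙 (F x)) (appIso F m k).hom
    simp only [id_tensorHom] at n1
    rw [Ext.iso_there_hom, Ext.iso_there_hom, appIso_cons_hom, appIso_cons_hom]
    dsimp only [tensL, List.cons_append, List.append_eq] at h n1 ⊢
    simp only [Category.assoc, MonoidalCategory.whiskerLeft_comp]
    rw [← reassoc_of% n1, reassoc_of% h]
    simp only [swap3, Iso.trans_hom, Iso.symm_hom, whiskerRightIso_hom]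
    monoidal

theorem PermCert.append {l l' k k' : List ι} (p : PermCert l l') (q : PermCert k k') :
    ∃ r : PermCert (l ++ k) (l' ++ k'), ∀ F : ι → M,
      r.hom F ≫ (appIso F l' k').hom = (appIso F l k).hom ≫ (p.hom F ⊗ₘ q.hom F) := by
  induction p with
  | nil =>
    refine ⟨q, fun F => ?_⟩
    rw [appIso_nil_hom, appIso_nil_hom]
    dsimp only [List.nil_append, PermCert.hom, tensL]
    rw [id_tensorHom, leftUnitor_inv_naturality]
  | @cons x l l' m e p ih =>
    obtain ⟨r, hr⟩ := ih
    obtain ⟨e', he⟩ := Ext.append (M := M) e k'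
    refine ⟨.cons e' r, fun F => ?_⟩
    have hr := congrArg (fun t => F x ◁ t) (hr F)
    simp only [MonoidalCategory.whiskerLeft_comp] at hr
    have he : (e'.iso F).inv ≫ (appIso F l' k').hom = F x ◁ (appIso F m k').hom ≫
        (α_ _ _ _).inv ≫ (e.iso F).inv ▷ _ := by
      rw [Iso.inv_comp_eq, reassoc_of% (he F), Iso.hom_inv_id_assoc, ← comp_whiskerRight,
        Iso.hom_inv_id, id_whiskerRight, Category.comp_id]
    rw [PermCert.hom_cons, PermCert.hom_cons, appIso_cons_hom]
    dsimp only [tensL, List.cons_append, List.append_eq] at hr he ⊢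
    rw [Category.assoc, he, reassoc_of% hr]
    rw [← id_tensorHom _ (p.hom F ⊗ₘ q.hom F), associator_inv_naturality_assoc, ← tensorHom_id,
      tensorHom_comp_tensorHom, Category.comp_id, id_tensorHom, Category.assoc]

theorem PermCert.assoc (a b c : List ι) :
    ∃ r : PermCert ((a ++ b) ++ c) (a ++ (b ++ c)), ∀ F : ι → M,
      r.hom F ≫ (appIso F a (b ++ c)).hom ≫ _ ◁ (appIso F b c).hom =
        (appIso F (a ++ b) c).hom ≫ (appIso F a b).hom ▷ _ ≫ (α_ _ _ _).hom := by
  induction a with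
  | nil =>
    refine ⟨.refl _, fun F => ?_⟩
    rw [PermCert.refl_hom, appIso_nil_hom, appIso_nil_hom]
    dsimp only [tensL, List.nil_append]
    simp
  | cons x a ih =>
    obtain ⟨r, hr⟩ := ih
    refine ⟨.cons (.here _) r, fun F => ?_⟩
    have hr := congrArg (fun t => F x ◁ t) (hr F)
    simp only [MonoidalCategory.whiskerLeft_comp] at hr
    have h1 : ((Ext.here (x := x) (a ++ (b ++ c))).iso F).inv = 𝟙 _ := rfl
    have h2 : (appIso F (x :: a ++ b) c).hom = F x ◁ (appIso F (a ++ b) c).hom ≫ (α_ _ _ _).inv := rfl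
    rw [PermCert.hom_cons, h2, appIso_cons_hom, appIso_cons_hom]
    dsimp only [tensL, List.cons_append, List.append_eq] at hr h1 ⊢
    rw [h1]
    simp only [Category.id_comp, Category.assoc]
    rw [← associator_inv_naturality_right, reassoc_of% hr]
    simp

theorem PermCert.rightNil (a : List ι) :
    ∃ r : PermCert a (a ++ []), ∀ F : ι → M,
      r.hom F ≫ (appIso F a []).hom = (ρ_ _).inv := by
  induction a with
  | nil =>
    refine ⟨.refl _, fun F => ?_⟩
    rw [PermCert.refl_hom, appIso_nil_hom]
    dsimp only [tensL, List.nil_append]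
    simp [unitors_inv_equal]
  | cons x a ih =>
    obtain ⟨r, hr⟩ := ih
    refine ⟨.cons (.here _) r, fun F => ?_⟩
    have hr := congrArg (fun t => F x ◁ t) (hr F)
    simp only [MonoidalCategory.whiskerLeft_comp] at hr
    have h1 : ((Ext.here (x := x) (a ++ [])).iso F).inv = 𝟙 _ := rfl
    rw [PermCert.hom_cons, appIso_cons_hom]
    dsimp only [tensL, List.cons_append, List.append_eq] at hr h1 ⊢
    rw [h1]
    simp only [Category.id_comp, Category.assoc]
    rw [reassoc_of% hr]
    simp

theorem swap3_tensor (x y b c : M) :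
    (swap3 (x ⊗ y) b c).hom = (α_ x y (b ⊗ c)).hom ≫ x ◁ (swap3 y b c).hom ≫
      (swap3 x b (y ⊗ c)).hom ≫ b ◁ (α_ x y c).inv := by
  simp only [swap3, Iso.trans_hom, Iso.symm_hom, whiskerRightIso_hom,
    BraidedCategory.braiding_tensor_left_hom]
  monoidal

theorem Ext.past (x : ι) (b r : List ι) :
    ∃ e : Ext x (b ++ x :: r) (b ++ r), ∀ F : ι → M,
      (e.iso F).hom ≫ F x ◁ (appIso F b r).hom =
        (appIso F b (x :: r)).hom ≫ (swap3 (tensL F b) (F x) (tensL F r)).hom := by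
  induction b with
  | nil =>
    refine ⟨.here r, fun F => ?_⟩
    have h1 : ((Ext.here (x := x) r).iso F).hom = 𝟙 _ := rfl
    have h2 : (appIso F [] (x :: r)).hom = (λ_ (F x ⊗ tensL F r)).inv := rfl
    rw [appIso_nil_hom]
    dsimp only [tensL, List.nil_append] at h1 h2 ⊢
    rw [h1, h2]
    simp [swap3]
  | cons y b ih =>
    obtain ⟨e, he⟩ := ih
    refine ⟨.there y e, fun F => ?_⟩
    have he := congrArg (fun t => F y ◁ t) (he F)
    dsimp only [tensL] at he
    simp only [MonoidalCategory.whiskerLeft_comp] at he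
    have n1 := swap3_nat (𝟙 (F y)) (𝟙 (F x)) (appIso F b r).hom
    simp only [id_tensorHom] at n1
    rw [Ext.iso_there_hom, appIso_cons_hom, appIso_cons_hom]
    dsimp only [tensL, List.cons_append, List.append_eq] at he n1 ⊢
    rw [swap3_tensor]
    simp only [MonoidalCategory.whiskerLeft_comp, Category.assoc, Iso.inv_hom_id_assoc]
    rw [← reassoc_of% n1, reassoc_of% he]

theorem PermCert.blockSwap (a b c : List ι) :
    ∃ p : PermCert (a ++ (b ++ c)) (b ++ (a ++ c)), ∀ F : ι → M,
      p.hom F ≫ (appIso F b (a ++ c)).hom ≫ _ ◁ (appIso F a c).hom =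
        (appIso F a (b ++ c)).hom ≫ _ ◁ (appIso F b c).hom ≫
          (swap3 (tensL F a) (tensL F b) (tensL F c)).hom := by
  induction a with
  | nil =>
    refine ⟨.refl _, fun F => ?_⟩
    rw [PermCert.refl_hom, appIso_nil_hom, appIso_nil_hom]
    dsimp only [tensL, List.nil_append]
    simp [swap3]
  | cons x a ih =>
    obtain ⟨p, hp⟩ := ih
    obtain ⟨e, he⟩ := Ext.past (M := M) x b (a ++ c)
    refine ⟨.cons e p, fun F => ?_⟩
    have hp := congrArg (fun t => F x ◁ t) (hp F)
    simp only [MonoidalCategory.whiskerLeft_comp] at hp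
    have he : (e.iso F).inv ≫ (appIso F b (x :: (a ++ c))).hom =
        F x ◁ (appIso F b (a ++ c)).hom ≫ (swap3 (F x) (tensL F b) (tensL F (a ++ c))).hom := by
      have he := he F
      dsimp only [tensL] at he ⊢
      rw [Iso.inv_comp_eq, reassoc_of% he, swap3_swap3, Category.comp_id]
    have n1 := swap3_nat (𝟙 (F x)) (𝟙 (tensL F b)) (appIso F a c).hom
    simp only [id_tensorHom] at n1
    rw [PermCert.hom_cons, appIso_cons_hom, appIso_cons_hom]
    dsimp only [tensL, List.cons_append, List.append_eq] at hp he n1 ⊢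
    rw [swap3_tensor]
    simp only [MonoidalCategory.whiskerLeft_comp, Category.assoc, Iso.inv_hom_id_assoc]
    rw [reassoc_of% he, ← reassoc_of% n1, reassoc_of% hp]
    simp

end Coherence

section Coherence
variable {M : Type u} [Category.{v} M] [MonoidalCategory M] [SymmetricCategory M]
variable {ι : Type w} {κ : Type w'}

/-- The concatenation of the lists `f x`, for `x` in a list. -/
def flatL (f : κ → List ι) : List κ → List ι
  | [] => []
  | x :: l => f x ++ flatL f l

def flatIso (F : ι → M) (f : κ → List ι) :
    (l : List κ) → (tensL F (flatL f l) ≅ tensL (fun x => tensL F (f x)) l)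
  | [] => Iso.refl _
  | x :: l => appIso F (f x) (flatL f l) ≪≫ whiskerLeftIso _ (flatIso F f l)

theorem flatIso_cons_hom (F : ι → M) (f : κ → List ι) (x : κ) (l : List κ) :
    (flatIso F f (x :: l)).hom = (appIso F (f x) (flatL f l)).hom ≫ _ ◁ (flatIso F f l).hom := rfl

theorem Ext.flat (f : κ → List ι) {x : κ} {l m : List κ} (e : Ext x l m) :
    ∃ p : PermCert (f x ++ flatL f m) (flatL f l), ∀ F : ι → M,
      p.hom F ≫ (flatIso F f l).hom ≫ (e.iso _).hom =
        (appIso F (f x) (flatL f m)).hom ≫ _ ◁ (flatIso F f m).hom := by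
  induction e with
  | here l =>
    refine ⟨.refl _, fun F => ?_⟩
    have h1 : ((Ext.here (x := x) l).iso fun x => tensL F (f x)).hom = 𝟙 _ := rfl
    rw [flatIso_cons_hom]
    dsimp only [tensL, flatL] at h1 ⊢
    rw [PermCert.refl_hom, h1, Category.id_comp, Category.comp_id]
  | @there l m y e ih =>
    obtain ⟨p, hp⟩ := ih
    obtain ⟨b, hb⟩ := PermCert.blockSwap (M := M) (f x) (f y) (flatL f m)
    obtain ⟨q, hq⟩ := PermCert.append (M := M) (.refl (f y)) p
    obtain ⟨r, hr⟩ := PermCert.comp M b q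
    refine ⟨r, fun F => ?_⟩
    have hp := congrArg (fun t => tensL F (f y) ◁ t) (hp F)
    have hb := hb F
    have hq := hq F
    have n1 := swap3_nat (𝟙 (tensL F (f x))) (𝟙 (tensL F (f y))) (flatIso F f m).hom
    have hr := hr F
    rw [Ext.iso_there_hom, flatIso_cons_hom, flatIso_cons_hom]
    dsimp only [tensL, flatL] at hp hb hq n1 hr ⊢
    rw [hr]
    simp only [MonoidalCategory.whiskerLeft_comp, PermCert.refl_hom, id_tensorHom] at hp hq n1
    simp only [Category.assoc, MonoidalCategory.whiskerLeft_comp]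
    rw [reassoc_of% hq, reassoc_of% hp, reassoc_of% hb, ← reassoc_of% n1, swap3_swap3,
      Category.comp_id]

theorem PermCert.flat (f : κ → List ι) {l l' : List κ} (p : PermCert l l') :
    ∃ q : PermCert (flatL f l) (flatL f l'), ∀ F : ι → M,
      q.hom F ≫ (flatIso F f l').hom = (flatIso F f l).hom ≫ p.hom _ := by
  induction p with
  | nil => exact ⟨.nil, fun F => rfl⟩
  | @cons x l l' m e p ih =>
    obtain ⟨q, hq⟩ := ih
    obtain ⟨c, hc⟩ := Ext.flat (M := M) f e
    obtain ⟨b, hb⟩ := PermCert.append (M := M) (.refl (f x)) q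
    obtain ⟨r, hr⟩ := PermCert.comp M b c
    refine ⟨r, fun F => ?_⟩
    have hb := hb F
    have hc := hc F
    have hq := congrArg (fun t => tensL F (f x) ◁ t) (hq F)
    have hr := hr F
    rw [PermCert.hom_cons, flatIso_cons_hom]
    dsimp only [tensL, flatL] at hb hq hc hr ⊢
    rw [hr]
    simp only [MonoidalCategory.whiskerLeft_comp, PermCert.refl_hom, id_tensorHom] at hb hq
    simp only [Category.assoc]
    rw [← reassoc_of% hq, ← reassoc_of% hb, ← reassoc_of% hc, Iso.hom_inv_id, Category.comp_id]

theorem PermCert.flatAppend (f : κ → List ι) (l k : List κ) :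
    ∃ p : PermCert (flatL f l ++ flatL f k) (flatL f (l ++ k)), ∀ F : ι → M,
      p.hom F ≫ (flatIso F f (l ++ k)).hom ≫ (appIso _ l k).hom =
        (appIso F (flatL f l) (flatL f k)).hom ≫ ((flatIso F f l).hom ⊗ₘ (flatIso F f k).hom) := by
  induction l with
  | nil =>
    refine ⟨.refl _, fun F => ?_⟩
    have h1 : (flatIso F f []).hom = 𝟙 (𝟙_ M) := rfl
    rw [h1]
    have h2 : (appIso F (flatL f []) (flatL f k)).hom = (λ_ (tensL F (flatL f k))).inv := rfl
    rw [h2]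
    dsimp only [flatL, List.nil_append, tensL]
    rw [PermCert.refl_hom, appIso_nil_hom, id_tensorHom, Category.id_comp, leftUnitor_inv_naturality]
  | cons x l ih =>
    obtain ⟨p, hp⟩ := ih
    obtain ⟨a, ha⟩ := PermCert.assoc (M := M) (f x) (flatL f l) (flatL f k)
    obtain ⟨b, hb⟩ := PermCert.append (M := M) (.refl (f x)) p
    obtain ⟨r, hr⟩ := PermCert.comp M a b
    refine ⟨r, fun F => ?_⟩
    have hp := congrArg (fun t => tensL F (f x) ◁ t) (hp F)
    have ha := ha F
    have hb := hb F
    have h1 : (flatIso F f (x :: l ++ k)).hom =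
      (appIso F (f x) (flatL f (l ++ k))).hom ≫ _ ◁ (flatIso F f (l ++ k)).hom := rfl
    have hr := hr F
    rw [h1, appIso_cons_hom, flatIso_cons_hom]
    dsimp only [tensL, flatL, List.cons_append, List.append_eq] at hp ha hb hr ⊢
    rw [hr]
    simp only [MonoidalCategory.whiskerLeft_comp, PermCert.refl_hom, id_tensorHom] at hp hb
    simp only [Category.assoc]
    rw [reassoc_of% hb, reassoc_of% hp]
    have ha' := congrArg (fun t => t ≫ _ ◁ ((flatIso F f l).hom ⊗ₘ (flatIso F f k).hom) ≫
      (α_ _ _ _).inv) ha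
    simp only [Category.assoc] at ha'
    rw [ha', ← id_tensorHom, ← associator_naturality_assoc, Iso.hom_inv_id, Category.comp_id,
      ← tensorHom_id, tensorHom_comp_tensorHom, Category.id_comp, id_tensorHom]

end Coherence

section Tree

/-- Shapes of iterated tensor products of objects indexed by `ι`. -/
inductive Tree (ι : Type w) : Type w
  | leaf (x : ι) : Tree ι
  | pair (s t : Tree ι) : Tree ι
  | node (n : ℕ) (t : Fin n → Tree ι) : Tree ι

variable {M : Type u} [Category.{v} M] [MonoidalCategory M] 
variable {ι : Type w} {κ : Type w'}

/-- The tensor product of shape `t` of the objects `F x`. -/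
def Tree.eval (F : ι → M) : Tree ι → M
  | .leaf x => F x
  | .pair s t => s.eval F ⊗ t.eval F
  | .node n t => bigT n (fun k => (t k).eval F)

def Tree.map {F G : ι → M} (θ : ∀ x, F x ⟶ G x) : (t : Tree ι) → (t.eval F ⟶ t.eval G)
  | .leaf x => θ x
  | .pair s t => s.map θ ⊗ₘ t.map θ
  | .node n t => bigTMap n (fun k => (t k).map θ)

/-- Replace each label by a shape. -/
def Tree.bind (f : κ → Tree ι) : Tree κ → Tree ι
  | .leaf x => f x
  | .pair s t => .pair (s.bind f) (t.bind f)
  | .node n t => .node n (fun k => (t k).bind f)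

def catL : (n : ℕ) → (Fin n → List ι) → List ι
  | 0, _ => []
  | n + 1, l => l 0 ++ catL n (fun k => l k.succ)

/-- The labels of a shape, from left to right. -/
def Tree.leaves : Tree ι → List ι
  | .leaf x => [x]
  | .pair s t => s.leaves ++ t.leaves
  | .node n t => catL n (fun k => (t k).leaves)

/-- The number of occurrences of a label. -/
def Tree.cnt [DecidableEq ι] (x : ι) : Tree ι → ℕ
  | .leaf y => if y = x then 1 else 0
  | .pair s t => s.cnt x + t.cnt x
  | .node n t => ∑ k : Fin n, (t k).cnt x

theorem catL_count [DecidableEq ι] (x : ι) : ∀ (n : ℕ) (l : Fin n → List ι),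
    (catL n l).count x = ∑ k, (l k).count x
  | 0, _ => rfl
  | n + 1, l => by rw [catL, List.count_append, catL_count x n, Fin.sum_univ_succ]

theorem Tree.leaves_count [DecidableEq ι] (x : ι) (t : Tree ι) : t.leaves.count x = t.cnt x := by
  induction t with
  | leaf y => simp [Tree.leaves, Tree.cnt, List.count_singleton]
  | pair s t hs ht => simp [Tree.leaves, Tree.cnt, hs, ht]
  | node n t ih => simp [Tree.leaves, Tree.cnt, catL_count, ih]

end Tree

section Coherence
variable {M : Type u} [Category.{v} M] [MonoidalCategory M] 
variable {ι : Type w} {κ : Type w'}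

def bigTIso (n : ℕ) {X Y : Fin n → M} (f : ∀ k, X k ≅ Y k) : bigT n X ≅ bigT n Y where
  hom := bigTMap n (fun k => (f k).hom)
  inv := bigTMap n (fun k => (f k).inv)
  hom_inv_id := by simp [bigTMap_comp, bigTMap_id]
  inv_hom_id := by simp [bigTMap_comp, bigTMap_id]

def catIso (F : ι → M) : (n : ℕ) → (l : Fin n → List ι) →
    (tensL F (catL n l) ≅ bigT n (fun k => tensL F (l k)))
  | 0, _ => Iso.refl _
  | n + 1, l => appIso F (l 0) (catL n fun k => l k.succ) ≪≫
      whiskerLeftIso _ (catIso F n (fun k => l k.succ))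

theorem catIso_succ_hom (F : ι → M) (n : ℕ) (l : Fin (n + 1) → List ι) :
    (catIso F (n + 1) l).hom = (appIso F (l 0) (catL n fun k => l k.succ)).hom ≫
      _ ◁ (catIso F n (fun k => l k.succ)).hom := rfl

/-- Rebracketing: an iterated tensor product is the tensor product of the list of its labels. -/
def Tree.norm (F : ι → M) : (t : Tree ι) → (t.eval F ≅ tensL F t.leaves)
  | .leaf _ => (ρ_ _).symm
  | .pair s t => (s.norm F ⊗ᵢ t.norm F) ≪≫ (appIso F s.leaves t.leaves).symm
  | .node n t => bigTIso n (fun k => (t k).norm F) ≪≫ (catIso F n (fun k => (t k).leaves)).symm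

theorem Tree.map_id (F : ι → M) (t : Tree ι) : t.map (fun x => 𝟙 (F x)) = 𝟙 (t.eval F) := by
  induction t with
  | leaf x => rfl
  | pair s t hs ht =>
    simp only [Tree.map, hs, ht]
    exact id_tensorHom_id _ _
  | node n t ih =>
    simp only [Tree.map, ih]
    exact bigTMap_id _ _

theorem Tree.map_comp {F G H : ι → M} (θ : ∀ x, F x ⟶ G x) (η : ∀ x, G x ⟶ H x) (t : Tree ι) :
    t.map θ ≫ t.map η = t.map (fun x => θ x ≫ η x) := by
  induction t with
  | leaf x => rfl
  | pair s t hs ht =>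
    simp only [Tree.map, ← hs, ← ht]
    exact tensorHom_comp_tensorHom _ _ _ _
  | node n t ih =>
    simp only [Tree.map, ← ih]
    exact bigTMap_comp _ _ _

theorem tensLMap_id (F : ι → M) : ∀ l : List ι, tensLMap (fun x => 𝟙 (F x)) l = 𝟙 (tensL F l)
  | [] => rfl
  | x :: l => by
    simp only [tensLMap, tensLMap_id F l]
    exact id_tensorHom_id _ _

end Coherence

section
variable {M : Type u} [Category.{v} M] [MonoidalCategory M] [SymmetricCategory M]
variable {ι : Type w} {κ : Type w'}

theorem catIso_nat {F G : ι → M} (θ : ∀ x, F x ⟶ G x) : ∀ (n : ℕ) (l : Fin n → List ι),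
    tensLMap θ (catL n l) ≫ (catIso G n l).hom =
      (catIso F n l).hom ≫ bigTMap n (fun k => tensLMap θ (l k))
  | 0, _ => (Category.comp_id _).trans (Category.id_comp _).symm
  | n + 1, l => by
    have h := catIso_nat θ n (fun k => l k.succ)
    have h2 := appIso_nat θ (l 0) (catL n fun k => l k.succ)
    rw [catIso_succ_hom, catIso_succ_hom]
    dsimp only [catL, bigT, bigTMap] at h h2 ⊢
    rw [reassoc_of% h2, ← id_tensorHom, ← id_tensorHom, tensorHom_comp_tensorHom, h, Category.assoc,
      tensorHom_comp_tensorHom, Category.id_comp, Category.comp_id]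

theorem Tree.norm_nat {F G : ι → M} (θ : ∀ x, F x ⟶ G x) (t : Tree ι) :
    t.map θ ≫ (t.norm G).hom = (t.norm F).hom ≫ tensLMap θ t.leaves := by
  induction t with
  | leaf x =>
    change θ x ≫ (ρ_ _).inv = (ρ_ _).inv ≫ (θ x ⊗ₘ 𝟙 (𝟙_ M))
    simp
  | pair s t hs ht =>
    change (s.map θ ⊗ₘ t.map θ) ≫ ((s.norm G).hom ⊗ₘ (t.norm G).hom) ≫ (appIso G _ _).inv =
      (((s.norm F).hom ⊗ₘ (t.norm F).hom) ≫ (appIso F _ _).inv) ≫ tensLMap θ (s.leaves ++ t.leaves)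
    rw [tensorHom_comp_tensorHom_assoc, hs, ht, ← tensorHom_comp_tensorHom_assoc, Category.assoc]
    congr 1
    rw [Iso.comp_inv_eq, Category.assoc, appIso_nat, Iso.inv_hom_id_assoc]
  | node n t ih =>
    change bigTMap n (fun k => (t k).map θ) ≫ bigTMap n (fun k => ((t k).norm G).hom) ≫
      (catIso G n _).inv = (bigTMap n (fun k => ((t k).norm F).hom) ≫ (catIso F n _).inv) ≫
        tensLMap θ (catL n fun k => (t k).leaves)
    rw [← Category.assoc, bigTMap_comp]
    simp only [ih]
    rw [← bigTMap_comp, Category.assoc, Category.assoc]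
    congr 1
    rw [Iso.comp_inv_eq, Category.assoc, catIso_nat, Iso.inv_hom_id_assoc]

theorem PermCert.cat : ∀ (n : ℕ) {l l' : Fin n → List ι} (p : ∀ k, PermCert (l k) (l' k)),
    ∃ q : PermCert (catL n l) (catL n l'), ∀ F : ι → M,
      q.hom F ≫ (catIso F n l').hom = (catIso F n l).hom ≫ bigTMap n (fun k => (p k).hom F)
  | 0, _, _, _ => ⟨.nil, fun F => rfl⟩
  | n + 1, l, l', p => by
    obtain ⟨q, hq⟩ := PermCert.cat n (fun k => p k.succ)
    obtain ⟨r, hr⟩ := PermCert.append (M := M) (p 0) q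
    refine ⟨r, fun F => ?_⟩
    have hr := hr F
    rw [catIso_succ_hom, catIso_succ_hom]
    dsimp only [catL, bigT, bigTMap] at hq hr ⊢
    rw [reassoc_of% hr, ← id_tensorHom, ← id_tensorHom, tensorHom_comp_tensorHom, hq,
      Category.assoc, tensorHom_comp_tensorHom, Category.id_comp, Category.comp_id]

theorem PermCert.perm {l l' : List ι} (p : PermCert l l') : l.Perm l' := by
  induction p with
  | nil => exact List.Perm.refl _
  | cons e p ih => exact (ih.cons _).trans e.perm.symm

/-- Two shapes with the same labels, each of which occurs only once. -/
def Tree.Comp (s t : Tree ι) : Prop := s.leaves.Perm t.leaves ∧ t.leaves.Nodup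

theorem Tree.Comp.trans {s t r : Tree ι} (h : s.Comp t) (k : t.Comp r) : s.Comp r :=
  ⟨h.1.trans k.1, k.2⟩

open scoped Classical in
/-- Every label occurs exactly once. -/
def Tree.Full (t : Tree ι) : Prop := ∀ x, t.cnt x = 1

open scoped Classical in
theorem Tree.Full.comp {s t : Tree ι} (hs : s.Full) (ht : t.Full) : s.Comp t := by
  refine ⟨List.perm_iff_count.2 fun x => ?_, List.nodup_iff_count_le_one.2 fun x => ?_⟩
  · rw [Tree.leaves_count, Tree.leaves_count, hs x, ht x]
  · rw [Tree.leaves_count, ht x]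

/-- The canonical isomorphism, built from associators, unitors and symmetries, between tensor
products of two shapes with the same labels, all distinct. -/
def can (F : ι → M) (s t : Tree ι) (h : s.Comp t) : s.eval F ⟶ t.eval F :=
  (s.norm F).hom ≫ (PermCert.nonempty h.1).some.hom F ≫ (t.norm F).inv

theorem can_eq (F : ι → M) {s t : Tree ι} (h : s.Comp t) (p : PermCert s.leaves t.leaves) :
    can F s t h = (s.norm F).hom ≫ p.hom F ≫ (t.norm F).inv := by
  rw [can, PermCert.unique h.2 (PermCert.nonempty h.1).some p]

theorem can_refl (F : ι → M) {s : Tree ι} (h : s.Comp s) : can F s s h = 𝟙 _ := by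
  rw [can_eq F h (.refl _), PermCert.refl_hom, Category.id_comp, Iso.hom_inv_id]

theorem can_trans (F : ι → M) {s t r : Tree ι} (h : s.Comp t) (k : t.Comp r) :
    can F s t h ≫ can F t r k = can F s r (h.trans k) := by
  obtain ⟨p⟩ := PermCert.nonempty h.1
  obtain ⟨q⟩ := PermCert.nonempty k.1
  obtain ⟨x, hx⟩ := PermCert.comp M p q
  rw [can_eq F h p, can_eq F k q, can_eq F (h.trans k) x, hx]
  simp

theorem can_nat {F G : ι → M} (θ : ∀ x, F x ⟶ G x) {s t : Tree ι} (h : s.Comp t) :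
    s.map θ ≫ can G s t h = can F s t h ≫ t.map θ := by
  obtain ⟨p⟩ := PermCert.nonempty h.1
  rw [can_eq F h p, can_eq G h p, reassoc_of% (s.norm_nat θ), reassoc_of% (p.nat θ)]
  simp only [Category.assoc]
  congr 2
  rw [Iso.comp_inv_eq, Category.assoc, Tree.norm_nat, Iso.inv_hom_id_assoc]

theorem can_pair (F : ι → M) {s s' t t' : Tree ι} (h : s.Comp s') (k : t.Comp t')
    (hk : (Tree.pair s t).Comp (.pair s' t')) :
    can F (.pair s t) (.pair s' t') hk = can F s s' h ⊗ₘ can F t t' k := by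
  obtain ⟨p⟩ := PermCert.nonempty h.1
  obtain ⟨q⟩ := PermCert.nonempty k.1
  obtain ⟨r, hr⟩ := PermCert.append (M := M) p q
  have hr := hr F
  rw [can_eq F h p, can_eq F k q, can_eq F hk r]
  change (((s.norm F).hom ⊗ₘ (t.norm F).hom) ≫ (appIso F _ _).inv) ≫ r.hom F ≫
    (appIso F _ _).hom ≫ ((s'.norm F).inv ⊗ₘ (t'.norm F).inv) = _
  rw [reassoc_of% hr]
  simp

theorem can_node (F : ι → M) {n : ℕ} {s t : Fin n → Tree ι} (h : ∀ k, (s k).Comp (t k))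
    (hk : (Tree.node n s).Comp (.node n t)) :
    can F (.node n s) (.node n t) hk = bigTMap n (fun k => can F (s k) (t k) (h k)) := by
  let p := fun k => (PermCert.nonempty (h k).1).some
  obtain ⟨r, hr⟩ := PermCert.cat (M := M) n p
  have hr := hr F
  rw [can_eq F hk r]
  change (bigTMap n (fun k => ((s k).norm F).hom) ≫ (catIso F n _).inv) ≫ r.hom F ≫
    (catIso F n _).hom ≫ bigTMap n (fun k => ((t k).norm F).inv) = _
  rw [reassoc_of% hr, Category.assoc, Iso.inv_hom_id_assoc, bigTMap_comp, bigTMap_comp]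
  rfl

def Tree.bindIso (F : ι → M) (f : κ → Tree ι) :
    (t : Tree κ) → ((t.bind f).eval F ≅ t.eval (fun x => (f x).eval F))
  | .leaf _ => Iso.refl _
  | .pair s t => s.bindIso F f ⊗ᵢ t.bindIso F f
  | .node n t => bigTIso n (fun k => (t k).bindIso F f)

theorem PermCert.flatCat (f : κ → List ι) : ∀ (n : ℕ) (l : Fin n → List κ),
    ∃ p : PermCert (catL n fun k => flatL f (l k)) (flatL f (catL n l)), ∀ F : ι → M,
      p.hom F ≫ (flatIso F f (catL n l)).hom ≫ (catIso _ n l).hom =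
        (catIso F n _).hom ≫ bigTMap n (fun k => (flatIso F f (l k)).hom)
  | 0, _ => ⟨.nil, fun F => by
      change 𝟙 (𝟙_ M) ≫ 𝟙 (𝟙_ M) ≫ 𝟙 (𝟙_ M) = 𝟙 (𝟙_ M) ≫ 𝟙 (𝟙_ M)
      simp⟩
  | n + 1, l => by
    obtain ⟨p, hp⟩ := PermCert.flatCat f n (fun k => l k.succ)
    obtain ⟨q, hq⟩ := PermCert.append (M := M) (.refl (flatL f (l 0))) p
    obtain ⟨a, ha⟩ := PermCert.flatAppend (M := M) f (l 0) (catL n (fun k => l k.succ))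
    obtain ⟨r, hr⟩ := PermCert.comp M q a
    refine ⟨r, fun F => ?_⟩
    have hr := hr F
    have ha := ha F
    have hq := hq F
    have hp := hp F
    rw [catIso_succ_hom, catIso_succ_hom]
    dsimp only [catL, bigT, bigTMap] at hp hq ha hr ⊢
    rw [PermCert.refl_hom] at hq
    rw [hr, Category.assoc, reassoc_of% ha, reassoc_of% hq, ← id_tensorHom, ← id_tensorHom,
      tensorHom_comp_tensorHom, tensorHom_comp_tensorHom, Category.assoc, hp,
      tensorHom_comp_tensorHom, Category.id_comp, Category.id_comp, Category.comp_id]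

theorem Tree.norm_bind (f : κ → Tree ι) (t : Tree κ) :
    ∃ p : PermCert (t.bind f).leaves (flatL (fun x => (f x).leaves) t.leaves), ∀ F : ι → M,
      ((t.bind f).norm F).hom ≫ p.hom F ≫ (flatIso F _ t.leaves).hom =
        (t.bindIso F f).hom ≫ t.map (fun x => ((f x).norm F).hom) ≫ (t.norm _).hom := by
  induction t with
  | leaf x =>
    obtain ⟨p, hp⟩ := PermCert.rightNil (M := M) (f x).leaves
    refine ⟨p, fun F => ?_⟩
    have hp := hp F
    change ((f x).norm F).hom ≫ p.hom F ≫ (appIso F (f x).leaves []).hom ≫ _ ◁ 𝟙 (tensL F []) =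
      𝟙 _ ≫ ((f x).norm F).hom ≫ (ρ_ _).inv
    rw [MonoidalCategory.whiskerLeft_id, Category.id_comp, Category.comp_id, hp]
    rfl
  | pair s t hs ht =>
    obtain ⟨p, hp⟩ := hs
    obtain ⟨q, hq⟩ := ht
    obtain ⟨r, hr⟩ := PermCert.append (M := M) p q
    obtain ⟨a, ha⟩ := PermCert.flatAppend (M := M) (fun x => (f x).leaves) s.leaves t.leaves
    obtain ⟨b, hb⟩ := PermCert.comp M r a
    refine ⟨b, fun F => ?_⟩
    have hr := hr F
    have ha := ha F
    have hb := hb F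
    have hp := hp F
    have hq := hq F
    change ((((s.bind f).norm F).hom ⊗ₘ ((t.bind f).norm F).hom) ≫ (appIso F _ _).inv) ≫
      b.hom F ≫ (flatIso F _ (s.leaves ++ t.leaves)).hom =
      ((s.bindIso F f).hom ⊗ₘ (t.bindIso F f).hom) ≫
        (s.map (fun x => ((f x).norm F).hom) ⊗ₘ t.map (fun x => ((f x).norm F).hom)) ≫
        ((s.norm _).hom ⊗ₘ (t.norm _).hom) ≫ (appIso _ _ _).inv
    rw [hb, tensorHom_comp_tensorHom_assoc, tensorHom_comp_tensorHom_assoc, Category.assoc,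
      Category.assoc (s.bindIso F f).hom, Category.assoc (t.bindIso F f).hom, ← hp,
      ← hq, Iso.eq_comp_inv]
    simp only [Category.assoc]
    rw [ha, reassoc_of% hr, Iso.inv_hom_id_assoc, tensorHom_comp_tensorHom,
      tensorHom_comp_tensorHom]
  | node n t ih =>
    choose p hp using ih
    obtain ⟨r, hr⟩ := PermCert.cat (M := M) n p
    obtain ⟨a, ha⟩ := PermCert.flatCat (M := M) (fun x => (f x).leaves) n (fun k => (t k).leaves)
    obtain ⟨b, hb⟩ := PermCert.comp M r a
    refine ⟨b, fun F => ?_⟩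
    have hr := hr F
    have ha := ha F
    have hb := hb F
    have hp := fun k => hp k F
    change (bigTMap n (fun k => (((t k).bind f).norm F).hom) ≫ (catIso F n _).inv) ≫
      b.hom F ≫ (flatIso F _ (catL n fun k => (t k).leaves)).hom =
      bigTMap n (fun k => ((t k).bindIso F f).hom) ≫
        bigTMap n (fun k => (t k).map (fun x => ((f x).norm F).hom)) ≫
        bigTMap n (fun k => ((t k).norm _).hom) ≫ (catIso _ n _).inv
    rw [hb, ← Category.assoc (bigTMap n fun k => ((t k).bindIso F f).hom), bigTMap_comp,
      ← Category.assoc (bigTMap n fun k => ((t k).bindIso F f).hom ≫ _), bigTMap_comp,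
      Iso.eq_comp_inv]
    simp only [Category.assoc] at hp ⊢
    simp only [← hp]
    rw [ha, reassoc_of% hr, Iso.inv_hom_id_assoc, bigTMap_comp, bigTMap_comp]

theorem can_bind (F : ι → M) (f : κ → Tree ι) {s t : Tree κ} (h : s.Comp t)
    (k : (s.bind f).Comp (t.bind f)) :
    (s.bindIso F f).hom ≫ can _ s t h = can F (s.bind f) (t.bind f) k ≫ (t.bindIso F f).hom := by
  obtain ⟨r⟩ := PermCert.nonempty h.1
  obtain ⟨c⟩ := PermCert.nonempty k.1
  obtain ⟨p, hp⟩ := Tree.norm_bind (M := M) f s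
  obtain ⟨q, hq⟩ := Tree.norm_bind (M := M) f t
  obtain ⟨a, ha⟩ := PermCert.flat (M := M) (fun x => (f x).leaves) r
  obtain ⟨x, hx⟩ := PermCert.comp M p a
  obtain ⟨y, hy⟩ := PermCert.comp M c q
  have hxy : x = y := PermCert.unique (q.perm.nodup_iff.1 k.2) x y
  subst hxy
  have h1 := hp F
  have h2 := hq F
  have e : p.hom F ≫ a.hom F = c.hom F ≫ q.hom F := (hx F).symm.trans (hy F)
  have e' := congrArg (fun z => ((s.bind f).norm F).hom ≫ z ≫ (flatIso F _ t.leaves).hom) e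
  simp only [Category.assoc] at e'
  rw [ha F, reassoc_of% h1] at e'
  have n1 := can_nat (fun x => ((f x).norm F).hom) h
  rw [can_eq (fun x => tensL F (f x).leaves) h r] at n1
  have h4 : t.map (fun x => ((f x).norm F).hom) ≫ t.map (fun x => ((f x).norm F).inv) = 𝟙 _ := by
    simp [Tree.map_comp, Tree.map_id]
  have h3 : (t.bindIso F f).hom = ((t.bind f).norm F).hom ≫ q.hom F ≫ (flatIso F _ t.leaves).hom
      ≫ (t.norm _).inv ≫ t.map (fun x => ((f x).norm F).inv) := by
    rw [reassoc_of% h2, Iso.hom_inv_id_assoc, h4, Category.comp_id]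
  rw [can_eq F k c, h3]
  simp only [Category.assoc, Iso.inv_hom_id_assoc] at n1 ⊢
  rw [← reassoc_of% e', reassoc_of% n1, h4, Category.comp_id]

end

/-! ### Profiles -/

/-- A finite sequence of colors. -/
structure Profile (C : Type v) : Type v where
  len : ℕ
  col : Fin len → C

namespace Profile
variable {C : Type v}

/-- A permutation `σ` with `σ a = b`, that is, `b (σ i) = a i`. -/
@[ext]
structure Hom (a b : Profile C) : Type v where
  σ : Fin a.len ≃ Fin b.len
  col_σ : ∀ i, b.col (σ i) = a.col i

/-- The groupoid of profiles and left permutations. -/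
instance : Groupoid (Profile C) where
  Hom := Hom
  id a := ⟨Equiv.refl _, fun _ => rfl⟩
  comp f g := ⟨f.σ.trans g.σ, fun i => (g.col_σ _).trans (f.col_σ i)⟩
  inv f := ⟨f.σ.symm, fun i => by rw [← f.col_σ, Equiv.apply_symm_apply]⟩
  inv_comp f := Hom.ext (by ext; simp)
  comp_inv f := Hom.ext (by ext; simp)

theorem id_σ (a : Profile C) : (𝟙 a : a ⟶ a).σ = Equiv.refl _ := rfl
theorem comp_σ {a b c : Profile C} (f : a ⟶ b) (g : b ⟶ c) : (f ≫ g).σ = f.σ.trans g.σ := rfl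

theorem hom_ext {a b : Profile C} {f g : a ⟶ b} (h : ∀ i, f.σ i = g.σ i) : f = g :=
  Hom.ext (Equiv.ext h)

/-- The profile with entries `col s`, the set `S` being ordered by `e`. -/
def ofEquiv {S : Type*} {n : ℕ} (e : Fin n ≃ S) (col : S → C) : Profile C := ⟨n, fun k => col (e k)⟩

/-- The permutation of profiles given by a bijection of the indexing sets. -/
def homOf {S S' : Type*} {n m : ℕ} {e : Fin n ≃ S} {e' : Fin m ≃ S'} {col : S → C} {col' : S' → C}
    (f : S ≃ S') (h : ∀ s, col' (f s) = col s) : ofEquiv e col ⟶ ofEquiv e' col' where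
  σ := e.trans (f.trans e'.symm)
  col_σ k := by
    change col' (e' (e'.symm (f (e k)))) = col (e k)
    rw [Equiv.apply_symm_apply, h]

/-- The profile with one entry. -/
def single (c : C) : Profile C := ⟨1, fun _ => c⟩

/-- The profile `(c, …, c)` with `t` entries. -/
def rep (t : ℕ) (c : C) : Profile C := ⟨t, fun _ => c⟩

/-- Concatenation of two profiles. -/
def append (a b : Profile C) : Profile C :=
  ofEquiv finSumFinEquiv.symm (Sum.elim a.col b.col)

/-- Concatenation of a finite sequence of profiles. -/
def concat {n : ℕ} (b : Fin n → Profile C) : Profile C :=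
  ofEquiv finSigmaFinEquiv.symm (fun p : Σ i, Fin (b i).len => (b p.1).col p.2)

theorem concat_col {n : ℕ} (b : Fin n → Profile C) (p : Σ i, Fin (b i).len) :
    (concat b).col (finSigmaFinEquiv p) = (b p.1).col p.2 := by
  change (b (finSigmaFinEquiv.symm (finSigmaFinEquiv p)).1).col _ = _
  rw [Equiv.symm_apply_apply]

def appendMap {a a' b b' : Profile C} (f : a ⟶ a') (g : b ⟶ b') : a.append b ⟶ a'.append b' :=
  homOf (Equiv.sumCongr f.σ g.σ) fun s => by
    rcases s with i | j
    · exact f.col_σ i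
    · exact g.col_σ j

def concatMap {n : ℕ} {b b' : Fin n → Profile C} (f : ∀ i, b i ⟶ b' i) : concat b ⟶ concat b' :=
  homOf (Equiv.sigmaCongrRight fun i => (f i).σ) fun p => (f p.1).col_σ p.2

/-- The block permutation induced by a permutation of the blocks. -/
def block {n m : ℕ} (σ : Fin n ≃ Fin m) (b : Fin m → Profile C) :
    concat (fun i => b (σ i)) ⟶ concat b :=
  homOf (Equiv.sigmaCongrLeft (β := fun i => Fin (b i).len) σ) fun _ => rfl

/-- The sequence of profiles `e i j`, as a sequence indexed by the entries of `concat b`. -/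
def regroup {α : Type*} {n : ℕ} {b : Fin n → Profile C} (e : ∀ i, Fin (b i).len → α) :
    Fin (concat b).len → α :=
  fun k => e (finSigmaFinEquiv.symm k).1 (finSigmaFinEquiv.symm k).2

/-- The bijection underlying `concatAssoc`. -/
def assocEquiv {n : ℕ} {b : Fin n → Profile C} (e : ∀ i, Fin (b i).len → Profile C) :
    (Σ k : Fin (concat b).len, Fin (regroup e k).len) ≃ Σ i, Fin (concat (e i)).len :=
  (Equiv.sigmaCongrLeft (β := fun p : Σ i, Fin (b i).len => Fin (e p.1 p.2).len)
    finSigmaFinEquiv.symm).trans <|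
  (Equiv.sigmaAssoc fun i j => Fin (e i j).len).trans <|
  Equiv.sigmaCongrRight fun _ => finSigmaFinEquiv

/-- Concatenation is associative: on entries, this is the order-preserving bijection. -/
def concatAssoc {n : ℕ} {b : Fin n → Profile C} (e : ∀ i, Fin (b i).len → Profile C) :
    concat (regroup e) ⟶ concat (fun i => concat (e i)) :=
  homOf (assocEquiv e) fun p =>
    concat_col (e (finSigmaFinEquiv.symm p.1).1) ⟨(finSigmaFinEquiv.symm p.1).2, p.2⟩

/-- The concatenation of a single profile `b` is `b`. -/
def concatOne (b : Profile C) : concat (fun _ : Fin 1 => b) ⟶ b :=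
  homOf (e' := Equiv.refl _) (col' := b.col)
    ⟨fun p => p.2, fun j => ⟨0, j⟩, fun p => by
      obtain ⟨i, j⟩ := p
      rw [Subsingleton.elim i 0], fun _ => rfl⟩ fun _ => rfl

/-- The concatenation of the one-entry profiles `(c₁), …, (cₘ)` is `c`. -/
def concatSingle (c : Profile C) : concat (fun i => single (c.col i)) ⟶ c :=
  homOf (e' := Equiv.refl _) (col' := c.col)
    ⟨fun p => p.1, fun i => ⟨i, (0 : Fin 1)⟩, fun p => by
      obtain ⟨i, j⟩ := p
      exact congrArg (Sigma.mk i) (Subsingleton.elim (α := Fin 1) _ _), fun _ => rfl⟩ fun _ => rfl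

end Profile

section
variable {M : Type u} [Category.{v} M] [MonoidalCategory M] [SymmetricCategory M]

theorem reindexFull {n m : ℕ} (e : Fin n ≃ Fin m) :
    (Tree.node n fun i => .leaf (e i)).Full := fun x => by
  classical
  have h := e.sum_comp (fun y => if y = x then 1 else 0)
  simp only [Finset.sum_ite_eq', Finset.mem_univ, if_true] at h
  exact (Finset.sum_congr rfl fun k _ => by simp only [Tree.cnt]; congr).trans h

theorem reindexComp {n m : ℕ} (e : Fin n ≃ Fin m) :
    (Tree.node n fun i => .leaf (e i)).Comp (.node m .leaf) :=
  (reindexFull e).comp (reindexFull (Equiv.refl _))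

/-- The permutation of the factors of a tensor product. -/
def permT {n m : ℕ} (e : Fin n ≃ Fin m) (F : Fin m → M) : bigT n (fun i => F (e i)) ⟶ bigT m F :=
  can F (.node n fun i => .leaf (e i)) (.node m .leaf) (reindexComp e)

theorem permT_can {ι : Type w} (F : ι → M) {n m : ℕ} (e : Fin n ≃ Fin m) (t : Fin m → Tree ι)
    (h : (Tree.node n fun i => t (e i)).Comp (.node m t)) :
    permT e (fun i => (t i).eval F) = can F _ _ h := by
  have := can_bind F t (reindexComp e) h
  have h1 : ((Tree.node n fun i => .leaf (e i)).bindIso F t).hom =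
    𝟙 (bigT n fun i => (t (e i)).eval F) := bigTMap_id _ _
  have h2 : ((Tree.node m .leaf).bindIso F t).hom = 𝟙 (bigT m fun i => (t i).eval F) :=
    bigTMap_id _ _
  rw [h1, h2] at this
  exact (Category.id_comp _).symm.trans (this.trans (Category.comp_id _))

theorem permT_refl {n : ℕ} (F : Fin n → M) : permT (Equiv.refl _) F = 𝟙 (bigT n F) :=
  can_refl F _

theorem permT_nat {n m : ℕ} (e : Fin n ≃ Fin m) {F H : Fin m → M} (η : ∀ i, F i ⟶ H i) :
    bigTMap n (fun i => η (e i)) ≫ permT e H = permT e F ≫ bigTMap m η :=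
  can_nat η (reindexComp e)

theorem permT_comp {n m k : ℕ} (e : Fin n ≃ Fin m) (e' : Fin m ≃ Fin k) (F : Fin k → M) :
    permT e (fun i => F (e' i)) ≫ permT e' F = permT (e.trans e') F := by
  have h := permT_can F e (fun i => .leaf (e' i))
    ((reindexFull (e.trans e')).comp (reindexFull e'))
  exact (congrArg (fun z => z ≫ permT e' F) h).trans (can_trans F _ _)

/-- The map of tensor products given by a bijection `e` of the indexing sets and maps
`G i ⟶ F (e i)`. -/
def reindex {n m : ℕ} (e : Fin n ≃ Fin m) {G : Fin n → M} {F : Fin m → M}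
    (θ : ∀ i, G i ⟶ F (e i)) : bigT n G ⟶ bigT m F :=
  bigTMap n θ ≫ permT e F

theorem reindex_id {n : ℕ} (F : Fin n → M) :
    reindex (Equiv.refl _) (fun i => 𝟙 (F i)) = 𝟙 (bigT n F) := by
  change bigTMap n (fun i => 𝟙 (F i)) ≫ permT (Equiv.refl _) F = _
  rw [permT_refl]
  exact (Category.comp_id _).trans (bigTMap_id _ _)

theorem reindex_pre {n m : ℕ} (e : Fin n ≃ Fin m) {H G : Fin n → M} {F : Fin m → M}
    (η : ∀ i, H i ⟶ G i) (θ : ∀ i, G i ⟶ F (e i)) :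
    bigTMap n η ≫ reindex e θ = reindex e (fun i => η i ≫ θ i) := by
  rw [reindex, ← Category.assoc, bigTMap_comp]
  rfl

theorem reindex_post {n m : ℕ} (e : Fin n ≃ Fin m) {G : Fin n → M} {F H : Fin m → M}
    (θ : ∀ i, G i ⟶ F (e i)) (η : ∀ i, F i ⟶ H i) :
    reindex e θ ≫ bigTMap m η = reindex e (fun i => θ i ≫ η (e i)) := by
  rw [reindex, reindex, ← bigTMap_comp, Category.assoc, Category.assoc, permT_nat]

theorem reindex_comp {n m k : ℕ} (e : Fin n ≃ Fin m) (e' : Fin m ≃ Fin k) {G : Fin n → M}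
    {F : Fin m → M} {H : Fin k → M} (θ : ∀ i, G i ⟶ F (e i)) (η : ∀ i, F i ⟶ H (e' i)) :
    reindex e θ ≫ reindex e' η =
      reindex (F := H) (e.trans e') (fun i => θ i ≫ η (e i) : ∀ i, G i ⟶ H (e' (e i))) := by
  change reindex e θ ≫ bigTMap m η ≫ permT e' H = _
  rw [← Category.assoc, reindex_post]
  change (bigTMap n _ ≫ permT e _) ≫ permT e' H = bigTMap n _ ≫ permT (e.trans e') H
  rw [Category.assoc, permT_comp]
  rfl

end

section
variable {M : Type u} [Category.{v} M] {C : Type v}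

theorem eqToHom_nat {X Y : C → M} (g : ∀ c, X c ⟶ Y c) {c d : C} (h : c = d) :
    eqToHom (congrArg X h) ≫ g d = g c ≫ eqToHom (congrArg Y h) := by
  subst h; simp

variable [MonoidalCategory M]

/-- The tensor product `X_{c₁} ⊗ ⋯ ⊗ X_{cₘ}`. -/
abbrev pw (X : C → M) (c : Profile C) : M := bigT c.len fun i => X (c.col i)

abbrev pwTrans {X Y : C → M} (g : ∀ c, X c ⟶ Y c) (a : Profile C) : pw X a ⟶ pw Y a :=
  bigTMap a.len fun i => g (a.col i)

variable [SymmetricCategory M]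

/-- The permutation of factors as a map `pw X a ⟶ pw X b`. -/
def pwMap (X : C → M) {a b : Profile C} (f : a ⟶ b) : pw X a ⟶ pw X b :=
  reindex f.σ fun i => eqToHom (congrArg X (f.col_σ i).symm)

theorem pwMap_id (X : C → M) (a : Profile C) : pwMap X (𝟙 a) = 𝟙 (pw X a) := reindex_id _

theorem pwMap_comp (X : C → M) {a b c : Profile C} (f : a ⟶ b) (g : b ⟶ c) :
    pwMap X (f ≫ g) = pwMap X f ≫ pwMap X g := by
  refine Eq.trans ?_ (reindex_comp _ _ _ _).symm
  simp only [eqToHom_trans]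
  rfl

/-- `pw X` as a functor of profiles, by permuting the factors. -/
abbrev pwF (X : C → M) : Profile C ⥤ M where
  obj := pw X
  map := pwMap X
  map_id := pwMap_id X
  map_comp := pwMap_comp X

theorem pwTrans_nat {X Y : C → M} (g : ∀ c, X c ⟶ Y c) {a b : Profile C} (f : a ⟶ b) :
    pwMap X f ≫ pwTrans g b = pwTrans g a ≫ pwMap Y f := by
  refine (reindex_post _ _ _).trans ((reindex_pre _ _ _).trans ?_).symm
  exact congrArg (reindex f.σ) (funext fun i => (eqToHom_nat g (f.col_σ i).symm).symm)

end

section Shuffle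
variable {M : Type u} [Category.{v} M] [MonoidalCategory M] [SymmetricCategory M]

/-- The shape `p₀ ⊗ (p₁ ⊗ (q₁₁ ⊗ ⋯)) ⊗ ⋯ ⊗ (pₙ ⊗ (qₙ₁ ⊗ ⋯))`. -/
def shufS {ι : Type w} {n : ℕ} {m : Fin n → ℕ} (p0 : Tree ι) (p : Fin n → Tree ι)
    (q : ∀ i, Fin (m i) → Tree ι) : Tree ι :=
  .pair p0 (.node n fun i => .pair (p i) (.node (m i) (q i)))

/-- The shape `(p₀ ⊗ (p₁ ⊗ ⋯ ⊗ pₙ)) ⊗ (q₁₁ ⊗ ⋯)`. -/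
def shufT {ι : Type w} {n : ℕ} {m : Fin n → ℕ} (p0 : Tree ι) (p : Fin n → Tree ι)
    (q : ∀ i, Fin (m i) → Tree ι) : Tree ι :=
  .pair (.pair p0 (.node n p)) (.node (∑ i, m i) fun k =>
    q (finSigmaFinEquiv.symm k).1 (finSigmaFinEquiv.symm k).2)

theorem sigma_sum {n : ℕ} {m : Fin n → ℕ} (f : ∀ i, Fin (m i) → ℕ) :
    ∑ k, f (finSigmaFinEquiv.symm k).1 (finSigmaFinEquiv.symm k).2 = ∑ i, ∑ j, f i j := by
  rw [finSigmaFinEquiv.symm.sum_comp (fun p => f p.1 p.2), Fintype.sum_sigma]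

theorem shuf_cnt {ι : Type w} [DecidableEq ι] {n : ℕ} {m : Fin n → ℕ} (p0 : Tree ι)
    (p : Fin n → Tree ι) (q : ∀ i, Fin (m i) → Tree ι) (x : ι) :
    (shufS p0 p q).cnt x = (shufT p0 p q).cnt x := by
  simp only [shufS, shufT, Tree.cnt]
  rw [sigma_sum (fun i j => (q i j).cnt x), Finset.sum_add_distrib, add_assoc]

theorem Tree.comp_of_cnt {ι : Type w} [DecidableEq ι] {s t : Tree ι} (h : ∀ x, s.cnt x = t.cnt x)
    (h' : ∀ x, t.cnt x ≤ 1) : s.Comp t :=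
  ⟨List.perm_iff_count.2 fun x => by rw [Tree.leaves_count, Tree.leaves_count, h x],
    List.nodup_iff_count_le_one.2 fun x => by rw [Tree.leaves_count]; exact h' x⟩

theorem Tree.Comp.cnt_eq {ι : Type w} [DecidableEq ι] {s t : Tree ι} (h : s.Comp t) (x : ι) :
    s.cnt x = t.cnt x := by
  rw [← Tree.leaves_count, ← Tree.leaves_count, h.1.count_eq]

/-- Labels for the factors of a shuffle. -/
abbrev ShufL {n : ℕ} (m : Fin n → ℕ) : Type := Unit ⊕ (Fin n ⊕ Σ i, Fin (m i))

abbrev shufL0 {n : ℕ} {m : Fin n → ℕ} : Tree (ShufL m) := .leaf (.inl ())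
abbrev shufL1 {n : ℕ} {m : Fin n → ℕ} (i : Fin n) : Tree (ShufL m) := .leaf (.inr (.inl i))
abbrev shufL2 {n : ℕ} {m : Fin n → ℕ} (i : Fin n) (j : Fin (m i)) : Tree (ShufL m) :=
  .leaf (.inr (.inr ⟨i, j⟩))

theorem shufComp {n : ℕ} (m : Fin n → ℕ) : (shufS (m := m) shufL0 shufL1 shufL2).Comp
    (shufT shufL0 shufL1 shufL2) := by
  classical
  refine Tree.comp_of_cnt (shuf_cnt _ _ _) fun x => ?_
  rw [← shuf_cnt]
  rcases x with x | x | ⟨x, y⟩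
  · simp [shufS, Tree.cnt]
  · simp [shufS, Tree.cnt]
  · simp only [shufS, Tree.cnt]
    have h : ∀ i, (∑ j : Fin (m i), if (Sum.inr (Sum.inr ⟨i, j⟩) : ShufL m) =
        Sum.inr (Sum.inr ⟨x, y⟩) then 1 else 0) = if i = x then 1 else 0 := by
      intro i
      by_cases hi : i = x
      · subst hi
        simp
      · simp [hi]
    simp only [h]
    simp

/-- The factors of a shuffle. -/
def shufF {n : ℕ} {m : Fin n → ℕ} (P0 : M) (P : Fin n → M) (Q : ∀ i, Fin (m i) → M) :
    ShufL m → M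
  | .inl _ => P0
  | .inr (.inl i) => P i
  | .inr (.inr p) => Q p.1 p.2

/-- The tensor product of `Q i j` over all pairs `i, j` in lexicographic order. -/
abbrev bigT2 {n : ℕ} {m : Fin n → ℕ} (Q : ∀ i, Fin (m i) → M) : M :=
  bigT (∑ i, m i) fun k => Q (finSigmaFinEquiv.symm k).1 (finSigmaFinEquiv.symm k).2

/-- The permutation of factors
`P₀ ⊗ (P₁ ⊗ (Q₁₁ ⊗ ⋯)) ⊗ ⋯ ⊗ (Pₙ ⊗ (Qₙ₁ ⊗ ⋯)) ⟶ (P₀ ⊗ (P₁ ⊗ ⋯ ⊗ Pₙ)) ⊗ (Q₁₁ ⊗ ⋯)`. -/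
def shuffle {n : ℕ} {m : Fin n → ℕ} (P0 : M) (P : Fin n → M) (Q : ∀ i, Fin (m i) → M) :
    P0 ⊗ bigT n (fun i => P i ⊗ bigT (m i) (Q i)) ⟶ (P0 ⊗ bigT n P) ⊗ bigT2 Q :=
  can (shufF P0 P Q) (shufS shufL0 shufL1 shufL2) (shufT shufL0 shufL1 shufL2) (shufComp m)

theorem shuffle_nat {n : ℕ} {m : Fin n → ℕ} {P0 P0' : M} {P P' : Fin n → M}
    {Q Q' : ∀ i, Fin (m i) → M} (f : P0 ⟶ P0') (g : ∀ i, P i ⟶ P' i)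
    (h : ∀ i j, Q i j ⟶ Q' i j) :
    (f ⊗ₘ bigTMap n fun i => g i ⊗ₘ bigTMap (m i) (h i)) ≫ shuffle P0' P' Q' =
      shuffle P0 P Q ≫ ((f ⊗ₘ bigTMap n g) ⊗ₘ bigTMap (∑ i, m i)
        fun k => h (finSigmaFinEquiv.symm k).1 (finSigmaFinEquiv.symm k).2) := by
  let θ : ∀ x, shufF P0 P Q x ⟶ shufF P0' P' Q' x
    | .inl _ => f
    | .inr (.inl i) => g i
    | .inr (.inr p) => h p.1 p.2
  exact can_nat θ (shufComp m)

theorem shuffle_can {ι : Type w} (F : ι → M) {n : ℕ} {m : Fin n → ℕ} (p0 : Tree ι)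
    (p : Fin n → Tree ι) (q : ∀ i, Fin (m i) → Tree ι) (h : (shufS p0 p q).Comp (shufT p0 p q)) :
    shuffle (p0.eval F) (fun i => (p i).eval F) (fun i j => (q i j).eval F) = can F _ _ h := by
  let f : ShufL m → Tree ι
    | .inl _ => p0
    | .inr (.inl i) => p i
    | .inr (.inr x) => q x.1 x.2
  have := can_bind F f (shufComp m) h
  have hF : (fun x => (f x).eval F) = shufF (p0.eval F) (fun i => (p i).eval F)
      (fun i j => (q i j).eval F) := by
    funext x
    rcases x with x | x | x <;> rfl
  have h1 : ((shufS (m := m) shufL0 shufL1 shufL2).bindIso F f).hom = 𝟙 ((shufS p0 p q).eval F) := by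
    have e1 : ∀ i, bigTMap (m i) (fun j => 𝟙 ((q i j).eval F)) = 𝟙 _ := fun i => bigTMap_id _ _
    have e2 : bigTMap n (fun i => 𝟙 ((p i).eval F) ⊗ₘ
      bigTMap (m i) (fun j => 𝟙 ((q i j).eval F))) = 𝟙 _ := by
      simp only [e1, id_tensorHom_id]
      exact bigTMap_id _ _
    change 𝟙 (p0.eval F) ⊗ₘ (bigTMap n (fun i => 𝟙 ((p i).eval F) ⊗ₘ
      bigTMap (m i) (fun j => 𝟙 ((q i j).eval F)))) = _
    rw [e2]
    exact id_tensorHom_id _ _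
  have h2 : ((shufT (m := m) shufL0 shufL1 shufL2).bindIso F f).hom = 𝟙 ((shufT p0 p q).eval F) := by
    have e1 : bigTMap n (fun i => 𝟙 ((p i).eval F)) = 𝟙 _ := bigTMap_id _ _
    have e2 : bigTMap (∑ i, m i) (fun k => 𝟙 ((q (finSigmaFinEquiv.symm k).1
      (finSigmaFinEquiv.symm k).2).eval F)) = 𝟙 _ := bigTMap_id _ _
    change (𝟙 (p0.eval F) ⊗ₘ bigTMap n (fun i => 𝟙 ((p i).eval F))) ⊗ₘ
      bigTMap (∑ i, m i) (fun k => 𝟙 ((q (finSigmaFinEquiv.symm k).1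
      (finSigmaFinEquiv.symm k).2).eval F)) = _
    rw [e1, e2, id_tensorHom_id]
    exact id_tensorHom_id _ _
  rw [h1, h2] at this
  erw [Category.id_comp, Category.comp_id] at this
  have key : ∀ (G : ShufL m → M), (fun x => (f x).eval F) = G →
      HEq (can G _ _ (shufComp m)) (can F (shufS p0 p q) (shufT p0 p q) h) := by
    rintro _ rfl
    exact heq_of_eq this
  exact eq_of_heq (key _ hF)

end Shuffle

/-! ### Tensor products and colimits -/

section
variable {M : Type u} [Category.{v} M] [MonoidalCategory M] [SymmetricCategory M] [MonoidalClosed M]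
variable {J : Type w} [Category.{w'} J] [HasColimitsOfShape J M]

/-- A tensor product with a colimit in the middle is a colimit. -/
def midColim (Z R : M) (F : J ⥤ M) :
    IsColimit ((tensorRight R ⋙ tensorLeft Z).mapCocone (colimit.cocone F)) :=
  isColimitOfPreserves (tensorRight R ⋙ tensorLeft Z) (colimit.isColimit F)

theorem mid_ext {Z R W : M} {F : J ⥤ M} {f g : Z ⊗ (colimit F ⊗ R) ⟶ W}
    (h : ∀ j, Z ◁ (colimit.ι F j ▷ R) ≫ f = Z ◁ (colimit.ι F j ▷ R) ≫ g) : f = g :=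
  (midColim Z R F).hom_ext h

theorem mid_desc {Z R W : M} {F : J ⥤ M} (φ : ∀ j, Z ⊗ (F.obj j ⊗ R) ⟶ W)
    (h : ∀ {j j'} (u : j ⟶ j'), Z ◁ (F.map u ▷ R) ≫ φ j' = φ j) :
    ∃ ψ : Z ⊗ (colimit F ⊗ R) ⟶ W, ∀ j, Z ◁ (colimit.ι F j ▷ R) ≫ ψ = φ j :=
  let c : Cocone (F ⋙ tensorRight R ⋙ tensorLeft Z) :=
    ⟨W, ⟨φ, fun _ _ u => (h u).trans (Category.comp_id _).symm⟩⟩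
  ⟨(midColim Z R F).desc c, fun j => (midColim Z R F).fac c j⟩

theorem step_ext {Z A A' R R' W : M} {a : A ⟶ A'} {r : R ⟶ R'} {f g : Z ⊗ (A' ⊗ R') ⟶ W}
    (h : Z ◁ (a ⊗ₘ r) ≫ f = Z ◁ (a ⊗ₘ r) ≫ g) :
    ((Z ⊗ A) ◁ r) ≫ (α_ Z A R').hom ≫ Z ◁ (a ▷ R') ≫ f =
      ((Z ⊗ A) ◁ r) ≫ (α_ Z A R').hom ≫ Z ◁ (a ▷ R') ≫ g := by
  rw [tensorHom_def', MonoidalCategory.whiskerLeft_comp, Category.assoc, Category.assoc] at h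
  rw [associator_naturality_right_assoc, associator_naturality_right_assoc, h]

theorem step_nat {Z A R R' W : M} {r : R ⟶ R'} {f : Z ⊗ (A ⊗ R) ⟶ W} {f' : Z ⊗ (A ⊗ R') ⟶ W}
    (h : Z ◁ (𝟙 A ⊗ₘ r) ≫ f' = f) :
    ((Z ⊗ A) ◁ r) ≫ (α_ Z A R').hom ≫ f' = (α_ Z A R).hom ≫ f := by
  rw [← h, id_tensorHom, associator_naturality_right_assoc]

theorem step_u {Z A A' R R' W : M} {u : A ⟶ A'} {r : R ⟶ R'} {f : Z ⊗ (A ⊗ R) ⟶ W}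
    {f' : Z ⊗ (A' ⊗ R) ⟶ W} {p : (Z ⊗ A) ⊗ R' ⟶ W} {p' : (Z ⊗ A') ⊗ R' ⟶ W}
    (h : Z ◁ (u ⊗ₘ 𝟙 R) ≫ f' = f) (hp : ((Z ⊗ A) ◁ r) ≫ p = (α_ Z A R).hom ≫ f)
    (hp' : ((Z ⊗ A') ◁ r) ≫ p' = (α_ Z A' R).hom ≫ f') :
    ((Z ⊗ A) ◁ r) ≫ (α_ Z A R').hom ≫ Z ◁ (u ▷ R') ≫ (α_ Z A' R').inv ≫ p' =
      ((Z ⊗ A) ◁ r) ≫ (α_ Z A R').hom ≫ (α_ Z A R').inv ≫ p := by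
  rw [Iso.hom_inv_id_assoc, hp, ← h, tensorHom_id, associator_inv_naturality_middle_assoc,
    Iso.hom_inv_id_assoc, whisker_exchange_assoc, hp', associator_naturality_middle_assoc]

theorem step_fac {Z A A' R R' W : M} {a : A ⟶ A'} {r : R ⟶ R'} {f : Z ⊗ (A ⊗ R) ⟶ W}
    {p : (Z ⊗ A) ⊗ R' ⟶ W} {q : Z ⊗ (A' ⊗ R') ⟶ W}
    (hp : ((Z ⊗ A) ◁ r) ≫ p = (α_ Z A R).hom ≫ f)
    (hq : Z ◁ (a ▷ R') ≫ q = (α_ Z A R').inv ≫ p) : Z ◁ (a ⊗ₘ r) ≫ q = f := by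
  rw [tensorHom_def', MonoidalCategory.whiskerLeft_comp, Category.assoc, hq,
    associator_inv_naturality_right_assoc, hp, Iso.inv_hom_id_assoc]

theorem bigT_ext : ∀ (n : ℕ) {D : Fin n → J ⥤ M} {Z W : M}
    {f g : Z ⊗ bigT n (fun i => colimit (D i)) ⟶ W}
    (_ : ∀ j : Fin n → J, Z ◁ bigTMap n (fun i => colimit.ι (D i) (j i)) ≫ f =
      Z ◁ bigTMap n (fun i => colimit.ι (D i) (j i)) ≫ g), f = g
  | 0, D, Z, W, f, g, h => by
    have h1 := h Fin.elim0
    have h2 : Z ◁ bigTMap 0 (fun i => colimit.ι (D i) (Fin.elim0 i)) = 𝟙 (Z ⊗ 𝟙_ M) :=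
      MonoidalCategory.whiskerLeft_id _ _
    rw [h2] at h1
    exact (Category.id_comp _).symm.trans (h1.trans (Category.id_comp _))
  | n + 1, D, Z, W, f, g, h => by
    refine mid_ext (F := D 0) (R := bigT n fun i => colimit (D i.succ)) fun j0 => ?_
    rw [← cancel_epi (α_ _ _ _).hom]
    exact bigT_ext n (D := fun i => D i.succ) fun j => step_ext (h (Fin.cons j0 j))

theorem bigT_desc : ∀ (n : ℕ) {D : Fin n → J ⥤ M} {Z W : M}
    (φ : ∀ j : Fin n → J, Z ⊗ bigT n (fun i => (D i).obj (j i)) ⟶ W)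
    (_ : ∀ {j j' : Fin n → J} (u : ∀ i, j i ⟶ j' i),
      Z ◁ bigTMap n (fun i => (D i).map (u i)) ≫ φ j' = φ j),
    ∃ ψ : Z ⊗ bigT n (fun i => colimit (D i)) ⟶ W,
      ∀ j : Fin n → J, Z ◁ bigTMap n (fun i => colimit.ι (D i) (j i)) ≫ ψ = φ j
  | 0, D, Z, W, φ, h => by
    refine ⟨φ Fin.elim0, fun j => ?_⟩
    have h2 : Z ◁ bigTMap 0 (fun i => colimit.ι (D i) (j i)) = 𝟙 (Z ⊗ 𝟙_ M) :=
      MonoidalCategory.whiskerLeft_id _ _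
    rw [h2]
    have : j = Fin.elim0 := funext fun i => i.elim0
    subst this
    exact Category.id_comp _
  | n + 1, D, Z, W, φ, h => by
    have ex : ∀ j0 : J, ∃ ψ : (Z ⊗ (D 0).obj j0) ⊗ bigT n (fun i => colimit (D i.succ)) ⟶ W,
        ∀ j : Fin n → J, _ ◁ bigTMap n (fun i => colimit.ι (D i.succ) (j i)) ≫ ψ =
          (α_ Z ((D 0).obj j0) (bigT n fun i => (D i.succ).obj (j i))).hom ≫
            (φ (Fin.cons j0 j) : Z ⊗ ((D 0).obj j0 ⊗ bigT n fun i => (D i.succ).obj (j i)) ⟶ W) := by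
      intro j0
      refine bigT_desc n (D := fun i => D i.succ) _ fun {j j'} u => step_nat ?_
      have h1 := h (j := Fin.cons j0 j) (j' := Fin.cons j0 j')
        (fun i => Fin.cases (motive := fun i => (Fin.cons j0 j : Fin (n + 1) → J) i ⟶
          (Fin.cons j0 j' : Fin (n + 1) → J) i) (𝟙 j0) u i)
      rw [← (D 0).map_id]
      exact h1
    choose ψ hψ using ex
    obtain ⟨χ, hχ⟩ := mid_desc (F := D 0) (R := bigT n fun i => colimit (D i.succ))
      (fun j0 => (α_ _ _ _).inv ≫ ψ j0) (fun {j0 j0'} u => by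
        rw [← cancel_epi (α_ _ _ _).hom]
        refine bigT_ext n (D := fun i => D i.succ) fun j => step_u ?_ (hψ j0 j) (hψ j0' j)
        have h1 := h (j := Fin.cons j0 j) (j' := Fin.cons j0' j)
          (fun i => Fin.cases (motive := fun i => (Fin.cons j0 j : Fin (n + 1) → J) i ⟶
            (Fin.cons j0' j : Fin (n + 1) → J) i) u (fun i => 𝟙 (j i)) i)
        have h2 : bigTMap n (fun i => (D i.succ).map (𝟙 (j i))) = 𝟙 _ := by
          simp only [CategoryTheory.Functor.map_id]
          exact bigTMap_id _ _
        rw [← h2]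
        exact h1)
    refine ⟨χ, fun j => ?_⟩
    have h3 := step_fac (hψ (j 0) fun i => j i.succ) (hχ (j 0))
    have : (Fin.cons (j 0) fun i => j i.succ : Fin (n + 1) → J) = j := Fin.cons_self_tail j
    have key : ∀ k, k = j → HEq (φ k) (φ j) := by
      rintro _ rfl
      rfl
    exact h3.trans (eq_of_heq (key _ this))

end

/-! ### Tensor products over groupoids -/

section
variable {M : Type u} [Category.{v} M] [MonoidalCategory M]
variable {D : Type w} [Groupoid.{w'} D]

/-- The functor `d ↦ X d ⊗ Y d`, where `D` is identified with its opposite by inverses. -/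
@[simps]
def tensDiag (X : Dᵒᵖ ⥤ M) (Y : D ⥤ M) : D ⥤ M where
  obj d := X.obj (op d) ⊗ Y.obj d
  map g := X.map (Groupoid.inv g).op ⊗ₘ Y.map g
  map_id d := by
    rw [Groupoid.inv_eq_inv, IsIso.inv_id, op_id, X.map_id, Y.map_id, id_tensorHom_id]
  map_comp f g := by
    rw [Groupoid.inv_eq_inv, Groupoid.inv_eq_inv, Groupoid.inv_eq_inv, IsIso.inv_comp, op_comp,
      X.map_comp, Y.map_comp, tensorHom_comp_tensorHom]

variable [HasColimitsOfShape D M]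

/-- The tensor product `X ⊗_D Y` of a right and a left module over a groupoid `D`. -/
abbrev tensorOver (X : Dᵒᵖ ⥤ M) (Y : D ⥤ M) : M := colimit (tensDiag X Y)

abbrev tι (X : Dᵒᵖ ⥤ M) (Y : D ⥤ M) (d : D) : X.obj (op d) ⊗ Y.obj d ⟶ tensorOver X Y :=
  colimit.ι (tensDiag X Y) d

theorem bal_iff {X Y X' Y' W : M} {f : X ⟶ X'} {f' : X' ⟶ X} {g : Y ⟶ Y'} (h : f ≫ f' = 𝟙 X)
    (h' : f' ≫ f = 𝟙 X') {p : X ⊗ Y ⟶ W} {q : X' ⊗ Y' ⟶ W} :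
    (f ⊗ₘ g) ≫ q = p ↔ (f' ▷ Y) ≫ p = (X' ◁ g) ≫ q := by
  constructor
  · rintro rfl
    rw [← tensorHom_id, ← id_tensorHom, tensorHom_comp_tensorHom_assoc, h', Category.id_comp]
  · intro e
    rw [MonoidalCategory.tensorHom_def, Category.assoc, ← e, ← comp_whiskerRight_assoc, h,
      id_whiskerRight, Category.id_comp]

theorem tensDiag_inv (X : Dᵒᵖ ⥤ M) {a b : D} (g : a ⟶ b) :
    X.map (Groupoid.inv g).op ≫ X.map g.op = 𝟙 _ ∧
    X.map g.op ≫ X.map (Groupoid.inv g).op = 𝟙 _ := by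
  rw [← X.map_comp, ← X.map_comp, ← op_comp, ← op_comp, Groupoid.comp_inv, Groupoid.inv_comp,
    op_id, op_id, X.map_id, X.map_id]
  exact ⟨rfl, rfl⟩

theorem tι_w (X : Dᵒᵖ ⥤ M) (Y : D ⥤ M) {a b : D} (g : a ⟶ b) :
    (X.map g.op ▷ Y.obj a) ≫ tι X Y a = (X.obj (op b) ◁ Y.map g) ≫ tι X Y b :=
  (bal_iff (tensDiag_inv X g).1 (tensDiag_inv X g).2).1 (colimit.w (tensDiag X Y) g)

/-- The map out of `X ⊗_D Y` given by a balanced family of maps. -/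
def tdesc (X : Dᵒᵖ ⥤ M) (Y : D ⥤ M) {W : M} (φ : ∀ d, X.obj (op d) ⊗ Y.obj d ⟶ W)
    (h : ∀ {a b : D} (g : a ⟶ b),
      (X.map g.op ▷ Y.obj a) ≫ φ a = (X.obj (op b) ◁ Y.map g) ≫ φ b) : tensorOver X Y ⟶ W :=
  colimit.desc (tensDiag X Y) ⟨W, ⟨φ, fun _ _ g =>
    ((bal_iff (tensDiag_inv X g).1 (tensDiag_inv X g).2).2 (h g)).trans
      (Category.comp_id _).symm⟩⟩

theorem tι_desc (X : Dᵒᵖ ⥤ M) (Y : D ⥤ M) {W : M} (φ : ∀ d, X.obj (op d) ⊗ Y.obj d ⟶ W) (h)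
    (d : D) : tι X Y d ≫ tdesc X Y φ h = φ d :=
  colimit.ι_desc _ _

theorem tmap_aux {X Y X' Y' X1 Y1 W : M} {f : X' ⟶ X1} {g : Y ⟶ Y1} {f' : X ⟶ X'} {g' : Y' ⟶ Y}
    {p : X1 ⊗ Y ⟶ W} {q : X' ⊗ Y1 ⟶ W} (h : (f ▷ Y) ≫ p = (X' ◁ g) ≫ q) :
    ((f' ≫ f) ⊗ₘ g') ≫ p = (f' ⊗ₘ (g' ≫ g)) ≫ q := by
  have h := congrArg (fun z => (f' ⊗ₘ g') ≫ z) h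
  simp only [← tensorHom_id, ← id_tensorHom, tensorHom_comp_tensorHom_assoc, Category.comp_id] at h
  exact h

/-- Functoriality of `X ⊗_D Y`. -/
def tmap {X X' : Dᵒᵖ ⥤ M} {Y Y' : D ⥤ M} (f : X ⟶ X') (g : Y ⟶ Y') :
    tensorOver X Y ⟶ tensorOver X' Y' :=
  tdesc X Y (fun d => (f.app (op d) ⊗ₘ g.app d) ≫ tι X' Y' d) fun u => by
    rw [← tensorHom_id, ← id_tensorHom, tensorHom_comp_tensorHom_assoc,
      tensorHom_comp_tensorHom_assoc, f.naturality, g.naturality, Category.id_comp,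
      Category.id_comp]
    exact tmap_aux (tι_w X' Y' u)

theorem tι_map {X X' : Dᵒᵖ ⥤ M} {Y Y' : D ⥤ M} (f : X ⟶ X') (g : Y ⟶ Y') (d : D) :
    tι X Y d ≫ tmap f g = (f.app (op d) ⊗ₘ g.app d) ≫ tι X' Y' d :=
  tι_desc _ _ _ _ _

theorem t_ext {X : Dᵒᵖ ⥤ M} {Y : D ⥤ M} {W : M} {f g : tensorOver X Y ⟶ W}
    (h : ∀ d, tι X Y d ≫ f = tι X Y d ≫ g) : f = g :=
  colimit.hom_ext h

end

/-! ### Coherence for the permutations of factors used below -/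

section
variable {ι : Type w}

/-- Two shapes have the same labels, up to order. -/
def Tree.P (s t : Tree ι) : Prop := s.leaves.Perm t.leaves

/-- The labels of a shape are distinct. -/
def Tree.Nd (t : Tree ι) : Prop := t.leaves.Nodup

theorem Tree.P.refl (s : Tree ι) : s.P s := List.Perm.refl _
theorem Tree.P.symm {s t : Tree ι} (h : s.P t) : t.P s := List.Perm.symm h
theorem Tree.P.trans {s t r : Tree ι} (h : s.P t) (k : t.P r) : s.P r := List.Perm.trans h k
theorem Tree.P.nd {s t : Tree ι} (h : s.P t) (k : t.Nd) : s.Nd := (List.Perm.nodup_iff h).2 k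
theorem Tree.P.comp {s t : Tree ι} (h : s.P t) (k : t.Nd) : s.Comp t := ⟨h, k⟩
theorem Tree.P.pair {s t s' t' : Tree ι} (h : s.P s') (k : t.P t') :
    (Tree.pair s t).P (.pair s' t') := List.Perm.append h k

theorem catL_perm : ∀ {n : ℕ} {l l' : Fin n → List ι} (_ : ∀ i, (l i).Perm (l' i)),
    (catL n l).Perm (catL n l')
  | 0, _, _, _ => List.Perm.refl _
  | _ + 1, _, _, h => (h 0).append (catL_perm fun i => h i.succ)

theorem Tree.P.node {n : ℕ} {s t : Fin n → Tree ι} (h : ∀ i, (s i).P (t i)) :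
    (Tree.node n s).P (.node n t) := catL_perm h

theorem Tree.Nd.left {s t : Tree ι} (h : (Tree.pair s t).Nd) : s.Nd := (List.nodup_append.1 h).1
theorem Tree.Nd.right {s t : Tree ι} (h : (Tree.pair s t).Nd) : t.Nd :=
  (List.nodup_append.1 h).2.1

theorem catL_nodup : ∀ {n : ℕ} {l : Fin n → List ι} (_ : (catL n l).Nodup) (i : Fin n),
    (l i).Nodup
  | _ + 1, l, h, i => Fin.cases (motive := fun i => (l i).Nodup) (List.nodup_append.1 h).1
      (fun j => catL_nodup (List.nodup_append.1 h).2.1 j) i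

theorem Tree.Nd.node {n : ℕ} {t : Fin n → Tree ι} (h : (Tree.node n t).Nd) (i : Fin n) :
    (t i).Nd := catL_nodup h i

theorem Tree.P.of_cnt [DecidableEq ι] {s t : Tree ι} (h : ∀ x, s.cnt x = t.cnt x) : s.P t :=
  List.perm_iff_count.2 fun x => by rw [Tree.leaves_count, Tree.leaves_count, h x]

theorem Tree.Nd.of_cnt [DecidableEq ι] {t : Tree ι} (h : ∀ x, t.cnt x ≤ 1) : t.Nd :=
  List.nodup_iff_count_le_one.2 fun x => by rw [Tree.leaves_count]; exact h x

theorem P_perm {n m : ℕ} (e : Fin n ≃ Fin m) (t : Fin m → Tree ι) :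
    (Tree.node n fun i => t (e i)).P (.node m t) := by
  classical
  exact .of_cnt fun x => e.sum_comp (fun i => (t i).cnt x)

theorem P_perm' {n m : ℕ} (e : Fin n ≃ Fin m) {t' : Fin n → Tree ι} {t : Fin m → Tree ι}
    (h : ∀ i, t' i = t (e i)) : (Tree.node n t').P (.node m t) := by
  obtain rfl : t' = fun i => t (e i) := funext h
  exact P_perm e t

theorem P_shuf {n : ℕ} {m : Fin n → ℕ} (p0 : Tree ι) (p : Fin n → Tree ι)
    (q : ∀ i, Fin (m i) → Tree ι) : (shufS p0 p q).P (shufT p0 p q) := by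
  classical
  exact .of_cnt (shuf_cnt p0 p q)

end

section
variable {M : Type u} [Category.{v} M] [MonoidalCategory M] [SymmetricCategory M]
variable {ι : Type w}

theorem can_pairP (F : ι → M) {s s' t t' : Tree ι} (h : s.P s') (k : t.P t')
    (nd : (Tree.pair s' t').Nd) :
    can F s s' (h.comp nd.left) ⊗ₘ can F t t' (k.comp nd.right) =
      can F (.pair s t) (.pair s' t') ((h.pair k).comp nd) :=
  (can_pair F _ _ _).symm

theorem can_whiskerLeft (F : ι → M) {p t t' : Tree ι} (k : t.P t') (nd : (Tree.pair p t').Nd) :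
    p.eval F ◁ can F t t' (k.comp nd.right) =
      can F (.pair p t) (.pair p t') (((Tree.P.refl p).pair k).comp nd) := by
  rw [← can_pairP F (.refl p) k nd, can_refl, id_tensorHom]

theorem can_whiskerRight (F : ι → M) {p t t' : Tree ι} (k : t.P t') (nd : (Tree.pair t' p).Nd) :
    can F t t' (k.comp nd.left) ▷ p.eval F =
      can F (.pair t p) (.pair t' p) ((k.pair (Tree.P.refl p)).comp nd) := by
  rw [← can_pairP F k (.refl p) nd, can_refl, tensorHom_id]

theorem can_nodeP (F : ι → M) {n : ℕ} {s t : Fin n → Tree ι} (h : ∀ i, (s i).P (t i))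
    (nd : (Tree.node n t).Nd) :
    bigTMap n (fun i => can F (s i) (t i) ((h i).comp (nd.node i))) =
      can F (.node n s) (.node n t) ((Tree.P.node h).comp nd) :=
  (can_node F _ _).symm

theorem reindex_canP (F : ι → M) {n m : ℕ} (e : Fin n ≃ Fin m) {t' : Fin n → Tree ι}
    {t : Fin m → Tree ι} (h : ∀ i, t' i = t (e i)) (nd : (Tree.node m t).Nd) :
    reindex (F := fun i => (t i).eval F) e
      (fun i => eqToHom (congrArg (Tree.eval F) (h i))) =
      can F (.node n t') (.node m t) ((P_perm' e h).comp nd) := by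
  obtain rfl : t' = fun i => t (e i) := funext h
  rw [← permT_can F e t ((P_perm' e h).comp nd)]
  exact (congrArg (fun z => z ≫ permT e fun i => (t i).eval F) (bigTMap_id n _)).trans
    (Category.id_comp _)

/-- The bijection of pairs of indices given by bijections in each block. -/
abbrev innerE {n : ℕ} {m m' : Fin n → ℕ} (e : ∀ i, Fin (m i) ≃ Fin (m' i)) :
    Fin (∑ i, m i) ≃ Fin (∑ i, m' i) :=
  finSigmaFinEquiv.symm.trans ((Equiv.sigmaCongrRight e).trans finSigmaFinEquiv.symm.symm)

/-- The bijection of pairs of indices given by a bijection of the blocks. -/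
abbrev outerE {n n' : ℕ} {m' : Fin n' → ℕ} (σ : Fin n ≃ Fin n') :
    Fin (∑ i, m' (σ i)) ≃ Fin (∑ i, m' i) :=
  finSigmaFinEquiv.symm.trans
    ((Equiv.sigmaCongrLeft (β := fun i => Fin (m' i)) σ).trans finSigmaFinEquiv.symm.symm)

theorem innerE_symm {n : ℕ} {m m' : Fin n → ℕ} (e : ∀ i, Fin (m i) ≃ Fin (m' i)) (k) :
    finSigmaFinEquiv.symm (innerE e k) =
      ⟨(finSigmaFinEquiv.symm k).1, e _ (finSigmaFinEquiv.symm k).2⟩ :=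
  Equiv.symm_apply_apply _ _

theorem outerE_symm {n n' : ℕ} {m' : Fin n' → ℕ} (σ : Fin n ≃ Fin n') (k) :
    finSigmaFinEquiv.symm (outerE (m' := m') σ k) =
      ⟨σ (finSigmaFinEquiv.symm k).1, (finSigmaFinEquiv.symm k).2⟩ :=
  Equiv.symm_apply_apply _ _

theorem flat_congr {α : Sort*} {n : ℕ} {m : Fin n → ℕ} (Q : ∀ i, Fin (m i) → α)
    {p : Σ i, Fin (m i)} {i : Fin n} {j : Fin (m i)} (h : p = ⟨i, j⟩) : Q i j = Q p.1 p.2 := by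
  subst h; rfl

theorem shuffle_perm_inner {n : ℕ} {m m' : Fin n → ℕ} (P0 : M) (P : Fin n → M)
    (Q : ∀ i, Fin (m' i) → M) (e : ∀ i, Fin (m i) ≃ Fin (m' i)) :
    (P0 ◁ bigTMap n fun i => P i ◁ permT (e i) (Q i)) ≫ shuffle P0 P Q =
      shuffle P0 P (fun i j => Q i (e i j)) ≫ (P0 ⊗ bigT n P) ◁ reindex (innerE e)
        (F := fun k => Q (finSigmaFinEquiv.symm k).1 (finSigmaFinEquiv.symm k).2)
        (fun k => eqToHom (flat_congr Q (innerE_symm e k))) := by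
  let F := shufF P0 P Q
  have ndT : (shufT (m := m') shufL0 shufL1 shufL2).Nd := (shufComp m').2
  have ndS : (shufS (m := m') shufL0 shufL1 shufL2).Nd := (P_shuf _ _ _).nd ndT
  have h1 : ∀ i, (Tree.node (m i) fun j => shufL2 i (e i j)).P (.node (m' i) (shufL2 i)) :=
    fun i => P_perm (e i) (shufL2 i)
  have e1 := fun i => permT_can F (e i) (shufL2 i) ((h1 i).comp (ndS.right.node i).right)
  have e2 := fun i => (congrArg (fun z => P i ◁ z) (e1 i)).trans
    (can_whiskerLeft F (p := shufL1 i) (h1 i) (ndS.right.node i))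
  have e3 := (congrArg (fun z => P0 ◁ bigTMap n z) (funext e2)).trans
    ((congrArg (fun z => P0 ◁ z) (can_nodeP F (fun i => (Tree.P.refl _).pair (h1 i)) ndS.right)).trans
      (can_whiskerLeft F (p := shufL0) (.node fun i => (Tree.P.refl _).pair (h1 i)) ndS))
  have f1 := reindex_canP F (innerE e)
    (t' := fun k => shufL2 (finSigmaFinEquiv.symm k).1 (e _ (finSigmaFinEquiv.symm k).2))
    (fun k => flat_congr (shufL2 (m := m')) (innerE_symm e k)) ndT.right
  have f2 := (congrArg (fun z => (P0 ⊗ bigT n P) ◁ z) f1).trans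
    (can_whiskerLeft F (p := .pair shufL0 (.node n shufL1)) (P_perm' (innerE e)
      (fun k => flat_congr (shufL2 (m := m')) (innerE_symm e k))) ndT)
  have hP := P_shuf (m := m) (shufL0 (m := m')) shufL1 fun i j => shufL2 i (e i j)
  have hT : (shufT (m := m) (shufL0 (m := m')) shufL1 fun i j => shufL2 i (e i j)).P
    (shufT shufL0 shufL1 shufL2) := (Tree.P.refl _).pair (P_perm' (innerE e)
      (fun k => flat_congr (shufL2 (m := m')) (innerE_symm e k)))
  have g1 := shuffle_can F (m := m) shufL0 shufL1 (fun i j => shufL2 i (e i j))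
    (hP.comp (hT.nd ndT))
  have lhs := (congrArg (fun z => z ≫ shuffle P0 P Q) e3).trans (can_trans F _ (shufComp m'))
  have rhs := (congrArg₂ (fun z z' => z ≫ z') g1 f2).trans (can_trans F _ _)
  exact lhs.trans rhs.symm

theorem shuffle_perm_outer {n n' : ℕ} {m : Fin n' → ℕ} (P0 : M) (P : Fin n' → M)
    (Q : ∀ i, Fin (m i) → M) (σ : Fin n ≃ Fin n') :
    (P0 ◁ permT σ fun i => P i ⊗ bigT (m i) (Q i)) ≫ shuffle P0 P Q =
      shuffle P0 (fun i => P (σ i)) (fun i => Q (σ i)) ≫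
        ((P0 ◁ permT σ P) ⊗ₘ reindex (outerE σ)
        (F := fun k => Q (finSigmaFinEquiv.symm k).1 (finSigmaFinEquiv.symm k).2)
        (fun k => eqToHom (flat_congr Q (outerE_symm σ k)))) := by
  let F := shufF P0 P Q
  have ndT : (shufT (m := m) shufL0 shufL1 shufL2).Nd := (shufComp m).2
  have ndS : (shufS (m := m) shufL0 shufL1 shufL2).Nd := (P_shuf _ _ _).nd ndT
  have e1 := permT_can F σ (fun i => .pair (shufL1 i) (.node (m i) (shufL2 i)))
    ((P_perm σ _).comp ndS.right)
  have e3 := (congrArg (fun z => P0 ◁ z) e1).trans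
      (can_whiskerLeft F (p := shufL0) (P_perm σ _) ndS)
  have f0 := permT_can F σ (shufL1 (m := m)) ((P_perm σ _).comp ndT.left.right)
  have f00 := (congrArg (fun z => P0 ◁ z) f0).trans
    (can_whiskerLeft F (p := shufL0) (P_perm σ _) ndT.left)
  have hE : ∀ k, shufL2 (σ (finSigmaFinEquiv.symm k).1) (finSigmaFinEquiv.symm k).2 = _ :=
    (fun k => flat_congr (shufL2 (m := m)) (outerE_symm σ k))
  have f1 := reindex_canP F (outerE σ) hE ndT.right
  have f2 := (congrArg₂ (fun z z' => z ⊗ₘ z') f00 f1).trans (can_pairP F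
    ((Tree.P.refl _).pair (P_perm σ _)) (P_perm' (outerE σ) hE) ndT)
  have hP := P_shuf (m := fun i => m (σ i)) (shufL0 (m := m)) (fun i => shufL1 (σ i))
    fun i => shufL2 (σ i)
  have hT : (shufT (m := fun i => m (σ i)) (shufL0 (m := m)) (fun i => shufL1 (σ i))
    fun i => shufL2 (σ i)).P (shufT shufL0 shufL1 shufL2) :=
    ((Tree.P.refl _).pair (P_perm σ _)).pair (P_perm' (outerE σ) hE)
  have g1 := shuffle_can F (m := fun i => m (σ i)) shufL0 (fun i => shufL1 (σ i))
    (fun i => shufL2 (σ i)) (hP.comp (hT.nd ndT))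
  have lhs := (congrArg (fun z => z ≫ shuffle P0 P Q) e3).trans (can_trans F _ (shufComp m))
  have rhs := (congrArg₂ (fun z z' => z ≫ z') g1 f2).trans (can_trans F _ _)
  exact lhs.trans rhs.symm

end

section
variable {n : ℕ} {m : Fin n → ℕ} (l : ∀ i, Fin (m i) → ℕ)

/-- The order-preserving bijection of triples of indices. -/
abbrev assocE : Fin (∑ k, l (finSigmaFinEquiv.symm k).1 (finSigmaFinEquiv.symm k).2) ≃
    Fin (∑ i, ∑ j, l i j) :=
  finSigmaFinEquiv.symm.trans <| Equiv.trans
    ((Equiv.sigmaCongrLeft (β := fun p : Σ i, Fin (m i) => Fin (l p.1 p.2))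
      finSigmaFinEquiv.symm).trans <|
    (Equiv.sigmaAssoc fun i j => Fin (l i j)).trans <|
    Equiv.sigmaCongrRight fun _ => finSigmaFinEquiv) finSigmaFinEquiv.symm.symm

theorem assocE_symm (k) : finSigmaFinEquiv.symm (assocE l k) =
    ⟨(finSigmaFinEquiv.symm (finSigmaFinEquiv.symm k).1).1,
      finSigmaFinEquiv ⟨(finSigmaFinEquiv.symm (finSigmaFinEquiv.symm k).1).2,
        (finSigmaFinEquiv.symm k).2⟩⟩ :=
  Equiv.symm_apply_apply _ _

theorem assoc_congr {α : Sort*} (R : ∀ i j, Fin (l i j) → α)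
    (k : Fin (∑ k, l (finSigmaFinEquiv.symm k).1 (finSigmaFinEquiv.symm k).2)) :
    R (finSigmaFinEquiv.symm (finSigmaFinEquiv.symm k).1).1
      (finSigmaFinEquiv.symm (finSigmaFinEquiv.symm k).1).2 (finSigmaFinEquiv.symm k).2 =
    R (finSigmaFinEquiv.symm (assocE l k)).1
      (finSigmaFinEquiv.symm (finSigmaFinEquiv.symm (assocE l k)).2).1
      (finSigmaFinEquiv.symm (finSigmaFinEquiv.symm (assocE l k)).2).2 := by
  have h := flat_congr (fun i (q : Fin (∑ j, l i j)) => R i (finSigmaFinEquiv.symm q).1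
    (finSigmaFinEquiv.symm q).2) (assocE_symm l k)
  refine Eq.trans ?_ h
  exact flat_congr (R _) (finSigmaFinEquiv.symm_apply_apply _)

/-- Labels for the factors in the associativity of shuffles. -/
abbrev AssocL : Type := Unit ⊕ (Fin n ⊕ ((Σ i, Fin (m i)) ⊕ (Σ i, Σ j, Fin (l i j))))

abbrev aL0 : Tree (AssocL l) := .leaf (.inl ())
abbrev aL1 (i : Fin n) : Tree (AssocL l) := .leaf (.inr (.inl i))
abbrev aL2 (i : Fin n) (j : Fin (m i)) : Tree (AssocL l) := .leaf (.inr (.inr (.inl ⟨i, j⟩)))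
abbrev aL3 (i : Fin n) (j : Fin (m i)) (k : Fin (l i j)) : Tree (AssocL l) :=
  .leaf (.inr (.inr (.inr ⟨i, j, k⟩)))

theorem aNd : (shufS (aL0 l) (aL1 l) fun i j => .pair (aL2 l i j) (.node _ (aL3 l i j))).Nd := by
  classical
  refine .of_cnt fun x => ?_
  rcases x with x | x | x | x
  · simp [shufS, Tree.cnt]
  · simp [shufS, Tree.cnt]
  · have h : (∑ i, ∑ j : Fin (m i), if (⟨i, j⟩ : Σ i, Fin (m i)) = x then 1 else 0) =
        ∑ p : Σ i, Fin (m i), if p = x then 1 else 0 := by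
      rw [Fintype.sum_sigma]
    simp only [shufS, Tree.cnt, reduceCtorEq, if_false, Sum.inr.injEq, Sum.inl.injEq, zero_add,
      Finset.sum_const_zero, add_zero, h, Finset.sum_ite_eq', Finset.mem_univ, if_true, le_refl]
  · have h : (∑ i, ∑ j, ∑ k : Fin (l i j), if (⟨i, j, k⟩ : Σ i, Σ j, Fin (l i j)) = x
        then 1 else 0) = ∑ p : Σ i, Σ j, Fin (l i j), if p = x then 1 else 0 := by
      simp only [Fintype.sum_sigma]
    simp only [shufS, Tree.cnt, reduceCtorEq, if_false, Sum.inr.injEq, zero_add,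
      h, Finset.sum_ite_eq', Finset.mem_univ, if_true, le_refl]

end

section
variable {M : Type u} [Category.{v} M] [MonoidalCategory M] [SymmetricCategory M]

/-- The factors in the associativity of shuffles. -/
def assocF {n : ℕ} {m : Fin n → ℕ} (l : ∀ i, Fin (m i) → ℕ) (P0 : M) (P : Fin n → M)
    (Q : ∀ i, Fin (m i) → M) (R : ∀ i j, Fin (l i j) → M) : AssocL l → M
  | .inl _ => P0
  | .inr (.inl i) => P i
  | .inr (.inr (.inl p)) => Q p.1 p.2
  | .inr (.inr (.inr p)) => R p.1 p.2.1 p.2.2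

theorem shuffle_assoc {n : ℕ} {m : Fin n → ℕ} (l : ∀ i, Fin (m i) → ℕ) (P0 : M) (P : Fin n → M)
    (Q : ∀ i, Fin (m i) → M) (R : ∀ i j, Fin (l i j) → M) :
    (P0 ◁ bigTMap n fun i => shuffle (P i) (Q i) (R i)) ≫
      shuffle P0 (fun i => P i ⊗ bigT (m i) (Q i))
        (fun i k => R i (finSigmaFinEquiv.symm k).1 (finSigmaFinEquiv.symm k).2) ≫
      (shuffle P0 P Q ▷ _) =
    shuffle P0 P (fun i j => Q i j ⊗ bigT (l i j) (R i j)) ≫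
      shuffle (P0 ⊗ bigT n P) (fun k => Q (finSigmaFinEquiv.symm k).1 (finSigmaFinEquiv.symm k).2)
        (fun k => R (finSigmaFinEquiv.symm k).1 (finSigmaFinEquiv.symm k).2) ≫
      (_ ◁ reindex (assocE l) (F := fun k => R (finSigmaFinEquiv.symm k).1
          (finSigmaFinEquiv.symm (finSigmaFinEquiv.symm k).2).1
          (finSigmaFinEquiv.symm (finSigmaFinEquiv.symm k).2).2)
        (fun k => eqToHom (assoc_congr l R k))) := by
  let F := assocF l P0 P Q R
  have nd0 := aNd l
  -- left-hand side
  have hP1 : ∀ i, (shufS (aL1 l i) (aL2 l i) (aL3 l i)).P (shufT (aL1 l i) (aL2 l i) (aL3 l i)) :=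
    fun i => P_shuf _ _ _
  have hA : (Tree.pair (aL0 l) (.node n fun i => shufS (aL1 l i) (aL2 l i) (aL3 l i))).P
    (.pair (aL0 l) (.node n fun i => shufT (aL1 l i) (aL2 l i) (aL3 l i))) :=
    (Tree.P.refl _).pair (.node hP1)
  have nd1 := hA.symm.nd nd0
  have a1 : ∀ i, shuffle (P i) (Q i) (R i) = _ :=
    fun i => shuffle_can F (aL1 l i) (aL2 l i) (aL3 l i) ((hP1 i).comp (nd1.right.node i))
  have a2 := (congrArg (fun z => P0 ◁ bigTMap n z) (funext a1)).trans
    ((congrArg (fun z => P0 ◁ z) (can_nodeP F hP1 nd1.right)).trans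
      (can_whiskerLeft F (p := aL0 l) (.node hP1) nd1))
  have hB := P_shuf (aL0 l) (fun i => .pair (aL1 l i) (.node (m i) (aL2 l i)))
    (fun i k => aL3 l i (finSigmaFinEquiv.symm k).1 (finSigmaFinEquiv.symm k).2)
  have nd2 := hB.symm.nd nd1
  have a3 := shuffle_can F _ _ _ (hB.comp nd2)
  have hC := (P_shuf (aL0 l) (aL1 l) (aL2 l)).pair (Tree.P.refl (.node (∑ i, ∑ j, l i j)
    fun k => aL3 l (finSigmaFinEquiv.symm k).1 (finSigmaFinEquiv.symm (finSigmaFinEquiv.symm k).2).1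
      (finSigmaFinEquiv.symm (finSigmaFinEquiv.symm k).2).2))
  have nd3 := hC.symm.nd nd2
  have a4 : shuffle P0 P Q = _ :=
    shuffle_can F (aL0 l) (aL1 l) (aL2 l) ((P_shuf _ _ _).comp nd3.left)
  have a5 := (congrArg (fun z => z ▷ bigT (∑ i, ∑ j, l i j) fun k => R (finSigmaFinEquiv.symm k).1
          (finSigmaFinEquiv.symm (finSigmaFinEquiv.symm k).2).1
          (finSigmaFinEquiv.symm (finSigmaFinEquiv.symm k).2).2) a4).trans
    (can_whiskerRight F (p := .node (∑ i, ∑ j, l i j)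
    fun k => aL3 l (finSigmaFinEquiv.symm k).1 (finSigmaFinEquiv.symm (finSigmaFinEquiv.symm k).2).1
      (finSigmaFinEquiv.symm (finSigmaFinEquiv.symm k).2).2) (P_shuf _ _ _) nd3)
  have lhs := (congrArg₂ (fun z z' => z ≫ z') a2 ((congrArg₂ (fun z z' => z ≫ z') a3 a5).trans
    (can_trans F (hB.comp nd2) (hC.comp nd3)))).trans
    (can_trans F (hA.comp nd1) ((hB.comp nd2).trans (hC.comp nd3)))
  -- right-hand side
  have kA := P_shuf (aL0 l) (aL1 l) fun i j => .pair (aL2 l i j) (.node (l i j) (aL3 l i j))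
  have md1 := kA.symm.nd nd0
  have b1 := shuffle_can F _ _ _ (kA.comp md1)
  have kB := P_shuf (.pair (aL0 l) (.node n (aL1 l)))
    (fun k => aL2 l (finSigmaFinEquiv.symm k).1 (finSigmaFinEquiv.symm k).2)
    (fun k => aL3 l (finSigmaFinEquiv.symm k).1 (finSigmaFinEquiv.symm k).2)
  have md2 := kB.symm.nd md1
  have b2 := shuffle_can F _ _ _ (kB.comp md2)
  have b3 := reindex_canP F (assocE l) (assoc_congr l (aL3 l)) nd3.right
  have kC : (Tree.node _ _).P (.node _ _) := P_perm' (assocE l) (t := fun k =>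
    aL3 l (finSigmaFinEquiv.symm k).1 (finSigmaFinEquiv.symm (finSigmaFinEquiv.symm k).2).1
      (finSigmaFinEquiv.symm (finSigmaFinEquiv.symm k).2).2) (assoc_congr l (aL3 l))
  have b4 := (congrArg (fun z => ((P0 ⊗ bigT n P) ⊗ bigT (∑ i, m i) fun k =>
      Q (finSigmaFinEquiv.symm k).1 (finSigmaFinEquiv.symm k).2) ◁ z) b3).trans
    (can_whiskerLeft F (p := shufT (aL0 l) (aL1 l) (aL2 l)) kC nd3)
  have kD := (Tree.P.refl (shufT (aL0 l) (aL1 l) (aL2 l))).pair kC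
  have rhs := (congrArg₂ (fun z z' => z ≫ z') b1 ((congrArg₂ (fun z z' => z ≫ z') b2 b4).trans
    (can_trans F (kB.comp md2) (kD.comp nd3)))).trans
    (can_trans F (kA.comp md1) ((kB.comp md2).trans (kD.comp nd3)))
  exact lhs.trans rhs.symm

/-- `𝟙 ⟶ 𝟙 ⊗ ⋯ ⊗ 𝟙` (`n` factors). -/
def unitT : (n : ℕ) → (𝟙_ M ⟶ bigT n fun _ => 𝟙_ M)
  | 0 => 𝟙 (𝟙_ M)
  | n + 1 => (λ_ (𝟙_ M)).inv ≫ 𝟙_ M ◁ unitT n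

variable {ι : Type w}

/-- The shape of a tensor product without factors. -/
abbrev Tree.nil : Tree ι := .node 0 fun i => i.elim0

theorem unit_aux1 {A B : M} {f : 𝟙_ M ⟶ A} {g : A ⟶ B} {h : 𝟙_ M ⟶ B} (e : f ≫ g = h) :
    f ≫ (λ_ A).inv ≫ 𝟙_ M ◁ g = (λ_ (𝟙_ M)).inv ≫ 𝟙_ M ◁ h := by
  rw [← e, MonoidalCategory.whiskerLeft_comp, leftUnitor_inv_naturality_assoc]

theorem unit_aux2 {A B : M} (f : A ⟶ B) (g : B ⟶ A) (h : f ≫ g = 𝟙 A) :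
    f ≫ 𝟙 B ≫ (λ_ B).inv ≫ ((𝟙 (𝟙_ M) ≫ 𝟙 (𝟙_ M)) ⊗ₘ g) = (λ_ A).inv := by
  rw [Category.comp_id, id_tensorHom, ← leftUnitor_inv_naturality, Category.id_comp,
    reassoc_of% h]

theorem unit_aux3 {A B B' : M} (f : A ⟶ B) (g : B ⟶ A) (h : f ≫ g = 𝟙 A) {p : B ⟶ B'}
    {q : B' ⟶ B ⊗ 𝟙_ M} (hp : p ≫ q = (ρ_ B).inv) :
    f ≫ p ≫ q ≫ (g ⊗ₘ (𝟙 (𝟙_ M) ≫ 𝟙 (𝟙_ M))) = (ρ_ A).inv := by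
  rw [reassoc_of% hp, Category.comp_id, tensorHom_id, ← rightUnitor_inv_naturality,
    reassoc_of% h]

theorem unit_aux4 {A B B' : M} (f : A ⟶ B) (g : B ⟶ A) (h : f ≫ g = 𝟙 A) {p : B ⟶ B'}
    {q : B' ⟶ B ⊗ 𝟙_ M} (hp : p ≫ q = (ρ_ B).inv) :
    f ≫ p ≫ (q ≫ B ◁ 𝟙 (𝟙_ M)) ≫ (g ⊗ₘ 𝟙 (𝟙_ M)) = (ρ_ A).inv := by
  rw [MonoidalCategory.whiskerLeft_id, Category.comp_id, reassoc_of% hp, tensorHom_id,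
    ← rightUnitor_inv_naturality, reassoc_of% h]

theorem unitT_aux (F : ι → M) : ∀ (n : ℕ) (p : PermCert [] (catL n fun _ => ([] : List ι))),
    p.hom F ≫ (catIso F n fun _ => []).hom = unitT (M := M) n
  | 0, p => by
    have h : p = .nil := PermCert.unique List.nodup_nil _ _
    subst h
    exact Category.comp_id _
  | n + 1, p => by
    exact unit_aux1 (unitT_aux F n p)

theorem unitT_can (F : ι → M) (n : ℕ) (h : (Tree.nil : Tree ι).Comp (.node n fun _ => .nil)) :
    can F .nil (.node n fun _ => .nil) h = unitT n := by
  obtain ⟨p⟩ := PermCert.nonempty h.1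
  rw [can_eq F h p]
  have e : bigTMap n (fun _ => 𝟙 (𝟙_ M)) = 𝟙 _ := bigTMap_id _ _
  have h1 : (Tree.norm F (Tree.node n fun _ => .nil)).inv = (catIso F n fun _ => []).hom := by
    have e' : (𝟙 (𝟙_ M) ≫ 𝟙 (𝟙_ M)) = 𝟙 (𝟙_ M) := Category.comp_id _
    exact (congrArg (fun z => (catIso F n fun _ => []).hom ≫ z)
      ((congrArg (fun z => bigTMap n fun _ => z) e').trans e)).trans (Category.comp_id _)
  have h0 : (Tree.norm F Tree.nil).hom = 𝟙 (𝟙_ M) := Category.comp_id _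
  rw [h1, h0]
  exact (Category.id_comp _).trans (unitT_aux F n p)

theorem P_lam (t : Tree ι) : t.P (.pair .nil t) := List.Perm.refl _
theorem P_rho (t : Tree ι) : t.P (.pair t .nil) := List.Perm.of_eq (List.append_nil _).symm
theorem P_rho' (t : Tree ι) : t.P (.node 1 fun _ => t) := List.Perm.of_eq (List.append_nil _).symm

theorem can_lam (F : ι → M) (t : Tree ι) (h : t.Comp (.pair .nil t)) :
    can F t (.pair .nil t) h = (λ_ (t.eval F)).inv := by
  refine (can_eq F h (.refl t.leaves)).trans ?_
  refine (congrArg (fun z => (t.norm F).hom ≫ z ≫ _) (PermCert.refl_hom F t.leaves)).trans ?_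
  exact unit_aux2 _ _ (t.norm F).hom_inv_id

theorem can_rho (F : ι → M) (t : Tree ι) (h : t.Comp (.pair t .nil)) :
    can F t (.pair t .nil) h = (ρ_ (t.eval F)).inv := by
  obtain ⟨p, hp⟩ := PermCert.rightNil (M := M) t.leaves
  rw [can_eq F h p]
  exact unit_aux3 _ _ (t.norm F).hom_inv_id (hp F)

theorem can_rho' (F : ι → M) (t : Tree ι) (h : t.Comp (.node 1 fun _ => t)) :
    can F t (.node 1 fun _ => t) h = (ρ_ (t.eval F)).inv := by
  obtain ⟨p, hp⟩ := PermCert.rightNil (M := M) t.leaves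
  rw [can_eq F h p]
  exact unit_aux4 _ _ (t.norm F).hom_inv_id (hp F)

/-- The bijection of pairs of indices with one block. -/
abbrev oneE (k : ℕ) : Fin (∑ _ : Fin 1, k) ≃ Fin k :=
  finSigmaFinEquiv.symm.trans
    (Equiv.trans (α := Σ _ : Fin 1, Fin k) ⟨fun p => p.2, fun j => ⟨0, j⟩, fun p => by
      obtain ⟨i, j⟩ := p
      rw [Subsingleton.elim i 0], fun _ => rfl⟩ (Equiv.refl _).symm)

/-- The bijection of pairs of indices with blocks of length one. -/
abbrev singleE (n : ℕ) : Fin (∑ _ : Fin n, 1) ≃ Fin n :=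
  finSigmaFinEquiv.symm.trans
    (Equiv.trans (α := Σ _ : Fin n, Fin 1) ⟨fun p => p.1, fun i => ⟨i, (0 : Fin 1)⟩, fun p => by
      obtain ⟨i, j⟩ := p
      exact congrArg (Sigma.mk i) (Subsingleton.elim (α := Fin 1) _ _), fun _ => rfl⟩
      (Equiv.refl _).symm)

/-- Labels for the unit laws. -/
abbrev uL0 {n : ℕ} : Tree (Option (Fin n)) := .leaf none
abbrev uL1 {n : ℕ} (i : Fin n) : Tree (Option (Fin n)) := .leaf (some i)

theorem uNd (n : ℕ) : (Tree.pair uL0 (.node n uL1)).Nd := by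
  classical
  refine .of_cnt fun x => ?_
  rcases x with _ | x
  · simp [Tree.cnt]
  · simp [Tree.cnt]

/-- The factors in the unit laws. -/
def unitF {n : ℕ} (P : M) (Q : Fin n → M) : Option (Fin n) → M
  | none => P
  | some i => Q i

theorem shuffle_unit_left {k : ℕ} (P : M) (Q : Fin k → M) :
    (ρ_ (P ⊗ bigT k Q)).inv ≫ (λ_ ((P ⊗ bigT k Q) ⊗ 𝟙_ M)).inv ≫
      (shuffle (n := 1) (m := fun _ => k) (𝟙_ M) (fun _ => P) (fun _ => Q) :
        𝟙_ M ⊗ ((P ⊗ bigT k Q) ⊗ 𝟙_ M) ⟶ (𝟙_ M ⊗ (P ⊗ 𝟙_ M)) ⊗ bigT2 fun _ : Fin 1 => Q) ≫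
      (_ ◁ reindex (oneE k) (F := Q) (fun _ => eqToHom rfl)) =
    ((ρ_ P).inv ≫ (λ_ (P ⊗ 𝟙_ M)).inv) ▷ bigT k Q := by
  let F := unitF P Q
  have nd := uNd k
  let t : Tree (Option (Fin k)) := .pair uL0 (.node k uL1)
  have hA := P_rho' t
  have nd1 := hA.symm.nd nd
  have a1 := can_rho' F t (hA.comp nd1)
  have hB := P_lam (.node 1 fun _ => t)
  have nd2 := hB.symm.nd nd1
  have a2 := can_lam F (.node 1 fun _ => t) (hB.comp nd2)
  have hC := P_shuf (m := fun _ => k) .nil (fun _ : Fin 1 => uL0) (fun _ => uL1)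
  have nd3 := hC.symm.nd nd2
  have a3 := shuffle_can F (m := fun _ => k) .nil (fun _ : Fin 1 => uL0) (fun _ => uL1)
    (hC.comp nd3)
  have hD : (Tree.node _ fun j => uL1 ((finSigmaFinEquiv (n := fun _ : Fin 1 => k)).symm j).2).P
    (.node k uL1) := P_perm' (oneE k) fun _ => rfl
  have hD' := (Tree.P.refl (.pair .nil (.node 1 fun _ => uL0))).pair hD
  have nd4 := hD'.symm.nd nd3
  have a4 := (congrArg (fun z => (𝟙_ M ⊗ (P ⊗ 𝟙_ M)) ◁ z)
    (reindex_canP F (oneE k) (t := uL1) (fun _ => rfl) nd.right)).trans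
      (can_whiskerLeft F (p := .pair .nil (.node 1 fun _ => uL0)) hD nd4)
  have lhs := (congrArg₂ (fun z z' => z ≫ z') a1.symm ((congrArg₂ (fun z z' => z ≫ z') a2.symm
    ((congrArg₂ (fun z z' => z ≫ z') a3 a4).trans
    (can_trans F (hC.comp nd3) (hD'.comp nd4)))).trans
    (can_trans F (hB.comp nd2) ((hC.comp nd3).trans (hD'.comp nd4))))).trans
    (can_trans F (hA.comp nd1) ((hB.comp nd2).trans ((hC.comp nd3).trans (hD'.comp nd4))))
  have kA := P_rho' (uL0 (n := k))
  have kB := P_lam (.node 1 fun _ => uL0 (n := k))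
  have ndB : (Tree.pair .nil (.node 1 fun _ => uL0 (n := k))).Nd := nd4.left
  have ndA := kB.nd ndB
  have b := (congrArg₂ (fun z z' => z ≫ z') (can_rho' F uL0 (kA.comp ndA))
    (can_lam F _ (kB.comp ndB))).symm.trans (can_trans F (kA.comp ndA) (kB.comp ndB))
  have rhs := (congrArg (fun z => z ▷ bigT k Q) b).trans
    (can_whiskerRight F (p := .node k uL1) (kA.trans kB) nd4)
  exact lhs.trans rhs.symm

theorem shuffle_unit_right {n : ℕ} (W : M) (X : Fin n → M) :
    (W ◁ bigTMap n fun i => (ρ_ (X i)).inv ≫ (λ_ (X i ⊗ 𝟙_ M)).inv) ≫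
      (shuffle (m := fun _ => 1) W (fun _ => 𝟙_ M) (fun i _ => X i) :
        W ⊗ bigT n (fun i => 𝟙_ M ⊗ (X i ⊗ 𝟙_ M)) ⟶ _) ≫
      (_ ◁ reindex (singleE n) (F := X) (fun _ => eqToHom rfl)) =
    ((ρ_ W).inv ≫ W ◁ unitT n) ▷ bigT n X := by
  let F := unitF W X
  have nd := uNd n
  have hA : ∀ i : Fin n, (uL1 i).P (.pair .nil (.node 1 fun _ => uL1 i)) :=
    fun i => (P_rho' _).trans (P_lam _)
  have hA' := (Tree.P.refl uL0).pair (.node hA)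
  have nd1 := hA'.symm.nd nd
  have a0 : ∀ i, (ρ_ (X i)).inv ≫ (λ_ (X i ⊗ 𝟙_ M)).inv = _ := fun i =>
    (congrArg₂ (fun z z' => z ≫ z')
      (can_rho' F (uL1 i) ((P_rho' _).comp (nd1.right.node i).right))
      (can_lam F _ ((P_lam _).comp (nd1.right.node i)))).symm.trans (can_trans F _ _)
  have a1 := (congrArg (fun z => W ◁ bigTMap n z) (funext a0)).trans
    ((congrArg (fun z => W ◁ z) (can_nodeP F hA nd1.right)).trans
      (can_whiskerLeft F (p := uL0) (.node hA) nd1))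
  have hC := P_shuf (m := fun _ : Fin n => 1) uL0 (fun _ => .nil) (fun i _ => uL1 i)
  have nd3 := hC.symm.nd nd1
  have a3 := shuffle_can F (m := fun _ : Fin n => 1) uL0 (fun _ => .nil) (fun i _ => uL1 i)
    (hC.comp nd3)
  have hD : (Tree.node _ fun j => uL1 ((finSigmaFinEquiv (n := fun _ : Fin n => 1)).symm j).1).P
    (.node n uL1) := P_perm' (singleE n) fun _ => rfl
  have hD' := (Tree.P.refl (.pair uL0 (.node n fun _ => .nil))).pair hD
  have nd4 := hD'.symm.nd nd3
  have a4 := (congrArg (fun z => (W ⊗ bigT n fun _ => 𝟙_ M) ◁ z)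
    (reindex_canP F (singleE n) (t := uL1) (fun _ => rfl) nd.right)).trans
      (can_whiskerLeft F (p := .pair uL0 (.node n fun _ => .nil)) hD nd4)
  have lhs := (congrArg₂ (fun z z' => z ≫ z') a1
    ((congrArg₂ (fun z z' => z ≫ z') a3 a4).trans
    (can_trans F (hC.comp nd3) (hD'.comp nd4)))).trans
    (can_trans F (hA'.comp nd1) ((hC.comp nd3).trans (hD'.comp nd4)))
  have kA := P_rho (uL0 (n := n))
  have kU : (Tree.nil : Tree (Option (Fin n))).P (.node n fun _ => .nil) := by
    classical
    exact .of_cnt fun x => by simp [Tree.cnt]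
  have kB := (Tree.P.refl (uL0 (n := n))).pair kU
  have ndB : (Tree.pair (uL0 (n := n)) (.node n fun _ => .nil)).Nd := nd4.left
  have ndA := kB.nd ndB
  have b0 := (congrArg (fun z => W ◁ z) (unitT_can F n (kU.comp ndB.right))).symm.trans
    (can_whiskerLeft F (p := uL0) kU ndB)
  have b := (congrArg₂ (fun z z' => z ≫ z') (can_rho F uL0 (kA.comp ndA)).symm b0).trans
    (can_trans F (kA.comp ndA) (kB.comp ndB))
  have rhs := (congrArg (fun z => z ▷ bigT n X) b).trans
    (can_whiskerRight F (p := .node n uL1) (kA.trans kB) nd4)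
  exact lhs.trans rhs.symm

end

/-! ### Colored operads -/

open Profile in
/-- A `C`-colored operad in `M`, in the form of an equivariant operadic composition `γ` and
colored units. -/
structure Operad (C : Type v) (M : Type u) [Category.{v} M] [MonoidalCategory M]
    [SymmetricCategory M] where
  /-- The object `O(d; a)` is `(obj d).obj (op a)`, with the right action of permutations. -/
  obj : C → (Profile C)ᵒᵖ ⥤ M
  /-- The unit of color `c`. -/
  one (c : C) : 𝟙_ M ⟶ (obj c).obj (op (single c))
  /-- `O(d; c₁, …, cₘ) ⊗ O(c₁; b₁) ⊗ ⋯ ⊗ O(cₘ; bₘ) ⟶ O(d; b₁, …, bₘ)`. -/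
  γ (d : C) (c : Profile C) (b : Fin c.len → Profile C) :
    (obj d).obj (op c) ⊗ bigT c.len (fun i => (obj (c.col i)).obj (op (b i))) ⟶
      (obj d).obj (op (concat b))
  γ_inner (d : C) (c : Profile C) {b b' : Fin c.len → Profile C} (u : ∀ i, b i ⟶ b' i) :
    ((obj d).obj (op c) ◁ bigTMap c.len (fun i => (obj (c.col i)).map (u i).op)) ≫ γ d c b =
      γ d c b' ≫ (obj d).map (concatMap u).op
  γ_outer (d : C) {c c' : Profile C} (f : c ⟶ c') (b : Fin c'.len → Profile C) :
    ((obj d).map f.op ▷ bigT c.len (fun i => (obj (c.col i)).obj (op (b (f.σ i))))) ≫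
        γ d c (fun i => b (f.σ i)) =
      ((obj d).obj (op c') ◁ reindex f.σ
        (fun i => eqToHom (congrArg (fun x => (obj x).obj (op (b (f.σ i)))) (f.col_σ i).symm))) ≫
        γ d c' b ≫ (obj d).map (block f.σ b).op
  assoc (d : C) (c : Profile C) (b : Fin c.len → Profile C)
    (e : ∀ i, Fin (b i).len → Profile C) :
    ((obj d).obj (op c) ◁ bigTMap c.len (fun i => γ (c.col i) (b i) (e i))) ≫
        γ d c (fun i => concat (e i)) ≫ (obj d).map (concatAssoc e).op =
      shuffle ((obj d).obj (op c)) (fun i => (obj (c.col i)).obj (op (b i)))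
          (fun i j => (obj ((b i).col j)).obj (op (e i j))) ≫
        (γ d c b ▷ _) ≫ γ d (concat b) (regroup e)
  one_left (d : C) (b : Profile C) :
    (ρ_ ((obj d).obj (op b))).inv ≫ (λ_ _).inv ≫ (one d ▷ _) ≫ γ d (single d) (fun _ => b) =
      (obj d).map (concatOne b).op
  one_right (d : C) (c : Profile C) :
    (ρ_ ((obj d).obj (op c))).inv ≫
        (_ ◁ (unitT c.len ≫ bigTMap c.len (fun i => one (c.col i)))) ≫
        γ d c (fun i => single (c.col i)) =
      (obj d).map (concatSingle c).op

section
variable {M : Type u} [Category.{v} M] [MonoidalCategory M] [SymmetricCategory M]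

theorem shuffle_inner {n : ℕ} {m m' : Fin n → ℕ} {P0 P0' : M} {P P' : Fin n → M}
    {Q : ∀ i, Fin (m i) → M} {Q' : ∀ i, Fin (m' i) → M} (f : P0 ⟶ P0') (g : ∀ i, P i ⟶ P' i)
    (e : ∀ i, Fin (m i) ≃ Fin (m' i)) (h : ∀ i j, Q i j ⟶ Q' i (e i j)) :
    (f ⊗ₘ bigTMap n fun i => g i ⊗ₘ reindex (e i) (h i)) ≫ shuffle P0' P' Q' =
      shuffle P0 P Q ≫ ((f ⊗ₘ bigTMap n g) ⊗ₘ reindex (innerE e)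
        (F := fun k => Q' (finSigmaFinEquiv.symm k).1 (finSigmaFinEquiv.symm k).2)
        fun k => h (finSigmaFinEquiv.symm k).1 (finSigmaFinEquiv.symm k).2 ≫
          eqToHom (flat_congr Q' (innerE_symm e k))) := by
  have h1 : (f ⊗ₘ bigTMap n fun i => g i ⊗ₘ reindex (e i) (h i)) =
      (f ⊗ₘ bigTMap n fun i => g i ⊗ₘ bigTMap (m i) (h i)) ≫
        (P0' ◁ bigTMap n fun i => P' i ◁ permT (e i) (Q' i)) := by
    rw [← id_tensorHom, tensorHom_comp_tensorHom, bigTMap_comp, Category.comp_id]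
    refine congrArg (fun z => f ⊗ₘ bigTMap n z) (funext fun i => ?_)
    rw [← id_tensorHom, tensorHom_comp_tensorHom, Category.comp_id]
    rfl
  rw [h1, Category.assoc, shuffle_perm_inner, ← Category.assoc, shuffle_nat, Category.assoc,
    ← id_tensorHom, tensorHom_comp_tensorHom, Category.comp_id]
  exact congrArg (fun z => shuffle P0 P Q ≫ (_ ⊗ₘ z)) (reindex_pre _ _ _)

theorem shuffle_outer {n n' : ℕ} {m : Fin n' → ℕ} {P0 : M} {P : Fin n → M}
    {P' : Fin n' → M} {Q : ∀ i, Fin (m i) → M} (σ : Fin n ≃ Fin n') (θ : ∀ i, P i ⟶ P' (σ i)) :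
    (P0 ◁ reindex (F := fun i => P' i ⊗ bigT (m i) (Q i)) σ
      fun i => θ i ▷ bigT (m (σ i)) (Q (σ i))) ≫ shuffle P0 P' Q =
      shuffle P0 P (fun i => Q (σ i)) ≫ ((P0 ◁ reindex σ θ) ⊗ₘ reindex (outerE σ)
        (F := fun k => Q (finSigmaFinEquiv.symm k).1 (finSigmaFinEquiv.symm k).2)
        fun k => eqToHom (flat_congr Q (outerE_symm σ k))) := by
  have h1 : (P0 ◁ reindex (F := fun i => P' i ⊗ bigT (m i) (Q i)) σ
      fun i => θ i ▷ bigT (m (σ i)) (Q (σ i))) =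
      (𝟙 P0 ⊗ₘ bigTMap n fun i => θ i ⊗ₘ bigTMap (m (σ i)) fun j => 𝟙 (Q (σ i) j)) ≫
        (P0 ◁ permT σ fun i => P' i ⊗ bigT (m i) (Q i)) := by
    rw [id_tensorHom, ← MonoidalCategory.whiskerLeft_comp]
    refine congrArg (fun z => P0 ◁ (bigTMap n z ≫ _)) (funext fun i => ?_)
    rw [bigTMap_id, tensorHom_id]
  rw [h1, Category.assoc, shuffle_perm_outer, ← Category.assoc, shuffle_nat, Category.assoc,
    tensorHom_comp_tensorHom, bigTMap_id]
  refine congrArg₂ (fun z z' => shuffle P0 P (fun i => Q (σ i)) ≫ (z ⊗ₘ z')) ?_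
    (Category.id_comp _)
  rw [id_tensorHom, ← MonoidalCategory.whiskerLeft_comp]
  rfl

theorem tι_w' {D : Type w} [Groupoid.{w'} D] [HasColimitsOfShape D M] (X : Dᵒᵖ ⥤ M) (Y : D ⥤ M)
    {a b : D} (g : a ⟶ b) :
    (X.map (Groupoid.inv g).op ⊗ₘ Y.map g) ≫ tι X Y b = tι X Y a :=
  colimit.w (tensDiag X Y) g

end

section
variable {M : Type u} [Category.{v} M] [MonoidalCategory M] [SymmetricCategory M]
variable {C : Type v}

/-- The permutation of factors
`P₀ ⊗ (P₁ ⊗ X^{b₁}) ⊗ ⋯ ⊗ (Pₙ ⊗ X^{bₙ}) ⟶ (P₀ ⊗ (P₁ ⊗ ⋯ ⊗ Pₙ)) ⊗ X^{(b₁, …, bₙ)}`. -/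
def shufP {n : ℕ} (P0 : M) (P : Fin n → M) (X : C → M) (b : Fin n → Profile C) :
    P0 ⊗ bigT n (fun i => P i ⊗ pw X (b i)) ⟶ (P0 ⊗ bigT n P) ⊗ pw X (Profile.concat b) :=
  shuffle P0 P (fun i j => X ((b i).col j))

theorem shufP_nat {n : ℕ} {b : Fin n → Profile C} {P0 P0' : M} {P P' : Fin n → M} {X X' : C → M}
    (f : P0 ⟶ P0') (g : ∀ i, P i ⟶ P' i) (h : ∀ c, X c ⟶ X' c) :
    (f ⊗ₘ bigTMap n fun i => g i ⊗ₘ pwTrans h (b i)) ≫ shufP P0' P' X' b =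
      shufP P0 P X b ≫ ((f ⊗ₘ bigTMap n g) ⊗ₘ pwTrans h (Profile.concat b)) :=
  shuffle_nat f g fun i j => h ((b i).col j)

theorem shufP_left {n : ℕ} {b : Fin n → Profile C} {P0 P0' : M} (P : Fin n → M) (X : C → M)
    (f : P0 ⟶ P0') :
    (f ▷ bigT n fun i => P i ⊗ pw X (b i)) ≫ shufP P0' P X b =
      shufP P0 P X b ≫ ((f ▷ bigT n P) ▷ pw X (Profile.concat b)) := by
  have h := shufP_nat (b := b) f (fun i => 𝟙 (P i)) (fun c => 𝟙 (X c))
  simp only [pwTrans, bigTMap_id, tensorHom_id, id_whiskerRight] at h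
  exact h

theorem shufP_pwMap {n : ℕ} {b b' : Fin n → Profile C} {P0 : M} {P P' : Fin n → M}
    (g : ∀ i, P i ⟶ P' i) (X : C → M) (u : ∀ i, b i ⟶ b' i) :
    (P0 ◁ bigTMap n fun i => g i ⊗ₘ pwMap X (u i)) ≫ shufP P0 P' X b' =
      shufP P0 P X b ≫ ((P0 ◁ bigTMap n g) ⊗ₘ pwMap X (Profile.concatMap u)) := by
  have h := shuffle_inner (𝟙 P0) g (fun i => (u i).σ)
    (Q := fun i j => X ((b i).col j)) (Q' := fun i j => X ((b' i).col j))
    (fun i j => eqToHom (congrArg X ((u i).col_σ j).symm))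
  simp only [id_tensorHom, eqToHom_trans] at h
  exact h

theorem shufP_block {n n' : ℕ} {b : Fin n' → Profile C} {P0 : M} {P : Fin n → M}
    {P' : Fin n' → M} (σ : Fin n ≃ Fin n') (θ : ∀ i, P i ⟶ P' (σ i)) (X : C → M) :
    (P0 ◁ reindex (F := fun i => P' i ⊗ pw X (b i)) σ fun i => θ i ▷ pw X (b (σ i))) ≫
        shufP P0 P' X b =
      shufP P0 P X (fun i => b (σ i)) ≫
        ((P0 ◁ reindex σ θ) ⊗ₘ pwMap X (Profile.block σ b)) :=
  shuffle_outer (Q := fun i j => X ((b i).col j)) σ θ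

theorem shufP_assoc {n : ℕ} {b : Fin n → Profile C} (e : ∀ i, Fin (b i).len → Profile C)
    (P0 : M) (P : Fin n → M) (Q : ∀ i, Fin (b i).len → M) (X : C → M) :
    (P0 ◁ bigTMap n fun i => shufP (P i) (Q i) X (e i)) ≫
      shufP P0 (fun i => P i ⊗ bigT (b i).len (Q i)) X (fun i => Profile.concat (e i)) ≫
      (shuffle P0 P Q ▷ _) =
    shuffle P0 P (fun i j => Q i j ⊗ pw X (e i j)) ≫
      (shufP (P0 ⊗ bigT n P) (Profile.regroup Q) X (Profile.regroup e) :
        (P0 ⊗ bigT n P) ⊗ bigT (Profile.concat b).len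
          (fun k => Profile.regroup Q k ⊗ pw X (Profile.regroup e k)) ⟶ _) ≫
      (_ ◁ pwMap X (Profile.concatAssoc e)) :=
  shuffle_assoc (fun i j => (e i j).len) P0 P Q (fun i j k => X ((e i j).col k))

theorem shufP_one (P : M) (X : C → M) (b : Profile C) :
    (ρ_ (P ⊗ pw X b)).inv ≫ (λ_ ((P ⊗ pw X b) ⊗ 𝟙_ M)).inv ≫
      (shufP (𝟙_ M) (fun _ : Fin 1 => P) X (fun _ => b) : 𝟙_ M ⊗ ((P ⊗ pw X b) ⊗ 𝟙_ M) ⟶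
        (𝟙_ M ⊗ (P ⊗ 𝟙_ M)) ⊗ pw X (Profile.concat fun _ : Fin 1 => b)) ≫
      (_ ◁ pwMap X (Profile.concatOne b)) =
    ((ρ_ P).inv ≫ (λ_ (P ⊗ 𝟙_ M)).inv) ▷ pw X b :=
  shuffle_unit_left P fun i => X (b.col i)

theorem shufP_single (W : M) (X : C → M) (a : Profile C) :
    (W ◁ bigTMap a.len fun i => (ρ_ (X (a.col i))).inv ≫ (λ_ (X (a.col i) ⊗ 𝟙_ M)).inv) ≫
      (shufP W (fun _ => 𝟙_ M) X (fun i => Profile.single (a.col i)) :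
        W ⊗ bigT a.len (fun i => 𝟙_ M ⊗ (X (a.col i) ⊗ 𝟙_ M)) ⟶
          (W ⊗ bigT a.len fun _ => 𝟙_ M) ⊗ pw X (Profile.concat fun i =>
            Profile.single (a.col i))) ≫
      (_ ◁ pwMap X (Profile.concatSingle a)) =
    ((ρ_ W).inv ≫ W ◁ unitT a.len) ▷ pw X a :=
  shuffle_unit_right W fun i => X (a.col i)

end

section
variable {C : Type v} {M : Type u} [Category.{v} M] [MonoidalCategory M] [SymmetricCategory M]

open Profile in
/-- A right action of an operad on a right module over profiles: an equivariant family of maps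
`W(a) ⊗ O(a₁; b₁) ⊗ ⋯ ⊗ O(aₘ; bₘ) ⟶ W(b₁, …, bₘ)`. -/
structure RightAct (O : Operad C M) (W : (Profile C)ᵒᵖ ⥤ M) where
  act (a : Profile C) (b : Fin a.len → Profile C) :
    W.obj (op a) ⊗ bigT a.len (fun i => (O.obj (a.col i)).obj (op (b i))) ⟶ W.obj (op (concat b))
  inner (a : Profile C) {b b' : Fin a.len → Profile C} (u : ∀ i, b i ⟶ b' i) :
    (W.obj (op a) ◁ bigTMap a.len (fun i => (O.obj (a.col i)).map (u i).op)) ≫ act a b =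
      act a b' ≫ W.map (concatMap u).op
  outer {a a' : Profile C} (f : a ⟶ a') (b : Fin a'.len → Profile C) :
    (W.map f.op ▷ bigT a.len (fun i => (O.obj (a.col i)).obj (op (b (f.σ i))))) ≫
        act a (fun i => b (f.σ i)) =
      (W.obj (op a') ◁ reindex f.σ
        (fun i => eqToHom (congrArg (fun x => (O.obj x).obj (op (b (f.σ i)))) (f.col_σ i).symm))) ≫
        act a' b ≫ W.map (block f.σ b).op

/-- The right action of an operad on itself. -/
def Operad.self (O : Operad C M) (d : C) : RightAct O (O.obj d) where
  act := O.γ d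
  inner := O.γ_inner d
  outer := O.γ_outer d

variable [MonoidalClosed M] [HasColimits M]

/-- The colored object `O ∘ X`. -/
abbrev Operad.app (O : Operad C M) (X : C → M) : C → M := fun d => tensorOver (O.obj d) (pwF X)

namespace RightAct
variable {O : Operad C M} {W : (Profile C)ᵒᵖ ⥤ M} (R : RightAct O W) (X : C → M)

/-- The action of operations of arities `b i` on elements. -/
def gen (a : Profile C) (b : Fin a.len → Profile C) :
    W.obj (op a) ⊗ bigT a.len (fun i => (O.obj (a.col i)).obj (op (b i)) ⊗ pw X (b i)) ⟶
      tensorOver W (pwF X) :=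
  shufP (W.obj (op a)) (fun i => (O.obj (a.col i)).obj (op (b i))) X b ≫
    (R.act a b ▷ pw X (Profile.concat b)) ≫ tι W (pwF X) (Profile.concat b)

theorem concatMap_inv {n : ℕ} {b b' : Fin n → Profile C} (u : ∀ i, b i ⟶ b' i) :
    Profile.concatMap (fun i => Groupoid.inv (u i)) = Groupoid.inv (Profile.concatMap u) :=
  Profile.hom_ext fun _ => rfl

theorem gen_inner (a : Profile C) {b b' : Fin a.len → Profile C} (u : ∀ i, b i ⟶ b' i) :
    (W.obj (op a) ◁ bigTMap a.len
      (fun i => (O.obj (a.col i)).map (Groupoid.inv (u i)).op ⊗ₘ pwMap X (u i))) ≫ R.gen X a b' =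
      R.gen X a b := by
  have h := R.inner a fun i => Groupoid.inv (u i)
  rw [gen, gen, ← Category.assoc, shufP_pwMap, Category.assoc, ← tensorHom_id,
    tensorHom_comp_tensorHom_assoc, h, concatMap_inv, ← tι_w' W (pwF X) (Profile.concatMap u),
    ← tensorHom_id, tensorHom_comp_tensorHom_assoc, Category.comp_id, Category.id_comp]

/-- The action of `O ∘ X` on `W(a)`, as a map out of `W(a) ⊗ (O ∘ X)^a`. -/
def pre (a : Profile C) : W.obj (op a) ⊗ pw (O.app X) a ⟶ tensorOver W (pwF X) :=
  (bigT_desc a.len (D := fun i => tensDiag (O.obj (a.col i)) (pwF X)) (R.gen X a)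
    fun u => R.gen_inner X a u).choose

theorem pre_spec (a : Profile C) (b : Fin a.len → Profile C) :
    (W.obj (op a) ◁ bigTMap a.len fun i => tι (O.obj (a.col i)) (pwF X) (b i)) ≫ R.pre X a =
      R.gen X a b :=
  (bigT_desc a.len (D := fun i => tensDiag (O.obj (a.col i)) (pwF X)) (R.gen X a)
    fun u => R.gen_inner X a u).choose_spec b

theorem pw_ext {a : Profile C} {Z V : M} {f g : Z ⊗ pw (O.app X) a ⟶ V}
    (h : ∀ b : Fin a.len → Profile C,
      (Z ◁ bigTMap a.len fun i => tι (O.obj (a.col i)) (pwF X) (b i)) ≫ f =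
      (Z ◁ bigTMap a.len fun i => tι (O.obj (a.col i)) (pwF X) (b i)) ≫ g) : f = g :=
  bigT_ext a.len (D := fun i => tensDiag (O.obj (a.col i)) (pwF X)) h

theorem tι_cast {c c' : C} (h : c = c') (b : Profile C) :
    tι (O.obj c) (pwF X) b ≫ eqToHom (congrArg (O.app X) h) =
      (eqToHom (congrArg (fun x => (O.obj x).obj (op b)) h) ▷ pw X b) ≫
        tι (O.obj c') (pwF X) b := by
  subst h
  rw [eqToHom_refl, eqToHom_refl, id_whiskerRight]
  exact (Category.comp_id _).trans (Category.id_comp _).symm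

theorem ins_perm {a a' : Profile C} (g : a ⟶ a') (b : Fin a'.len → Profile C) :
    (bigTMap a.len fun i => tι (O.obj (a.col i)) (pwF X) (b (g.σ i))) ≫ pwMap (O.app X) g =
      reindex (F := fun i => (O.obj (a'.col i)).obj (op (b i)) ⊗ pw X (b i)) g.σ
        (fun i => eqToHom (congrArg (fun x => (O.obj x).obj (op (b (g.σ i)))) (g.col_σ i).symm) ▷
          pw X (b (g.σ i))) ≫
      bigTMap a'.len fun i => tι (O.obj (a'.col i)) (pwF X) (b i) := by
  refine (reindex_pre _ _ _).trans (Eq.trans ?_ (reindex_post _ _ _).symm)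
  exact congrArg (reindex g.σ) (funext fun i => tι_cast X (g.col_σ i).symm (b (g.σ i)))

theorem gen_outer {a a' : Profile C} (g : a ⟶ a') (b : Fin a'.len → Profile C) :
    (W.map g.op ▷ _) ≫ R.gen X a (fun i => b (g.σ i)) =
      (W.obj (op a') ◁ reindex (F := fun i => (O.obj (a'.col i)).obj (op (b i)) ⊗ pw X (b i)) g.σ
        (fun i => eqToHom (congrArg (fun x => (O.obj x).obj (op (b (g.σ i)))) (g.col_σ i).symm) ▷
          pw X (b (g.σ i)))) ≫ R.gen X a' b := by
  have h := R.outer g b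
  have hs := shufP_left (b := fun i => b (g.σ i))
    (fun i => (O.obj (a.col i)).obj (op (b (g.σ i)))) X (W.map g.op)
  have hw := tι_w W (pwF X) (Profile.block g.σ b)
  have hb := shufP_block (b := b) (P0 := W.obj (op a'))
    (P' := fun i => (O.obj (a'.col i)).obj (op (b i))) g.σ (fun i =>
      eqToHom (congrArg (fun x => (O.obj x).obj (op (b (g.σ i)))) (g.col_σ i).symm)) X
  rw [gen, gen, reassoc_of% hs, reassoc_of% hb]
  refine congrArg (fun z => shufP _ _ _ _ ≫ z) ?_
  have h1 := congrArg (fun z => (z ▷ _) ≫ tι W (pwF X) (Profile.concat fun i => b (g.σ i))) h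
  simp only [comp_whiskerRight, Category.assoc] at h1
  refine h1.trans ?_
  refine (congrArg (fun z => _ ≫ _ ≫ z) hw).trans ?_
  rw [MonoidalCategory.tensorHom_def, Category.assoc, ← whisker_exchange_assoc]

/-- The map `W ∘ (O ∘ X) ⟶ W ∘ X` induced by the action. -/
def map : tensorOver W (pwF (O.app X)) ⟶ tensorOver W (pwF X) :=
  tdesc W (pwF (O.app X)) (R.pre X) fun {a a'} g => by
    refine pw_ext X fun b0 => ?_
    obtain ⟨b, rfl⟩ : ∃ b : Fin a'.len → Profile C, b0 = fun i => b (g.σ i) :=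
      ⟨fun i => b0 (g.σ.symm i), by simp⟩
    rw [whisker_exchange_assoc]
    refine (congrArg (fun z => _ ≫ z) (R.pre_spec X a fun i => b (g.σ i))).trans ?_
    rw [gen_outer, ← pre_spec, ← MonoidalCategory.whiskerLeft_comp_assoc,
      ← MonoidalCategory.whiskerLeft_comp_assoc]
    exact congrArg (fun z => (_ ◁ z) ≫ R.pre X a') (ins_perm X g b).symm

theorem ι_map (a : Profile C) : tι W (pwF (O.app X)) a ≫ R.map X = R.pre X a :=
  tι_desc _ _ _ _ _

theorem gen_spec (a : Profile C) (b : Fin a.len → Profile C) :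
    (W.obj (op a) ◁ bigTMap a.len fun i => tι (O.obj (a.col i)) (pwF X) (b i)) ≫
      tι W (pwF (O.app X)) a ≫ R.map X = R.gen X a b := by
  rw [ι_map, pre_spec]

theorem ext2 {V : M} {f g : tensorOver W (pwF (O.app X)) ⟶ V}
    (h : ∀ (a : Profile C) (b : Fin a.len → Profile C),
      (W.obj (op a) ◁ bigTMap a.len fun i => tι (O.obj (a.col i)) (pwF X) (b i)) ≫
        tι W (pwF (O.app X)) a ≫ f =
      (W.obj (op a) ◁ bigTMap a.len fun i => tι (O.obj (a.col i)) (pwF X) (b i)) ≫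
        tι W (pwF (O.app X)) a ≫ g) : f = g :=
  t_ext fun a => pw_ext X fun b => h a b

end RightAct
end

section
variable {M : Type u} [Category.{v} M] [MonoidalCategory M] [SymmetricCategory M]

instance can_isIso {ι : Type w} (F : ι → M) {s t : Tree ι} (h : s.Comp t) : IsIso (can F s t h) :=
  ⟨can F t s ⟨h.1.symm, (List.Perm.nodup_iff h.1).2 h.2⟩,
    (can_trans F _ _).trans (can_refl F _), (can_trans F _ _).trans (can_refl F _)⟩

instance shuffle_isIso {n : ℕ} {m : Fin n → ℕ} (P0 : M) (P : Fin n → M)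
    (Q : ∀ i, Fin (m i) → M) : IsIso (shuffle P0 P Q) :=
  can_isIso (shufF P0 P Q) (shufComp m)

instance shufP_isIso {C : Type v} {n : ℕ} (P0 : M) (P : Fin n → M) (X : C → M)
    (b : Fin n → Profile C) : IsIso (shufP P0 P X b) :=
  shuffle_isIso P0 P _

theorem left_unit_aux {P U V x x' P' V' : M} {ι : P ⊗ x ⟶ V} {o : 𝟙_ M ⟶ U}
    {κ : U ⊗ (V ⊗ 𝟙_ M) ⟶ V'} {μ : V' ⟶ V} {s : U ⊗ ((P ⊗ x) ⊗ 𝟙_ M) ⟶ (U ⊗ (P ⊗ 𝟙_ M)) ⊗ x'}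
    {s1 : 𝟙_ M ⊗ ((P ⊗ x) ⊗ 𝟙_ M) ⟶ (𝟙_ M ⊗ (P ⊗ 𝟙_ M)) ⊗ x'} {γ : U ⊗ (P ⊗ 𝟙_ M) ⟶ P'}
    {ι' : P' ⊗ x' ⟶ V} {p : x' ⟶ x} {f : P ⟶ P'} {f' : P' ⟶ P}
    (hgen : (U ◁ (ι ⊗ₘ 𝟙 (𝟙_ M))) ≫ κ ≫ μ = s ≫ (γ ▷ x') ≫ ι')
    (hs : (o ▷ ((P ⊗ x) ⊗ 𝟙_ M)) ≫ s = s1 ≫ ((o ▷ (P ⊗ 𝟙_ M)) ▷ x'))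
    (hone : (ρ_ (P ⊗ x)).inv ≫ (λ_ ((P ⊗ x) ⊗ 𝟙_ M)).inv ≫ s1 ≫ ((𝟙_ M ⊗ (P ⊗ 𝟙_ M)) ◁ p) =
      ((ρ_ P).inv ≫ (λ_ (P ⊗ 𝟙_ M)).inv) ▷ x)
    (hunit : (ρ_ P).inv ≫ (λ_ (P ⊗ 𝟙_ M)).inv ≫ (o ▷ (P ⊗ 𝟙_ M)) ≫ γ = f)
    (hf : f ≫ f' = 𝟙 P) (hw : (f' ⊗ₘ p) ≫ ι = ι') :
    ι ≫ ((ρ_ V).inv ≫ (λ_ (V ⊗ 𝟙_ M)).inv ≫ (o ▷ (V ⊗ 𝟙_ M)) ≫ κ) ≫ μ = ι := by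
  rw [tensorHom_id] at hgen
  simp only [Category.assoc]
  rw [rightUnitor_inv_naturality_assoc, leftUnitor_inv_naturality_assoc, whisker_exchange_assoc,
    hgen, reassoc_of% hs, ← hw, tensorHom_def', Category.assoc, ← whisker_exchange_assoc,
    ← whisker_exchange_assoc, reassoc_of% hone, ← comp_whiskerRight_assoc, ← comp_whiskerRight_assoc,
    ← comp_whiskerRight_assoc]
  simp only [Category.assoc]
  rw [reassoc_of% hunit, hf, id_whiskerRight, Category.id_comp]

theorem right_unit_aux {W x y y1 y2 V V' K K' x' W' : M} {ι : W ⊗ x ⟶ V} {T : x ⟶ y}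
    {T1 : x ⟶ y1} {T2 : y1 ⟶ y2} {T3 : y2 ⟶ y} {τ : V ⟶ V'} {κ : W ⊗ y ⟶ V'} {μ : V' ⟶ V}
    {s : W ⊗ y2 ⟶ (W ⊗ K) ⊗ x'} {γ : W ⊗ K ⟶ W'} {ι' : W' ⊗ x' ⟶ V}
    {s1 : W ⊗ y1 ⟶ (W ⊗ K') ⊗ x'} {t : K' ⟶ K} {p : x' ⟶ x} {u : 𝟙_ M ⟶ K'}
    {f : W ⟶ W'} {f' : W' ⟶ W} (hτ : ι ≫ τ = (W ◁ T) ≫ κ) (hT : T = T1 ≫ T2 ≫ T3)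
    (hgen : (W ◁ T3) ≫ κ ≫ μ = s ≫ (γ ▷ x') ≫ ι')
    (hs : (W ◁ T2) ≫ s = s1 ≫ ((W ◁ t) ▷ x'))
    (hone : (W ◁ T1) ≫ s1 ≫ ((W ⊗ K') ◁ p) = ((ρ_ W).inv ≫ W ◁ u) ▷ x)
    (hunit : (ρ_ W).inv ≫ (W ◁ (u ≫ t)) ≫ γ = f)
    (hf : f ≫ f' = 𝟙 W) (hw : (f' ⊗ₘ p) ≫ ι = ι') : ι ≫ τ ≫ μ = ι := by
  rw [reassoc_of% hτ, hT, MonoidalCategory.whiskerLeft_comp, MonoidalCategory.whiskerLeft_comp]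
  simp only [Category.assoc]
  rw [hgen, reassoc_of% hs, ← hw, tensorHom_def', Category.assoc,
    ← whisker_exchange_assoc, ← whisker_exchange_assoc, reassoc_of% hone, ← comp_whiskerRight_assoc, ← comp_whiskerRight_assoc,
    ← comp_whiskerRight_assoc]
  simp only [Category.assoc, MonoidalCategory.whiskerLeft_comp] at hunit ⊢
  rw [reassoc_of% hunit, hf, id_whiskerRight, Category.id_comp]

theorem assoc_aux {W B0 B1 B2 K2 y K1 W1 K B' W2 L y' W3 V : M} {A1 : B0 ⟶ B1} {A2 : B1 ⟶ B2}
    {s2 : W ⊗ B2 ⟶ (W ⊗ K2) ⊗ y} {g1 : W ⊗ K2 ⟶ W1} {ι : W1 ⊗ y ⟶ V}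
    {s1 : W ⊗ B1 ⟶ (W ⊗ K1) ⊗ y} {t : K1 ⟶ K2} {S : W ⊗ B0 ⟶ (W ⊗ K) ⊗ B'} {h : W ⊗ K ⟶ W2}
    {s3 : W2 ⊗ B' ⟶ (W2 ⊗ L) ⊗ y'} {g2 : W2 ⊗ L ⟶ W3} {ι' : W3 ⊗ y' ⟶ V}
    {s4 : (W ⊗ K) ⊗ B' ⟶ ((W ⊗ K) ⊗ L) ⊗ y'} {q : W ⊗ K1 ⟶ (W ⊗ K) ⊗ L} {p : y' ⟶ y}
    {f : W1 ⟶ W3} {f' : W3 ⟶ W1}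
    (hA2 : (W ◁ A2) ≫ s2 = s1 ≫ ((W ◁ t) ▷ y))
    (hs3 : (h ▷ B') ≫ s3 = s4 ≫ ((h ▷ L) ▷ y'))
    (hassoc : (W ◁ A1) ≫ s1 ≫ (q ▷ y) = S ≫ s4 ≫ (((W ⊗ K) ⊗ L) ◁ p))
    (hop : (W ◁ t) ≫ g1 ≫ f = q ≫ (h ▷ L) ≫ g2) (hf : f ≫ f' = 𝟙 W1)
    (hw : (f' ⊗ₘ p) ≫ ι = ι') :
    (W ◁ A1) ≫ (W ◁ A2) ≫ s2 ≫ (g1 ▷ y) ≫ ι = S ≫ (h ▷ B') ≫ s3 ≫ (g2 ▷ y') ≫ ι' := by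
  rw [reassoc_of% hA2, reassoc_of% hs3, ← hw, tensorHom_def', Category.assoc,
    ← whisker_exchange_assoc, ← whisker_exchange_assoc, ← reassoc_of% hassoc, ← comp_whiskerRight_assoc,
    ← comp_whiskerRight_assoc, ← comp_whiskerRight_assoc, ← comp_whiskerRight_assoc]
  have h1 := congrArg (fun z => z ≫ f') hop
  simp only [Category.assoc] at h1 ⊢
  rw [hf, Category.comp_id] at h1
  rw [h1]

theorem iso_ext {A A' B B' V : M} {s : A ⟶ B} [IsIso s] {s' : A' ⟶ B'} (i' : IsIso s') {a : A' ⟶ A}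
    {b : B' ⟶ B} {f g : A ⟶ V} (h : a ≫ s = s' ≫ b) (e : a ≫ f = a ≫ g) :
    b ≫ inv s ≫ f = b ≫ inv s ≫ g := by
  have h' : b ≫ inv s = inv s' ≫ a := by
    rw [IsIso.comp_inv_eq, Category.assoc, h, IsIso.inv_hom_id_assoc]
  rw [reassoc_of% h', reassoc_of% h', e]

theorem mul_aux {V1 W B B0 B1 B2 Y V V' V2 K2 W1 K y W2 Y' B' L y' W3 : M} {e : B0 ⟶ B}
    {m : B ⟶ Y} {k : W ⊗ Y ⟶ V} {A1 : B0 ⟶ B1} {A2 : B1 ⟶ B2} {A3 : B2 ⟶ Y}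
    {s2 : W ⊗ B2 ⟶ (W ⊗ K2) ⊗ y} {g1 : W ⊗ K2 ⟶ W1} {ι : W1 ⊗ y ⟶ V}
    (hm : e ≫ m = A1 ≫ A2 ≫ A3) (hk : (W ◁ A3) ≫ k = s2 ≫ (g1 ▷ y) ≫ ι)
    {j : W ⊗ B ⟶ V1} {i : V1 ⟶ V2} {j' : V2 ⟶ V'} {n : V' ⟶ V} {s0 : W ⊗ B ⟶ (W ⊗ K) ⊗ Y'} {h : W ⊗ K ⟶ W2}
    {ι2 : W2 ⊗ Y' ⟶ V'} {s3 : W2 ⊗ B' ⟶ (W2 ⊗ L) ⊗ y'} {g2 : W2 ⊗ L ⟶ W3} {ι' : W3 ⊗ y' ⟶ V}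
    {E : B' ⟶ Y'} {S : W ⊗ B0 ⟶ (W ⊗ K) ⊗ B'}
    (hj : j ≫ i ≫ j' = s0 ≫ (h ▷ Y') ≫ ι2) (hn : (W2 ◁ E) ≫ ι2 ≫ n = s3 ≫ (g2 ▷ y') ≫ ι')
    (hE : (W ◁ e) ≫ s0 = S ≫ ((W ⊗ K) ◁ E))
    (hA : (W ◁ A1) ≫ (W ◁ A2) ≫ s2 ≫ (g1 ▷ y) ≫ ι = S ≫ (h ▷ B') ≫ s3 ≫ (g2 ▷ y') ≫ ι') :
    (W ◁ e) ≫ (W ◁ m) ≫ k = (W ◁ e) ≫ j ≫ i ≫ j' ≫ n := by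
  rw [← MonoidalCategory.whiskerLeft_comp_assoc, hm, reassoc_of% hj, reassoc_of% hE,
    whisker_exchange_assoc, hn, ← hA, ← hk, MonoidalCategory.whiskerLeft_comp,
    MonoidalCategory.whiskerLeft_comp]
  simp only [Category.assoc]

theorem unit_nat_aux {A B U V V' : M} {f : A ⟶ B} {o : 𝟙_ M ⟶ U} {i : U ⊗ (B ⊗ 𝟙_ M) ⟶ V}
    {i' : U ⊗ (A ⊗ 𝟙_ M) ⟶ V'} {g : V' ⟶ V} (h : i' ≫ g = (U ◁ (f ⊗ₘ 𝟙 (𝟙_ M))) ≫ i) :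
    f ≫ (ρ_ B).inv ≫ (λ_ (B ⊗ 𝟙_ M)).inv ≫ (o ▷ (B ⊗ 𝟙_ M)) ≫ i =
      ((ρ_ A).inv ≫ (λ_ (A ⊗ 𝟙_ M)).inv ≫ (o ▷ (A ⊗ 𝟙_ M)) ≫ i') ≫ g := by
  simp only [Category.assoc]
  rw [h, rightUnitor_inv_naturality_assoc, leftUnitor_inv_naturality_assoc, whisker_exchange_assoc,
    tensorHom_id]

theorem map_nat_aux {W B B' B1 K x x' W' V V1 V2 : M} {A : B ⟶ B1} {G : B ⟶ B'}
    {A' : B' ⟶ B1}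
    {pre : W ⊗ B1 ⟶ V} {s : W ⊗ B ⟶ (W ⊗ K) ⊗ x} {s' : W ⊗ B' ⟶ (W ⊗ K) ⊗ x'}
    {γ : W ⊗ K ⟶ W'} {g : x ⟶ x'} {ι : W' ⊗ x ⟶ V1} {ι' : W' ⊗ x' ⟶ V} {τ : V1 ⟶ V}
    {gen : W ⊗ B ⟶ V2} {μ : V2 ⟶ V1}
    (hA : A = G ≫ A') (hpre : (W ◁ A') ≫ pre = s' ≫ (γ ▷ x') ≫ ι')
    (hs : (W ◁ G) ≫ s' = s ≫ ((W ⊗ K) ◁ g)) (hgen : gen ≫ μ = s ≫ (γ ▷ x) ≫ ι)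
    (hτ : ι ≫ τ = (W' ◁ g) ≫ ι') : (W ◁ A) ≫ pre = gen ≫ μ ≫ τ := by
  rw [reassoc_of% hgen, hA, MonoidalCategory.whiskerLeft_comp, Category.assoc, hpre,
    reassoc_of% hs, hτ, whisker_exchange_assoc]

end

section
variable {C : Type v} {M : Type u} [Category.{v} M] [MonoidalCategory M] [SymmetricCategory M]
  [MonoidalClosed M] [HasColimits M]

/-- Functoriality of `pwF`. -/
def pwT {X Y : C → M} (g : ∀ c, X c ⟶ Y c) : pwF X ⟶ pwF Y where
  app a := pwTrans g a
  naturality _ _ f := pwTrans_nat g f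

/-- Functoriality of `W ∘ X` in `X`. -/
def circMap (W : (Profile C)ᵒᵖ ⥤ M) {X Y : C → M} (g : ∀ c, X c ⟶ Y c) :
    tensorOver W (pwF X) ⟶ tensorOver W (pwF Y) := tmap (𝟙 W) (pwT g)

theorem ι_circMap (W : (Profile C)ᵒᵖ ⥤ M) {X Y : C → M} (g : ∀ c, X c ⟶ Y c) (a : Profile C) :
    tι W (pwF X) a ≫ circMap W g = (W.obj (op a) ◁ pwTrans g a) ≫ tι W (pwF Y) a := by
  rw [circMap, tι_map, NatTrans.id_app, id_tensorHom]
  rfl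

theorem circMap_id (W : (Profile C)ᵒᵖ ⥤ M) (X : C → M) :
    circMap W (fun c => 𝟙 (X c)) = 𝟙 (tensorOver W (pwF X)) := by
  refine t_ext fun a => ?_
  have h : pwTrans (fun c => 𝟙 (X c)) a = 𝟙 (pw X a) := bigTMap_id _ _
  rw [ι_circMap, h, MonoidalCategory.whiskerLeft_id]
  exact (Category.id_comp _).trans (Category.comp_id _).symm

theorem circMap_comp (W : (Profile C)ᵒᵖ ⥤ M) {X Y Z : C → M} (f : ∀ c, X c ⟶ Y c)
    (g : ∀ c, Y c ⟶ Z c) : circMap W (fun c => f c ≫ g c) = circMap W f ≫ circMap W g := by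
  refine t_ext fun a => ?_
  have h : pwTrans (fun c => f c ≫ g c) a = pwTrans f a ≫ pwTrans g a := (bigTMap_comp _ _ _).symm
  rw [ι_circMap, ← Category.assoc, ι_circMap, Category.assoc, ι_circMap, h,
    MonoidalCategory.whiskerLeft_comp, Category.assoc]

/-- The endofunctor `O ∘ -`. -/
def Operad.functor (O : Operad C M) : (C → M) ⥤ (C → M) where
  obj X := O.app X
  map g := fun d => circMap (O.obj d) g
  map_id X := funext fun d => circMap_id (O.obj d) X
  map_comp f g := funext fun d => circMap_comp (O.obj d) f g

/-- The unit of `O ∘ -`. -/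
def Operad.unit (O : Operad C M) (X : C → M) (d : C) : X d ⟶ O.app X d :=
  (ρ_ (X d)).inv ≫ (λ_ (X d ⊗ 𝟙_ M)).inv ≫ (O.one d ▷ (X d ⊗ 𝟙_ M)) ≫
    tι (O.obj d) (pwF X) (Profile.single d)

theorem Operad.unit_nat (O : Operad C M) {X Y : C → M} (g : ∀ c, X c ⟶ Y c) (d : C) :
    g d ≫ O.unit Y d = O.unit X d ≫ circMap (O.obj d) g :=
  unit_nat_aux (ι_circMap (O.obj d) g (Profile.single d))

theorem Operad.left_unit (O : Operad C M) (X : C → M) (d : C) :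
    O.unit (O.app X) d ≫ (O.self d).map X = 𝟙 (O.app X d) := by
  refine t_ext fun b => Eq.trans ?_ (Category.comp_id _).symm
  exact left_unit_aux (f' := (O.obj d).map (Groupoid.inv (Profile.concatOne b)).op)
    ((O.self d).gen_spec X (Profile.single d) fun _ => b)
    (shufP_left (b := fun _ : Fin 1 => b) (fun _ => (O.obj d).obj (op b)) X (O.one d))
    (shufP_one ((O.obj d).obj (op b)) X b) (O.one_left d b)
    (tensDiag_inv (O.obj d) (Profile.concatOne b)).2 (tι_w' (O.obj d) (pwF X) (Profile.concatOne b))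

theorem Operad.right_unit (O : Operad C M) (X : C → M) (d : C) :
    circMap (O.obj d) (O.unit X) ≫ (O.self d).map X = 𝟙 (O.app X d) := by
  refine t_ext fun a => Eq.trans ?_ (Category.comp_id _).symm
  have hs := shufP_nat (b := fun i => Profile.single (a.col i)) (𝟙 ((O.obj d).obj (op a)))
    (fun i => O.one (a.col i)) (fun c => 𝟙 (X c))
  simp only [pwTrans, bigTMap_id, id_tensorHom, tensorHom_id] at hs
  exact right_unit_aux (f' := (O.obj d).map (Groupoid.inv (Profile.concatSingle a)).op)
    (T1 := bigTMap a.len fun i => (ρ_ (X (a.col i))).inv ≫ (λ_ (X (a.col i) ⊗ 𝟙_ M)).inv)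
    (T2 := bigTMap a.len fun i => O.one (a.col i) ▷ (X (a.col i) ⊗ 𝟙_ M))
    (ι_circMap (O.obj d) (O.unit X) a)
    (by
      refine Eq.symm ((congrArg (fun z => _ ≫ z) (bigTMap_comp _ _ _)).trans
        ((bigTMap_comp _ _ _).trans ?_))
      refine congrArg (bigTMap a.len) (funext fun i => ?_)
      exact (Category.assoc _ _ _))
    ((O.self d).gen_spec X a fun i => Profile.single (a.col i)) hs
    (shufP_single ((O.obj d).obj (op a)) X a) (O.one_right d a)
    (tensDiag_inv (O.obj d) (Profile.concatSingle a)).2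
    (tι_w' (O.obj d) (pwF X) (Profile.concatSingle a))

namespace RightAct
variable {O : Operad C M} {W : (Profile C)ᵒᵖ ⥤ M} (R : RightAct O W)

theorem bigTMap_ins {X Y : C → M} (g : ∀ c, O.app X c ⟶ Y c) (a : Profile C)
    (b : Fin a.len → Profile C) {V V' : M} {f : W.obj (op a) ⊗ pw Y a ⟶ V}
    {ι : W.obj (op a) ⊗ pw (O.app X) a ⟶ V'} {τ : V' ⟶ V}
    (h : ι ≫ τ = (W.obj (op a) ◁ pwTrans g a) ≫ f) :
    (W.obj (op a) ◁ bigTMap a.len fun i => tι (O.obj (a.col i)) (pwF X) (b i)) ≫ ι ≫ τ =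
      (W.obj (op a) ◁ bigTMap a.len fun i => tι (O.obj (a.col i)) (pwF X) (b i) ≫
        g (a.col i)) ≫ f := by
  rw [h, ← MonoidalCategory.whiskerLeft_comp_assoc, ← bigTMap_comp]

theorem map_nat {X Y : C → M} (g : ∀ c, X c ⟶ Y c) :
    circMap W (fun c => circMap (O.obj c) g) ≫ R.map Y = R.map X ≫ circMap W g := by
  refine ext2 X fun a b => ?_
  have h3 : (bigTMap a.len fun i => tι (O.obj (a.col i)) (pwF X) (b i) ≫
      circMap (O.obj (a.col i)) g) =
    (bigTMap a.len fun i => (O.obj (a.col i)).obj (op (b i)) ◁ pwTrans g (b i)) ≫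
      bigTMap a.len fun i => tι (O.obj (a.col i)) (pwF Y) (b i) := by
    rw [bigTMap_comp]
    exact congrArg (bigTMap a.len) (funext fun i => ι_circMap _ g (b i))
  have h4 := shufP_nat (b := b) (𝟙 (W.obj (op a)))
    (fun i => 𝟙 ((O.obj (a.col i)).obj (op (b i)))) g
  simp only [bigTMap_id, id_tensorHom, MonoidalCategory.whiskerLeft_id] at h4
  have h5 : tι W (pwF (O.app X)) a ≫ circMap W (fun c => circMap (O.obj c) g) ≫ R.map Y =
      (W.obj (op a) ◁ pwTrans (fun c => circMap (O.obj c) g) a) ≫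
        tι W (pwF (O.app Y)) a ≫ R.map Y := by
    rw [← Category.assoc, ι_circMap, Category.assoc]
  refine (bigTMap_ins _ a b h5).trans ?_
  refine (map_nat_aux h3 (R.gen_spec Y a b) h4 ((Category.assoc _ _ _).trans (R.gen_spec X a b))
    (ι_circMap W g (Profile.concat b))).trans ?_
  simp only [Category.assoc]

theorem ext3 {X : C → M} {n : ℕ} {b : Fin n → Profile C} {Z : M} {P : Fin n → M} {V : M}
    {f g : Z ⊗ bigT n (fun i => P i ⊗ pw (O.app X) (b i)) ⟶ V}
    (h : ∀ e : ∀ i, Fin (b i).len → Profile C,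
      (Z ◁ bigTMap n fun i => P i ◁ bigTMap (b i).len
        fun j => tι (O.obj ((b i).col j)) (pwF X) (e i j)) ≫ f =
      (Z ◁ bigTMap n fun i => P i ◁ bigTMap (b i).len
        fun j => tι (O.obj ((b i).col j)) (pwF X) (e i j)) ≫ g) : f = g := by
  rw [← cancel_epi (inv (shufP Z P (O.app X) b))]
  refine pw_ext X fun e' => ?_
  obtain ⟨e, rfl⟩ : ∃ e : ∀ i, Fin (b i).len → Profile C, e' = Profile.regroup e :=
    ⟨fun i j => e' (finSigmaFinEquiv ⟨i, j⟩), funext fun k =>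
      congrArg e' (finSigmaFinEquiv.apply_symm_apply k).symm⟩
  have hs := shuffle_nat (𝟙 Z) (fun i => 𝟙 (P i))
    (fun i j => tι (O.obj ((b i).col j)) (pwF X) (e i j))
  simp only [bigTMap_id, id_tensorHom, MonoidalCategory.whiskerLeft_id] at hs
  have i1 : IsIso (shuffle Z P fun i j => (O.obj ((b i).col j)).obj (op (e i j)) ⊗ pw X (e i j)) :=
    shuffle_isIso _ _ _
  exact iso_ext (s := shufP Z P (O.app X) b) i1 hs (h e)

end RightAct

theorem Operad.mul_assoc (O : Operad C M) (X : C → M) (d : C) :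
    circMap (O.obj d) (fun c => (O.self c).map X) ≫ (O.self d).map X =
      (O.self d).map (O.app X) ≫ (O.self d).map X := by
  refine RightAct.ext2 _ fun a b => RightAct.ext3 fun e => ?_
  have h0 : tι (O.obj d) (pwF (O.app (O.app X))) a ≫
      circMap (O.obj d) (fun c => (O.self c).map X) ≫ (O.self d).map X =
      ((O.obj d).obj (op a) ◁ pwTrans (fun c => (O.self c).map X) a) ≫
        tι (O.obj d) (pwF (O.app X)) a ≫ (O.self d).map X := by
    rw [← Category.assoc, ι_circMap, Category.assoc]
  have h1 := RightAct.bigTMap_ins (X := O.app X) _ a b h0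
  refine (congrArg (fun z => _ ≫ z) h1).trans ?_
  have hm : (bigTMap a.len fun i => (O.obj (a.col i)).obj (op (b i)) ◁ bigTMap (b i).len
      fun j => tι (O.obj ((b i).col j)) (pwF X) (e i j)) ≫
      (bigTMap a.len fun i => tι (O.obj (a.col i)) (pwF (O.app X)) (b i) ≫
        (O.self (a.col i)).map X) =
      (bigTMap a.len fun i => shufP ((O.obj (a.col i)).obj (op (b i)))
        (fun j => (O.obj ((b i).col j)).obj (op (e i j))) X (e i)) ≫
      (bigTMap a.len fun i => O.γ (a.col i) (b i) (e i) ▷ pw X (Profile.concat (e i))) ≫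
      (bigTMap a.len fun i => tι (O.obj (a.col i)) (pwF X) (Profile.concat (e i))) := by
    rw [bigTMap_comp, bigTMap_comp, bigTMap_comp]
    exact congrArg (bigTMap a.len) (funext fun i => (O.self (a.col i)).gen_spec X (b i) (e i))
  have hs := shuffle_nat (𝟙 ((O.obj d).obj (op a)))
    (fun i => 𝟙 ((O.obj (a.col i)).obj (op (b i))))
    (fun i j => tι (O.obj ((b i).col j)) (pwF X) (e i j))
  simp only [bigTMap_id, id_tensorHom, MonoidalCategory.whiskerLeft_id] at hs
  have hA2 := shufP_nat (b := fun i => Profile.concat (e i)) (𝟙 ((O.obj d).obj (op a)))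
    (fun i => O.γ (a.col i) (b i) (e i)) (fun c => 𝟙 (X c))
  simp only [pwTrans, bigTMap_id, id_tensorHom, tensorHom_id] at hA2
  exact mul_aux hm ((O.self d).gen_spec X a fun i => Profile.concat (e i))
    ((O.self d).gen_spec (O.app X) a b)
    ((O.self d).gen_spec X (Profile.concat b) (Profile.regroup e)) hs
    (assoc_aux hA2 (shufP_left (b := Profile.regroup e) _ X (O.γ d a b))
      (shufP_assoc e _ _ _ X) (O.assoc d a b e)
      (tensDiag_inv (O.obj d) (Profile.concatAssoc e)).2
      (tι_w' (O.obj d) (pwF X) (Profile.concatAssoc e)))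

/-- The monad `O ∘ -` on colored objects. -/
def Operad.monad (O : Operad C M) : Monad (C → M) where
  toFunctor := O.functor
  η := { app := O.unit, naturality := fun _ _ g => funext fun d => O.unit_nat g d }
  μ := { app := fun X d => (O.self d).map X
         naturality := fun _ _ g => funext fun d => (O.self d).map_nat g }
  left_unit X := funext fun d => O.left_unit X d
  right_unit X := funext fun d => O.right_unit X d
  assoc X := funext fun d => O.mul_assoc X d

end

/-! ### The right module `a ↦ O(d; a, c)` -/

namespace Profile
variable {C : Type v}

theorem homOf_comp {S S' S'' : Type*} {n m k : ℕ} {e : Fin n ≃ S} {e' : Fin m ≃ S'}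
    {e'' : Fin k ≃ S''} {col : S → C} {col' : S' → C} {col'' : S'' → C} (f : S ≃ S') (h)
    (f' : S' ≃ S'') (h') :
    (homOf f h : ofEquiv e col ⟶ ofEquiv e' col') ≫ (homOf f' h' : _ ⟶ ofEquiv e'' col'') =
      homOf (f.trans f') fun s => (h' _).trans (h s) :=
  hom_ext fun _ => congrArg (fun x => e''.symm (f' x)) (e'.apply_symm_apply _)

theorem homOf_congr {S S' : Type*} {n m : ℕ} {e : Fin n ≃ S} {e' : Fin m ≃ S'}
    {col : S → C} {col' : S' → C} {f f' : S ≃ S'} (h h') (hf : ∀ s, f s = f' s) :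
    (homOf f h : ofEquiv e col ⟶ ofEquiv e' col') = homOf f' h' :=
  hom_ext fun i => congrArg e'.symm (hf (e i))

theorem appendMap_id (a b : Profile C) : appendMap (𝟙 a) (𝟙 b) = 𝟙 (a.append b) :=
  hom_ext fun i => (congrArg finSumFinEquiv (by
    change Sum.map id id _ = _
    rw [Sum.map_id_id]; rfl)).trans (finSumFinEquiv.apply_symm_apply i)

theorem appendMap_comp {a a' a'' b b' b'' : Profile C} (f : a ⟶ a') (f' : a' ⟶ a'') (g : b ⟶ b')
    (g' : b' ⟶ b'') : appendMap (f ≫ f') (g ≫ g') = appendMap f g ≫ appendMap f' g' := by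
  refine Eq.trans ?_ (homOf_comp _ _ _ _).symm
  refine homOf_congr _ _ fun s => ?_
  rcases s with i | j <;> rfl

/-- Fill up `b` with one-entry profiles. -/
def padS {a : Profile C} (b : Fin a.len → Profile C) (c : Profile C) :
    Fin a.len ⊕ Fin c.len → Profile C :=
  Sum.elim b fun j => single (c.col j)

/-- Fill up `b` with one-entry profiles, as a sequence indexed by the entries of `(a, c)`. -/
abbrev pad {a : Profile C} (b : Fin a.len → Profile C) (c : Profile C) :
    Fin (a.append c).len → Profile C :=
  fun k => padS b c (finSumFinEquiv.symm k)

/-- The bijection underlying `padIso`. -/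
def padEquiv {a : Profile C} (b : Fin a.len → Profile C) (c : Profile C) :
    (Σ k : Fin (a.append c).len, Fin (pad b c k).len) ≃ Fin (concat b).len ⊕ Fin c.len :=
  (Equiv.sigmaCongrLeft (β := fun s => Fin (padS b c s).len) finSumFinEquiv.symm).trans <|
  (Equiv.sumSigmaDistrib fun s => Fin (padS b c s).len).trans <|
  Equiv.sumCongr finSigmaFinEquiv
    ⟨fun p => p.1, fun i => ⟨i, (0 : Fin 1)⟩, fun p => by
      obtain ⟨i, j⟩ := p
      exact congrArg (Sigma.mk i) (Subsingleton.elim (α := Fin 1) _ _), fun _ => rfl⟩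

theorem padEquiv_col {a : Profile C} (b : Fin a.len → Profile C) (c : Profile C)
    (p : Σ s, Fin (padS b c s).len) :
    Sum.elim (concat b).col c.col (Equiv.sumCongr finSigmaFinEquiv
      (Equiv.mk (fun p => p.1) (fun i => ⟨i, (0 : Fin 1)⟩) (fun p => by
      obtain ⟨i, j⟩ := p
      exact congrArg (Sigma.mk i) (Subsingleton.elim (α := Fin 1) _ _)) fun _ => rfl)
      (Equiv.sumSigmaDistrib (fun s => Fin (padS b c s).len) p)) = (padS b c p.1).col p.2 := by
  obtain ⟨s | s, x⟩ := p
  · exact concat_col b ⟨s, x⟩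
  · rfl

/-- `(b₁, …, bₘ, (c₁), …, (cₖ))` is `(b₁, …, bₘ, c)`. -/
def padIso {a : Profile C} (b : Fin a.len → Profile C) (c : Profile C) :
    concat (pad b c) ⟶ (concat b).append c :=
  homOf (padEquiv b c) fun p => padEquiv_col b c ⟨finSumFinEquiv.symm p.1, p.2⟩

def padMapS {a : Profile C} {b b' : Fin a.len → Profile C} (u : ∀ i, b i ⟶ b' i)
    (c : Profile C) : ∀ s, padS b c s ⟶ padS b' c s
  | .inl i => u i
  | .inr j => 𝟙 (single (c.col j))

theorem padIso_inner {a : Profile C} {b b' : Fin a.len → Profile C} (u : ∀ i, b i ⟶ b' i)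
    (c : Profile C) :
    concatMap (fun k => padMapS u c (finSumFinEquiv.symm k)) ≫ padIso b' c =
      padIso b c ≫ appendMap (concatMap u) (𝟙 c) := by
  refine (homOf_comp _ _ _ _).trans (Eq.trans ?_ (homOf_comp _ _ _ _).symm)
  refine homOf_congr _ _ fun p => ?_
  obtain ⟨k, x⟩ := p
  have key : ∀ s (x : Fin (padS b c s).len),
      Equiv.sumSigmaDistrib (fun s => Fin (padS b' c s).len) ⟨s, (padMapS u c s).σ x⟩ =
      Sum.map (fun p => ⟨p.1, (u p.1).σ p.2⟩) (fun p => p)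
        (Equiv.sumSigmaDistrib (fun s => Fin (padS b c s).len) ⟨s, x⟩) := by
    rintro (i | j) x <;> rfl
  have h := key (finSumFinEquiv.symm k) x
  change Sum.map _ _ (Equiv.sumSigmaDistrib (fun s => Fin (padS b' c s).len)
    ⟨finSumFinEquiv.symm k, (padMapS u c (finSumFinEquiv.symm k)).σ x⟩) =
    Sum.map _ _ (Sum.map _ _ (Equiv.sumSigmaDistrib (fun s => Fin (padS b c s).len)
    ⟨finSumFinEquiv.symm k, x⟩))
  rw [h]
  rcases Equiv.sumSigmaDistrib (fun s => Fin (padS b c s).len) ⟨finSumFinEquiv.symm k, x⟩ with p | p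
  · refine congrArg Sum.inl ?_
    exact (congrArg (fun z => finSigmaFinEquiv ((Equiv.sigmaCongrRight fun i => (u i).σ) z))
      (finSigmaFinEquiv.symm_apply_apply p)).symm
  · rfl

theorem pad_perm {a a' c c' : Profile C} (f : a ⟶ a') (h : c ⟶ c') (b : Fin a'.len → Profile C)
    (s : Fin a.len ⊕ Fin c.len) :
    padS (fun i => b (f.σ i)) c s = padS b c' (Equiv.sumCongr f.σ h.σ s) := by
  rcases s with i | j
  · rfl
  · exact congrArg single (h.col_σ j).symm

theorem sumE_symm {n m n' m' : ℕ} (e : Fin n ≃ Fin n') (e' : Fin m ≃ Fin m') (k : Fin (n + m)) :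
    finSumFinEquiv.symm ((finSumFinEquiv.symm.trans ((Equiv.sumCongr e e').trans
      finSumFinEquiv.symm.symm)) k) = Equiv.sumCongr e e' (finSumFinEquiv.symm k) :=
  Equiv.symm_apply_apply _ _

theorem pad_perm' {a a' c c' : Profile C} (f : a ⟶ a') (h : c ⟶ c') (b : Fin a'.len → Profile C)
    (k : Fin (a.append c).len) :
    pad (fun i => b (f.σ i)) c k = pad b c' ((appendMap f h).σ k) :=
  (pad_perm f h b _).trans (congrArg (padS b c') (sumE_symm f.σ h.σ k).symm)

theorem sum_aux {α α' β β' γ' γ : Type*} (f : α → γ') (g : β → γ) (g' : γ' → α')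
    (x : α ⊕ β) {h : γ → β'} :
    Sum.map g' h (Sum.map f g x) = Sum.map (fun a => g' (f a)) (fun b => h (g b)) x := by
  rcases x with x | x <;> rfl

theorem padIso_outer {a a' c c' : Profile C} (f : a ⟶ a') (h : c ⟶ c')
    (b : Fin a'.len → Profile C) :
    concatMap (fun k => eqToHom (pad_perm' f h b k)) ≫ block (appendMap f h).σ (pad b c') ≫
        padIso b c' =
      padIso (fun i => b (f.σ i)) c ≫ appendMap (block f.σ b) h := by
  refine (congrArg (fun z => _ ≫ z) (homOf_comp _ _ _ _)).trans ((homOf_comp _ _ _ _).trans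
    (Eq.trans ?_ (homOf_comp _ _ _ _).symm))
  refine homOf_congr _ _ fun p => ?_
  obtain ⟨k, x⟩ := p
  have key : ∀ s (x : Fin (padS (fun i => b (f.σ i)) c s).len) t
      (ht : t = Equiv.sumCongr f.σ h.σ s) (e : padS (fun i => b (f.σ i)) c s = padS b c' t),
      Sum.map id (fun p => p.1) (Equiv.sumSigmaDistrib (fun s => Fin (padS b c' s).len)
        ⟨t, Hom.σ (eqToHom e) x⟩) =
      Sum.map (fun p => ⟨f.σ p.1, p.2⟩) (fun p => h.σ p.1)
        (Equiv.sumSigmaDistrib (fun s => Fin (padS (fun i => b (f.σ i)) c s).len) ⟨s, x⟩) := by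
    rintro (i | j) x _ rfl e <;> rfl
  have h1 := key (finSumFinEquiv.symm k) x _ (sumE_symm f.σ h.σ k) (pad_perm' f h b k)
  have h2 := congrArg (Sum.map (finSigmaFinEquiv (n := fun i => (b i).len)) id) h1
  have h3 := (h2.symm.trans (sum_aux _ _ _ _)).symm
  refine Eq.trans h3 ?_
  change _ = Sum.map _ _ (Sum.map _ _
    (Equiv.sumSigmaDistrib (fun s => Fin (padS (fun i => b (f.σ i)) c s).len)
    ⟨finSumFinEquiv.symm k, x⟩))
  rcases Equiv.sumSigmaDistrib (fun s => Fin (padS (fun i => b (f.σ i)) c s).len)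
    ⟨finSumFinEquiv.symm k, x⟩ with p | p
  · refine congrArg Sum.inl ?_
    exact (congrArg (fun z => finSigmaFinEquiv (Equiv.sigmaCongrLeft
      (β := fun i => Fin (b i).len) f.σ z)) (finSigmaFinEquiv.symm_apply_apply p)).symm
  · rfl

end Profile

section
variable {M : Type u} [Category.{v} M] [MonoidalCategory M] [SymmetricCategory M]

theorem P_cat {ι : Type w} {n m : ℕ} (t : Fin n ⊕ Fin m → Tree ι) :
    (Tree.pair (.node n fun i => t (.inl i)) (.node m fun j => t (.inr j))).P
      (.node (n + m) fun k => t (finSumFinEquiv.symm k)) := by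
  classical
  refine .of_cnt fun x => ?_
  refine Eq.trans ?_ (finSumFinEquiv.symm.sum_comp fun s => (t s).cnt x).symm
  exact (Fintype.sum_sum_type fun s => (t s).cnt x).symm

theorem catNd (n m : ℕ) : (Tree.node (n + m) fun k => .leaf (finSumFinEquiv.symm k) :
    Tree (Fin n ⊕ Fin m)).Nd := by
  classical
  refine .of_cnt fun x => ?_
  refine le_of_eq ((finSumFinEquiv.symm.sum_comp fun s => (Tree.leaf s).cnt x).trans ?_)
  simp [Tree.cnt]

/-- The tensor product of a concatenation of two sequences. -/
def catT {n m : ℕ} (G : Fin n ⊕ Fin m → M) :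
    bigT n (fun i => G (.inl i)) ⊗ bigT m (fun j => G (.inr j)) ⟶
      bigT (n + m) fun k => G (finSumFinEquiv.symm k) :=
  can G _ _ ((P_cat .leaf).comp (catNd n m))

theorem catT_nat {n m : ℕ} {G G' : Fin n ⊕ Fin m → M} (θ : ∀ s, G s ⟶ G' s) :
    (bigTMap n (fun i => θ (.inl i)) ⊗ₘ bigTMap m (fun j => θ (.inr j))) ≫ catT G' =
      catT G ≫ bigTMap (n + m) fun k => θ (finSumFinEquiv.symm k) :=
  can_nat θ ((P_cat .leaf).comp (catNd n m))

theorem catT_can {ι : Type w} (F : ι → M) {n m : ℕ} (t : Fin n ⊕ Fin m → Tree ι) (h) :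
    catT (fun s => (t s).eval F) = can F (.pair (.node n fun i => t (.inl i))
      (.node m fun j => t (.inr j))) (.node (n + m) fun k => t (finSumFinEquiv.symm k)) h := by
  have := can_bind F t ((P_cat .leaf).comp (catNd n m)) h
  have h1 : ((Tree.pair (.node n fun i => .leaf (.inl i)) (.node m fun j => .leaf (.inr j))).bindIso
      F t).hom = 𝟙 (bigT n (fun i => (t (.inl i)).eval F) ⊗ bigT m fun j => (t (.inr j)).eval F) :=
    (congrArg₂ (fun z z' => z ⊗ₘ z') (bigTMap_id n _) (bigTMap_id m _)).trans (id_tensorHom_id _ _)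
  have h2 : ((Tree.node (n + m) fun k => .leaf (finSumFinEquiv.symm k)).bindIso F t).hom =
    𝟙 (bigT (n + m) fun k => (t (finSumFinEquiv.symm k)).eval F) := bigTMap_id _ _
  rw [h1, h2] at this
  exact (Category.id_comp _).symm.trans (this.trans (Category.comp_id _))

/-- The bijection of a sum of indexing sets given by bijections of the summands. -/
abbrev sumE {n m n' m' : ℕ} (e : Fin n ≃ Fin n') (e' : Fin m ≃ Fin m') :
    Fin (n + m) ≃ Fin (n' + m') :=
  finSumFinEquiv.symm.trans ((Equiv.sumCongr e e').trans finSumFinEquiv.symm.symm)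

theorem catT_perm {n m n' m' : ℕ} (e : Fin n ≃ Fin n') (e' : Fin m ≃ Fin m')
    (G : Fin n' ⊕ Fin m' → M) :
    (permT e (fun i => G (.inl i)) ⊗ₘ permT e' fun j => G (.inr j)) ≫ catT G =
      catT (fun s => G (Equiv.sumCongr e e' s)) ≫
        reindex (sumE e e') (F := fun k => G (finSumFinEquiv.symm k))
          fun k => eqToHom (congrArg G (Profile.sumE_symm e e' k).symm) := by
  have ndT := catNd n' m'
  have ndS := (P_cat (n := n') (m := m') Tree.leaf).nd ndT
  have e1 := permT_can G e (fun i => .leaf (.inl i)) ((P_perm e _).comp ndS.left)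
  have e2 := permT_can G e' (fun j => .leaf (.inr j)) ((P_perm e' _).comp ndS.right)
  have e3 := (congrArg₂ (fun z z' => z ⊗ₘ z') e1 e2).trans
    (can_pairP G (P_perm e _) (P_perm e' _) ndS)
  have lhs := (congrArg (fun z => z ≫ catT G) e3).trans (can_trans G _ _)
  have hk : ∀ k, Tree.leaf (Equiv.sumCongr e e' (finSumFinEquiv.symm k)) =
      Tree.leaf (finSumFinEquiv.symm (sumE e e' k)) :=
    fun k => congrArg Tree.leaf (Profile.sumE_symm e e' k).symm
  have f1 := reindex_canP G (sumE e e') hk ndT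
  have f2 := catT_can G (fun s => .leaf (Equiv.sumCongr e e' s))
    ((P_cat fun s => .leaf (Equiv.sumCongr e e' s)).comp ((P_perm' (sumE e e') hk).nd ndT))
  have rhs := (congrArg₂ (fun z z' => z ≫ z') f2 f1).trans (can_trans G _ _)
  exact lhs.trans rhs.symm

theorem cat_aux {A B A' B' A'' B'' Z Z' Z'' : M} {f : A ⟶ A'} {f' : A' ⟶ A''} {g : B ⟶ B'}
    {g' : B' ⟶ B''} {c : A ⊗ B ⟶ Z} {c' : A' ⊗ B' ⟶ Z'} {c'' : A'' ⊗ B'' ⟶ Z''} {h : Z ⟶ Z'}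
    {h' : Z' ⟶ Z''} (e : (f ⊗ₘ g) ≫ c' = c ≫ h) (e' : (f' ⊗ₘ g') ≫ c'' = c' ≫ h') :
    ((f ≫ f') ⊗ₘ (g ≫ g')) ≫ c'' = c ≫ h ≫ h' := by
  rw [← tensorHom_comp_tensorHom, Category.assoc, e', reassoc_of% e]

theorem catT_reindex {n m n' m' : ℕ} (e : Fin n ≃ Fin n') (e' : Fin m ≃ Fin m')
    {G : Fin n ⊕ Fin m → M} {G' : Fin n' ⊕ Fin m' → M}
    (θ : ∀ s, G s ⟶ G' (Equiv.sumCongr e e' s)) :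
    (reindex (F := fun i => G' (.inl i)) e (fun i => θ (.inl i)) ⊗ₘ
        reindex (F := fun j => G' (.inr j)) e' (fun j => θ (.inr j))) ≫ catT G' =
      catT G ≫ reindex (sumE e e') (F := fun k => G' (finSumFinEquiv.symm k))
        fun k => θ (finSumFinEquiv.symm k) ≫
          eqToHom (congrArg G' (Profile.sumE_symm e e' k).symm) := by
  refine Eq.trans ?_ ((congrArg (fun z => catT G ≫ z) (reindex_pre _ _ _)))
  exact cat_aux (catT_nat θ) (catT_perm e e' G')

theorem unitT_perm {n m : ℕ} (e : Fin n ≃ Fin m) :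
    unitT n ≫ permT e (fun _ => 𝟙_ M) = unitT m := by
  let F : Empty → M := fun _ => 𝟙_ M
  have nd : ∀ m, (Tree.node m fun _ => (Tree.nil : Tree Empty)).Nd := fun m =>
    .of_cnt fun x => x.elim
  have hP : ∀ m, (Tree.nil : Tree Empty).P (.node m fun _ => .nil) := fun m =>
    .of_cnt fun x => x.elim
  have e1 := unitT_can F n ((hP n).comp (nd n))
  have e2 := unitT_can F m ((hP m).comp (nd m))
  have e3 := permT_can F e (fun _ => .nil) ((P_perm e _).comp (nd m))
  exact (congrArg₂ (fun z z' => z ≫ z') e1.symm e3).trans ((can_trans F _ _).trans e2)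

end

section
variable {C : Type v} {M : Type u} [Category.{v} M] [MonoidalCategory M] [SymmetricCategory M]

namespace Operad
variable (O : Operad C M)

/-- The colored units of the entries of a profile. -/
def units (c : Profile C) :
    𝟙_ M ⟶ bigT c.len fun j => (O.obj (c.col j)).obj (op (Profile.single (c.col j))) :=
  unitT c.len ≫ bigTMap c.len fun j => O.one (c.col j)

/-- The objects `O(a₁; b₁), …, O(aₘ; bₘ), O(c₁; c₁), …, O(cₖ; cₖ)`. -/
abbrev padO {a : Profile C} (b : Fin a.len → Profile C) (c : Profile C)
    (s : Fin a.len ⊕ Fin c.len) : M :=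
  (O.obj (Sum.elim a.col c.col s)).obj (op (Profile.padS b c s))

/-- Fill up a sequence of operations with colored units. -/
def padT {a : Profile C} (b : Fin a.len → Profile C) (c : Profile C) :
    bigT a.len (fun i => (O.obj (a.col i)).obj (op (b i))) ⟶
      bigT (a.append c).len fun k =>
        (O.obj ((a.append c).col k)).obj (op (Profile.pad b c k)) :=
  (ρ_ _).inv ≫ (_ ◁ O.units c) ≫ catT (O.padO b c)

theorem pad_aux {A A' V V' Z Z' : M} {f : A ⟶ A'} {g : V ⟶ V'} {u : 𝟙_ M ⟶ V}
    {u' : 𝟙_ M ⟶ V'} {c : A ⊗ V ⟶ Z} {c' : A' ⊗ V' ⟶ Z'} {h : Z ⟶ Z'} (hu : u ≫ g = u')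
    (hc : (f ⊗ₘ g) ≫ c' = c ≫ h) :
    f ≫ (ρ_ A').inv ≫ (A' ◁ u') ≫ c' = ((ρ_ A).inv ≫ (A ◁ u) ≫ c) ≫ h := by
  rw [← hu, rightUnitor_inv_naturality_assoc, ← whisker_exchange_assoc,
    MonoidalCategory.whiskerLeft_comp]
  simp only [Category.assoc]
  rw [← hc, MonoidalCategory.tensorHom_def', Category.assoc]

theorem padT_inner {a : Profile C} {b b' : Fin a.len → Profile C} (u : ∀ i, b i ⟶ b' i)
    (c : Profile C) :
    bigTMap a.len (fun i => (O.obj (a.col i)).map (u i).op) ≫ O.padT b c =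
      O.padT b' c ≫ bigTMap (a.append c).len fun k =>
        (O.obj ((a.append c).col k)).map (Profile.padMapS u c (finSumFinEquiv.symm k)).op := by
  have h := catT_nat (G := O.padO b' c) (G' := O.padO b c) fun s =>
    (O.obj (Sum.elim a.col c.col s)).map (Profile.padMapS u c s).op
  refine pad_aux ?_ h
  have h1 : (bigTMap c.len fun j => (O.obj (Sum.elim a.col c.col (.inr j))).map
      (Profile.padMapS u c (.inr j)).op) = 𝟙 _ :=
    (congrArg (bigTMap c.len) (funext fun j => (O.obj (c.col j)).map_id _)).trans (bigTMap_id _ _)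
  exact (congrArg (fun z => O.units c ≫ z) h1).trans (Category.comp_id _)

theorem one_cast {x y : C} (h : x = y) : O.one x ≫
    eqToHom (congrArg (fun x => (O.obj x).obj (op (Profile.single x))) h) = O.one y := by
  subst h
  exact Category.comp_id _

theorem units_perm {c c' : Profile C} (h : c ⟶ c') :
    O.units c ≫ reindex
      (F := fun j => (O.obj (c'.col j)).obj (op (Profile.single (c'.col j)))) h.σ
      (fun j => eqToHom (congrArg (fun x => (O.obj x).obj (op (Profile.single x)))
        (h.col_σ j).symm)) = O.units c' := by
  have h1 := (reindex_pre h.σ (fun j => O.one (c.col j)) fun j => eqToHom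
      (congrArg (fun x => (O.obj x).obj (op (Profile.single x))) (h.col_σ j).symm)).trans
    (congrArg (reindex (G := fun _ => 𝟙_ M)
      (F := fun j => (O.obj (c'.col j)).obj (op (Profile.single (c'.col j)))) h.σ)
      (funext fun j => O.one_cast (h.col_σ j).symm))
  refine (Category.assoc _ _ _).trans ((congrArg (fun z => unitT c.len ≫ z) (h1.trans
    (permT_nat h.σ fun j => O.one (c'.col j)))).trans ?_)
  rw [← Category.assoc, unitT_perm]
  rfl

theorem padO_perm {a a' c c' : Profile C} (f : a ⟶ a') (h : c ⟶ c')
    (b : Fin a'.len → Profile C) (s : Fin a.len ⊕ Fin c.len) :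
    O.padO (fun i => b (f.σ i)) c s = O.padO b c' (Equiv.sumCongr f.σ h.σ s) := by
  rcases s with i | j
  · exact congrArg (fun x => (O.obj x).obj (op (b (f.σ i)))) (f.col_σ i).symm
  · exact congrArg (fun x => (O.obj x).obj (op (Profile.single x))) (h.col_σ j).symm

theorem padT_outer {a a' c c' : Profile C} (f : a ⟶ a') (h : c ⟶ c')
    (b : Fin a'.len → Profile C) (e : ∀ k, (O.obj ((a.append c).col k)).obj
      (op (Profile.pad (fun i => b (f.σ i)) c k)) = (O.obj ((a'.append c').col
        ((Profile.appendMap f h).σ k))).obj (op (Profile.pad b c' ((Profile.appendMap f h).σ k)))) :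
    reindex (F := fun i => (O.obj (a'.col i)).obj (op (b i))) f.σ (fun i => eqToHom
        (congrArg (fun x => (O.obj x).obj (op (b (f.σ i)))) (f.col_σ i).symm)) ≫ O.padT b c' =
      O.padT (fun i => b (f.σ i)) c ≫ reindex (F := fun k => (O.obj ((a'.append c').col k)).obj
        (op (Profile.pad b c' k))) (Profile.appendMap f h).σ fun k => eqToHom (e k) := by
  have h1 := catT_reindex (G' := O.padO b c') f.σ h.σ fun s => eqToHom (O.padO_perm f h b s)
  simp only [eqToHom_trans] at h1
  exact pad_aux (O.units_perm h) h1

end Operad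
end

namespace Profile
variable {C : Type v}

theorem block_refl {n : ℕ} (b : Fin n → Profile C) : block (Equiv.refl _) b = 𝟙 (concat b) := by
  refine hom_ext fun k => ?_
  exact finSigmaFinEquiv.apply_symm_apply k

end Profile

section
variable {C : Type v} {M : Type u} [Category.{v} M] [MonoidalCategory M] [SymmetricCategory M]

theorem op_congr (W : (Profile C)ᵒᵖ ⥤ M) {a b : Profile C} {f g : a ⟶ b} (h : f = g) :
    W.map f.op = W.map g.op := by rw [h]

theorem inv_op_aux {W : (Profile C)ᵒᵖ ⥤ M} {a a' b b' : Profile C} {p : a ⟶ b} {q : a' ⟶ b'}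
    {f : a ⟶ a'} {g : b ⟶ b'} (h : f ≫ q = p ≫ g) :
    W.map f.op ≫ W.map (Groupoid.inv p).op = W.map (Groupoid.inv q).op ≫ W.map g.op := by
  rw [← W.map_comp, ← W.map_comp, ← op_comp, ← op_comp]
  refine op_congr W ?_
  rw [Groupoid.inv_eq_inv, Groupoid.inv_eq_inv, IsIso.inv_comp_eq, ← Category.assoc, ← h,
    Category.assoc, IsIso.hom_inv_id, Category.comp_id]

namespace Operad
variable (O : Operad C M)

/-- The right module `a ↦ O(d; a, c)`. -/
def shift (d : C) (c : Profile C) : (Profile C)ᵒᵖ ⥤ M where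
  obj a := (O.obj d).obj (op (a.unop.append c))
  map f := (O.obj d).map (Profile.appendMap f.unop (𝟙 c)).op
  map_id a := (op_congr (O.obj d) (Profile.appendMap_id a.unop c)).trans
    ((O.obj d).map_id _)
  map_comp f g := by
    rw [← (O.obj d).map_comp, ← op_comp, ← Profile.appendMap_comp, Category.comp_id]
    rfl

/-- The operadic composition
`O(d; a, c) ⊗ O(a₁; b₁) ⊗ ⋯ ⊗ O(aₘ; bₘ) ⟶ O(d; b₁, …, bₘ, c)`, with units on the entries of `c`. -/
def shiftAct (d : C) (c a : Profile C) (b : Fin a.len → Profile C) :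
    (O.obj d).obj (op (a.append c)) ⊗ bigT a.len (fun i => (O.obj (a.col i)).obj (op (b i))) ⟶
      (O.obj d).obj (op ((Profile.concat b).append c)) :=
  (_ ◁ O.padT b c) ≫ O.γ d (a.append c) (Profile.pad b c) ≫
    (O.obj d).map (Groupoid.inv (Profile.padIso b c)).op

theorem inner_aux {W B B' P P' K K' L L' : M} {m : B' ⟶ B} {p : B ⟶ P} {p' : B' ⟶ P'} {m' : P' ⟶ P}
    {g : W ⊗ P ⟶ K} {g' : W ⊗ P' ⟶ K'} {k : K' ⟶ K} {i : K ⟶ L} {i' : K' ⟶ L'} {l : L' ⟶ L}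
    (h : m ≫ p = p' ≫ m') (h' : (W ◁ m') ≫ g = g' ≫ k) (h'' : k ≫ i = i' ≫ l) :
    (W ◁ m) ≫ (W ◁ p) ≫ g ≫ i = ((W ◁ p') ≫ g' ≫ i') ≫ l := by
  rw [← MonoidalCategory.whiskerLeft_comp_assoc, h, MonoidalCategory.whiskerLeft_comp_assoc,
    reassoc_of% h', h'']
  simp only [Category.assoc]

theorem shiftAct_inner (d : C) (c a : Profile C) {b b' : Fin a.len → Profile C}
    (u : ∀ i, b i ⟶ b' i) :
    (_ ◁ bigTMap a.len (fun i => (O.obj (a.col i)).map (u i).op)) ≫ O.shiftAct d c a b =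
      O.shiftAct d c a b' ≫
        (O.obj d).map (Profile.appendMap (Profile.concatMap u) (𝟙 c)).op :=
  inner_aux (O.padT_inner u c) (O.γ_inner d (a.append c) _)
    (inv_op_aux (Profile.padIso_inner u c))

theorem outer_aux {W W' B B' P P1 P' K K' K'' L L' : M} {m : W' ⟶ W} {p : B ⟶ P} {p' : B' ⟶ P'}
    {R : B ⟶ B'} {u : P ⟶ P1} {R1 : P1 ⟶ P'} {g : W ⊗ P ⟶ K} {g1 : W ⊗ P1 ⟶ K'}
    {g' : W' ⊗ P' ⟶ K''} {k : K ⟶ K'} {l : K'' ⟶ K'} {k' : K' ⟶ K} {i : K ⟶ L} {i' : K'' ⟶ L'}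
    {n : L' ⟶ L} (h1 : (W ◁ u) ≫ g1 = g ≫ k) (h2 : (m ▷ P1) ≫ g1 = (W' ◁ R1) ≫ g' ≫ l)
    (h3 : R ≫ p' = p ≫ u ≫ R1) (h4 : k ≫ k' = 𝟙 K) (h5 : (l ≫ k') ≫ i = i' ≫ n) :
    (m ▷ B) ≫ (W ◁ p) ≫ g ≫ i = (W' ◁ R) ≫ ((W' ◁ p') ≫ g' ≫ i') ≫ n := by
  have e : g = (W ◁ u) ≫ g1 ≫ k' := by rw [reassoc_of% h1, h4, Category.comp_id]
  rw [e]
  simp only [Category.assoc]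
  rw [← h5, ← MonoidalCategory.whiskerLeft_comp_assoc W' R, h3]
  simp only [MonoidalCategory.whiskerLeft_comp, Category.assoc]
  rw [← whisker_exchange_assoc, ← whisker_exchange_assoc, reassoc_of% h2]

theorem shiftAct_outer (d : C) {a a' c c' : Profile C} (f : a ⟶ a') (h : c ⟶ c')
    (b : Fin a'.len → Profile C) :
    ((O.obj d).map (Profile.appendMap f h).op ▷
        bigT a.len (fun i => (O.obj (a.col i)).obj (op (b (f.σ i))))) ≫
        O.shiftAct d c a (fun i => b (f.σ i)) =
      (_ ◁ reindex f.σ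
        (fun i => eqToHom (congrArg (fun x => (O.obj x).obj (op (b (f.σ i)))) (f.col_σ i).symm))) ≫
        O.shiftAct d c' a' b ≫
          (O.obj d).map (Profile.appendMap (Profile.block f.σ b) h).op := by
  have e : ∀ k, (O.obj ((a.append c).col k)).obj
      (op (Profile.pad (fun i => b (f.σ i)) c k)) = (O.obj ((a'.append c').col
        ((Profile.appendMap f h).σ k))).obj
        (op (Profile.pad b c' ((Profile.appendMap f h).σ k))) := fun k => by
    rw [Profile.pad_perm' f h b k, (Profile.appendMap f h).col_σ k]
  have h3 : ∀ k, (O.obj ((a.append c).col k)).map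
      (eqToHom (Profile.pad_perm' f h b k).symm).op ≫ eqToHom (congrArg
        (fun x => (O.obj x).obj (op (Profile.pad b c' ((Profile.appendMap f h).σ k))))
        ((Profile.appendMap f h).col_σ k).symm) = eqToHom (e k) := fun k => by
    rw [eqToHom_op, eqToHom_map, eqToHom_trans]
  have h4 := (O.padT_outer f h b e).trans (congrArg (fun z => O.padT (fun i => b (f.σ i)) c ≫ z)
    ((congrArg (reindex _) (funext fun k => (h3 k).symm)).trans (reindex_pre _ _ _).symm))
  refine outer_aux (O.γ_inner d (a.append c) fun k => eqToHom (Profile.pad_perm' f h b k).symm)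
    (O.γ_outer d (Profile.appendMap f h) (Profile.pad b c')) h4
    (k' := (O.obj d).map (Profile.concatMap fun k => eqToHom (Profile.pad_perm' f h b k)).op)
    ?_ ?_
  · rw [← (O.obj d).map_comp, ← op_comp, ← (O.obj d).map_id]
    refine op_congr (O.obj d) ?_
    have : ∀ {n : ℕ} {p q : Fin n → Profile C} (h : ∀ k, p k = q k),
        Profile.concatMap (fun k => eqToHom (h k)) ≫
          Profile.concatMap (fun k => eqToHom (h k).symm) = 𝟙 _ := by
      intro n p q h
      obtain rfl : p = q := funext h
      refine Profile.hom_ext fun k => ?_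
      exact (congrArg (fun z => finSigmaFinEquiv z) ((finSigmaFinEquiv.symm_apply_apply _).trans
        rfl)).trans (finSigmaFinEquiv.apply_symm_apply k)
    exact this _
  · rw [← (O.obj d).map_comp, ← op_comp]
    refine inv_op_aux ?_
    rw [Category.assoc, Profile.padIso_outer]

/-- The right action of `O` on the module `a ↦ O(d; a, c)`. -/
def shiftRight (d : C) (c : Profile C) : RightAct O (O.shift d c) where
  act a b := O.shiftAct d c a b
  inner a _ _ u := O.shiftAct_inner d c a u
  outer f b := O.shiftAct_outer d f (𝟙 c) b

/-- Functoriality of `a ↦ O(d; a, c)` in `c`. -/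
def shiftMap (d : C) {c c' : Profile C} (h : c ⟶ c') : O.shift d c' ⟶ O.shift d c where
  app a := (O.obj d).map (Profile.appendMap (𝟙 a.unop) h).op
  naturality a a' f := by
    refine ((O.obj d).map_comp _ _).symm.trans (Eq.trans ?_ ((O.obj d).map_comp _ _))
    rw [← op_comp, ← op_comp, ← Profile.appendMap_comp, ← Profile.appendMap_comp,
      Category.comp_id, Category.comp_id, Category.id_comp, Category.id_comp]

theorem shiftMap_act (d : C) {c c' : Profile C} (h : c ⟶ c') (a : Profile C)
    (b : Fin a.len → Profile C) :
    ((O.shiftMap d h).app (op a) ▷ _) ≫ (O.shiftRight d c).act a b =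
      (O.shiftRight d c').act a b ≫ (O.shiftMap d h).app (op (Profile.concat b)) := by
  have h1 := O.shiftAct_outer d (𝟙 a) h b
  have h2 : reindex (Equiv.refl (Fin a.len)) (fun i => eqToHom (rfl :
    (O.obj (a.col i)).obj (op (b i)) = (O.obj (a.col i)).obj (op (b i)))) = 𝟙 _ := reindex_id _
  have h3 := op_congr (O.obj d) (congrArg (fun z => Profile.appendMap z h) (Profile.block_refl b))
  refine h1.trans ((congrArg₂ (fun z z' => (_ ◁ z) ≫ O.shiftAct d c' a b ≫ z') h2 h3).trans ?_)
  rw [MonoidalCategory.whiskerLeft_id]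
  exact Category.id_comp _

end Operad
end

section
variable {C : Type v} {M : Type u} [Category.{v} M] [MonoidalCategory M] [SymmetricCategory M]
  [MonoidalClosed M] [HasColimits M]

theorem act_aux {Z Z' p p0 V V0 L L' x K K' B : M} {m : p0 ⟶ p} {α : Z ⟶ Z'}
    {ι : Z ⊗ p ⟶ V} {T : V ⟶ V0} {ι' : Z' ⊗ p ⟶ V0} {r' : V0 ⟶ L'} {r : V ⟶ L} {T' : L ⟶ L'}
    {s : Z ⊗ p0 ⟶ (Z ⊗ B) ⊗ x} {s' : Z' ⊗ p0 ⟶ (Z' ⊗ B) ⊗ x} {a : Z ⊗ B ⟶ K} {a' : Z' ⊗ B ⟶ K'}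
    {β : K ⟶ K'} {κ : K ⊗ x ⟶ L} {κ' : K' ⊗ x ⟶ L'}
    (h1 : ι ≫ T = (α ▷ p) ≫ ι') (h2 : (Z' ◁ m) ≫ ι' ≫ r' = s' ≫ (a' ▷ x) ≫ κ')
    (h3 : (α ▷ p0) ≫ s' = s ≫ ((α ▷ B) ▷ x)) (h4 : (α ▷ B) ≫ a' = a ≫ β)
    (h5 : (Z ◁ m) ≫ ι ≫ r = s ≫ (a ▷ x) ≫ κ) (h6 : κ ≫ T' = (β ▷ x) ≫ κ') :
    (Z ◁ m) ≫ ι ≫ T ≫ r' = (Z ◁ m) ≫ ι ≫ r ≫ T' := by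
  have e := congrArg (fun z => z ≫ T') h5
  simp only [Category.assoc] at e
  rw [reassoc_of% h1, e, h6, whisker_exchange_assoc, h2, reassoc_of% h3]
  rw [← comp_whiskerRight_assoc, h4, comp_whiskerRight_assoc]

theorem RightAct.map_act {O : Operad C M} {W W' : (Profile C)ᵒᵖ ⥤ M} (R : RightAct O W)
    (R' : RightAct O W') (α : W ⟶ W') (h : ∀ (a : Profile C) (b : Fin a.len → Profile C),
      (α.app (op a) ▷ _) ≫ R'.act a b = R.act a b ≫ α.app (op (Profile.concat b))) (X : C → M) :
    tmap α (𝟙 (pwF (O.app X))) ≫ R'.map X = R.map X ≫ tmap α (𝟙 (pwF X)) := by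
  refine ext2 X fun a b => ?_
  have e : ∀ (Y : C → M) (a : Profile C), tι W (pwF Y) a ≫ tmap α (𝟙 (pwF Y)) =
      (α.app (op a) ▷ pw Y a) ≫ tι W' (pwF Y) a := fun Y a =>
    (tι_map α (𝟙 (pwF Y)) a).trans (congrArg (fun z => z ≫ tι W' (pwF Y) a) (tensorHom_id _ _))
  exact act_aux (e _ a) (R'.gen_spec X a b)
    (shufP_left (b := b) (fun i => (O.obj (a.col i)).obj (op (b i))) X (α.app (op a))) (h a b)
    (R.gen_spec X a b) (e X (Profile.concat b))

theorem nat_aux {Z Z' p p' V V' K K' : M} {α : Z ⟶ Z'} {g : p ⟶ p'} {i : Z ⊗ p ⟶ V}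
    {i' : Z' ⊗ p' ⟶ V'} {T : V ⟶ K} {T' : K' ⟶ V'} {G : V ⟶ K'} {G' : K ⟶ V'} {k : Z' ⊗ p ⟶ K}
    {k' : Z ⊗ p' ⟶ K'} (h1 : i ≫ T = (α ▷ p) ≫ k) (h2 : k' ≫ T' = (α ▷ p') ≫ i')
    (h3 : i ≫ G = (Z ◁ g) ≫ k') (h4 : k ≫ G' = (Z' ◁ g) ≫ i') : i ≫ T ≫ G' = i ≫ G ≫ T' := by
  rw [reassoc_of% h1, reassoc_of% h3, h2, h4, whisker_exchange_assoc]

theorem circMap_tmap {W W' : (Profile C)ᵒᵖ ⥤ M} (α : W ⟶ W') {X Y : C → M} (g : ∀ c, X c ⟶ Y c) :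
    tmap α (𝟙 (pwF X)) ≫ circMap W' g = circMap W g ≫ tmap α (𝟙 (pwF Y)) := by
  refine t_ext fun a => ?_
  have e : ∀ Z : C → M, tι W (pwF Z) a ≫ tmap α (𝟙 (pwF Z)) =
      (α.app (op a) ▷ pw Z a) ≫ tι W' (pwF Z) a := fun Z =>
    (tι_map α (𝟙 (pwF Z)) a).trans (congrArg (fun z => z ≫ tι W' (pwF Z) a) (tensorHom_id _ _))
  exact nat_aux (e X) (e Y) (ι_circMap W g a) (ι_circMap W' g a)

theorem tmap_id {D : Type w} [Groupoid.{w'} D] [HasColimitsOfShape D M] (X : Dᵒᵖ ⥤ M) (Y : D ⥤ M) :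
    tmap (𝟙 X) (𝟙 Y) = 𝟙 (tensorOver X Y) := by
  refine t_ext fun a => ?_
  rw [tι_map, NatTrans.id_app, NatTrans.id_app, id_tensorHom_id]
  exact (Category.id_comp _).trans (Category.comp_id _).symm

theorem tmap_comp {D : Type w} [Groupoid.{w'} D] [HasColimitsOfShape D M] {X X' X'' : Dᵒᵖ ⥤ M}
    {Y Y' Y'' : D ⥤ M} (f : X ⟶ X') (f' : X' ⟶ X'') (g : Y ⟶ Y') (g' : Y' ⟶ Y'') :
    tmap (f ≫ f') (g ≫ g') = tmap f g ≫ tmap f' g' := by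
  refine t_ext fun a => ?_
  rw [tι_map, ← Category.assoc, tι_map, Category.assoc, tι_map, NatTrans.comp_app,
    NatTrans.comp_app, tensorHom_comp_tensorHom_assoc]

namespace Operad
variable (O : Operad C M)

theorem shiftMap_id (d : C) (c : Profile C) : O.shiftMap d (𝟙 c) = 𝟙 (O.shift d c) := by
  ext a
  exact (op_congr (O.obj d) (Profile.appendMap_id a.unop c)).trans ((O.obj d).map_id _)

theorem shiftMap_comp (d : C) {c c' c'' : Profile C} (h : c ⟶ c') (h' : c' ⟶ c'') :
    O.shiftMap d (h ≫ h') = O.shiftMap d h' ≫ O.shiftMap d h := by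
  ext a
  have e := Profile.appendMap_comp (𝟙 a.unop) (𝟙 a.unop) h h'
  rw [Category.comp_id] at e
  exact (op_congr (O.obj d) e).trans ((O.obj d).map_comp _ _)

variable (A : O.monad.Algebra)

/-- The object of elements of `O(d; a, c) ⊗_{Σₐ} A^a`, for all `a`. -/
abbrev envT (X : C → M) (d : C) (c : Profile C) : M := tensorOver (O.shift d c) (pwF X)

/-- The map `d₀` given by the operadic composition. -/
def env0 (d : C) (c : Profile C) : O.envT (O.app A.A) d c ⟶ O.envT A.A d c :=
  (O.shiftRight d c).map A.A

/-- The map `d₁` given by the action on `A`. -/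
def env1 (d : C) (c : Profile C) : O.envT (O.app A.A) d c ⟶ O.envT A.A d c :=
  circMap (O.shift d c) A.a

def envTMap (X : C → M) (d : C) {c c' : Profile C} (h : c ⟶ c') :
    O.envT X d c' ⟶ O.envT X d c := tmap (O.shiftMap d h) (𝟙 (pwF X))

theorem envTMap_env0 (d : C) {c c' : Profile C} (h : c ⟶ c') :
    O.envTMap (O.app A.A) d h ≫ O.env0 A d c = O.env0 A d c' ≫ O.envTMap A.A d h :=
  RightAct.map_act _ _ (O.shiftMap d h) (O.shiftMap_act d h) A.A

theorem envTMap_env1 (d : C) {c c' : Profile C} (h : c ⟶ c') :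
    O.envTMap (O.app A.A) d h ≫ O.env1 A d c = O.env1 A d c' ≫ O.envTMap A.A d h :=
  circMap_tmap (O.shiftMap d h) A.a

theorem envTMap_id (X : C → M) (d : C) (c : Profile C) :
    O.envTMap X d (𝟙 c) = 𝟙 (O.envT X d c) := by
  rw [envTMap, shiftMap_id, tmap_id]

theorem envTMap_comp (X : C → M) (d : C) {c c' c'' : Profile C} (h : c ⟶ c') (h' : c' ⟶ c'') :
    O.envTMap X d (h ≫ h') = O.envTMap X d h' ≫ O.envTMap X d h := by
  rw [envTMap, shiftMap_comp, envTMap, envTMap, ← tmap_comp, Category.comp_id]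

theorem env_w (d : C) {c c' : Profile C} (h : c ⟶ c') :
    O.env0 A d c' ≫ O.envTMap A.A d h ≫ coequalizer.π (O.env0 A d c) (O.env1 A d c) =
      O.env1 A d c' ≫ O.envTMap A.A d h ≫ coequalizer.π (O.env0 A d c) (O.env1 A d c) := by
  rw [← Category.assoc, ← envTMap_env0, ← Category.assoc, ← envTMap_env1, Category.assoc,
    Category.assoc, coequalizer.condition]

/-- `O_A(d; c)`, the coequalizer of `d₀` and `d₁`, with the right action of permutations of `c`. -/
def env (d : C) : (Profile C)ᵒᵖ ⥤ M where
  obj c := coequalizer (O.env0 A d c.unop) (O.env1 A d c.unop)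
  map h := coequalizer.desc (O.envTMap A.A d h.unop ≫ coequalizer.π _ _) (by
    exact O.env_w A d h.unop)
  map_id c := by
    refine coequalizer.hom_ext ?_
    refine (coequalizer.π_desc _ _).trans (Eq.trans ?_ (Category.comp_id _).symm)
    exact (congrArg (fun z => z ≫ coequalizer.π _ _) (O.envTMap_id A.A d c.unop)).trans
      (Category.id_comp _)
  map_comp h h' := by
    refine coequalizer.hom_ext ?_
    rw [coequalizer.π_desc, coequalizer.π_desc_assoc, Category.assoc, coequalizer.π_desc,
      unop_comp, envTMap_comp, Category.assoc]

/-- The map `O(d; a, c) ⊗ A^a ⟶ O_A(d; c)`. -/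
def envι (d : C) (a c : Profile C) :
    (O.obj d).obj (op (a.append c)) ⊗ pw A.A a ⟶ (O.env A d).obj (op c) :=
  tι (O.shift d c) (pwF A.A) a ≫ coequalizer.π (O.env0 A d c) (O.env1 A d c)

end Operad
end

/-! ### The cube of a map -/

/-- The group `Σₜ`, as a groupoid with one object. -/
abbrev BSym (t : ℕ) : Type := SingleObj (Equiv.Perm (Fin t))

abbrev BSym.pt (t : ℕ) : BSym t := SingleObj.star _

/-- The profile `(c, …, c)` with the action of `Σₜ`. -/
def repF {C : Type v} (t : ℕ) (c : C) : BSym t ⥤ Profile C where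
  obj _ := Profile.rep t c
  map σ := (⟨(σ : Equiv.Perm (Fin t)), fun _ => rfl⟩ : Profile.Hom _ _)
  map_id _ := rfl
  map_comp _ _ := rfl

section
variable {M : Type u} [Category.{v} M] [MonoidalCategory M] [SymmetricCategory M]

/-- `Y ⊗ ⋯ ⊗ Y` with the action of `Σₜ`. -/
def powF (Y : M) (t : ℕ) : BSym t ⥤ M where
  obj _ := bigT t fun _ => Y
  map σ := permT (σ : Equiv.Perm (Fin t)) fun _ => Y
  map_id _ := permT_refl _
  map_comp σ τ := (permT_comp (σ : Equiv.Perm (Fin t)) (τ : Equiv.Perm (Fin t)) fun _ => Y).symm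

/-- Vertices of the `t`-dimensional cube with at most `q` coordinates equal to `true`. -/
abbrev Cube (t q : ℕ) : Type :=
  {ε : Fin t → Bool // (Finset.univ.filter fun k => ε k = true).card ≤ q}

variable {X Y : M} (i : X ⟶ Y)

/-- The value `X` or `Y` of the arrow `X ⟶ Y`. -/
def side (X Y : M) : Bool → M
  | false => X
  | true => Y

def sideMap : {b b' : Bool} → (b ≤ b') → (side X Y b ⟶ side X Y b')
  | false, false, _ => 𝟙 X
  | false, true, _ => i
  | true, true, _ => 𝟙 Y
  | true, false, h => absurd h (by decide)

def sideTo : (b : Bool) → (side X Y b ⟶ Y)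
  | false => i
  | true => 𝟙 Y

theorem sideMap_id : ∀ b : Bool, sideMap i (le_refl b) = 𝟙 (side X Y b)
  | false => rfl
  | true => rfl

theorem sideMap_comp : ∀ {b b' b'' : Bool} (h : b ≤ b') (h' : b' ≤ b''),
    sideMap i h ≫ sideMap i h' = sideMap i (h.trans h')
  | false, false, _, _, _ => Category.id_comp _
  | false, true, true, _, _ => Category.comp_id _
  | true, true, true, _, _ => Category.comp_id _
  | true, false, _, h, _ => absurd h (by decide)
  | false, true, false, _, h => absurd h (by decide)
  | true, true, false, _, h => absurd h (by decide)

theorem sideMap_to : ∀ {b b' : Bool} (h : b ≤ b'), sideMap i h ≫ sideTo i b' = sideTo i b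
  | false, false, _ => Category.id_comp _
  | false, true, _ => Category.comp_id _
  | true, true, _ => Category.comp_id _
  | true, false, h => absurd h (by decide)

theorem side_cast {b b' : Bool} (e : b = b') :
    eqToHom (congrArg (side X Y) e) ≫ sideTo i b' = sideTo i b := by
  subst e
  exact Category.id_comp _

theorem sideMap_cast {a a' b b' : Bool} (h : a ≤ a') (h' : b ≤ b') (e : a = b) (e' : a' = b') :
    sideMap i h ≫ eqToHom (congrArg (side X Y) e') =
      eqToHom (congrArg (side X Y) e) ≫ sideMap i h' := by
  subst e e'
  exact (Category.comp_id _).trans (Category.id_comp _).symm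

/-- The tensor product of copies of `X` and `Y` at a vertex of the cube. -/
abbrev vert (X Y : M) {t : ℕ} (ε : Fin t → Bool) : M := bigT t fun k => side X Y (ε k)

/-- The cube `X ⟶ Y` to the power `t`, restricted to the vertices with at most `q` factors `Y`. -/
def cubeF (t q : ℕ) : Cube t q ⥤ M where
  obj ε := vert X Y ε.1
  map h := bigTMap t fun k => sideMap i (leOfHom h k)
  map_id ε := (congrArg (bigTMap t) (funext fun k => sideMap_id i (ε.1 k))).trans (bigTMap_id t _)
  map_comp h h' := Eq.symm ((bigTMap_comp t _ _).trans (congrArg (bigTMap t) (funext fun k =>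
    sideMap_comp i (leOfHom h k) (leOfHom h' k))))

/-- Permutation of coordinates. -/
def Cube.perm {t q : ℕ} (σ : Fin t ≃ Fin t) (ε : Cube t q) : Cube t q :=
  ⟨fun k => ε.1 (σ.symm k), by
    refine le_trans (le_of_eq ?_) ε.2
    refine Finset.card_bij (fun k _ => σ.symm k) ?_ ?_ ?_
    · intro k hk
      simpa using hk
    · intro k _ l _ h
      exact σ.symm.injective h
    · intro k hk
      exact ⟨σ k, by simpa using hk, σ.symm_apply_apply k⟩⟩

/-- The permutation of the factors at a vertex of the cube. -/
def cubePerm (X Y : M) {t q : ℕ} (σ : Fin t ≃ Fin t) (ε : Cube t q) :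
    vert X Y ε.1 ⟶ vert X Y (ε.perm σ).1 :=
  reindex σ fun k => eqToHom (congrArg (fun l => side X Y (ε.1 l)) (σ.symm_apply_apply k).symm)

theorem cubePerm_nat {t q : ℕ} (σ : Fin t ≃ Fin t) {ε ε' : Cube t q} (h : ε ≤ ε') :
    (bigTMap t fun k => sideMap i (h k)) ≫ cubePerm X Y σ ε' =
      cubePerm X Y σ ε ≫ bigTMap t fun k => sideMap i (h (σ.symm k)) := by
  refine (reindex_pre _ _ _).trans (Eq.trans ?_ (reindex_post _ _ _).symm)
  refine congrArg (reindex σ) (funext fun k => ?_)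
  exact sideMap_cast i (h k) (h (σ.symm (σ k))) (congrArg ε.1 (σ.symm_apply_apply k).symm)
    (congrArg ε'.1 (σ.symm_apply_apply k).symm)

theorem cubePerm_refl {t q : ℕ} (ε : Cube t q) :
    cubePerm X Y (Equiv.refl _) ε = 𝟙 (vert X Y ε.1) := reindex_id _

theorem cubePerm_comp {t q : ℕ} (σ τ : Fin t ≃ Fin t) (ε : Cube t q) :
    cubePerm X Y σ ε ≫ cubePerm X Y τ (ε.perm σ) = cubePerm X Y (σ.trans τ) ε := by
  refine (reindex_comp _ _ _ _).trans ?_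
  refine congrArg (reindex (σ.trans τ)) (funext fun k => ?_)
  exact eqToHom_trans _ _

variable [HasColimits M]

/-- The inclusion of a vertex in the colimit of the cube. -/
def cubeι {t q : ℕ} (ε : Cube t q) : vert X Y ε.1 ⟶ colimit (cubeF i t q) :=
  colimit.ι (cubeF i t q) ε

theorem cubeι_w {t q : ℕ} {ε ε' : Cube t q} (h : ε ≤ ε') :
    (bigTMap t fun k => sideMap i (h k)) ≫ cubeι i ε' = cubeι i ε :=
  colimit.w (cubeF i t q) (homOfLE h)

theorem cube_ext {t q : ℕ} {V : M} {f g : colimit (cubeF i t q) ⟶ V}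
    (h : ∀ ε, cubeι i ε ≫ f = cubeι i ε ≫ g) : f = g := colimit.hom_ext h

/-- The map out of the colimit of the cube given by maps on the vertices. -/
def cubeDesc {t q : ℕ} {V : M} (φ : ∀ ε : Cube t q, vert X Y ε.1 ⟶ V)
    (h : ∀ {ε ε' : Cube t q} (h : ε ≤ ε'), (bigTMap t fun k => sideMap i (h k)) ≫ φ ε' = φ ε) :
    colimit (cubeF i t q) ⟶ V :=
  colimit.desc (cubeF i t q) ⟨V, ⟨φ, fun _ _ u => (h (leOfHom u)).trans (Category.comp_id _).symm⟩⟩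

theorem cubeι_desc {t q : ℕ} {V : M} (φ : ∀ ε : Cube t q, vert X Y ε.1 ⟶ V) (h) (ε : Cube t q) :
    cubeι i ε ≫ cubeDesc i φ h = φ ε := colimit.ι_desc _ _

/-- The action of permutations on the colimit of the cube. -/
def cubeAct {t q : ℕ} (σ : Fin t ≃ Fin t) : colimit (cubeF i t q) ⟶ colimit (cubeF i t q) :=
  cubeDesc i (fun ε => cubePerm X Y σ ε ≫ cubeι i (ε.perm σ)) fun {ε ε'} h => by
    have e : ε.perm σ ≤ ε'.perm σ := fun k => h (σ.symm k)
    rw [← cubeι_w i e, ← Category.assoc, cubePerm_nat]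
    exact Category.assoc _ _ _

theorem ι_cubeAct {t q : ℕ} (σ : Fin t ≃ Fin t) (ε : Cube t q) :
    cubeι i ε ≫ cubeAct i σ = cubePerm X Y σ ε ≫ cubeι i (ε.perm σ) := cubeι_desc _ _ _ _

theorem cubeAct_refl (t q : ℕ) : cubeAct (q := q) i (Equiv.refl (Fin t)) = 𝟙 _ := by
  refine cube_ext i fun ε => ?_
  rw [ι_cubeAct, cubePerm_refl]
  exact (Category.id_comp _).trans (Category.comp_id _).symm

theorem cubeAct_comp {t q : ℕ} (σ τ : Fin t ≃ Fin t) :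
    cubeAct (q := q) i (σ.trans τ) = cubeAct i σ ≫ cubeAct i τ := by
  refine cube_ext i fun ε => ?_
  rw [ι_cubeAct, ← Category.assoc, ι_cubeAct, Category.assoc, ι_cubeAct, ← Category.assoc,
    cubePerm_comp]
  rfl

/-- The map from the colimit of the cube to `Y ⊗ ⋯ ⊗ Y`. -/
def cubeTo (t q : ℕ) : colimit (cubeF i t q) ⟶ bigT t fun _ => Y :=
  cubeDesc i (fun ε => bigTMap t fun k => sideTo i (ε.1 k)) fun h =>
    (bigTMap_comp t _ _).trans (congrArg (bigTMap t) (funext fun k => sideMap_to i (h k)))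

theorem cubeAct_to {t q : ℕ} (σ : Fin t ≃ Fin t) :
    cubeAct i σ ≫ cubeTo i t q = cubeTo i t q ≫ permT σ fun _ => Y := by
  refine cube_ext i fun ε => ?_
  rw [← Category.assoc, ι_cubeAct, Category.assoc, cubeTo, cubeι_desc, ← Category.assoc,
    cubeι_desc]
  refine (reindex_post (F := fun k => side X Y ((ε.perm σ).1 k)) σ _ _).trans ?_
  exact congrArg (reindex σ) (funext fun k =>
    side_cast i (congrArg ε.1 (σ.symm_apply_apply k).symm))

/-- The object `Q^t_q`: the colimit of the tensor products of `t` factors `X` or `Y`, at most `q`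
of which are `Y`, with the action of `Σₜ`. -/
def Q (t q : ℕ) : BSym t ⥤ M where
  obj _ := colimit (cubeF i t q)
  map σ := cubeAct i (σ : Equiv.Perm (Fin t))
  map_id _ := cubeAct_refl i t q
  map_comp σ τ := cubeAct_comp i (σ : Equiv.Perm (Fin t)) (τ : Equiv.Perm (Fin t))

/-- The map from `Q^t_q` to `Y ⊗ ⋯ ⊗ Y`; for `q = t - 1` it is the iterated pushout product of
`t` copies of `i`. -/
def corner (t q : ℕ) : Q i t q ⟶ powF Y t where
  app _ := cubeTo i t q
  naturality _ _ σ := cubeAct_to i (σ : Equiv.Perm (Fin t))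

end

/-! ### The filtration of a pushout of algebras -/

namespace Profile
variable {C : Type v}

theorem append_left (a b : Profile C) (i : Fin a.len) :
    (a.append b).col (Fin.castAdd b.len i) = a.col i :=
  congrArg (Sum.elim a.col b.col) (finSumFinEquiv_symm_apply_castAdd i)

theorem append_right (a b : Profile C) (i : Fin b.len) :
    (a.append b).col (Fin.natAdd a.len i) = b.col i :=
  congrArg (Sum.elim a.col b.col) (finSumFinEquiv_symm_apply_natAdd i)

theorem append_rep (a : Profile C) (t : ℕ) (c : C) (k : Fin (a.append (rep t c)).len) :
    (∀ h : k.1 < a.len, (a.append (rep t c)).col k = a.col ⟨k.1, h⟩) ∧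
      (a.len ≤ k.1 → (a.append (rep t c)).col k = c) := by
  refine Fin.addCases (fun i => ?_) (fun i => ?_) k
  · exact ⟨fun _ => append_left a (rep t c) i, fun h => absurd i.2 (not_lt.2 h)⟩
  · exact ⟨fun h => absurd h (not_lt.2 (Nat.le_add_right _ _)), fun _ => append_right a (rep t c) i⟩

/-- The profiles `((a, c), (c, …, c))` and `(a, (c, c, …, c))` are the same. -/
def shiftRep (a : Profile C) (t : ℕ) (c : C) :
    (a.append (single c)).append (rep t c) ⟶ a.append (rep (t + 1) c) :=
  Hom.mk (finCongr (by change a.len + 1 + t = a.len + (t + 1); omega)) fun k => by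
    obtain ⟨h1, h2⟩ := append_rep (a.append (single c)) t c k
    obtain ⟨h3, h4⟩ := append_rep a (t + 1) c
      (finCongr (by change a.len + 1 + t = a.len + (t + 1); omega) k)
    by_cases h : k.1 < a.len
    · have h' : k.1 < a.len + 1 := by omega
      exact (h3 h).trans ((append_left a (single c) ⟨k.1, h⟩).symm.trans (h1 h').symm)
    · refine (h4 (not_lt.1 h)).trans ?_
      by_cases h' : k.1 < a.len + 1
      · have h5 := append_right a (single c) ⟨0, Nat.one_pos⟩
        refine h5.symm.trans (Eq.trans ?_ (h1 h').symm)
        exact congrArg (a.append (single c)).col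
          (Fin.ext (by change a.len + 0 = k.1; omega))
      · exact (h2 (not_lt.1 h')).symm

end Profile

section
variable {C : Type v} {M : Type u} [Category.{v} M] [MonoidalCategory M] [SymmetricCategory M]
  [MonoidalClosed M] [HasColimits M]

/-- The isomorphism `X^a ⊗ X^b ⟶ X^{(a, b)}`. -/
def pwCat (X : C → M) (a b : Profile C) : pw X a ⊗ pw X b ⟶ pw X (a.append b) :=
  catT fun s => X (Sum.elim a.col b.col s)

/-- `O_A(d; c, …, c)` with the right action of `Σₜ`. -/
abbrev Operad.envRep (O : Operad C M) (A : O.monad.Algebra) (d : C) (t : ℕ) (c : C) :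
    (BSym t)ᵒᵖ ⥤ M := (repF t c).op ⋙ O.env A d

/-- The map `O(d; a, c, …, c) ⊗ A^a ⊗ Y ⊗ ⋯ ⊗ Y ⟶ O_A(d; c, …, c) ⊗_{Σₜ} (Y ⊗ ⋯ ⊗ Y)`. -/
def Operad.envGen (O : Operad C M) (A : O.monad.Algebra) (Y : M) (d : C) (a : Profile C) (t : ℕ)
    (c : C) : ((O.obj d).obj (op (a.append (Profile.rep t c))) ⊗ pw A.A a) ⊗ bigT t (fun _ => Y) ⟶
      tensorOver (O.envRep A d t c) (powF Y t) :=
  (O.envι A d a (Profile.rep t c) ▷ bigT t fun _ => Y) ≫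
    tι (O.envRep A d t c) (powF Y t) (BSym.pt t)

/-- The action `O(d; a, c, …, c) ⊗ B^a ⊗ B_c ⊗ ⋯ ⊗ B_c ⟶ B_d`. -/
def Operad.actRep (O : Operad C M) (B : O.monad.Algebra) (d : C) (a : Profile C) (t : ℕ) (c : C) :
    ((O.obj d).obj (op (a.append (Profile.rep t c))) ⊗ pw B.A a) ⊗ bigT t (fun _ => B.A c) ⟶
      B.A d :=
  (α_ _ _ _).hom ≫ (_ ◁ pwCat B.A a (Profile.rep t c)) ≫
    tι (O.obj d) (pwF B.A) (a.append (Profile.rep t c)) ≫ B.a d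

/-- The vertex `X ⊗ Y ⊗ ⋯ ⊗ Y` of the cube. -/
def cubeVert {X Y : M} (i : X ⟶ Y) (t : ℕ) :
    X ⊗ bigT t (fun _ => Y) ⟶ (Q i (t + 1) t).obj (BSym.pt (t + 1)) :=
  cubeι i (⟨Fin.cons false fun _ => true, by
    have h : (Finset.univ.filter fun k : Fin (t + 1) =>
        (Fin.cons false fun _ => true : Fin (t + 1) → Bool) k = true) ⊆ Finset.univ.erase 0 := by
      intro k hk
      simp only [Finset.mem_filter, Finset.mem_univ, true_and, Finset.mem_erase, and_true] at hk ⊢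
      rintro rfl
      exact absurd hk (by simp)
    refine (Finset.card_le_card h).trans ?_
    simp⟩ : Cube (t + 1) t)

/-- A pushout of `O`-algebras along `O ∘ i`, for a map `i` of colored objects that is concentrated
in the color `c`. -/
structure CellAttachment (O : Operad C M) (c : C) where
  A : O.monad.Algebra
  X : C → M
  Y : C → M
  i : X ⟶ Y
  initialX : ∀ d, d ≠ c → Nonempty (IsInitial (X d))
  initialY : ∀ d, d ≠ c → Nonempty (IsInitial (Y d))
  f : O.monad.free.obj X ⟶ A
  P : O.monad.Algebra
  j : A ⟶ P
  g : O.monad.free.obj Y ⟶ P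
  isPushout : IsPushout (O.monad.free.map i) f g j

/-- A morphism of the diagrams `Y ⟵ X`, `O ∘ X ⟶ A`, and the induced map of the pushouts. -/
structure CellAttachment.Hom {O : Operad C M} {c : C} (D D' : CellAttachment O c) where
  α : D.A ⟶ D'.A
  x : D.X ⟶ D'.X
  y : D.Y ⟶ D'.Y
  p : D.P ⟶ D'.P
  i_y : D.i ≫ y = x ≫ D'.i
  f_α : D.f ≫ α = O.monad.free.map x ≫ D'.f
  j_p : D.j ≫ p = α ≫ D'.j
  g_p : D.g ≫ p = O.monad.free.map y ≫ D'.g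

namespace CellAttachment
variable {O : Operad C M} {c : C} (D : CellAttachment O c)

/-- The map `X_c ⟶ A_c` that corresponds to `f`. -/
def fc : D.X c ⟶ D.A.A c := O.unit D.X c ≫ D.f.f c

/-- The map `Y_c ⟶ P_c` that corresponds to `g`. -/
def gc : D.Y c ⟶ D.P.A c := O.unit D.Y c ≫ D.g.f c

/-- The map
`O(d; a, c, c, …, c) ⊗ A^a ⊗ (X_c ⊗ Y_c ⊗ ⋯ ⊗ Y_c) ⟶ O(d; a, c, c, …, c) ⊗ A^{(a, c)} ⊗ (Y_c ⊗ ⋯ ⊗ Y_c)`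
given by `f` on the factor `X_c`. -/
def attach (d : C) (a : Profile C) (t : ℕ) :
    ((O.obj d).obj (op (a.append (Profile.rep (t + 1) c))) ⊗ pw D.A.A a) ⊗
        (D.X c ⊗ bigT t fun _ => D.Y c) ⟶
      ((O.obj d).obj (op ((a.append (Profile.single c)).append (Profile.rep t c))) ⊗
        pw D.A.A (a.append (Profile.single c))) ⊗ bigT t fun _ => D.Y c :=
  (α_ _ _ _).inv ≫ ((α_ _ _ _).hom ▷ _) ≫
    (((O.obj d).map (Profile.shiftRep a t c).op ⊗ₘ
      ((pw D.A.A a ◁ (D.fc ≫ (ρ_ (D.A.A c)).inv)) ≫ pwCat D.A.A a (Profile.single c))) ▷ _)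

/-- The sequence `A, N₀, N₁, …`. -/
def stages (A : C → M) (N : ℕ → C → M) : ℕ → C → M
  | 0 => A
  | t + 1 => N t

/-- A filtration `A = A₀ ⟶ A₁ ⟶ ⋯` of the pushout of algebras, in which every step is a pushout
along `O_A(d; c, …, c) ⊗_{Σₜ} i^{□ t}`. -/
structure Filtration where
  /-- `next t` is `A_{t+1}`. -/
  next : ℕ → C → M
  /-- The maps `A_t ⟶ A_{t+1}`. -/
  step (t : ℕ) : stages D.A.A next t ⟶ stages D.A.A next (t + 1)
  /-- The maps `O_A(d; c, …, c) ⊗_{Σₜ} Y^{⊗ t} ⟶ (A_t)_d`. -/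
  ξ (t : ℕ) (d : C) : tensorOver (O.envRep D.A d t c) (powF (D.Y c) t) ⟶ stages D.A.A next t d
  /-- The maps `O_A(d; c, …, c) ⊗_{Σ_{t+1}} Q^{t+1}_t ⟶ (A_t)_d`. -/
  fstar (t : ℕ) (d : C) : tensorOver (O.envRep D.A d (t + 1) c) (Q (D.i c) (t + 1) t) ⟶
    stages D.A.A next t d
  isPushout (t : ℕ) (d : C) : IsPushout (fstar t d)
    (tmap (𝟙 (O.envRep D.A d (t + 1) c)) (corner (D.i c) (t + 1) t)) (step t d) (ξ (t + 1) d)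
  /-- `O_A(d; ) ⟶ A_d` is given by the action of `O` on `A`. -/
  ξ_zero (d : C) (a : Profile C) :
    O.envGen D.A (D.Y c) d a 0 c ≫ ξ 0 d = O.actRep D.A d a 0 c
  /-- `f_*` is induced by `f`: on `O(d; a, c, …, c) ⊗ A^a ⊗ (X_c ⊗ Y_c ⊗ ⋯ ⊗ Y_c)`, it is given by
  `X_c ⟶ A_c`, followed by `ξ`. -/
  fstar_gen (t : ℕ) (d : C) (a : Profile C) :
    (O.envι D.A d a (Profile.rep (t + 1) c) ⊗ₘ cubeVert (D.i c) t) ≫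
        tι (O.envRep D.A d (t + 1) c) (Q (D.i c) (t + 1) t) (BSym.pt (t + 1)) ≫ fstar t d =
      D.attach d a t ≫ O.envGen D.A (D.Y c) d (a.append (Profile.single c)) t c ≫ ξ t d
  /-- The maps from `A_t` to the underlying colored object of the pushout. -/
  incl (t : ℕ) : stages D.A.A next t ⟶ D.P.A
  step_incl (t : ℕ) : step t ≫ incl (t + 1) = incl t
  incl_zero : incl 0 = D.j.f
  /-- On `O(d; a, c, …, c) ⊗ A^a ⊗ Y_c ⊗ ⋯ ⊗ Y_c`, the map to the pushout is given by `j` and `g` and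
  the action of `O`. -/
  ξ_incl (t : ℕ) (d : C) (a : Profile C) :
    O.envGen D.A (D.Y c) d a t c ≫ ξ t d ≫ incl t d =
      ((_ ◁ pwTrans D.j.f a) ⊗ₘ bigTMap t fun _ => D.gc) ≫ O.actRep D.P d a t c
  /-- The pushout is the colimit of the sequence. -/
  isColimit : IsColimit (Cocone.mk (F := Functor.ofSequence step) D.P.A
    (NatTrans.ofSequence incl fun t => by
      change _ ≫ incl (t + 1) = incl t ≫ 𝟙 _
      rw [Functor.ofSequence_map_homOfLE_succ, step_incl, Category.comp_id]))

variable {D}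

/-- `A_t`. -/
abbrev Filtration.stage (F : D.Filtration) (t : ℕ) : C → M := stages D.A.A F.next t

end CellAttachment
end

end
end ColoredOperads

open ColoredOperads

/-!
The filtration exists because the pushout `P` can be presented in each color, without reference to
algebras, in terms of the objects `O_A(d; c, …, c) ⊗_{Σ_q} (Y_c ⊗ ⋯ ⊗ Y_c)`, which are called cells
below.

As an algebra, `P` is generated by `A` and `Y`, with relations that evaluate operations in `A` and
identify the images of `X` in `A` and in `Y`. These relations are a reflexive pair, and tensor
powers preserve reflexive coequalizers in a closed symmetric monoidal category, so that the functor
`O ∘ -` does so as well (`ReflexiveCoeq.circ`). Therefore the coequalizer of the relations may be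
computed in every color separately (`pushout_quotient`, `reflexive_free`). Distributing `⊗` over the
coproduct of `A` and `Y`, a map from `O ∘ (A ⊔ Y)` to an object `N` is a family of maps from
`O(d; r) ⊗ (A or Y in the entries of r)`, for profiles `r` whose entries are labelled by `false`
(for `A`) or `true` (for `Y`). As `X` and `Y` are initial in all colors but `c`, only the sorted
profiles `(κ, c, …, c)` matter. Dividing by the relations that evaluate operations in `A` turns
`O(d; κ, c, …, c) ⊗ A^κ` into `O_A(d; c, …, c)` (`labGen_rel`). What remains is a `Cocell`: maps
from the cells to `N` for which a factor `X_c` may be mapped to `A_c` or to `Y_c`. Hence maps from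
`P` in the color `d` to `N` are the same as total cocells on `N` (`exists_of_target`,
`target_hom_ext`).

The stage `A_t` is the object built for cocells that are defined for `q ≤ t`. A cocell defined for
`q ≤ t` gives a map out of `O_A(d; c, …, c) ⊗_{Σ_{t+1}} Q^{t+1}_t` (`exists_desc`), where all
factors `X_c` of a vertex of the cube are mapped to `A_c`; the compatibility with the edges of the
cube is `val_tri`. The pushout along the corner map adjoins the next map of the cocell. A cocone on
the sequence of these pushouts is a total cocell, so that the colimit is `P` (`tower_desc`).

Up to permutations every vertex of `Q^{t+1}_t` maps to `X ⊗ Y ⊗ ⋯ ⊗ Y` (`head_ext`), so the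
attaching maps are determined by the given formula. This makes a map of diagrams compatible with
them (`step_compat`), which gives the map of stages by induction (`mapStage`) and its uniqueness
(`hom_unique`).

Isomorphisms that only permute and reassociate factors are compared through `IsCan`: two canonical
isomorphisms of tensor products with distinct labels are equal. Lemmas whose names end in `_aux` are
identities between composites in which the concrete tensor products are replaced by arbitrary
objects, which keeps the terms that are rewritten small.
-/

namespace ColoredOperads
noncomputable section

/-! ### Canonical isomorphisms between tensor products -/

section
variable {M : Type u} [Category.{v} M] [MonoidalCategory M] [SymmetricCategory M]
variable {ι : Type w} {F : ι → M}

/-- `f` is the canonical isomorphism between tensor products of shapes `s` and `t`, as soon as the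
labels are distinct. -/
def IsCan (F : ι → M) (s t : Tree ι) (f : s.eval F ⟶ t.eval F) : Prop :=
  s.P t ∧ ∀ h : s.Comp t, f = can F s t h

namespace IsCan
variable {s t r s' t' : Tree ι}

/-- Parallel canonical isomorphisms are equal. -/
theorem eq {f g : s.eval F ⟶ t.eval F} (hf : IsCan F s t f) (hg : IsCan F s t g) (nd : t.Nd) :
    f = g :=
  (hf.2 ⟨hf.1, nd⟩).trans (hg.2 ⟨hf.1, nd⟩).symm

theorem refl (s : Tree ι) : IsCan F s s (𝟙 _) := ⟨.refl _, fun h => (can_refl F h).symm⟩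

theorem trans {f : s.eval F ⟶ t.eval F} {g : t.eval F ⟶ r.eval F} (hf : IsCan F s t f)
    (hg : IsCan F t r g) : IsCan F s r (f ≫ g) :=
  ⟨hf.1.trans hg.1, fun h => (congrArg₂ (fun z z' => z ≫ z') (hf.2 ⟨hf.1, hg.1.nd h.2⟩)
    (hg.2 ⟨hg.1, h.2⟩)).trans (can_trans F _ _)⟩

theorem inv {f : s.eval F ≅ t.eval F} (hf : IsCan F s t f.hom) : IsCan F t s f.inv :=
  ⟨hf.1.symm, fun h => by
    have h' : s.Comp t := ⟨hf.1, hf.1.symm.nd h.2⟩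
    rw [← cancel_epi f.hom, Iso.hom_inv_id]
    exact ((congrArg (fun z => z ≫ can F t s h) (hf.2 h')).trans ((can_trans F h' h).trans
      (can_refl F _))).symm⟩

theorem pair {f : s.eval F ⟶ s'.eval F} {g : t.eval F ⟶ t'.eval F} (hf : IsCan F s s' f)
    (hg : IsCan F t t' g) : IsCan F (.pair s t) (.pair s' t') (f ⊗ₘ g) :=
  ⟨hf.1.pair hg.1, fun h => by
    rw [hf.2 (hf.1.comp (Tree.Nd.left h.2)), hg.2 (hg.1.comp (Tree.Nd.right h.2))]
    exact can_pairP F hf.1 hg.1 h.2⟩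

theorem left (p : Tree ι) {g : t.eval F ⟶ t'.eval F} (hg : IsCan F t t' g) :
    IsCan F (.pair p t) (.pair p t') (p.eval F ◁ g) := by
  have h := (refl (F := F) p).pair hg
  rwa [id_tensorHom] at h

theorem right (p : Tree ι) {g : t.eval F ⟶ t'.eval F} (hg : IsCan F t t' g) :
    IsCan F (.pair t p) (.pair t' p) (g ▷ p.eval F) := by
  have h := hg.pair (refl (F := F) p)
  rwa [tensorHom_id] at h

theorem node {n : ℕ} {s t : Fin n → Tree ι} {f : ∀ k, (s k).eval F ⟶ (t k).eval F}
    (h : ∀ k, IsCan F (s k) (t k) (f k)) : IsCan F (.node n s) (.node n t) (bigTMap n f) :=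
  ⟨.node fun k => (h k).1, fun hc => by
    rw [← can_nodeP F (fun k => (h k).1) hc.2]
    exact congrArg (bigTMap n) (funext fun k => (h k).2 _)⟩

theorem lam (t : Tree ι) : IsCan F t (.pair .nil t) (λ_ (t.eval F)).inv :=
  ⟨P_lam t, fun h => (can_lam F t h).symm⟩

theorem rho (t : Tree ι) : IsCan F t (.pair t .nil) (ρ_ (t.eval F)).inv :=
  ⟨P_rho t, fun h => (can_rho F t h).symm⟩

theorem rho' (t : Tree ι) : IsCan F t (.node 1 fun _ => t) (ρ_ (t.eval F)).inv :=
  ⟨P_rho' t, fun h => (can_rho' F t h).symm⟩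

theorem unit (n : ℕ) : IsCan F .nil (.node n fun _ => .nil) (unitT n) :=
  ⟨by
    classical
    exact .of_cnt fun x => by simp [Tree.cnt], fun h => (unitT_can F n h).symm⟩

theorem perm {n m : ℕ} (e : Fin n ≃ Fin m) (t : Fin m → Tree ι) :
    IsCan F (.node n fun i => t (e i)) (.node m t) (permT e fun i => (t i).eval F) :=
  ⟨P_perm e t, fun h => permT_can F e t h⟩

theorem reindex {n m : ℕ} (e : Fin n ≃ Fin m) {t' : Fin n → Tree ι} {t : Fin m → Tree ι}
    (h : ∀ i, t' i = t (e i)) :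
    IsCan F (.node n t') (.node m t) (reindex (F := fun i => (t i).eval F) e
      (fun i => eqToHom (congrArg (Tree.eval F) (h i)))) :=
  ⟨P_perm' e h, fun hc => reindex_canP F e h hc.2⟩

theorem cat {n m : ℕ} (t : Fin n ⊕ Fin m → Tree ι) :
    IsCan F (.pair (.node n fun i => t (.inl i)) (.node m fun j => t (.inr j)))
      (.node (n + m) fun k => t (finSumFinEquiv.symm k)) (catT fun s => (t s).eval F) :=
  ⟨P_cat t, fun h => catT_can F t h⟩

theorem shuf {n : ℕ} {m : Fin n → ℕ} (p0 : Tree ι) (p : Fin n → Tree ι)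
    (q : ∀ i, Fin (m i) → Tree ι) : IsCan F (shufS p0 p q) (shufT p0 p q)
      (shuffle (p0.eval F) (fun i => (p i).eval F) (fun i j => (q i j).eval F)) :=
  ⟨P_shuf p0 p q, fun h => shuffle_can F p0 p q h⟩

theorem assoc_aux {a b c a' b' c' ab abc bc abc' : M} {f : a ⟶ a'} {g : b ⟶ b'} {h : c ⟶ c'}
    {f' : a' ⟶ a} {g' : b' ⟶ b} {h' : c' ⟶ c} (hf : f ≫ f' = 𝟙 a) (hg : g ≫ g' = 𝟙 b)
    (hh : h ≫ h' = 𝟙 c) (x : ab ≅ a' ⊗ b') (y : abc ≅ ab ⊗ c') {p : abc ⟶ abc'}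
    {z : abc' ⟶ a' ⊗ bc} {k : bc ⟶ b' ⊗ c'}
    (hp : p ≫ z ≫ a' ◁ k = y.hom ≫ x.hom ▷ c' ≫ (α_ _ _ _).hom) :
    ((((f ⊗ₘ g) ≫ x.inv) ⊗ₘ h) ≫ y.inv) ≫ p ≫ z ≫ (f' ⊗ₘ (k ≫ (g' ⊗ₘ h'))) =
      (α_ a b c).hom := by
  have e : (f' ⊗ₘ (k ≫ (g' ⊗ₘ h'))) = a' ◁ k ≫ (f' ⊗ₘ (g' ⊗ₘ h')) := by
    rw [← id_tensorHom, tensorHom_comp_tensorHom, Category.id_comp]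
  rw [e, Category.assoc, reassoc_of% hp, Iso.inv_hom_id_assoc, ← tensorHom_id,
    tensorHom_comp_tensorHom_assoc, Category.assoc, Iso.inv_hom_id, Category.comp_id,
    Category.comp_id, associator_naturality_assoc, tensorHom_comp_tensorHom,
    tensorHom_comp_tensorHom, hf, hg, hh, id_tensorHom_id, id_tensorHom_id, Category.comp_id]

/-- The associator is canonical: this is the coherence theorem for permutations of factors, applied
to the normal forms of the three trees. -/
theorem assoc (s t r : Tree ι) : IsCan F (.pair (.pair s t) r) (.pair s (.pair t r))
    (α_ (s.eval F) (t.eval F) (r.eval F)).hom :=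
  ⟨List.Perm.of_eq (List.append_assoc _ _ _), fun h => by
    obtain ⟨p, hp⟩ := PermCert.assoc (M := M) s.leaves t.leaves r.leaves
    have hp := hp F
    rw [can_eq F h p]
    exact (assoc_aux (s.norm F).hom_inv_id (t.norm F).hom_inv_id (r.norm F).hom_inv_id
      (appIso F s.leaves t.leaves) (appIso F _ _) hp).symm⟩

end IsCan
end

/-! ### Operations padded by units -/

section
variable {C : Type v} {M : Type u} [Category.{v} M] [MonoidalCategory M] [SymmetricCategory M]

open Profile

/-- Labels for the factors of a shuffle in which the profiles `b` are padded by the entries of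
`κ`. -/
abbrev PadL {a : Profile C} (b : Fin a.len → Profile C) (κ : Profile C) : Type :=
  Unit ⊕ (Fin a.len ⊕ Σ s : Fin a.len ⊕ Fin κ.len, Fin (padS b κ s).len)

section
variable {a : Profile C} (b : Fin a.len → Profile C) (κ : Profile C)

/-- The factor `Z`. -/
abbrev padL0 : Tree (PadL b κ) := .leaf (.inl ())

/-- The operations: one factor for each profile `b i`, and the unit at the entries of `κ`. -/
def padLP : Fin a.len ⊕ Fin κ.len → Tree (PadL b κ)
  | .inl i => .leaf (.inr (.inl i))
  | .inr _ => .nil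

/-- The entries of the profiles of the padded operations. -/
abbrev padLQ (s : Fin a.len ⊕ Fin κ.len) (x : Fin (padS b κ s).len) : Tree (PadL b κ) :=
  .leaf (.inr (.inr ⟨s, x⟩))

/-- The entries of `(b₁, …, bₘ, κ)` as labels. -/
def padLT : Fin (concat b).len ⊕ Fin κ.len → Tree (PadL b κ)
  | .inl w => padLQ b κ (.inl (finSigmaFinEquiv.symm w).1) (finSigmaFinEquiv.symm w).2
  | .inr j => padLQ b κ (.inr j) (0 : Fin 1)

/-- The source of the shuffle: `Z`, the pairs of an operation and its inputs, and the entries of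
`κ`. -/
abbrev padSource : Tree (PadL b κ) :=
  .pair (padL0 b κ) (.pair (.node a.len fun i => .pair (padLP b κ (.inl i))
    (.node (b i).len (padLQ b κ (.inl i)))) (.node κ.len fun j => padLQ b κ (.inr j) (0 : Fin 1)))

theorem padSource_nd : (padSource b κ).Nd := by
  classical
  refine .of_cnt fun x => ?_
  rcases x with x | x | ⟨x | x, y⟩
  · simp [Tree.cnt, padLP]
  · simp [Tree.cnt, padLP]
  · have h : (∑ i, ∑ j : Fin (b i).len, if (⟨.inl i, j⟩ :
        Σ s : Fin a.len ⊕ Fin κ.len, Fin (padS b κ s).len) = ⟨.inl x, y⟩ then 1 else 0) =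
        ∑ p : Σ i, Fin (b i).len, if p = ⟨x, y⟩ then 1 else 0 := by
      rw [Fintype.sum_sigma]
      refine Finset.sum_congr rfl fun i _ => Finset.sum_congr rfl fun j _ => ?_
      refine if_congr ?_ rfl rfl
      constructor
      · intro h
        cases h
        rfl
      · intro h
        cases h
        rfl
    have h2 : ∀ j : Fin κ.len, (⟨.inr j, (0 : Fin 1)⟩ :
        Σ s : Fin a.len ⊕ Fin κ.len, Fin (padS b κ s).len) ≠ ⟨.inl x, y⟩ := by
      intro j h
      cases h
    simp only [Tree.cnt, padLP, reduceCtorEq, if_false, Sum.inr.injEq, zero_add, h, h2,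
      Finset.sum_const_zero, add_zero, Finset.sum_ite_eq', Finset.mem_univ, if_true, le_refl]
  · have h : ∀ j : Fin κ.len, ((⟨.inr j, (0 : Fin 1)⟩ :
        Σ s : Fin a.len ⊕ Fin κ.len, Fin (padS b κ s).len) = ⟨.inr x, y⟩) ↔ j = x := by
      intro j
      constructor
      · intro h
        cases h
        rfl
      · rintro rfl
        exact congrArg (Sigma.mk (Sum.inr j)) (Subsingleton.elim (α := Fin 1) _ _)
    have h2 : ∀ (i : Fin a.len) (j : Fin (b i).len), (⟨.inl i, j⟩ :
        Σ s : Fin a.len ⊕ Fin κ.len, Fin (padS b κ s).len) ≠ ⟨.inr x, y⟩ := by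
      intro i j h
      cases h
    simp only [Tree.cnt, padLP, reduceCtorEq, if_false, Sum.inr.injEq, zero_add, h, h2,
      Finset.sum_const_zero, Finset.sum_ite_eq', Finset.mem_univ, if_true, le_refl]

theorem padLT_perm (K : Fin (concat (pad b κ)).len) :
    padLQ b κ (finSumFinEquiv.symm (finSigmaFinEquiv.symm K).1) (finSigmaFinEquiv.symm K).2 =
      padLT b κ (finSumFinEquiv.symm ((padIso b κ).σ K)) := by
  have h1 : finSumFinEquiv.symm ((padIso b κ).σ K) = padEquiv b κ (finSigmaFinEquiv.symm K) :=
    Equiv.symm_apply_apply _ _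
  rw [h1]
  have key : ∀ (s) (x : Fin (padS b κ s).len), padLQ b κ s x = padLT b κ (Equiv.sumCongr
      finSigmaFinEquiv
      (Equiv.mk (fun p => p.1) (fun i => ⟨i, (0 : Fin 1)⟩) (fun p => by
      obtain ⟨i, j⟩ := p
      exact congrArg (Sigma.mk i) (Subsingleton.elim (α := Fin 1) _ _)) fun _ => rfl)
      (Equiv.sumSigmaDistrib (fun s => Fin (padS b κ s).len) ⟨s, x⟩)) := by
    rintro (i | j) x
    · change _ = padLT b κ (.inl (finSigmaFinEquiv ⟨i, x⟩))
      simp only [padLT]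
      exact flat_congr (m := fun i => (b i).len) (fun i x => padLQ b κ (.inl i) x)
        (finSigmaFinEquiv.symm_apply_apply (⟨i, x⟩ : Σ i, Fin (b i).len))
    · change _ = padLQ b κ (.inr j) (0 : Fin 1)
      exact congrArg (padLQ b κ (.inr j)) (Subsingleton.elim (α := Fin 1) _ _)
  exact key _ _

/-- The factors of a shuffle in which the profiles `b` are padded. -/
def padF (Z : M) (P : Fin a.len → M) (X : C → M) : PadL b κ → M
  | .inl _ => Z
  | .inr (.inl i) => P i
  | .inr (.inr p) => X ((padS b κ p.1).col p.2)

/-- The factors `P₁, …, Pₘ, 𝟙, …, 𝟙`. -/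
abbrev padP (Z : M) (P : Fin a.len → M) (X : C → M) (s : Fin a.len ⊕ Fin κ.len) : M :=
  (padLP b κ s).eval (padF b κ Z P X)

end

theorem catT_cast {n m : ℕ} {G G' : Fin n ⊕ Fin m → M} (h : ∀ s, G s = G' s)
    (hl : ∀ i, G (.inl i) = G' (.inl i)) :
    (bigTMap n (fun i => eqToHom (hl i)) ⊗ₘ bigTMap m fun j => eqToHom (h (.inr j))) ≫ catT G' =
      catT G ≫ bigTMap (n + m) fun k => eqToHom (h (finSumFinEquiv.symm k)) :=
  catT_nat fun s => eqToHom (h s)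

theorem padLT_eval {a : Profile C} (b : Fin a.len → Profile C) (κ : Profile C) (Z : M)
    (P : Fin a.len → M) (X : C → M) (s : Fin (concat b).len ⊕ Fin κ.len) :
    (padLT b κ s).eval (padF b κ Z P X) = X (Sum.elim (concat b).col κ.col s) := by
  rcases s with w | j <;> rfl

theorem pad_core_aux {S Z K L L' : M} {f : S ⟶ Z ⊗ K} {g : K ⟶ L} {h : L ⟶ L'} {k : K ⟶ L'}
    {Z' K' : M} {f' : S ⟶ Z' ⊗ K'} {x : Z' ⟶ Z} {g' : K' ⟶ L} {k' : K' ⟶ L'}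
    (hk : k = g ≫ h) (hk' : k' = g' ≫ h) (e : f ≫ Z ◁ g = f' ≫ (x ⊗ₘ g')) :
    f ≫ Z ◁ k = f' ≫ (x ⊗ₘ k') := by
  rw [hk, hk', MonoidalCategory.whiskerLeft_comp, reassoc_of% e, ← id_tensorHom,
    tensorHom_comp_tensorHom, Category.comp_id]

/-- The shuffle for profiles that are padded by the entries of `κ` is the shuffle for `b` next to
the entries of `κ`. Both sides are canonical isomorphisms between the same tensor products with
distinct labels, up to the equality `padLT_eval` of the factors. -/
theorem shufP_pad_core {a : Profile C} (b : Fin a.len → Profile C) (κ : Profile C)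
    (Z : M) (P : Fin a.len → M) (X : C → M) :
    ((Z ◁ ((bigT a.len fun i => P i ⊗ pw X (b i)) ◁
        bigTMap κ.len fun j => (ρ_ (X (κ.col j))).inv ≫ (λ_ (X (κ.col j) ⊗ 𝟙_ M)).inv)) ≫
      (Z ◁ catT fun s => padP b κ Z P X s ⊗ pw X (padS b κ s)) ≫
      (shufP Z (fun k => padP b κ Z P X (finSumFinEquiv.symm k)) X (pad b κ) :
        Z ⊗ bigT (a.len + κ.len) (fun k => padP b κ Z P X (finSumFinEquiv.symm k) ⊗
          pw X (pad b κ k)) ⟶ _)) ≫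
      (_ ◁ pwMap X (padIso b κ)) =
    ((α_ _ _ _).inv ≫ (shufP Z P X b ▷ pw X κ) ≫ (α_ _ _ _).hom) ≫
      ((Z ◁ ((ρ_ _).inv ≫ (_ ◁ unitT κ.len) ≫ catT (padP b κ Z P X))) ⊗ₘ
        pwCat X (concat b) κ) := by
  let F := padF b κ Z P X
  have hQ : ∀ j : Fin κ.len, (fun _ : Fin 1 => padLQ b κ (.inr j) (0 : Fin 1)) =
      fun x : Fin 1 => padLQ b κ (.inr j) x := fun j => funext fun x =>
    congrArg (padLQ b κ (.inr j)) (Subsingleton.elim (α := Fin 1) _ _)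
  have h1 : ∀ j : Fin κ.len, IsCan F (padLQ b κ (.inr j) (0 : Fin 1))
      (.node 1 fun x : Fin 1 => padLQ b κ (.inr j) x) (ρ_ (X (κ.col j))).inv := fun j => by
    have key : ∀ t : Fin 1 → Tree (PadL b κ), (fun _ => padLQ b κ (.inr j) (0 : Fin 1)) = t →
        ∀ e : (Tree.node 1 fun _ => padLQ b κ (.inr j) (0 : Fin 1)).eval F = (Tree.node 1 t).eval F,
        IsCan F (padLQ b κ (.inr j) (0 : Fin 1)) (.node 1 t)
          ((ρ_ (X (κ.col j))).inv ≫ eqToHom e) := by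
      rintro _ rfl e
      exact (IsCan.rho' _).trans (IsCan.refl _)
    have h := key _ (hQ j) rfl
    exact (congrArg (IsCan F _ _) (Category.comp_id (ρ_ (X (κ.col j))).inv)).mp h
  have L1 := IsCan.left (padL0 b κ) (IsCan.left (.node a.len fun i => .pair (padLP b κ (.inl i))
    (.node (b i).len (padLQ b κ (.inl i)))) (IsCan.node fun j => (h1 j).trans (IsCan.lam _)))
  have L2 := IsCan.left (F := F) (padL0 b κ) (IsCan.cat fun s =>
    .pair (padLP b κ s) (.node (padS b κ s).len (padLQ b κ s)))
  have L3 := IsCan.shuf (F := F) (padL0 b κ) (fun k => padLP b κ (finSumFinEquiv.symm k))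
    (fun k => padLQ b κ (finSumFinEquiv.symm k))
  have L4 := IsCan.left (F := F) (.pair (padL0 b κ) (.node (a.len + κ.len) fun k =>
    padLP b κ (finSumFinEquiv.symm k))) (IsCan.reindex (padIso b κ).σ
    (t' := fun K => padLQ b κ (finSumFinEquiv.symm (finSigmaFinEquiv.symm K).1)
      (finSigmaFinEquiv.symm K).2) (t := fun k => padLT b κ (finSumFinEquiv.symm k))
    (padLT_perm b κ))
  have R1 := (IsCan.assoc (F := F) (padL0 b κ) (.node a.len fun i => .pair (padLP b κ (.inl i))
    (.node (b i).len (padLQ b κ (.inl i))))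
    (.node κ.len fun j => padLQ b κ (.inr j) (0 : Fin 1))).inv
  have R2 := IsCan.right (F := F) (.node κ.len fun j => padLQ b κ (.inr j) (0 : Fin 1))
    (IsCan.shuf (F := F) (padL0 b κ) (fun i => padLP b κ (.inl i)) fun i => padLQ b κ (.inl i))
  have R3 := IsCan.assoc (F := F) (.pair (padL0 b κ) (.node a.len fun i => padLP b κ (.inl i)))
    (.node (concat b).len fun w => padLT b κ (.inl w)) (.node κ.len fun j => padLT b κ (.inr j))
  have R4 := (IsCan.left (F := F) (padL0 b κ) ((IsCan.rho _).trans ((IsCan.left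
    (.node a.len fun i => padLP b κ (.inl i)) (IsCan.unit κ.len)).trans
    (IsCan.cat (padLP b κ))))).pair (IsCan.cat (F := F) (padLT b κ))
  -- `hl` and `hr` exhibit the two sides as canonical isomorphisms of the same trees.
  have hl := (L1.trans (L2.trans L3)).trans L4
  have hr := (R1.trans (R2.trans R3)).trans R4
  have e := hl.eq hr (hl.1.symm.nd (padSource_nd b κ))
  refine pad_core_aux (h := bigTMap ((concat b).append κ).len fun k =>
    eqToHom (padLT_eval b κ Z P X (finSumFinEquiv.symm k))) ?_ ?_ e
  · refine ((reindex_post _ _ _).trans ?_).symm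
    exact congrArg (reindex _) (funext fun k => eqToHom_trans _ _)
  · refine Eq.trans ?_ (catT_cast (padLT_eval b κ Z P X) fun _ => rfl)
    have e1 : bigTMap (concat b).len (fun w => 𝟙 (X ((concat b).col w))) = 𝟙 _ := bigTMap_id _ _
    have e2 : bigTMap κ.len (fun w => 𝟙 (X (κ.col w))) = 𝟙 _ := bigTMap_id _ _
    exact ((congrArg (fun z => z ≫ pwCat X (concat b) κ)
      ((congrArg₂ (fun z z' => z ⊗ₘ z') e1 e2).trans (id_tensorHom_id _ _))).trans
        (Category.id_comp _)).symm

end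

/-! ### The action of operations that are padded by units -/

section
variable {C : Type v} {M : Type u} [Category.{v} M] [MonoidalCategory M] [SymmetricCategory M]
  [MonoidalClosed M] [HasColimits M]

open Profile

/-- Insert colored units at the entries of `κ`. -/
def padOne (O : Operad C M) {a : Profile C} (b : Fin a.len → Profile C) (κ : Profile C) (Z : M)
    (X : C → M) : ∀ s, padP b κ Z (fun i => (O.obj (a.col i)).obj (op (b i))) X s ⟶ O.padO b κ s
  | .inl i => 𝟙 ((O.obj (a.col i)).obj (op (b i)))
  | .inr j => O.one (κ.col j)

theorem padOne_aux {B U V Z Z' : M} {u : 𝟙_ M ⟶ U} {f : B ⟶ B} {o : U ⟶ V} {c : B ⊗ U ⟶ Z}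
    {c' : B ⊗ V ⟶ Z'} {y : Z ⟶ Z'} (h : (f ⊗ₘ o) ≫ c' = c ≫ y) (hf : f = 𝟙 B) :
    ((ρ_ B).inv ≫ (B ◁ u) ≫ c) ≫ y = (ρ_ B).inv ≫ (B ◁ (u ≫ o)) ≫ c' := by
  subst hf
  simp only [Category.assoc]
  rw [← h, id_tensorHom, MonoidalCategory.whiskerLeft_comp_assoc]

theorem padT_eq_padOne (O : Operad C M) {a : Profile C} (b : Fin a.len → Profile C)
    (κ : Profile C) (Z : M) (X : C → M) :
    ((ρ_ _).inv ≫ (_ ◁ unitT κ.len) ≫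
        catT (padP b κ Z (fun i => (O.obj (a.col i)).obj (op (b i))) X)) ≫
      bigTMap (a.len + κ.len) (fun k => padOne O b κ Z X (finSumFinEquiv.symm k)) =
    O.padT b κ := by
  exact padOne_aux (catT_nat (padOne O b κ Z X)) (bigTMap_id _ _)

theorem gen_pad_aux {W B U U1 U2 B4 B5 K1 K2 Q W' V : M} {f1 : U ⟶ U1} {f2 : U1 ⟶ U2}
    {fB : B ⟶ B} {c2 : B ⊗ U2 ⟶ B5} {c1 : B ⊗ U1 ⟶ B4} {y : B4 ⟶ B5}
    {sh1 : W ⊗ B4 ⟶ (W ⊗ K1) ⊗ Q} {sh2 : W ⊗ B5 ⟶ (W ⊗ K2) ⊗ Q} {z : K1 ⟶ K2}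
    {act : W ⊗ K2 ⟶ W'} {ι : W' ⊗ Q ⟶ V} {Q' : M} {q : Q ⟶ Q'} {W'' : M} {g : W' ⟶ W''}
    {ι' : W'' ⊗ Q' ⟶ V} {B0 R : M} {r : W ⊗ (B ⊗ U) ⟶ (W ⊗ B0) ⊗ R} {k : B0 ⟶ K1}
    {pc : R ⟶ Q'} {p : B0 ⟶ K2}
    (h1 : (fB ⊗ₘ f2) ≫ c2 = c1 ≫ y) (hB : fB = 𝟙 B) (h2 : (W ◁ y) ≫ sh2 = sh1 ≫ ((W ◁ z) ▷ Q))
    (hι : (g ⊗ₘ q) ≫ ι' = ι) (hp : k ≫ z = p)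
    (core : ((W ◁ (B ◁ f1)) ≫ (W ◁ c1) ≫ sh1) ≫ (_ ◁ q) = r ≫ ((W ◁ k) ⊗ₘ pc)) :
    (W ◁ (B ◁ (f1 ≫ f2))) ≫ (W ◁ c2) ≫ sh2 ≫ (act ▷ Q) ≫ ι =
      r ≫ (((W ◁ p) ≫ act ≫ g) ⊗ₘ pc) ≫ ι' := by
  subst hB
  rw [id_tensorHom] at h1
  simp only [Category.assoc] at core
  have e : (((W ◁ p) ≫ act ≫ g) ⊗ₘ pc) = ((W ◁ k) ⊗ₘ pc) ≫ (((W ◁ z) ≫ act ≫ g) ▷ Q') := by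
    rw [← hp, ← tensorHom_id, tensorHom_comp_tensorHom, Category.comp_id,
      MonoidalCategory.whiskerLeft_comp, Category.assoc]
  have e2 : ((W ⊗ K1) ◁ q) ≫ (((W ◁ z) ≫ act ≫ g) ▷ Q') =
      ((W ◁ z) ▷ Q) ≫ (act ▷ Q) ≫ (g ⊗ₘ q) := by
    rw [whisker_exchange, comp_whiskerRight, comp_whiskerRight, Category.assoc, Category.assoc,
      MonoidalCategory.tensorHom_def]
  rw [e, Category.assoc, ← reassoc_of% core, reassoc_of% e2, hι, ← reassoc_of% h2,
    MonoidalCategory.whiskerLeft_comp, MonoidalCategory.whiskerLeft_comp, Category.assoc,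
    ← MonoidalCategory.whiskerLeft_comp_assoc W (B ◁ f2), h1,
      MonoidalCategory.whiskerLeft_comp_assoc]

namespace RightAct
variable {O : Operad C M} {W : (Profile C)ᵒᵖ ⥤ M} (R : RightAct O W) (X : C → M)

/-- The generators of the action for operations that are padded by units: the units at the entries
of `κ` are absorbed. -/
theorem gen_pad (a κ : Profile C) (b : Fin a.len → Profile C) :
    (W.obj (op (a.append κ)) ◁
        ((bigT a.len fun i => (O.obj (a.col i)).obj (op (b i)) ⊗ pw X (b i)) ◁
          (bigTMap κ.len (fun j => (ρ_ (X (κ.col j))).inv ≫ (λ_ (X (κ.col j) ⊗ 𝟙_ M)).inv) ≫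
            bigTMap κ.len fun j => O.one (κ.col j) ▷ (X (κ.col j) ⊗ 𝟙_ M)))) ≫
      (_ ◁ catT fun s => O.padO b κ s ⊗ pw X (padS b κ s)) ≫
      R.gen X (a.append κ) (pad b κ) =
    ((α_ _ _ _).inv ≫ (shufP _ _ X b ▷ pw X κ) ≫ (α_ _ _ _).hom) ≫
      (((_ ◁ O.padT b κ) ≫ R.act (a.append κ) (pad b κ) ≫
        W.map (Groupoid.inv (padIso b κ)).op) ⊗ₘ pwCat X (concat b) κ) ≫
      tι W (pwF X) ((concat b).append κ) := by
  have core := shufP_pad_core b κ (W.obj (op (a.append κ)))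
    (fun i => (O.obj (a.col i)).obj (op (b i))) X
  have h1 := catT_nat (fun s => padOne O b κ (W.obj (op (a.append κ))) X s ▷ pw X (padS b κ s))
  have e1 : (bigTMap a.len fun i => padOne O b κ (W.obj (op (a.append κ))) X (.inl i) ▷
      pw X (padS b κ (.inl i))) = 𝟙 (bigT a.len fun i => (O.obj (a.col i)).obj (op (b i)) ⊗
        pw X (b i)) :=
    (congrArg (bigTMap a.len) (funext fun i => id_whiskerRight _ _)).trans (bigTMap_id _ _)
  have h2 := shufP_nat (b := pad b κ) (𝟙 (W.obj (op (a.append κ))))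
    (fun k => padOne O b κ (W.obj (op (a.append κ))) X (finSumFinEquiv.symm k))
    (fun c => 𝟙 (X c))
  simp only [pwTrans, bigTMap_id, tensorHom_id, id_tensorHom] at h2
  exact gen_pad_aux h1 e1 h2 (tι_w' W (pwF X) (padIso b κ)) (padT_eq_padOne O b κ _ X) core

theorem comp_assoc_left {A B C D E : M} (f : A ⟶ B) (g : B ⟶ C) (h : C ⟶ D) (k : D ⟶ E) :
    ((f ≫ g) ≫ h) ≫ k = f ≫ g ≫ h ≫ k := by
  simp only [Category.assoc]

theorem map_pad_aux {W B B' U U1 U2 Z Z' V : M} {τ : B ⟶ B'} {p1 : U ⟶ U1} {p2 : U1 ⟶ U2}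
    {η : U ⟶ U2} {c' : B' ⊗ U2 ⟶ Z'} {c : B ⊗ U1 ⟶ Z} {y : Z ⟶ Z'} {k : W ⊗ Z' ⟶ V}
    (h : (τ ⊗ₘ p2) ≫ c' = c ≫ y) (he : η = p1 ≫ p2) :
    (W ◁ (τ ⊗ₘ η)) ≫ (W ◁ c') ≫ k = (W ◁ (B ◁ p1)) ≫ (W ◁ c) ≫ (W ◁ y) ≫ k := by
  subst he
  rw [← MonoidalCategory.whiskerLeft_comp_assoc W c, ← h, MonoidalCategory.whiskerLeft_comp_assoc,
    ← MonoidalCategory.whiskerLeft_comp_assoc W (B ◁ p1), ← id_tensorHom B,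
    tensorHom_comp_tensorHom, Category.id_comp]

/-- Operations `b` on the entries of `a`, and generators on the entries of `κ`: the action is the
operadic composition with units inserted at the entries of `κ`. -/
theorem map_pad (a κ : Profile C) (b : Fin a.len → Profile C) :
    (W.obj (op (a.append κ)) ◁
        ((bigTMap a.len fun i => tι (O.obj (a.col i)) (pwF X) (b i)) ⊗ₘ pwTrans (O.unit X) κ)) ≫
      (_ ◁ pwCat (O.app X) a κ) ≫ tι W (pwF (O.app X)) (a.append κ) ≫ R.map X =
    ((α_ _ _ _).inv ≫ (shufP _ _ X b ▷ pw X κ) ≫ (α_ _ _ _).hom) ≫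
      (((_ ◁ O.padT b κ) ≫ R.act (a.append κ) (pad b κ) ≫
        W.map (Groupoid.inv (padIso b κ)).op) ⊗ₘ pwCat X (concat b) κ) ≫
      tι W (pwF X) ((concat b).append κ) := by
  rw [← gen_pad, ← gen_spec]
  have h := catT_nat (fun s => tι (O.obj (Sum.elim a.col κ.col s)) (pwF X) (padS b κ s))
  have e : pwTrans (O.unit X) κ = ((bigTMap κ.len fun j => (ρ_ (X (κ.col j))).inv ≫
      (λ_ (X (κ.col j) ⊗ 𝟙_ M)).inv) ≫
      bigTMap κ.len fun j => O.one (κ.col j) ▷ (X (κ.col j) ⊗ 𝟙_ M)) ≫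
      bigTMap κ.len fun j => tι (O.obj (κ.col j)) (pwF X) (single (κ.col j)) := by
    refine Eq.symm ((congrArg (fun z => z ≫ _) (bigTMap_comp _ _ _)).trans
      ((bigTMap_comp _ _ _).trans ?_))
    exact congrArg (bigTMap κ.len) (funext fun j => comp_assoc_left _ _ _ _)
  exact map_pad_aux h e

end RightAct
end

/-! ### Canonical isomorphisms up to equality of objects -/

section
variable {M : Type u} [Category.{v} M] [MonoidalCategory M] [SymmetricCategory M]
variable {ι : Type w} {F : ι → M}

/-- `f` is the canonical isomorphism between tensor products of shapes `s` and `t`, up to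
identifications of its source and target with these tensor products. -/
def IsCanE (F : ι → M) (s t : Tree ι) {X Y : M} (f : X ⟶ Y) : Prop :=
  ∃ (hX : s.eval F = X) (hY : t.eval F = Y), IsCan F s t (eqToHom hX ≫ f ≫ eqToHom hY.symm)

theorem IsCan.toE {s t : Tree ι} {f : s.eval F ⟶ t.eval F} (h : IsCan F s t f) :
    IsCanE F s t f :=
  ⟨rfl, rfl, by
    have e : eqToHom (rfl : s.eval F = s.eval F) ≫ f ≫ eqToHom rfl = f :=
      (Category.id_comp _).trans (Category.comp_id _)
    rwa [e]⟩

namespace IsCanE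
variable {s t r s' t' : Tree ι}

theorem toCan {f : s.eval F ⟶ t.eval F} (h : IsCanE F s t f) : IsCan F s t f := by
  obtain ⟨h1, h2, h⟩ := h
  have e : eqToHom (rfl : s.eval F = s.eval F) ≫ f ≫ eqToHom rfl = f :=
    (Category.id_comp _).trans (Category.comp_id _)
  exact (congrArg (IsCan F s t) e).mp h

theorem perm {X Y : M} {f : X ⟶ Y} (h : IsCanE F s t f) : s.P t := h.choose_spec.choose_spec.1

theorem eq {X Y : M} {f g : X ⟶ Y} (hf : IsCanE F s t f) (hg : IsCanE F s t g) (nd : t.Nd) :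
    f = g := by
  obtain ⟨rfl, rfl, _⟩ := id hf
  exact hf.toCan.eq hg.toCan nd

theorem trans {X Y Z : M} {f : X ⟶ Y} {g : Y ⟶ Z} (hf : IsCanE F s t f) (hg : IsCanE F t r g) :
    IsCanE F s r (f ≫ g) := by
  obtain ⟨rfl, rfl, _⟩ := id hf
  obtain ⟨_, rfl, _⟩ := id hg
  exact (hf.toCan.trans hg.toCan).toE

theorem refl {X : M} (s : Tree ι) (h : s.eval F = X) : IsCanE F s s (𝟙 X) := by
  subst h
  exact (IsCan.refl s).toE

theorem pair {X Y X' Y' : M} {f : X ⟶ X'} {g : Y ⟶ Y'} (hf : IsCanE F s s' f)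
    (hg : IsCanE F t t' g) : IsCanE F (.pair s t) (.pair s' t') (f ⊗ₘ g) := by
  obtain ⟨rfl, rfl, _⟩ := id hf
  obtain ⟨rfl, rfl, _⟩ := id hg
  exact (hf.toCan.pair hg.toCan).toE

theorem left {Z X Y : M} (p : Tree ι) (hp : p.eval F = Z) {f : X ⟶ Y} (hf : IsCanE F s t f) :
    IsCanE F (.pair p s) (.pair p t) (Z ◁ f) := by
  obtain ⟨rfl, rfl, _⟩ := id hf
  subst hp
  exact (hf.toCan.left p).toE

theorem right {Z X Y : M} (p : Tree ι) (hp : p.eval F = Z) {f : X ⟶ Y} (hf : IsCanE F s t f) :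
    IsCanE F (.pair s p) (.pair t p) (f ▷ Z) := by
  obtain ⟨rfl, rfl, _⟩ := id hf
  subst hp
  exact (hf.toCan.right p).toE

theorem assoc {X Y Z : M} (hs : s.eval F = X) (ht : t.eval F = Y) (hr : r.eval F = Z) :
    IsCanE F (.pair (.pair s t) r) (.pair s (.pair t r)) (α_ X Y Z).hom := by
  subst hs ht hr
  exact (IsCan.assoc s t r).toE

theorem cat {n m : ℕ} (t : Fin n ⊕ Fin m → Tree ι) {G : Fin n ⊕ Fin m → M}
    (h : ∀ s, (t s).eval F = G s) :
    IsCanE F (.pair (.node n fun i => t (.inl i)) (.node m fun j => t (.inr j)))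
      (.node (n + m) fun k => t (finSumFinEquiv.symm k)) (catT G) := by
  obtain rfl : (fun s => (t s).eval F) = G := funext h
  exact (IsCan.cat t).toE

theorem reindex {n m : ℕ} (e : Fin n ≃ Fin m) {t' : Fin n → Tree ι} {t : Fin m → Tree ι}
    (h : ∀ i, t' i = t (e i)) {G : Fin n → M} {H : Fin m → M} (hG : ∀ i, (t' i).eval F = G i)
    (hH : ∀ i, (t i).eval F = H i) (θ : ∀ i, G i = H (e i)) :
    IsCanE F (.node n t') (.node m t) (reindex e fun i => eqToHom (θ i)) := by
  obtain rfl : (fun i => (t' i).eval F) = G := funext hG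
  obtain rfl : (fun i => (t i).eval F) = H := funext hH
  exact (IsCan.reindex e h).toE

end IsCanE

/-- The associativity of sums, for initial segments of the natural numbers. -/
abbrev assocSum (n m k : ℕ) : Fin (n + m) ⊕ Fin k ≃ Fin n ⊕ Fin (m + k) :=
  (Equiv.sumCongr finSumFinEquiv.symm (Equiv.refl _)).trans
    ((Equiv.sumAssoc _ _ _).trans (Equiv.sumCongr (Equiv.refl _) finSumFinEquiv))

section
variable {n m k : ℕ}

/-- Labels for the factors of a concatenation of three sequences. -/
abbrev CatL (n m k : ℕ) : Type := Fin n ⊕ (Fin m ⊕ Fin k)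

/-- The factors of the first two sequences. -/
def catFst : Fin n ⊕ Fin m → Tree (CatL n m k)
  | .inl i => .leaf (.inl i)
  | .inr j => .leaf (.inr (.inl j))

/-- The factors of the concatenation of the first two sequences, and of the third one. -/
def catLeft : Fin (n + m) ⊕ Fin k → Tree (CatL n m k)
  | .inl w => catFst (finSumFinEquiv.symm w)
  | .inr l => .leaf (.inr (.inr l))

/-- The factors of the last two sequences. -/
abbrev catSnd (s : Fin m ⊕ Fin k) : Tree (CatL n m k) := .leaf (.inr s)

/-- The factors of the first sequence, and of the concatenation of the last two. -/
def catRight : Fin n ⊕ Fin (m + k) → Tree (CatL n m k)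
  | .inl i => .leaf (.inl i)
  | .inr w => catSnd (finSumFinEquiv.symm w)

theorem catL_assoc (s : Fin (n + m) ⊕ Fin k) :
    (catLeft s : Tree (CatL n m k)) = catRight (assocSum n m k s) := by
  rcases s with w | l
  · obtain ⟨s, rfl⟩ := finSumFinEquiv.surjective w
    rcases s with i | j <;> simp [catLeft, catRight, catFst, catSnd]
  · simp [catLeft, catRight, catSnd]

theorem catL_nd : (Tree.pair (.pair (.node n fun i => .leaf (.inl i))
    (.node m fun j => .leaf (.inr (.inl j)))) (.node k fun l => .leaf (.inr (.inr l))) :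
      Tree (CatL n m k)).Nd := by
  classical
  refine .of_cnt fun x => ?_
  rcases x with x | x | x <;> simp [Tree.cnt]

theorem elim_assocSum {α : Type*} (f : Fin n → α) (g : Fin m → α) (h : Fin k → α)
    (s : Fin (n + m) ⊕ Fin k) :
    Sum.elim f (fun w => Sum.elim g h (finSumFinEquiv.symm w)) (assocSum n m k s) =
      Sum.elim (fun w => Sum.elim f g (finSumFinEquiv.symm w)) h s := by
  rcases s with w | l
  · obtain ⟨s, rfl⟩ := finSumFinEquiv.surjective w
    rcases s with i | j <;> simp
  · simp

end
end

namespace Profile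
variable {C : Type v}

/-- `((a, κ), ρ)` is `(a, (κ, ρ))`. -/
def assocP (a κ ρ : Profile C) : (a.append κ).append ρ ⟶ a.append (κ.append ρ) :=
  homOf (assocSum a.len κ.len ρ.len) (elim_assocSum a.col κ.col ρ.col)

theorem assocP_σ (a κ ρ : Profile C) (K : Fin ((a.append κ).append ρ).len) :
    finSumFinEquiv.symm ((assocP a κ ρ).σ K) =
      assocSum a.len κ.len ρ.len (finSumFinEquiv.symm K) :=
  Equiv.symm_apply_apply _ _

end Profile

/-! ### Padding twice -/

section
variable {M : Type u} [Category.{v} M] [MonoidalCategory M] [SymmetricCategory M]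

theorem unitT_append (n m : ℕ) :
    unitT (n + m) = (λ_ (𝟙_ M)).inv ≫ (unitT n ⊗ₘ unitT m) ≫
      catT (fun _ : Fin n ⊕ Fin m => 𝟙_ M) := by
  let F : Empty → M := fun _ => 𝟙_ M
  have nd : (Tree.node (n + m) fun _ => (Tree.nil : Tree Empty)).Nd := .of_cnt fun x => x.elim
  have h1 := IsCan.unit (F := F) (n + m)
  have h2 := (IsCan.lam (F := F) .nil).trans (((IsCan.unit (F := F) n).pair (IsCan.unit m)).trans
    (IsCan.cat (F := F) (n := n) (m := m) fun _ => .nil))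
  exact h1.eq h2 nd

theorem units_append_aux {u a a' b b' c d : M} {l : u ⟶ a ⊗ b} {f : a ⟶ a'} {g : b ⟶ b'}
    {k : a ⊗ b ⟶ c} {k' : a' ⊗ b' ⟶ d} {h : c ⟶ d} (e : (f ⊗ₘ g) ≫ k' = k ≫ h)
    {x y : M} {p : x ⟶ a} {q : y ⟶ b} {l' : u ⟶ x ⊗ y} (hl : l = l' ≫ (p ⊗ₘ q)) :
    (l ≫ k) ≫ h = l' ≫ ((p ≫ f) ⊗ₘ (q ≫ g)) ≫ k' := by
  rw [Category.assoc, ← e, ← tensorHom_comp_tensorHom, Category.assoc, hl, Category.assoc]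

theorem pad_twice_aux {B K AB D BD Z Z' : M} {u : 𝟙_ M ⟶ K} {w : 𝟙_ M ⟶ D} {c1 : B ⊗ K ⟶ AB}
    {c2 : AB ⊗ D ⟶ Z} {r : Z ⟶ Z'} {c3 : K ⊗ D ⟶ BD} {c4 : B ⊗ BD ⟶ Z'}
    (h : (c1 ▷ D) ≫ c2 ≫ r = (α_ _ _ _).hom ≫ (B ◁ c3) ≫ c4) :
    ((ρ_ B).inv ≫ (B ◁ u) ≫ c1) ≫ ((ρ_ AB).inv ≫ (AB ◁ w) ≫ c2) ≫ r =
      (ρ_ B).inv ≫ (B ◁ ((λ_ (𝟙_ M)).inv ≫ (u ⊗ₘ w) ≫ c3)) ≫ c4 := by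
  simp only [Category.assoc, MonoidalCategory.whiskerLeft_comp]
  rw [rightUnitor_inv_naturality_assoc c1, ← whisker_exchange_assoc, h,
    MonoidalCategory.tensorHom_def]
  simp only [← Category.assoc]
  congr 2
  monoidal

end

namespace Profile
variable {C : Type v}

theorem padS_assoc {a : Profile C} (b : Fin a.len → Profile C) (κ ρ : Profile C)
    (s : Fin (a.append κ).len ⊕ Fin ρ.len) :
    padS (pad b κ) ρ s = padS b (κ.append ρ) (assocSum a.len κ.len ρ.len s) := by
  have h := elim_assocSum b (fun j => single (κ.col j)) (fun l => single (ρ.col l)) s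
  refine Eq.trans ?_ (h.symm.trans ?_)
  · rcases s with w | l <;> rfl
  · rcases assocSum a.len κ.len ρ.len s with i | w
    · rfl
    · change Sum.elim (fun j => single (κ.col j)) (fun l => single (ρ.col l))
          (finSumFinEquiv.symm w) = single (Sum.elim κ.col ρ.col (finSumFinEquiv.symm w))
      rcases finSumFinEquiv.symm w with i | j <;> rfl

theorem pad_assoc {a : Profile C} (b : Fin a.len → Profile C) (κ ρ : Profile C)
    (K : Fin ((a.append κ).append ρ).len) :
    pad (pad b κ) ρ K = pad b (κ.append ρ) ((assocP a κ ρ).σ K) :=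
  (padS_assoc b κ ρ _).trans (congrArg (padS b (κ.append ρ)) (assocP_σ a κ ρ K).symm)

end Profile

section
variable {C : Type v} {M : Type u} [Category.{v} M] [MonoidalCategory M] [SymmetricCategory M]
open Profile

namespace Operad
variable (O : Operad C M)

theorem units_append (κ ρ : Profile C) :
    O.units (κ.append ρ) = (λ_ (𝟙_ M)).inv ≫ (O.units κ ⊗ₘ O.units ρ) ≫
      catT (fun s => (O.obj (Sum.elim κ.col ρ.col s)).obj (op (single (Sum.elim κ.col ρ.col s))))
        := by
  have h := catT_nat (fun s => O.one (Sum.elim κ.col ρ.col s))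
  refine Eq.trans ?_ (units_append_aux h (l' := (λ_ (𝟙_ M)).inv) (p := unitT κ.len) (q :=
    unitT ρ.len)
    rfl)
  refine congrArg (fun z => z ≫ _) ?_
  exact (unitT_append κ.len ρ.len).trans (Category.assoc _ _ _).symm

/-- Padding by the units of `κ` and then by those of `ρ` is padding by the units of `(κ, ρ)`. -/
theorem padT_assoc {a : Profile C} (b : Fin a.len → Profile C) (κ ρ : Profile C)
    (e : ∀ K, (O.obj (((a.append κ).append ρ).col K)).obj (op (pad (pad b κ) ρ K)) =
      (O.obj ((a.append (κ.append ρ)).col ((assocP a κ ρ).σ K))).obj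
        (op (pad b (κ.append ρ) ((assocP a κ ρ).σ K)))) :
    O.padT b κ ≫ O.padT (pad b κ) ρ ≫ reindex
      (F := fun k => (O.obj ((a.append (κ.append ρ)).col k)).obj (op (pad b (κ.append ρ) k)))
      (assocP a κ ρ).σ (fun K => eqToHom (e K)) =
    O.padT b (κ.append ρ) := by
  let F : CatL a.len κ.len ρ.len → M
    | .inl i => (O.obj (a.col i)).obj (op (b i))
    | .inr s => (O.obj (Sum.elim κ.col ρ.col s)).obj (op (single (Sum.elim κ.col ρ.col s)))
  have h1 : ∀ s, (catFst s).eval F = O.padO b κ s := by rintro (i | j) <;> rfl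
  have h2 : ∀ s, (catLeft s).eval F = O.padO (pad b κ) ρ s := by
    rintro (w | l)
    · exact h1 _
    · rfl
  have h4 : ∀ s, (catRight s).eval F = O.padO b (κ.append ρ) s := by
    rintro (w | l) <;> rfl
  have c1 := IsCanE.right (Z := bigT ρ.len fun l => O.padO (pad b κ) ρ (.inr l))
    (.node ρ.len fun l => .leaf (.inr (.inr l))) rfl (IsCanE.cat catFst h1)
  have c2 := IsCanE.cat catLeft h2
  have c5 := IsCanE.reindex (assocP a κ ρ).σ (t' := fun K => catLeft (finSumFinEquiv.symm K))
    (t := fun K => catRight (finSumFinEquiv.symm K))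
    (fun K => (catL_assoc _).trans (congrArg catRight (assocP_σ a κ ρ K).symm))
    (fun K => h2 _) (fun K => h4 _) e
  have d1 := IsCanE.assoc (F := F) (s := .node a.len fun i => .leaf (.inl i))
    (t := .node κ.len fun j => .leaf (.inr (.inl j)))
    (r := .node ρ.len fun l => .leaf (.inr (.inr l)))
    (X := bigT a.len fun i => O.padO b κ (.inl i)) (Y := bigT κ.len fun j => O.padO b κ (.inr j))
    (Z := bigT ρ.len fun l => O.padO (pad b κ) ρ (.inr l)) rfl rfl rfl
  have d2 := IsCanE.left (Z := bigT a.len fun i => O.padO b κ (.inl i))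
    (.node a.len fun i => .leaf (.inl i)) rfl
    (IsCanE.cat (F := F) catSnd (G := fun s => (O.obj (Sum.elim κ.col ρ.col s)).obj
      (op (single (Sum.elim κ.col ρ.col s)))) fun _ => rfl)
  have d3 := IsCanE.cat (F := F) catRight h4
  have l := c1.trans (c2.trans c5)
  have h := l.eq (d1.trans (d2.trans d3)) (l.perm.symm.nd catL_nd)
  refine (pad_twice_aux (u := O.units κ) (w := O.units ρ) h).trans ?_
  exact congrArg (fun z => (ρ_ _).inv ≫ (_ ◁ z) ≫ catT (O.padO b (κ.append ρ)))
    (O.units_append κ ρ).symm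

end Operad
end

/-! ### Associativity of the composition with padded operations -/

namespace Profile
variable {C : Type v}

theorem padIso_assoc {a : Profile C} (b : Fin a.len → Profile C) (κ ρ : Profile C) :
    concatMap (fun K => eqToHom (pad_assoc b κ ρ K)) ≫
        block (assocP a κ ρ).σ (pad b (κ.append ρ)) ≫ padIso b (κ.append ρ) =
      padIso (pad b κ) ρ ≫ appendMap (padIso b κ) (𝟙 ρ) ≫ assocP (concat b) κ ρ := by
  refine (congrArg (fun z => _ ≫ z) (homOf_comp _ _ _ _)).trans ((homOf_comp _ _ _ _).trans
    (Eq.trans ?_ ((congrArg (fun z => _ ≫ z) (homOf_comp _ _ _ _)).trans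
      (homOf_comp _ _ _ _)).symm))
  refine homOf_congr _ _ fun p => ?_
  obtain ⟨K, x⟩ := p
  have key : ∀ s (x : Fin (padS b κ s).len) t (_ : t = Sum.map id finSumFinEquiv
      (Equiv.sumAssoc _ _ (Fin ρ.len) (.inl s))) (e : padS b κ s = padS b (κ.append ρ) t),
      Sum.map (finSigmaFinEquiv (n := fun i => (b i).len)) (fun p => p.1)
        (Equiv.sumSigmaDistrib (fun s => Fin (padS b (κ.append ρ) s).len)
          ⟨t, Hom.σ (eqToHom e) x⟩) =
      Sum.map id finSumFinEquiv (Equiv.sumAssoc _ _ (Fin ρ.len) (.inl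
        (Sum.map (finSigmaFinEquiv (n := fun i => (b i).len)) (fun p => p.1)
          (Equiv.sumSigmaDistrib (fun s => Fin (padS b κ s).len) ⟨s, x⟩)))) := by
    rintro (i | j) x _ rfl e <;> rfl
  have key2 : ∀ s (x : Fin (padS (pad b κ) ρ s).len) t (_ : t = assocSum _ _ _ s)
      (e : padS (pad b κ) ρ s = padS b (κ.append ρ) t),
      Sum.map (finSigmaFinEquiv (n := fun i => (b i).len)) (fun p => p.1)
        (Equiv.sumSigmaDistrib (fun s => Fin (padS b (κ.append ρ) s).len)
          ⟨t, Hom.σ (eqToHom e) x⟩) =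
      assocSum (concat b).len κ.len ρ.len (Sum.map (padIso b κ).σ id
        (Sum.map (finSigmaFinEquiv (n := fun k => (pad b κ k).len)) (fun p => p.1)
          (Equiv.sumSigmaDistrib (fun s => Fin (padS (pad b κ) ρ s).len) ⟨s, x⟩))) := by
    rintro (w | l) x _ rfl e
    · refine (key (finSumFinEquiv.symm w) x _ rfl e).trans ?_
      change _ = Sum.map id finSumFinEquiv (Equiv.sumAssoc _ _ (Fin ρ.len) (.inl
        (finSumFinEquiv.symm ((padIso b κ).σ (finSigmaFinEquiv ⟨w, x⟩)))))
      refine congrArg (fun z => Sum.map id finSumFinEquiv (Equiv.sumAssoc _ _ (Fin ρ.len)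
        (.inl z))) ?_
      have h1 : finSumFinEquiv.symm ((padIso b κ).σ (finSigmaFinEquiv ⟨w, x⟩)) =
          padEquiv b κ (finSigmaFinEquiv.symm (finSigmaFinEquiv ⟨w, x⟩)) :=
        Equiv.symm_apply_apply _ _
      rw [h1, Equiv.symm_apply_apply]
      rfl
    · rfl
  have h := key2 (finSumFinEquiv.symm K) x _ (assocP_σ a κ ρ K) (pad_assoc b κ ρ K)
  refine Eq.trans ?_ (h.trans ?_)
  · change Sum.map _ _ (Equiv.sumSigmaDistrib (fun s => Fin (padS b (κ.append ρ) s).len)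
      (Equiv.sigmaCongrLeft (β := fun s => Fin (padS b (κ.append ρ) s).len) finSumFinEquiv.symm
        (Equiv.sigmaCongrLeft (β := fun k => Fin (pad b (κ.append ρ) k).len) (assocP a κ ρ).σ _)))
          = _
    rfl
  · have h2 : ∀ z : (Σ i, Fin (pad b κ i).len) ⊕ (Σ j : Fin ρ.len, Fin (padS (pad b κ)
      ρ (.inr j)).len),
        Sum.map (padIso b κ).σ id (Sum.map (finSigmaFinEquiv
        (n := fun k => (pad b κ k).len)) (fun p => p.1) z) =
        Sum.map (padIso b κ).σ (Hom.σ (𝟙 ρ)) (Sum.map finSigmaFinEquiv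
          (Equiv.mk (fun p => p.1) (fun i => ⟨i, (0 : Fin 1)⟩) (fun p => by
            obtain ⟨i, j⟩ := p
            exact congrArg (Sigma.mk i) (Subsingleton.elim (α := Fin 1) _ _)) fun _ => rfl) z) := by
      rintro (z | z) <;> rfl
    exact congrArg (assocSum _ _ _) (h2 _)

end Profile

section
variable {C : Type v} {M : Type u} [Category.{v} M] [MonoidalCategory M] [SymmetricCategory M]
open Profile

theorem concatMap_eqToHom {n : ℕ} {p q : Fin n → Profile C} (h : ∀ k, p k = q k) :
    concatMap (fun k => eqToHom (h k)) ≫ concatMap (fun k => eqToHom (h k).symm) = 𝟙 _ := by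
  obtain rfl : p = q := funext h
  refine hom_ext fun k => ?_
  exact (congrArg (fun z => finSigmaFinEquiv z) ((finSigmaFinEquiv.symm_apply_apply _).trans
    rfl)).trans (finSigmaFinEquiv.apply_symm_apply k)

theorem assoc_inv_aux {W : (Profile C)ᵒᵖ ⥤ M} {A B B' D E : Profile C} {p : A ⟶ B} {q : B ⟶ B'}
    {r : B' ⟶ E} {f : A ⟶ D} {i : D ⟶ E} (h : f ≫ i = p ≫ q ≫ r) :
    W.map f.op ≫ W.map (Groupoid.inv p).op ≫ W.map (Groupoid.inv q).op =
      W.map (Groupoid.inv i).op ≫ W.map r.op := by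
  have e : f ≫ i = (p ≫ q) ≫ r := by rw [h, Category.assoc]
  rw [← inv_op_aux e, ← W.map_comp (Groupoid.inv p).op, ← op_comp]
  refine congrArg (fun z => _ ≫ z) (op_congr W ?_)
  rw [Groupoid.inv_eq_inv, Groupoid.inv_eq_inv, Groupoid.inv_eq_inv, IsIso.inv_comp]

namespace Operad
variable (O : Operad C M)

theorem shiftAct_assoc_aux {W W' B P1 P P2 P' K K' K'' L L' L'' : M} {m : W' ⟶ W} {p0 : B ⟶ P1}
    {p1 : P1 ⟶ P} {p' : B ⟶ P'} {u : P ⟶ P2} {R1 : P2 ⟶ P'} {g : W ⊗ P ⟶ K} {g1 : W ⊗ P2 ⟶ K'}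
    {g' : W' ⊗ P' ⟶ K''} {k : K ⟶ K'} {l : K'' ⟶ K'} {k' : K' ⟶ K} {i : K ⟶ L} {j : L ⟶ L''}
    {i' : K'' ⟶ L'}
    {n : L' ⟶ L''} (h1 : (W ◁ u) ≫ g1 = g ≫ k) (h2 : (m ▷ P2) ≫ g1 = (W' ◁ R1) ≫ g' ≫ l)
    (h3 : p0 ≫ p1 ≫ u ≫ R1 = p') (h4 : k ≫ k' = 𝟙 K) (h5 : (l ≫ k') ≫ i ≫ j = i' ≫ n) :
    (m ▷ B) ≫ (W ◁ p0) ≫ ((W ◁ p1) ≫ g ≫ i) ≫ j = ((W' ◁ p') ≫ g' ≫ i') ≫ n := by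
  have h := outer_aux (m := m) (p := p0 ≫ p1) (p' := p') (R := 𝟙 B) h1 h2
    (by rw [Category.id_comp, ← h3, Category.assoc]) h4 h5
  rw [MonoidalCategory.whiskerLeft_id, Category.id_comp] at h
  rw [← h]
  simp only [MonoidalCategory.whiskerLeft_comp, Category.assoc]

/-- The right action of operations on `O(d; a, κ, ρ)` is the same whether the entries of `κ` are
fixed with those of `ρ`, or acted on by units. -/
theorem shiftAct_assoc (d : C) (a κ ρ : Profile C) (b : Fin a.len → Profile C) :
    ((O.obj d).map (assocP a κ ρ).op ▷ _) ≫ (_ ◁ O.padT b κ) ≫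
        O.shiftAct d ρ (a.append κ) (pad b κ) ≫
        (O.obj d).map (appendMap (Groupoid.inv (padIso b κ)) (𝟙 ρ)).op =
      O.shiftAct d (κ.append ρ) a b ≫ (O.obj d).map (assocP (concat b) κ ρ).op := by
  have e : ∀ K, (O.obj (((a.append κ).append ρ).col K)).obj (op (pad (pad b κ) ρ K)) =
      (O.obj ((a.append (κ.append ρ)).col ((assocP a κ ρ).σ K))).obj
        (op (pad b (κ.append ρ) ((assocP a κ ρ).σ K))) := fun K => by
    rw [pad_assoc b κ ρ K, (assocP a κ ρ).col_σ K]
  have h3 : ∀ K, (O.obj (((a.append κ).append ρ).col K)).map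
      (eqToHom (pad_assoc b κ ρ K).symm).op ≫ eqToHom (congrArg
        (fun x => (O.obj x).obj (op (pad b (κ.append ρ) ((assocP a κ ρ).σ K))))
        ((assocP a κ ρ).col_σ K).symm) = eqToHom (e K) := fun K => by
    rw [eqToHom_op, eqToHom_map, eqToHom_trans]
  have h4 := Eq.trans (congrArg (fun z => O.padT b κ ≫ O.padT (pad b κ) ρ ≫ z)
    ((reindex_pre _ _ _).trans (congrArg (reindex _) (funext h3)))) (O.padT_assoc b κ ρ e)
  refine shiftAct_assoc_aux
    (O.γ_inner d ((a.append κ).append ρ) fun K => eqToHom (pad_assoc b κ ρ K).symm)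
    (O.γ_outer d (assocP a κ ρ) (pad b (κ.append ρ))) h4
    (k' := (O.obj d).map (concatMap fun K => eqToHom (pad_assoc b κ ρ K)).op) ?_ ?_
  · rw [← (O.obj d).map_comp, ← op_comp, ← (O.obj d).map_id]
    exact op_congr (O.obj d) (concatMap_eqToHom _)
  · have e1 : appendMap (Groupoid.inv (padIso b κ)) (𝟙 ρ) =
        Groupoid.inv (appendMap (padIso b κ) (𝟙 ρ)) := hom_ext fun _ => rfl
    rw [← (O.obj d).map_comp, ← op_comp, e1]
    refine assoc_inv_aux ?_
    rw [Category.assoc, padIso_assoc]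

end Operad
end

/-! ### Labelled profiles -/

section
variable {M : Type u} [Category.{v} M] [MonoidalCategory M] [SymmetricCategory M] [MonoidalClosed M]

theorem isInitial_tensor_left (Z : M) {X : M} (h : Nonempty (IsInitial X)) :
    Nonempty (IsInitial (Z ⊗ X)) :=
  h.map fun h => IsInitial.isInitialObj (tensorLeft Z) X h

theorem isInitial_tensor_right {X : M} (h : Nonempty (IsInitial X)) (Z : M) :
    Nonempty (IsInitial (X ⊗ Z)) :=
  (isInitial_tensor_left Z h).map fun h => h.ofIso (β_ Z X)

theorem isInitial_bigT : ∀ (n : ℕ) {X : Fin n → M} (k : Fin n) (_ : Nonempty (IsInitial (X k))),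
    Nonempty (IsInitial (bigT n X))
  | n + 1, X, k, h => by
    revert h
    refine Fin.cases (fun h => ?_) (fun k h => ?_) k
    · exact isInitial_tensor_right h _
    · exact isInitial_tensor_left _ (isInitial_bigT n k h)

end

namespace Profile
variable {C : Type v} {Λ : Type}

/-- The profile of colors of a labelled profile. -/
def under (r : Profile (C × Λ)) : Profile C := ⟨r.len, fun k => (r.col k).1⟩

/-- The underlying map of profiles. -/
def underMap {r r' : Profile (C × Λ)} (f : r ⟶ r') : r.under ⟶ r'.under :=
  Hom.mk f.σ fun i => congrArg Prod.fst (f.col_σ i)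

/-- The labels of `(a, r)`, where the entries of `a` are labelled by `false`. -/
def labSum {n m : ℕ} (ℓ : Fin m → Bool) : Fin n ⊕ Fin m → Bool := Sum.elim (fun _ => false) ℓ

/-- The labelled profile `(a, r)`, where the entries of `a` are labelled by `false`. -/
def labApp (a : Profile C) (r : Profile (C × Bool)) : Profile (C × Bool) :=
  ⟨a.len + r.len, fun k => ((a.append r.under).col k,
    labSum (fun j => (r.col j).2) (finSumFinEquiv.symm k))⟩

/-- Permutations of `a` and of `r` permute `(a, r)`. -/
def labAppMap {a a' : Profile C} {r r' : Profile (C × Bool)} (f : a ⟶ a') (g : r ⟶ r') :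
    labApp a r ⟶ labApp a' r' :=
  Hom.mk (appendMap f (underMap g)).σ fun k => by
    refine Prod.ext ((appendMap f (underMap g)).col_σ k) ?_
    change labSum _ (finSumFinEquiv.symm ((appendMap f (underMap g)).σ k)) = labSum _ _
    refine (congrArg (labSum _) (sumE_symm f.σ g.σ k)).trans ?_
    rcases finSumFinEquiv.symm k with i | j
    · rfl
    · exact congrArg Prod.snd (g.col_σ j)

/-- The labelled profile `(κ, c, …, c)`, where the entries of `κ` are labelled by `false`, and
the `q` entries `c` by `true`. -/
abbrev sorted (κ : Profile C) (q : ℕ) (c : C) : Profile (C × Bool) := labApp κ (rep q (c, true))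

/-- The number of entries that are labelled by `true`. -/
def cnt (r : Profile (C × Bool)) : ℕ := (Finset.univ.filter fun k => (r.col k).2 = true).card

/-- A labelled profile, in which the entries with label `true` have color `c`, can be sorted, with
any prescribed order of these entries. -/
theorem exists_sorted {r : Profile (C × Bool)} {c : C} {q : ℕ}
    (h : ∀ k, (r.col k).2 = true → (r.col k).1 = c) (e : Fin q ≃ {k // (r.col k).2 = true}) :
    ∃ (κ : Profile C) (f : sorted κ q c ⟶ r), ∀ j, f.σ (Fin.natAdd κ.len j) = (e j).1 := by
  classical
  let e0 := (Fintype.equivFin {k // ¬ (r.col k).2 = true}).symm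
  let κ : Profile C := ⟨_, fun i => (r.col (e0 i).1).1⟩
  let σ : Fin (κ.len + q) ≃ Fin r.len := finSumFinEquiv.symm.trans
    ((Equiv.sumComm _ _).trans ((Equiv.sumCongr e e0).trans (Equiv.sumCompl _)))
  have key : ∀ s : Fin κ.len ⊕ Fin q, r.col (Equiv.sumCompl _ (Sum.map e e0 (Sum.swap s))) =
      (Sum.elim κ.col (fun _ => c) s, labSum (fun _ => true) s) := by
    rintro (i | j)
    · refine Prod.ext rfl ?_
      have h := (e0 i).2
      change (r.col (e0 i).1).2 = false
      simpa using h
    · exact Prod.ext (h _ (e j).2) (e j).2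
  refine ⟨κ, Hom.mk σ fun k => key _, fun j => ?_⟩
  exact congrArg (fun s => Equiv.sumCompl (fun k => (r.col k).2 = true) (Sum.map e e0 (Sum.swap s)))
    (finSumFinEquiv_symm_apply_natAdd j)

theorem exists_sorted' {r : Profile (C × Bool)} {c : C} {q : ℕ}
    (h : ∀ k, (r.col k).2 = true → (r.col k).1 = c) (hq : r.cnt = q) :
    ∃ κ : Profile C, Nonempty (sorted κ q c ⟶ r) := by
  classical
  have e : q = Fintype.card {k // (r.col k).2 = true} := by
    rw [Fintype.card_subtype]
    exact hq.symm
  obtain ⟨κ, f, _⟩ := exists_sorted h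
    ((finCongr e).trans (Fintype.equivFin {k // (r.col k).2 = true}).symm)
  exact ⟨κ, ⟨f⟩⟩

theorem sum_split {α α' β β' : Type*} (E : α ⊕ β ≃ α' ⊕ β')
    (h : ∀ s, (E s).isLeft = s.isLeft) :
    ∃ (e : α ≃ α') (e' : β ≃ β'), ∀ s, E s = Equiv.sumCongr e e' s := by
  have h' : ∀ s, (E.symm s).isLeft = s.isLeft := fun s => by rw [← h, Equiv.apply_symm_apply]
  have l : ∀ i, ∃ j, E (.inl i) = .inl j := fun i => Sum.isLeft_iff.1 (h (.inl i))
  have r : ∀ i, ∃ j, E (.inr i) = .inr j := fun i => by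
    have := h (.inr i)
    rcases hE : E (.inr i) with j | j
    · rw [hE] at this; cases this
    · exact ⟨j, rfl⟩
  have l' : ∀ i, ∃ j, E.symm (.inl i) = .inl j := fun i => Sum.isLeft_iff.1 (h' (.inl i))
  have r' : ∀ i, ∃ j, E.symm (.inr i) = .inr j := fun i => by
    have := h' (.inr i)
    rcases hE : E.symm (.inr i) with j | j
    · rw [hE] at this; cases this
    · exact ⟨j, rfl⟩
  choose f hf using l
  choose g hg using r
  choose f' hf' using l'
  choose g' hg' using r'
  refine ⟨⟨f, f', fun i => ?_, fun i => ?_⟩, ⟨g, g', fun i => ?_, fun i => ?_⟩, ?_⟩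
  · exact Sum.inl_injective (by rw [← hf', ← hf, Equiv.symm_apply_apply])
  · exact Sum.inl_injective (by rw [← hf, ← hf', Equiv.apply_symm_apply])
  · exact Sum.inr_injective (by rw [← hg', ← hg, Equiv.symm_apply_apply])
  · exact Sum.inr_injective (by rw [← hg, ← hg', Equiv.apply_symm_apply])
  · rintro (i | i)
    · exact hf i
    · exact hg i

/-- A permutation between sorted profiles preserves the two blocks. -/
theorem sorted_hom {κ κ' : Profile C} {q : ℕ} {c : C} (h : sorted κ q c ⟶ sorted κ' q c) :
    ∃ (g : κ ⟶ κ') (π : Equiv.Perm (Fin q)),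
      h = labAppMap g (Hom.mk π fun _ => rfl : rep q (c, true) ⟶ rep q (c, true)) := by
  obtain ⟨e, e', he⟩ := sum_split ((finSumFinEquiv (m := κ.len) (n := q)).trans
    (h.σ.trans (finSumFinEquiv (m := κ'.len) (n := q)).symm)) fun s => by
      have h1 := congrArg Prod.snd (h.col_σ (finSumFinEquiv s))
      have h2 : labSum (fun _ => true) (finSumFinEquiv.symm (h.σ (finSumFinEquiv s))) =
          labSum (fun _ => true) (finSumFinEquiv.symm (finSumFinEquiv s)) := h1
      rw [Equiv.symm_apply_apply] at h2
      change (finSumFinEquiv.symm (h.σ (finSumFinEquiv s))).isLeft = _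
      generalize finSumFinEquiv.symm (h.σ (finSumFinEquiv s)) = t at h2
      rcases t with i | i <;> rcases s with j | j <;> first | rfl | cases h2
  have hσ' : ∀ s, h.σ (finSumFinEquiv (m := κ.len) (n := q) s) =
      finSumFinEquiv (Equiv.sumCongr e e' s) := fun s =>
    (Equiv.symm_apply_eq _).1 (he s)
  have hσ : ∀ k, h.σ k = finSumFinEquiv (Equiv.sumCongr e e' (finSumFinEquiv.symm k)) := fun k =>
    (congrArg h.σ (finSumFinEquiv.apply_symm_apply k).symm).trans (hσ' _)
  refine ⟨Hom.mk e fun i => ?_, e', hom_ext hσ⟩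
  have h1 : Sum.elim κ'.col (fun _ => c) (finSumFinEquiv.symm (h.σ (finSumFinEquiv (.inl i)))) =
      Sum.elim κ.col (fun _ => c) (finSumFinEquiv.symm (finSumFinEquiv (.inl i))) :=
    congrArg Prod.fst (h.col_σ (finSumFinEquiv (.inl i)))
  have h2 := (congrArg (Sum.elim κ'.col (fun _ => c)) ((congrArg finSumFinEquiv.symm
    (hσ' (.inl i))).trans (finSumFinEquiv.symm_apply_apply _))).symm.trans h1
  exact h2.trans (congrArg (Sum.elim κ.col fun _ => c) (finSumFinEquiv.symm_apply_apply _))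

end Profile

/-! ### Tensor products over labelled profiles -/

section
variable {C : Type v} {M : Type u} [Category.{v} M] [MonoidalCategory M] [SymmetricCategory M]
open Profile

/-- The colored objects `A` and `Y`, as one object with colors in `C × Bool`. -/
abbrev twoObj (A Y : C → M) : C × Bool → M := fun p => side (A p.1) (Y p.1) p.2

variable (A Y : C → M)

/-- The isomorphism from `A^a ⊗ V^r` to the tensor product over the labelled profile `(a, r)`. -/
def labCat (a : Profile C) (r : Profile (C × Bool)) :
    pw A a ⊗ pw (twoObj A Y) r ⟶ pw (twoObj A Y) (labApp a r) :=
  catT fun s => twoObj A Y (Sum.elim a.col r.under.col s, labSum (fun j => (r.col j).2) s)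

instance labCat_isIso (a : Profile C) (r : Profile (C × Bool)) : IsIso (labCat A Y a r) :=
  can_isIso _ ((P_cat .leaf).comp (catNd a.len r.len))

theorem labCat_perm {a a' : Profile C} {r r' : Profile (C × Bool)} (f : a ⟶ a') (g : r ⟶ r') :
    (pwMap A f ⊗ₘ pwMap (twoObj A Y) g) ≫ labCat A Y a' r' =
      labCat A Y a r ≫ pwMap (twoObj A Y) (labAppMap f g) := by
  have e : ∀ s, (Sum.elim a.col r.under.col s, labSum (fun j => (r.col j).2) s) =
      (Sum.elim a'.col r'.under.col (Equiv.sumCongr f.σ g.σ s),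
        labSum (fun j => (r'.col j).2) (Equiv.sumCongr f.σ g.σ s)) := by
    rintro (i | j)
    · exact Prod.ext (f.col_σ i).symm rfl
    · exact (g.col_σ j).symm
  have h := catT_reindex (G' := fun s => twoObj A Y (Sum.elim a'.col r'.under.col s,
    labSum (fun j => (r'.col j).2) s)) f.σ g.σ fun s => eqToHom (congrArg (twoObj A Y) (e s))
  simp only [eqToHom_trans] at h
  exact h

/-- Maps `A ⟶ A'` and `Y ⟶ Y'`, as one map. -/
def twoMap {A Y A' Y' : C → M} (f : ∀ d, A d ⟶ A' d) (g : ∀ d, Y d ⟶ Y' d) :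
    ∀ p : C × Bool, twoObj A Y p ⟶ twoObj A' Y' p
  | (d, false) => f d
  | (d, true) => g d

theorem labCat_nat {A Y A' Y' : C → M} (f : ∀ d, A d ⟶ A' d) (g : ∀ d, Y d ⟶ Y' d)
    (a : Profile C) (r : Profile (C × Bool)) :
    (pwTrans f a ⊗ₘ pwTrans (twoMap f g) r) ≫ labCat A' Y' a r =
      labCat A Y a r ≫ pwTrans (twoMap f g) (labApp a r) :=
  catT_nat fun s => twoMap f g (Sum.elim a.col r.under.col s, labSum (fun j => (r.col j).2) s)

/-- The isomorphism from `W(κ, c, …, c) ⊗ (A^κ ⊗ Y_c ⊗ ⋯ ⊗ Y_c)` given by a sorting `f` of the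
labelled profile `r`. -/
def sortMap (W : (Profile C)ᵒᵖ ⥤ M) {r : Profile (C × Bool)} {κ : Profile C} {q : ℕ} {c : C}
    (f : sorted κ q c ⟶ r) :
    W.obj (op (κ.append (rep q c))) ⊗ (pw A κ ⊗ bigT q fun _ => Y c) ⟶
      W.obj (op r.under) ⊗ pw (twoObj A Y) r :=
  W.map (underMap (Groupoid.inv f)).op ⊗ₘ
    (labCat A Y κ (rep q (c, true)) ≫ pwMap (twoObj A Y) f)

theorem sortMap_comp_aux {A A' A'' B B0 B' B'' : M} {p : A ⟶ A'} {p' : A' ⟶ A''} {p'' : A ⟶ A''}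
    {l : B ⟶ B0} {m : B0 ⟶ B'} {m' : B' ⟶ B''} {m'' : B0 ⟶ B''} (h : p'' = p ≫ p')
    (h' : m'' = m ≫ m') : p'' ⊗ₘ (l ≫ m'') = (p ⊗ₘ (l ≫ m)) ≫ (p' ⊗ₘ m') := by
  rw [h, h', tensorHom_comp_tensorHom, Category.assoc]

theorem sortMap_comp (W : (Profile C)ᵒᵖ ⥤ M) {r r' : Profile (C × Bool)} {κ : Profile C} {q : ℕ}
    {c : C} (f : sorted κ q c ⟶ r) (g : r ⟶ r') :
    sortMap A Y W (f ≫ g) = sortMap A Y W f ≫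
      (W.map (underMap (Groupoid.inv g)).op ⊗ₘ pwMap (twoObj A Y) g) :=
  sortMap_comp_aux (W.map_comp (underMap (Groupoid.inv f)).op (underMap (Groupoid.inv g)).op)
    (pwMap_comp _ _ _)

instance pwMap_isIso {C : Type v} (X : C → M) {a b : Profile C} (f : a ⟶ b) : IsIso (pwMap X f) :=
  ⟨pwMap X (Groupoid.inv f), by rw [← pwMap_comp, Groupoid.comp_inv, pwMap_id],
    by rw [← pwMap_comp, Groupoid.inv_comp, pwMap_id]⟩

instance sortMap_isIso (W : (Profile C)ᵒᵖ ⥤ M) {r : Profile (C × Bool)} {κ : Profile C} {q : ℕ}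
    {c : C} (f : sorted κ q c ⟶ r) : IsIso (sortMap A Y W f) := by
  have h1 : IsIso (underMap (Groupoid.inv f)) := inferInstance
  have h2 : IsIso (W.map (underMap (Groupoid.inv f)).op) := inferInstance
  have h3 : IsIso (labCat A Y κ (rep q (c, true)) ≫ pwMap (twoObj A Y) f) := inferInstance
  exact @MonoidalCategory.tensor_isIso _ _ _ _ _ _ _ _ h2 _ h3

/-- If an entry labelled by `true` has a color other than `c`, its factor of `Y` is initial, and so
is the whole tensor product. -/
theorem isInitial_of_wrong_color [MonoidalClosed M] {Y : C → M} {c : C}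
    (hY : ∀ d, d ≠ c → Nonempty (IsInitial (Y d)))
    (W : (Profile C)ᵒᵖ ⥤ M) {r : Profile (C × Bool)}
    (hr : ¬ ∀ k, (r.col k).2 = true → (r.col k).1 = c) :
    Nonempty (IsInitial (W.obj (op r.under) ⊗ pw (twoObj A Y) r)) := by
  push Not at hr
  obtain ⟨k, h1, h2⟩ := hr
  have h3 : Nonempty (IsInitial (twoObj A Y (r.col k))) := by
    have : twoObj A Y (r.col k) = Y (r.col k).1 := by
      change side _ _ (r.col k).2 = _
      rw [h1]
      rfl
    rw [this]
    exact hY _ h2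
  exact isInitial_tensor_left (W.obj (op r.under))
    (isInitial_bigT (X := fun k => twoObj A Y (r.col k)) r.len k h3)

/-- Maps out of the tensor product over a labelled profile are determined by the sortings of the
profile: if there is none, then one of the factors is initial. -/
theorem sort_ext [MonoidalClosed M] {c : C} (hY : ∀ d, d ≠ c → Nonempty (IsInitial (Y d)))
    (W : (Profile C)ᵒᵖ ⥤ M) {r : Profile (C × Bool)} {q : ℕ} (hq : r.cnt = q) {Z : M}
    {φ φ' : W.obj (op r.under) ⊗ pw (twoObj A Y) r ⟶ Z}
    (h : ∀ (κ : Profile C) (f : sorted κ q c ⟶ r), sortMap A Y W f ≫ φ = sortMap A Y W f ≫ φ') :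
    φ = φ' := by
  by_cases hr : ∀ k, (r.col k).2 = true → (r.col k).1 = c
  · obtain ⟨κ, ⟨f⟩⟩ := exists_sorted' hr hq
    exact (cancel_epi (sortMap A Y W f)).1 (h κ f)
  · obtain ⟨i⟩ := isInitial_of_wrong_color A hY W hr
    exact i.hom_ext _ _

end

/-! ### The map to `O_A(d; c, …, c) ⊗ (Y ⊗ ⋯ ⊗ Y)` on labelled profiles -/

section
variable {C : Type v} {M : Type u} [Category.{v} M] [MonoidalCategory M] [SymmetricCategory M]
  [MonoidalClosed M] [HasColimits M]
open Profile

namespace Operad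
variable (O : Operad C M) (A : O.monad.Algebra)

theorem envι_map (d : C) (a : Profile C) {κ κ' : Profile C} (h : κ ⟶ κ') :
    O.envι A d a κ' ≫ (O.env A d).map h.op =
      ((O.obj d).map (appendMap (𝟙 a) h).op ▷ pw A.A a) ≫ O.envι A d a κ := by
  have h1 : coequalizer.π (O.env0 A d κ') (O.env1 A d κ') ≫ (O.env A d).map h.op =
      O.envTMap A.A d h ≫ coequalizer.π (O.env0 A d κ) (O.env1 A d κ) := coequalizer.π_desc _ _
  have h2 : tι (O.shift d κ') (pwF A.A) a ≫ O.envTMap A.A d h =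
      ((O.shiftMap d h).app (op a) ▷ pw A.A a) ≫ tι (O.shift d κ) (pwF A.A) a :=
    (tι_map _ _ a).trans (congrArg (fun z => z ≫ tι (O.shift d κ) (pwF A.A) a) (tensorHom_id _ _))
  refine (Category.assoc _ _ _).trans ((congrArg (fun z => _ ≫ z) h1).trans ?_)
  refine (Category.assoc _ _ _).symm.trans ((congrArg (fun z => z ≫ _) h2).trans ?_)
  exact Category.assoc _ _ _

theorem envι_w (d : C) {a a' : Profile C} (g : a ⟶ a') (κ : Profile C) :
    ((O.obj d).map (appendMap g (𝟙 κ)).op ▷ pw A.A a) ≫ O.envι A d a κ =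
      (_ ◁ pwMap A.A g) ≫ O.envι A d a' κ := by
  have h := tι_w (O.shift d κ) (pwF A.A) g
  exact (Category.assoc _ _ _).symm.trans ((congrArg (fun z => z ≫ _) h).trans
    (Category.assoc _ _ _))

theorem env_gen_aux {Z Z0 Z' x x' K K' P V : M} {p : Z' ⟶ Z} {f : Z0 ⟶ Z} {f' : Z' ⟶ Z0}
    {m : x ⟶ x'}
    {i : Z ⊗ x ⟶ K} {i' : Z' ⊗ x' ⟶ K'} {i0 : Z0 ⊗ x ⟶ K'} {e : K' ⟶ K} {s : P ⟶ P}
    {t : K ⊗ P ⟶ V} {t' : K' ⊗ P ⟶ V} (hp : p = f' ≫ f) (h1 : i0 ≫ e = (f ▷ x) ≫ i)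
    (h2 : (f' ▷ x) ≫ i0 = (Z' ◁ m) ≫ i') (h3 : (e ▷ P) ≫ t = (K' ◁ s) ≫ t') :
    ((p ▷ x) ▷ P) ≫ (i ▷ P) ≫ t = ((Z' ◁ m) ⊗ₘ s) ≫ (i' ▷ P) ≫ t' := by
  rw [hp, comp_whiskerRight, comp_whiskerRight, Category.assoc, ← comp_whiskerRight_assoc (f ▷ x),
    ← h1, comp_whiskerRight_assoc, h3, ← comp_whiskerRight_assoc, h2,
    MonoidalCategory.tensorHom_def, comp_whiskerRight_assoc, Category.assoc,
    ← whisker_exchange_assoc]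

/-- `(c, …, c)` with the action of a permutation. -/
abbrev repMap {t : ℕ} (π : Equiv.Perm (Fin t)) {D : Type v} (c : D) : rep t c ⟶ rep t c :=
  Hom.mk π fun _ => rfl

theorem envGen_perm (Y : M) (d : C) {a a' : Profile C} (g : a ⟶ a') {t : ℕ} (c : C)
    (π : Equiv.Perm (Fin t)) :
    (((O.obj d).map (appendMap g (repMap π c)).op ▷ pw A.A a) ▷ bigT t fun _ => Y) ≫
        O.envGen A Y d a t c =
      ((_ ◁ pwMap A.A g) ⊗ₘ permT π fun _ => Y) ≫ O.envGen A Y d a' t c := by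
  have h3 := tι_w (O.envRep A d t c) (powF Y t) (a := BSym.pt t) (b := BSym.pt t) π
  have e : appendMap g (repMap π c) = appendMap (𝟙 a) (repMap π c) ≫ appendMap g (𝟙 (rep t c)) := by
    rw [← appendMap_comp, Category.id_comp, Category.comp_id]
  have hp : (O.obj d).map (appendMap g (repMap π c)).op =
      (O.obj d).map (appendMap g (𝟙 _)).op ≫ (O.obj d).map (appendMap (𝟙 a) (repMap π c)).op := by
    rw [e, op_comp, Functor.map_comp]
  exact env_gen_aux hp (O.envι_map A d a (repMap π c)) (O.envι_w A d g (rep t c)) h3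


/-- `O_A(d; c, …, c) ⊗_{Σ_q} (Y_c ⊗ ⋯ ⊗ Y_c)`. -/
abbrev cell (Y : C → M) (d : C) (q : ℕ) (c : C) : M :=
  tensorOver (O.envRep A d q c) (powF (Y c) q)

theorem exists_labGen_aux {Z Z' x x' P P' V : M} {p : Z ⟶ Z'} {p' : Z' ⟶ Z} {m : x ⟶ x'}
    {s : P ⟶ P'} {φ : (Z ⊗ x) ⊗ P ⟶ V} {φ' : (Z' ⊗ x') ⊗ P' ⟶ V} (hp : p ≫ p' = 𝟙 Z)
    (h : ((p' ▷ x) ▷ P) ≫ φ = ((Z' ◁ m) ⊗ₘ s) ≫ φ') :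
    (p ⊗ₘ (m ⊗ₘ s)) ≫ (α_ _ _ _).inv ≫ φ' = (α_ _ _ _).inv ≫ φ := by
  have e : (p ⊗ₘ (m ⊗ₘ s)) ≫ (α_ _ _ _).inv =
      (α_ _ _ _).inv ≫ ((p ▷ x) ▷ P) ≫ ((Z' ◁ m) ⊗ₘ s) := by
    rw [associator_inv_naturality, ← tensorHom_id, ← tensorHom_id, ← id_tensorHom,
      tensorHom_comp_tensorHom, tensorHom_comp_tensorHom, Category.comp_id, Category.id_comp,
      Category.id_comp]
  rw [reassoc_of% e, ← h, ← comp_whiskerRight_assoc, ← comp_whiskerRight, hp, id_whiskerRight,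
    id_whiskerRight, Category.id_comp]

theorem sort_perm_aux {A A' A'' B B' D D' E : M} {p : A ⟶ A'} {p' : A' ⟶ A''} {p'' : A ⟶ A''}
    {l : B ⟶ D} {l' : B' ⟶ D'} {m : D ⟶ D'} {m' : D' ⟶ E} {m'' : D ⟶ E} {s : B ⟶ B'}
    (h : p'' = p ≫ p') (h' : m'' = m ≫ m') (h2 : s ≫ l' = l ≫ m) :
    p'' ⊗ₘ (l ≫ m'') = (p ⊗ₘ s) ≫ (p' ⊗ₘ (l' ≫ m')) := by
  rw [h, h', tensorHom_comp_tensorHom, reassoc_of% h2]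

/-- The generator on `r` is transported from any sorting; this does not depend on the sorting,
because two sortings differ by a permutation of `κ` and one of the factors `Y`, and both are divided
out in the target. -/
theorem exists_labGen {c : C} {Y : C → M} (hY : ∀ d, d ≠ c → Nonempty (IsInitial (Y d))) (d : C)
    (r : Profile (C × Bool)) (q : ℕ) (hq : r.cnt = q) :
    ∃ φ : (O.obj d).obj (op r.under) ⊗ pw (twoObj A.A Y) r ⟶ O.cell A Y d q c,
      ∀ (κ : Profile C) (f : sorted κ q c ⟶ r), sortMap A.A Y (O.obj d) f ≫ φ =
        (α_ _ _ _).inv ≫ O.envGen A (Y c) d κ q c := by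
  by_cases hr : Nonempty (Σ κ : Profile C, sorted κ q c ⟶ r)
  · obtain ⟨κ0, f0⟩ := hr
    refine ⟨inv (sortMap A.A Y (O.obj d) f0) ≫ (α_ _ _ _).inv ≫ O.envGen A (Y c) d κ0 q c,
      fun κ f => ?_⟩
    obtain ⟨g, π, h⟩ := sorted_hom (f ≫ Groupoid.inv f0)
    have hf : f = labAppMap g (repMap π (c, true)) ≫ f0 := by
      rw [← h, Category.assoc, Groupoid.inv_comp, Category.comp_id]
    have e1 : sortMap A.A Y (O.obj d) f =
        ((O.obj d).map (Groupoid.inv (appendMap g (repMap π c))).op ⊗ₘ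
          (pwMap A.A g ⊗ₘ permT π fun _ => Y c)) ≫ sortMap A.A Y (O.obj d) f0 := by
      rw [hf]
      refine sort_perm_aux ((O.obj d).map_comp (Groupoid.inv (appendMap g (repMap π c))).op
        (underMap (Groupoid.inv f0)).op) (pwMap_comp _ (labAppMap g (repMap π (c, true))) f0)
        (Eq.trans ?_ (labCat_perm A.A Y g (repMap π (c, true))))
      refine congrArg (fun z => (pwMap A.A g ⊗ₘ z) ≫ labCat A.A Y κ0 (rep q (c, true))) ?_
      exact ((congrArg (fun z => z ≫ permT π fun _ => Y c) (bigTMap_id q fun _ => Y c)).trans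
        (Category.id_comp _)).symm
    rw [e1, Category.assoc, IsIso.hom_inv_id_assoc]
    exact exists_labGen_aux (tensDiag_inv (O.obj d) (appendMap g (repMap π c))).1
      (O.envGen_perm A (Y c) d g c π)
  -- A profile that cannot be sorted has an initial tensor product.
  · refine ⟨?_, fun κ f => absurd ⟨⟨κ, f⟩⟩ hr⟩
    have h : ¬ ∀ k, (r.col k).2 = true → (r.col k).1 = c := fun h => hr (by
      obtain ⟨κ, ⟨f⟩⟩ := exists_sorted' h hq
      exact ⟨⟨κ, f⟩⟩)
    exact (isInitial_of_wrong_color A.A hY (O.obj d) h).some.to _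

/-- The generators of `O_A(d; c, …, c) ⊗_{Σ_q} (Y_c ⊗ ⋯ ⊗ Y_c)` in an arbitrary order: for a
labelled profile `r`, the factors of `A` are at the entries labelled by `false`, those of `Y` at
the entries labelled by `true`. -/
def labGen {c : C} {Y : C → M} (hY : ∀ d, d ≠ c → Nonempty (IsInitial (Y d))) (d : C)
    (r : Profile (C × Bool)) (q : ℕ) (hq : r.cnt = q) :
    (O.obj d).obj (op r.under) ⊗ pw (twoObj A.A Y) r ⟶ O.cell A Y d q c :=
  (O.exists_labGen A hY d r q hq).choose

variable {c : C} {Y : C → M} (hY : ∀ d, d ≠ c → Nonempty (IsInitial (Y d)))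

theorem sort_labGen (d : C) (r : Profile (C × Bool)) (q : ℕ) (hq : r.cnt = q) {κ : Profile C}
    (f : sorted κ q c ⟶ r) : sortMap A.A Y (O.obj d) f ≫ O.labGen A hY d r q hq =
      (α_ _ _ _).inv ≫ O.envGen A (Y c) d κ q c :=
  (O.exists_labGen A hY d r q hq).choose_spec κ f

theorem labGen_perm (d : C) {r r' : Profile (C × Bool)} (g : r ⟶ r') (q : ℕ) (hq : r.cnt = q)
    (hq' : r'.cnt = q) :
    ((O.obj d).map (underMap (Groupoid.inv g)).op ⊗ₘ pwMap (twoObj A.A Y) g) ≫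
      O.labGen A hY d r' q hq' = O.labGen A hY d r q hq :=
  sort_ext A.A Y hY (O.obj d) hq fun κ f => by
    rw [sort_labGen, ← Category.assoc, ← sortMap_comp, sort_labGen]

/-- On a labelled profile that is sorted, the generators are the usual ones. -/
theorem labGen_sorted (d : C) (κ : Profile C) (q : ℕ) (hq : (sorted κ q c).cnt = q) :
    ((O.obj d).obj (op (κ.append (rep q c))) ◁ labCat A.A Y κ (rep q (c, true))) ≫
      O.labGen A hY d (sorted κ q c) q hq = (α_ _ _ _).inv ≫ O.envGen A (Y c) d κ q c := by
  have h := O.sort_labGen A hY d (sorted κ q c) q hq (𝟙 _)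
  refine Eq.trans (congrArg (fun z => z ≫ O.labGen A hY d (sorted κ q c) q hq) ?_) h
  have e1 : (O.obj d).map (underMap (Groupoid.inv (𝟙 (sorted κ q c)))).op =
      𝟙 ((O.obj d).obj (op (κ.append (rep q c)))) := (O.obj d).map_id _
  have e2 : pwMap (twoObj A.A Y) (𝟙 (sorted κ q c)) = 𝟙 _ := pwMap_id _ _
  exact ((congrArg₂ (fun z z' => z ⊗ₘ (labCat A.A Y κ (rep q (c, true)) ≫ z')) e1 e2).trans
    ((congrArg (fun z => 𝟙 ((O.obj d).obj (op (κ.append (rep q c)))) ⊗ₘ z)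
      (Category.comp_id _)).trans (id_tensorHom _ _))).symm

end Operad
end

/-! ### Further associativity isomorphisms, and the relation that defines `O_A` -/

section
variable {C : Type v} {M : Type u} [Category.{v} M] [MonoidalCategory M] [SymmetricCategory M]
open Profile

/-- `((a, κ), r)` is `(a, (κ, r))`. -/
def Profile.labAssoc (a κ : Profile C) (r : Profile (C × Bool)) :
    labApp (a.append κ) r ⟶ labApp a (labApp κ r) :=
  Hom.mk (assocP a κ r.under).σ fun K => by
    refine Prod.ext ((assocP a κ r.under).col_σ K) ?_
    change labSum (fun w => labSum (fun j => (r.col j).2) (finSumFinEquiv.symm w))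
      (finSumFinEquiv.symm ((assocP a κ r.under).σ K)) = _
    refine (congrArg (labSum fun w => labSum (fun j => (r.col j).2) (finSumFinEquiv.symm w))
      (assocP_σ a κ r.under K)).trans ?_
    refine (elim_assocSum (fun _ => false) (fun _ => false) (fun j => (r.col j).2)
      (finSumFinEquiv.symm K)).trans ?_
    have key : ∀ s : Fin (a.append κ).len ⊕ Fin r.len,
        Sum.elim (fun w => Sum.elim (fun _ => false) (fun _ => false)
          ((finSumFinEquiv (m := a.len) (n := κ.len)).symm w)) (fun j => (r.col j).2) s =
        labSum (fun j => (r.col j).2) s := by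
      rintro (w | j)
      · change Sum.elim (fun _ => false) (fun _ => false)
          ((finSumFinEquiv (m := a.len) (n := κ.len)).symm w) = false
        rcases (finSumFinEquiv (m := a.len) (n := κ.len)).symm w with i | i <;> rfl
      · rfl
    exact key _

theorem labCat_assoc (A Y : C → M) (a κ : Profile C) (r : Profile (C × Bool)) :
    (pwCat A a κ ▷ pw (twoObj A Y) r) ≫ labCat A Y (a.append κ) r ≫
        pwMap (twoObj A Y) (labAssoc a κ r) =
      (α_ _ _ _).hom ≫ (pw A a ◁ labCat A Y κ r) ≫ labCat A Y a (labApp κ r) := by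
  let F : CatL a.len κ.len r.len → M
    | .inl i => A (a.col i)
    | .inr (.inl i) => A (κ.col i)
    | .inr (.inr j) => twoObj A Y (r.col j)
  have h1 : ∀ s, (catFst s).eval F = A (Sum.elim a.col κ.col s) := by rintro (i | j) <;> rfl
  have h2 : ∀ s, (catLeft s).eval F = twoObj A Y (Sum.elim (a.append κ).col r.under.col s,
      labSum (fun j => (r.col j).2) s) := by
    rintro (w | l)
    · exact h1 _
    · rfl
  have h3 : ∀ s, (catSnd (n := a.len) s).eval F = twoObj A Y (Sum.elim κ.col r.under.col s,
      labSum (fun j => (r.col j).2) s) := by rintro (i | j) <;> rfl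
  have h4 : ∀ s, (catRight s).eval F = twoObj A Y (Sum.elim a.col (labApp κ r).under.col s,
      labSum (fun j => ((labApp κ r).col j).2) s) := by
    rintro (w | l)
    · rfl
    · exact h3 _
  have c1 := IsCanE.right (Z := pw (twoObj A Y) r) (.node r.len fun l => .leaf (.inr (.inr l))) rfl
    (IsCanE.cat catFst h1)
  have c2 := IsCanE.cat catLeft h2
  have c5 := IsCanE.reindex (labAssoc a κ r).σ (t' := fun K => catLeft (finSumFinEquiv.symm K))
    (t := fun K => catRight (finSumFinEquiv.symm K))
    (fun K => (catL_assoc _).trans (congrArg catRight (assocP_σ a κ r.under K).symm))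
    (fun K => h2 _) (fun K => h4 _) fun K => congrArg (twoObj A Y) ((labAssoc a κ r).col_σ K).symm
  have d1 := IsCanE.assoc (F := F) (s := .node a.len fun i => .leaf (.inl i))
    (t := .node κ.len fun j => .leaf (.inr (.inl j)))
    (r := .node r.len fun l => .leaf (.inr (.inr l))) (X := pw A a) (Y := pw A κ)
    (Z := pw (twoObj A Y) r) rfl rfl rfl
  have d2 := IsCanE.left (Z := pw A a) (.node a.len fun i => .leaf (.inl i)) rfl
    (IsCanE.cat (F := F) catSnd h3)
  have d3 := IsCanE.cat (F := F) catRight h4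
  have l := c1.trans (c2.trans c5)
  exact l.eq (d1.trans (d2.trans d3)) (l.perm.symm.nd catL_nd)

theorem Profile.cnt_congr {r r' : Profile (C × Bool)} (f : r ⟶ r') : r.cnt = r'.cnt := by
  refine Finset.card_bij (fun k _ => f.σ k) ?_ ?_ ?_
  · intro k hk
    simp only [Finset.mem_filter, Finset.mem_univ, true_and] at hk ⊢
    rw [f.col_σ, hk]
  · intro k _ l _ h
    exact f.σ.injective h
  · intro k hk
    refine ⟨f.σ.symm k, ?_, f.σ.apply_symm_apply k⟩
    simp only [Finset.mem_filter, Finset.mem_univ, true_and] at hk ⊢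
    rw [← f.col_σ, Equiv.apply_symm_apply, hk]

theorem Profile.cnt_labApp (a : Profile C) (r : Profile (C × Bool)) : (labApp a r).cnt = r.cnt := by
  refine (Finset.card_bij (fun k _ => finSumFinEquiv (.inr k)) ?_ ?_ ?_).symm
  · intro k hk
    refine Finset.mem_filter.2 ⟨Finset.mem_univ _, Eq.trans ?_ (Finset.mem_filter.1 hk).2⟩
    exact congrArg (labSum fun j => (r.col j).2) (finSumFinEquiv.symm_apply_apply _)
  · intro k _ l _ h
    exact Sum.inr_injective (finSumFinEquiv.injective h)
  · intro k hk
    have hk : labSum (fun j => (r.col j).2) (finSumFinEquiv.symm k) = true :=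
      (Finset.mem_filter.1 hk).2
    rcases hs : (finSumFinEquiv (m := a.len) (n := r.len)).symm k with i | j
    · rw [hs] at hk
      cases hk
    · have hk' := (congrArg (labSum fun j => (r.col j).2) hs).symm.trans hk
      exact ⟨j, Finset.mem_filter.2 ⟨Finset.mem_univ _, hk'⟩, (Equiv.symm_apply_eq _).1 hs |>.symm⟩

theorem Profile.cnt_sorted (κ : Profile C) (q : ℕ) (c : C) : (sorted κ q c).cnt = q := by
  rw [cnt_labApp]
  exact (congrArg Finset.card (Finset.filter_true_of_mem fun k _ => rfl)).trans (Finset.card_fin q)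

end

section
variable {C : Type v} {M : Type u} [Category.{v} M] [MonoidalCategory M] [SymmetricCategory M]
  [MonoidalClosed M] [HasColimits M]
open Profile

namespace Operad
variable (O : Operad C M) (A : O.monad.Algebra)

theorem unit_act (c : C) : O.unit A.A c ≫ A.a c = 𝟙 (A.A c) := congrFun A.unit c

theorem envι_rel_aux {W S a κ a' κ' T T' V V' L L' : M} {t : S ⟶ a'} {u : κ ⟶ κ'} {f : a' ⟶ a}
    {f' : κ' ⟶ κ} {act : S ⟶ a} {c' : a' ⊗ κ' ⟶ T'} {c : a ⊗ κ ⟶ T} {g : T' ⟶ T}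
    {i' : W ⊗ T' ⟶ V'} {i : W ⊗ T ⟶ V} {e0 e1 : V' ⟶ V} {π : V ⟶ L} {ι : L' ⟶ V}
    {RHS : W ⊗ (S ⊗ κ) ⟶ L'}
    (hact : act = t ≫ f) (hu : u ≫ f' = 𝟙 κ) (hc : (f ⊗ₘ f') ≫ c = c' ≫ g)
    (h1 : i' ≫ e1 = (W ◁ g) ≫ i) (hπ : e0 ≫ π = e1 ≫ π)
    (h0 : (W ◁ (t ⊗ₘ u)) ≫ (W ◁ c') ≫ i' ≫ e0 = RHS ≫ ι) :
    (W ◁ (act ▷ κ)) ≫ (W ◁ c) ≫ i ≫ π = RHS ≫ ι ≫ π := by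
  have h0 := congrArg (fun z => z ≫ π) h0
  simp only [Category.assoc] at h0
  rw [← h0, hπ, reassoc_of% h1, ← MonoidalCategory.whiskerLeft_comp_assoc W c', ← hc,
    MonoidalCategory.whiskerLeft_comp_assoc, ← MonoidalCategory.whiskerLeft_comp_assoc W (t ⊗ₘ u),
    tensorHom_comp_tensorHom, hu, ← hact, tensorHom_id]

/-- The relation that defines `O_A(d; ρ)`, for operations `b` acting on a part of the elements. -/
theorem envι_rel (d : C) (a κ ρ : Profile C) (b : Fin a.len → Profile C) :
    ((O.obj d).obj (op ((a.append κ).append ρ)) ◁ ((bigTMap a.len fun i =>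
        tι (O.obj (a.col i)) (pwF A.A) (b i) ≫ A.a (a.col i)) ▷ pw A.A κ)) ≫
      (_ ◁ pwCat A.A a κ) ≫ O.envι A d (a.append κ) ρ =
    ((α_ _ _ _).inv ≫ (shufP _ _ A.A b ▷ pw A.A κ) ≫ (α_ _ _ _).hom) ≫
      (((_ ◁ O.padT b κ) ≫ O.shiftAct d ρ (a.append κ) (pad b κ) ≫
        (O.obj d).map (appendMap (Groupoid.inv (padIso b κ)) (𝟙 ρ)).op) ⊗ₘ
          pwCat A.A (concat b) κ) ≫ O.envι A d ((concat b).append κ) ρ := by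
  have h0 := (O.shiftRight d ρ).map_pad A.A a κ b
  have hact : (bigTMap a.len fun i => tι (O.obj (a.col i)) (pwF A.A) (b i) ≫ A.a (a.col i)) =
      bigTMap a.len (fun i => tι (O.obj (a.col i)) (pwF A.A) (b i)) ≫ pwTrans A.a a :=
    (bigTMap_comp _ _ _).symm
  have hu : pwTrans (O.unit A.A) κ ≫ pwTrans A.a κ = 𝟙 (pw A.A κ) :=
    (bigTMap_comp _ _ _).trans ((congrArg (bigTMap κ.len) (funext fun j =>
      O.unit_act A (κ.col j))).trans (bigTMap_id _ _))
  have hc := catT_nat fun s => A.a (Sum.elim a.col κ.col s)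
  have h1 := ι_circMap (O.shift d ρ) A.a (a.append κ)
  have hπ := coequalizer.condition (O.env0 A d ρ) (O.env1 A d ρ)
  have h := envι_rel_aux hact hu hc h1 hπ (h0.trans (Category.assoc _ _ _).symm)
  exact h.trans (Category.assoc _ _ _)

end Operad
end

/-! ### The relation of `O_A` on labelled profiles -/

section
variable {M : Type u} [Category.{v} M] [MonoidalCategory M]

theorem lab_nat_left {Z Z' S X X' a c c' V : M} {p : Z' ⟶ Z} {m : X' ⟶ X} {act : S ⟶ a}
    {l : a ⊗ X ⟶ c} {l' : a ⊗ X' ⟶ c'} {mm : c' ⟶ c} {φ : Z ⊗ c ⟶ V} {φ' : Z' ⊗ c' ⟶ V}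
    (hl : (𝟙 a ⊗ₘ m) ≫ l = l' ≫ mm) (hφ : (p ⊗ₘ mm) ≫ φ = φ') :
    (p ⊗ₘ (S ◁ m)) ≫ (Z ◁ (act ▷ X)) ≫ (Z ◁ l) ≫ φ = (Z' ◁ (act ▷ X')) ≫ (Z' ◁ l') ≫ φ' := by
  rw [← hφ, ← id_tensorHom Z, ← id_tensorHom Z, ← id_tensorHom Z', ← id_tensorHom Z',
    tensorHom_comp_tensorHom_assoc, tensorHom_comp_tensorHom_assoc, tensorHom_comp_tensorHom_assoc,
    tensorHom_comp_tensorHom_assoc, Category.comp_id, Category.comp_id, Category.id_comp,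
    Category.id_comp, Category.assoc, Category.assoc, ← hl, id_tensorHom,
    whisker_exchange_assoc]

theorem lab_nat_right {Z Z' S X X' B K L L' c c' V : M} {p : Z' ⟶ Z} {m : X' ⟶ X}
    {s : Z ⊗ S ⟶ (Z ⊗ B) ⊗ K} {s' : Z' ⊗ S ⟶ (Z' ⊗ B) ⊗ K} {t : Z ⊗ B ⟶ L} {t' : Z' ⊗ B ⟶ L'}
    {p2 : L' ⟶ L} {l : K ⊗ X ⟶ c} {l' : K ⊗ X' ⟶ c'} {mm : c' ⟶ c} {φ : L ⊗ c ⟶ V}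
    {φ' : L' ⊗ c' ⟶ V} (hs : (p ▷ S) ≫ s = s' ≫ ((p ▷ B) ▷ K)) (ht : (p ▷ B) ≫ t = t' ≫ p2)
    (hl : (𝟙 K ⊗ₘ m) ≫ l = l' ≫ mm) (hφ : (p2 ⊗ₘ mm) ≫ φ = φ') :
    (p ⊗ₘ (S ◁ m)) ≫ ((α_ _ _ _).inv ≫ (s ▷ X) ≫ (α_ _ _ _).hom) ≫ (t ⊗ₘ l) ≫ φ =
      ((α_ _ _ _).inv ≫ (s' ▷ X') ≫ (α_ _ _ _).hom) ≫ (t' ⊗ₘ l') ≫ φ' := by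
  rw [← hφ, tensorHom_comp_tensorHom_assoc, ← ht, ← hl]
  have e1 : (p ⊗ₘ (S ◁ m)) ≫ (α_ Z S X).inv = (α_ _ _ _).inv ≫ ((p ▷ S) ⊗ₘ m) := by
    rw [← id_tensorHom, associator_inv_naturality, tensorHom_id]
  have e2 : ((p ▷ B) ▷ K ⊗ₘ m) ≫ (α_ (Z ⊗ B) K X).hom = (α_ _ _ _).hom ≫ ((p ▷ B) ⊗ₘ (𝟙 K ⊗ₘ m)) :=
    by
    rw [← tensorHom_id, associator_naturality]
  have e3 : ((p ▷ S) ⊗ₘ m) ≫ (s ▷ X) = (s' ▷ X') ≫ ((p ▷ B) ▷ K ⊗ₘ m) := by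
    rw [← tensorHom_id s, ← tensorHom_id s', tensorHom_comp_tensorHom, tensorHom_comp_tensorHom, hs,
      Category.comp_id, Category.id_comp]
  simp only [Category.assoc]
  rw [reassoc_of% e1, reassoc_of% e3, reassoc_of% e2, tensorHom_comp_tensorHom_assoc]

theorem lab_assoc_aux {Z Z1 R P T a k D E V : M} {p : Z ⟶ Z1} {p' : Z1 ⟶ Z} (hp : p ≫ p' = 𝟙 Z)
    {l : k ⊗ P ⟶ R} {ca : a ⊗ R ⟶ E} {cA : a ⊗ k ⟶ T} {c1 : T ⊗ P ⟶ D} {m : D ⟶ E}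
    (hc : (cA ▷ P) ≫ c1 ≫ m = (α_ _ _ _).hom ≫ (a ◁ l) ≫ ca) {φ : Z ⊗ E ⟶ V}
    {ψ : Z1 ⊗ (T ⊗ P) ⟶ V} (hφ : (p' ⊗ₘ (c1 ≫ m)) ≫ φ = ψ) :
    (Z ◁ ((a ◁ l) ≫ ca)) ≫ φ = (p ⊗ₘ ((α_ _ _ _).inv ≫ (cA ▷ P))) ≫ ψ := by
  rw [← hφ, tensorHom_comp_tensorHom_assoc, hp, Category.assoc, hc, Iso.inv_hom_id_assoc,
    id_tensorHom]

theorem rel_sorted_aux {Z Z1 S k X P V B L L1 a Ab c cb T T' K : M} {act : S ⟶ a}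
    {l : k ⊗ P ⟶ X} {ca : a ⊗ X ⟶ c} {φa : Z ⊗ c ⟶ V} {p : Z ⟶ Z1} {cA : a ⊗ k ⟶ T}
    {ia : Z1 ⊗ T ⟶ K} {t : K ⊗ P ⟶ V} {s : Z ⊗ S ⟶ (Z ⊗ B) ⊗ Ab} {sh : Z ⊗ B ⟶ L}
    {lb : Ab ⊗ X ⟶ cb} {φb : L ⊗ cb ⟶ V} {pb : L ⟶ L1} {cB : Ab ⊗ k ⟶ T'} {ib : L1 ⊗ T' ⟶ K}
    {s1 : Z1 ⊗ S ⟶ (Z1 ⊗ B) ⊗ Ab} {act1 : Z1 ⊗ B ⟶ L1}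
    (hA : (Z ◁ ((a ◁ l) ≫ ca)) ≫ φa =
      (p ⊗ₘ ((α_ _ _ _).inv ≫ (cA ▷ P))) ≫ (α_ _ _ _).inv ≫ (ia ▷ P) ≫ t)
    (hB : (L ◁ ((Ab ◁ l) ≫ lb)) ≫ φb =
      (pb ⊗ₘ ((α_ _ _ _).inv ≫ (cB ▷ P))) ≫ (α_ _ _ _).inv ≫ (ib ▷ P) ≫ t)
    (hrel : (Z1 ◁ (act ▷ k)) ≫ (Z1 ◁ cA) ≫ ia =
      ((α_ _ _ _).inv ≫ (s1 ▷ k) ≫ (α_ _ _ _).hom) ≫ (act1 ⊗ₘ cB) ≫ ib)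
    (hp : (p ▷ B) ≫ act1 = sh ≫ pb) (hs : (p ▷ S) ≫ s1 = s ≫ ((p ▷ B) ▷ Ab)) :
    (Z ◁ (S ◁ l)) ≫ (Z ◁ (act ▷ X)) ≫ (Z ◁ ca) ≫ φa =
      (Z ◁ (S ◁ l)) ≫ ((α_ _ _ _).inv ≫ (s ▷ X) ≫ (α_ _ _ _).hom) ≫ (sh ⊗ₘ lb) ≫ φb := by
  have n : ∀ {U U1 S' T'' : M} (g : U ⟶ U1) (w : S' ⟶ T''),
      (g ⊗ₘ (w ▷ P)) ≫ (α_ U1 T'' P).inv = (α_ U S' P).inv ≫ ((g ⊗ₘ w) ▷ P) := by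
    intro U U1 S' T'' g w
    rw [← tensorHom_id, associator_inv_naturality, tensorHom_id]
  have hw : (p ⊗ₘ ((act ▷ k) ≫ cA)) ≫ ia =
      ((α_ _ _ _).inv ≫ (s ▷ k) ≫ (α_ _ _ _).hom) ≫ ((sh ≫ pb) ⊗ₘ cB) ≫ ib := by
    rw [MonoidalCategory.tensorHom_def, MonoidalCategory.whiskerLeft_comp, Category.assoc,
      Category.assoc, hrel, ← hp]
    simp only [Category.assoc]
    have e1 : p ▷ (S ⊗ k) ≫ (α_ Z1 S k).inv = (α_ _ _ _).inv ≫ ((p ▷ S) ▷ k) := by simp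
    have e2 : ((p ▷ B) ▷ Ab) ▷ k ≫ (α_ (Z1 ⊗ B) Ab k).hom =
      (α_ _ _ _).hom ≫ (p ▷ B) ▷ (Ab ⊗ k) := by simp
    rw [reassoc_of% e1, ← comp_whiskerRight_assoc, hs, comp_whiskerRight_assoc, reassoc_of% e2,
      ← tensorHom_id (p ▷ B), tensorHom_comp_tensorHom_assoc, Category.id_comp]
  have e1 : (Z ◁ (S ◁ l)) ≫ (Z ◁ (act ▷ X)) = (Z ◁ (act ▷ (k ⊗ P))) ≫ (Z ◁ (a ◁ l)) := by
    rw [← MonoidalCategory.whiskerLeft_comp, ← MonoidalCategory.whiskerLeft_comp, whisker_exchange]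
  have hL : (Z ◁ (S ◁ l)) ≫ (Z ◁ (act ▷ X)) ≫ (Z ◁ ca) ≫ φa =
      (Z ◁ (α_ S k P).inv) ≫ (α_ _ _ _).inv ≫ (((p ⊗ₘ ((act ▷ k) ≫ cA)) ≫ ia) ▷ P) ≫ t := by
    rw [reassoc_of% e1, ← MonoidalCategory.whiskerLeft_comp_assoc Z (a ◁ l), hA]
    have e2 : (Z ◁ (act ▷ (k ⊗ P))) ≫ (p ⊗ₘ ((α_ a k P).inv ≫ (cA ▷ P))) =
        (Z ◁ (α_ S k P).inv) ≫ (p ⊗ₘ (((act ▷ k) ≫ cA) ▷ P)) := by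
      rw [← id_tensorHom, ← id_tensorHom, tensorHom_comp_tensorHom, tensorHom_comp_tensorHom]
      simp
    rw [reassoc_of% e2, reassoc_of% (n p ((act ▷ k) ≫ cA)), comp_whiskerRight, Category.assoc]
  have e3 : (Z ◁ (S ◁ l)) ≫ (α_ Z S X).inv ≫ (s ▷ X) ≫ (α_ (Z ⊗ B) Ab X).hom ≫ (sh ⊗ₘ lb) =
      (α_ Z S (k ⊗ P)).inv ≫ (s ▷ (k ⊗ P)) ≫ (α_ _ _ _).hom ≫ (sh ▷ _) ≫
        (L ◁ ((Ab ◁ l) ≫ lb)) := by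
    rw [MonoidalCategory.tensorHom_def, MonoidalCategory.whiskerLeft_comp,
      ← whisker_exchange_assoc, ← associator_naturality_right_assoc, ← whisker_exchange_assoc,
      associator_inv_naturality_right_assoc]
  have e4 : (sh ▷ (Ab ⊗ (k ⊗ P))) ≫ (pb ⊗ₘ ((α_ Ab k P).inv ≫ (cB ▷ P))) ≫ (α_ _ _ _).inv =
      ((Z ⊗ B) ◁ (α_ Ab k P).inv) ≫ (α_ _ _ _).inv ≫ (((sh ≫ pb) ⊗ₘ cB) ▷ P) := by
    rw [← n, ← tensorHom_id, ← id_tensorHom, tensorHom_comp_tensorHom_assoc,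
      tensorHom_comp_tensorHom_assoc, Category.id_comp, Category.id_comp]
  rw [hL, hw]
  simp only [Category.assoc]
  rw [reassoc_of% e3, hB, reassoc_of% e4]
  simp only [comp_whiskerRight, Category.assoc]
  monoidal

end

section
variable {C : Type v} {M : Type u} [Category.{v} M] [MonoidalCategory M] [SymmetricCategory M]
open Profile

/-- The functor `r ↦ W(a, r) ⊗ S`. -/
def appTensor (W : (Profile C)ᵒᵖ ⥤ M) (a : Profile C) (S : M) : (Profile C)ᵒᵖ ⥤ M where
  obj r := W.obj (op (a.append r.unop)) ⊗ S
  map h := W.map (appendMap (𝟙 a) h.unop).op ▷ S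
  map_id r := (congrArg (fun z => z ▷ S) ((op_congr W (appendMap_id a r.unop)).trans
    (W.map_id _))).trans (id_whiskerRight _ _)
  map_comp f g := by
    rw [← comp_whiskerRight, ← W.map_comp, ← op_comp, ← appendMap_comp, Category.comp_id]
    rfl

theorem sort_ext_left_aux {Z S X Z' X' P V : M} {p : Z' ⟶ Z} {l : P ⟶ X'} {m : X' ⟶ X}
    {φ φ' : Z ⊗ (S ⊗ X) ⟶ V}
    (h : (Z' ◁ (S ◁ l)) ≫ (p ⊗ₘ (S ◁ m)) ≫ φ = (Z' ◁ (S ◁ l)) ≫ (p ⊗ₘ (S ◁ m)) ≫ φ') :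
    ((p ▷ S) ⊗ₘ (l ≫ m)) ≫ (α_ _ _ _).hom ≫ φ = ((p ▷ S) ⊗ₘ (l ≫ m)) ≫ (α_ _ _ _).hom ≫ φ' := by
  have e : ((p ▷ S) ⊗ₘ (l ≫ m)) ≫ (α_ _ _ _).hom =
      (α_ _ _ _).hom ≫ (Z' ◁ (S ◁ l)) ≫ (p ⊗ₘ (S ◁ m)) := by
    rw [← tensorHom_id, associator_naturality, ← id_tensorHom Z', tensorHom_comp_tensorHom,
      Category.id_comp, id_tensorHom, MonoidalCategory.whiskerLeft_comp]
  rw [← Category.assoc, ← Category.assoc, e]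
  simp only [Category.assoc]
  rw [h]

/-- Maps out of `W(a, r) ⊗ (S ⊗ V^r)` are determined by the sortings of the labelled profile
`r`. -/
theorem sort_ext_left [MonoidalClosed M] (A : C → M) {Y : C → M} {c : C}
    (hY : ∀ d, d ≠ c → Nonempty (IsInitial (Y d))) (W : (Profile C)ᵒᵖ ⥤ M) (a : Profile C) (S : M)
    {r : Profile (C × Bool)} {q : ℕ} (hq : r.cnt = q) {Z : M}
    {φ φ' : W.obj (op (a.append r.under)) ⊗ (S ⊗ pw (twoObj A Y) r) ⟶ Z}
    (h : ∀ (κ : Profile C) (f : sorted κ q c ⟶ r),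
      (_ ◁ (S ◁ labCat A Y κ (rep q (c, true)))) ≫
        (W.map (appendMap (𝟙 a) (underMap (Groupoid.inv f))).op ⊗ₘ
          (S ◁ pwMap (twoObj A Y) f)) ≫ φ =
      (_ ◁ (S ◁ labCat A Y κ (rep q (c, true)))) ≫
        (W.map (appendMap (𝟙 a) (underMap (Groupoid.inv f))).op ⊗ₘ
          (S ◁ pwMap (twoObj A Y) f)) ≫ φ') : φ = φ' := by
  have h' : (α_ _ _ _).hom ≫ φ = (α_ _ _ _).hom ≫ φ' :=
    sort_ext A Y hY (appTensor W a S) hq fun κ f => sort_ext_left_aux (h κ f)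
  exact (cancel_epi (α_ _ _ _).hom).1 h'

end

section
variable {C : Type v} {M : Type u} [Category.{v} M] [MonoidalCategory M] [SymmetricCategory M]
  [MonoidalClosed M] [HasColimits M]
open Profile
namespace Operad
variable (O : Operad C M) (A : O.monad.Algebra)
variable {c : C} {Y : C → M} (hY : ∀ d, d ≠ c → Nonempty (IsInitial (Y d)))

/-- The generator on `(a, (κ, c, …, c))`, where `(κ, c, …, c)` is sorted, is the one on
`((a, κ), c, …, c)`. -/
theorem labGen_assoc (d : C) (a κ : Profile C) (q : ℕ)
    (hq : (labApp a (sorted κ q c)).cnt = q) :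
    ((O.obj d).obj (op (a.append (κ.append (rep q c)))) ◁
      ((pw A.A a ◁ labCat A.A Y κ (rep q (c, true))) ≫ labCat A.A Y a (sorted κ q c))) ≫
        O.labGen A hY d (labApp a (sorted κ q c)) q hq =
    ((O.obj d).map (assocP a κ (rep q c)).op ⊗ₘ
      ((α_ _ _ _).inv ≫ (pwCat A.A a κ ▷ bigT q fun _ => Y c))) ≫ (α_ _ _ _).inv ≫
        (O.envι A d (a.append κ) (rep q c) ▷ bigT q fun _ => Y c) ≫
          tι (O.envRep A d q c) (powF (Y c) q) (BSym.pt q) :=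
  lab_assoc_aux (tensDiag_inv (O.obj d) (assocP a κ (rep q c))).2
    (labCat_assoc A.A Y a κ (rep q (c, true)))
    (O.sort_labGen A hY d (labApp a (sorted κ q c)) q hq (labAssoc a κ (rep q (c, true))))

theorem labCat_perm_right (A Y : C → M) (a : Profile C) {r r' : Profile (C × Bool)} (g : r ⟶ r') :
    (𝟙 (pw A a) ⊗ₘ pwMap (twoObj A Y) g) ≫ labCat A Y a r' =
      labCat A Y a r ≫ pwMap (twoObj A Y) (labAppMap (𝟙 a) g) := by
  rw [← labCat_perm, pwMap_id]

/-- The relation that defines `O_A`, in terms of labelled profiles: operations `b` that act on a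
part of the elements of `A` may be composed with the operation. -/
theorem labGen_rel (d : C) (a : Profile C) (b : Fin a.len → Profile C) (r : Profile (C × Bool))
    (q : ℕ) (hr : r.cnt = q) (hq : (labApp a r).cnt = q) (hq' : (labApp (concat b) r).cnt = q) :
    ((O.obj d).obj (op (a.append r.under)) ◁ ((bigTMap a.len fun i =>
        tι (O.obj (a.col i)) (pwF A.A) (b i) ≫ A.a (a.col i)) ▷ pw (twoObj A.A Y) r)) ≫
      (_ ◁ labCat A.A Y a r) ≫ O.labGen A hY d (labApp a r) q hq =
    ((α_ _ _ _).inv ≫ (shufP _ _ A.A b ▷ pw (twoObj A.A Y) r) ≫ (α_ _ _ _).hom) ≫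
      (O.shiftAct d r.under a b ⊗ₘ labCat A.A Y (concat b) r) ≫
        O.labGen A hY d (labApp (concat b) r) q hq' := by
  -- Both sides are natural in `r`, so `r` may be assumed to be sorted; then this is `envι_rel`.
  refine sort_ext_left A.A hY (O.obj d) a _ hr fun κ f => ?_
  have hs : (sorted κ q c).cnt = q := cnt_sorted κ q c
  have e1 := lab_nat_left
    (p := (O.obj d).map (appendMap (𝟙 a) (underMap (Groupoid.inv f))).op)
    (act := bigTMap a.len fun i => tι (O.obj (a.col i)) (pwF A.A) (b i) ≫ A.a (a.col i))
    (labCat_perm_right A.A Y a f)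
    (O.labGen_perm A hY d (labAppMap (𝟙 a) f) q ((cnt_labApp a _).trans hs) hq)
  have e2 := lab_nat_right (shufP_left _ A.A
      ((O.obj d).map (appendMap (𝟙 a) (underMap (Groupoid.inv f))).op))
    (O.shiftMap_act d (underMap (Groupoid.inv f)) a b) (labCat_perm_right A.A Y (concat b) f)
    (O.labGen_perm A hY d (labAppMap (𝟙 (concat b)) f) q ((cnt_labApp (concat b) _).trans hs) hq')
  refine (congrArg (fun z => (_ ◁ (_ ◁ labCat A.A Y κ (rep q (c, true)))) ≫ z) e1).trans
    (Eq.trans ?_ (congrArg (fun z => (_ ◁ (_ ◁ labCat A.A Y κ (rep q (c, true)))) ≫ z) e2.symm))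
  exact rel_sorted_aux (O.labGen_assoc A hY d a κ q _) (O.labGen_assoc A hY d (concat b) κ q _)
    (O.envι_rel A d a κ (rep q c) b) (O.shiftAct_assoc d a κ (rep q c) b) (shufP_left _ A.A _)

end Operad
end

/-! ### Moving the first factor `Y` to the factors `A` -/

section
variable {M : Type u} [Category.{v} M] [MonoidalCategory M] [SymmetricCategory M]
variable {ι : Type w} {F : ι → M}

theorem norm_cons_aux {A A' B B' B'' Z : M} (f : A ⟶ A') (g : B ⟶ B') (h : B' ⟶ B'')
    (k : A' ⊗ B'' ⟶ Z) : (f ⊗ₘ (g ≫ h)) ≫ k = (f ⊗ₘ g) ≫ (A' ◁ h) ≫ k := by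
  rw [← id_tensorHom, tensorHom_comp_tensorHom_assoc, Category.comp_id]

theorem IsCan.cons {n : ℕ} (t : Fin (n + 1) → Tree ι) :
    IsCan F (.pair (t 0) (.node n fun k => t k.succ)) (.node (n + 1) t)
      (𝟙 (bigT (n + 1) fun k => (t k).eval F)) := by
  refine ⟨List.Perm.refl _, fun h => ?_⟩
  refine Eq.symm ((can_eq F h (.refl _)).trans ?_)
  have e : ((Tree.pair (t 0) (.node n fun k => t k.succ)).norm F).hom =
      ((Tree.node (n + 1) t).norm F).hom := norm_cons_aux _ _ _ _
  rw [e]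
  refine (congrArg (fun z => _ ≫ z ≫ _) (PermCert.refl_hom F _)).trans ?_
  exact (congrArg (fun z => _ ≫ z) (Category.id_comp _)).trans (Iso.hom_inv_id _)

end

section
variable {C : Type v} {M : Type u} [Category.{v} M] [MonoidalCategory M] [SymmetricCategory M]
open Profile

/-- The profile `(c, …, c)` whose first entry is labelled by `b`, the others by `true`. -/
abbrev Profile.headLab (q : ℕ) (c : C) (b : Bool) : Profile (C × Bool) :=
  ⟨q + 1, fun k => (c, (Fin.cons b fun _ => true : Fin (q + 1) → Bool) k)⟩

theorem elim_cons {n q : ℕ} (h : n + 1 + q = n + (q + 1)) {α : Type*} (f : Fin n → α)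
    (x : α) (g : Fin q → α) (k : Fin (n + 1 + q)) :
    Sum.elim (Sum.elim f (fun _ : Fin 1 => x) ∘ finSumFinEquiv.symm) g
        (finSumFinEquiv.symm k) =
      Sum.elim f (Fin.cons x g : Fin (q + 1) → α) (finSumFinEquiv.symm (finCongr h k)) := by
  obtain ⟨s, rfl⟩ := finSumFinEquiv.surjective k
  rw [Equiv.symm_apply_apply]
  rcases s with w | j
  · obtain ⟨s, rfl⟩ := finSumFinEquiv.surjective w
    rcases s with i | j
    · have e : finCongr h (finSumFinEquiv (.inl (finSumFinEquiv (.inl i)))) =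
          finSumFinEquiv (.inl i) := Fin.ext rfl
      rw [e]
      simp
    · obtain rfl := Subsingleton.elim (α := Fin 1) j 0
      have e : finCongr h (finSumFinEquiv (.inl (finSumFinEquiv (.inr 0)))) =
          finSumFinEquiv (.inr 0) := Fin.ext rfl
      rw [e]
      simp
  · have e : finCongr h (finSumFinEquiv (.inr j)) = finSumFinEquiv (.inr j.succ) := Fin.ext (by
      change n + 1 + j.1 = n + (j.1 + 1)
      omega)
    rw [e]
    simp

theorem Profile.labSum_append (κ : Profile C) (q : ℕ) (s : Fin (κ.len + 1) ⊕ Fin q) :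
    labSum (fun _ => true) s = Sum.elim (Sum.elim (fun _ : Fin κ.len => false)
      (fun _ : Fin 1 => false) ∘ finSumFinEquiv.symm) (fun _ => true) s := by
  rcases s with w | j
  · obtain ⟨s, rfl⟩ := finSumFinEquiv.surjective w
    rcases s with i | j <;> simp [labSum]
  · rfl

/-- The profiles `((a, c), (c, …, c))` and `(a, (c, c, …, c))` are the same, with labels. -/
def Profile.shiftLab (κ : Profile C) (q : ℕ) (c : C) :
    sorted (κ.append (single c)) q c ⟶ labApp κ (headLab q c false) :=
  Hom.mk (shiftRep κ q c).σ fun k => by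
    refine Prod.ext ((shiftRep κ q c).col_σ k) ?_
    refine (elim_cons (by omega) (fun _ => false) false (fun _ => true) k).symm.trans ?_
    exact (labSum_append κ q _).symm

/-- The tensor product over `((a, c), (c, …, c))` is the one over `(a, (c, c, …, c))` with the first
`c` labelled by `false`. -/
theorem labCat_shift (A Y : C → M) (κ : Profile C) (q : ℕ) (c : C) :
    (((pw A κ ◁ (ρ_ (A c)).inv) ≫ pwCat A κ (single c)) ▷ bigT q fun _ => Y c) ≫
        labCat A Y (κ.append (single c)) (rep q (c, true)) ≫
        pwMap (twoObj A Y) (shiftLab κ q c) =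
      (α_ _ _ _).hom ≫ labCat A Y κ (headLab q c false) := by
  let F : CatL κ.len 1 q → M
    | .inl i => A (κ.col i)
    | .inr (.inl _) => A c
    | .inr (.inr _) => Y c
  let T4 : Fin κ.len ⊕ Fin (q + 1) → Tree (CatL κ.len 1 q) :=
    Sum.elim (fun i => .leaf (.inl i))
      (Fin.cons (.leaf (.inr (.inl 0))) fun j => .leaf (.inr (.inr j)))
  have h1 : ∀ s, (catFst s).eval F = A (Sum.elim κ.col (single c).col s) := by rintro (i | j)
    <;> rfl
  have h2 : ∀ s, (catLeft s).eval F = twoObj A Y (Sum.elim (κ.append (single c)).col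
      (fun _ => c) s, labSum (fun _ => true) s) := by
    rintro (w | l)
    · exact h1 _
    · rfl
  have h4 : ∀ s, (T4 s).eval F = twoObj A Y (Sum.elim κ.col (headLab q c false).under.col s,
      labSum (fun j => ((headLab q c false).col j).2) s) := by
    rintro (w | l)
    · rfl
    · exact Fin.cases rfl (fun _ => rfl) l
  have hk : ∀ s : Fin (κ.len + 1) ⊕ Fin q, (catLeft s : Tree (CatL κ.len 1 q)) =
      Sum.elim (Sum.elim (fun i => .leaf (.inl i)) (fun _ : Fin 1 => .leaf (.inr (.inl 0))) ∘
        finSumFinEquiv.symm) (fun j => .leaf (.inr (.inr j))) s := by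
    rintro (w | j)
    · obtain ⟨s, rfl⟩ := finSumFinEquiv.surjective w
      rcases s with i | j
      · simp [catLeft, catFst]
      · obtain rfl := Subsingleton.elim (α := Fin 1) j 0
        simp [catLeft, catFst]
    · rfl
  have c0 : IsCanE F (.leaf (.inr (.inl 0))) (.node 1 fun _ => .leaf (.inr (.inl 0)))
    (ρ_ (A c)).inv := (IsCan.rho' (F := F) (.leaf (.inr (.inl 0)))).toE
  have hs : (fun j : Fin 1 => (.leaf (.inr (.inl j)) : Tree (CatL κ.len 1 q))) =
    fun _ => .leaf (.inr (.inl 0)) := funext fun j => by rw [Subsingleton.elim j 0]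
  have c1 := IsCanE.cat catFst h1
  change IsCanE F (.pair (.node κ.len fun i => .leaf (.inl i))
    (.node 1 fun j => .leaf (.inr (.inl j)))) _ _ at c1
  rw [hs] at c1
  have c2 := ((c0.left (Z := pw A κ) (.node κ.len fun i => .leaf (.inl i)) rfl).trans c1).right
    (Z := bigT q fun _ => Y c) (.node q fun l => .leaf (.inr (.inr l))) rfl
  have c3 := IsCanE.cat catLeft h2
  have c5 := IsCanE.reindex (shiftLab κ q c).σ (t' := fun K => catLeft (finSumFinEquiv.symm K))
    (t := fun K => T4 (finSumFinEquiv.symm K))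
    (fun K => (hk _).trans (elim_cons (by omega) _ _ _ K))
    (fun K => h2 _) (fun K => h4 _) fun K => congrArg (twoObj A Y) ((shiftLab κ q c).col_σ K).symm
  have d1 := IsCanE.assoc (F := F) (s := .node κ.len fun i => .leaf (.inl i))
    (t := .leaf (.inr (.inl 0))) (r := .node q fun l => .leaf (.inr (.inr l))) (X := pw A κ)
    (Y := A c) (Z := bigT q fun _ => Y c) rfl rfl rfl
  have d2 : IsCanE F (.pair (.node κ.len fun i => .leaf (.inl i)) (.pair (.leaf (.inr (.inl 0)))
      (.node q fun l => .leaf (.inr (.inr l))))) (.pair (.node κ.len fun i => .leaf (.inl i))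
      (.node (q + 1) fun j => T4 (.inr j))) (𝟙 (pw A κ ⊗ (A c ⊗ bigT q fun _ => Y c))) := by
    have := (IsCan.cons (F := F) fun j => T4 (.inr j)).toE.left (Z := pw A κ)
      (.node κ.len fun i => .leaf (.inl i)) rfl
    have e : pw A κ ◁ 𝟙 (bigT (q + 1) fun j => (T4 (.inr j)).eval F) = 𝟙 _ :=
      MonoidalCategory.whiskerLeft_id _ _
    exact (congrArg (IsCanE F _ _) e).mp this
  have d3 := IsCanE.cat (F := F) T4 h4
  have l := c2.trans (c3.trans c5)
  refine (l.eq (d1.trans (d2.trans d3)) ?_).trans (congrArg (fun z => _ ≫ z) (Category.id_comp _))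
  refine (c3.trans c5).perm.symm.nd ?_
  refine (c1.right (Z := bigT q fun _ => Y c) (.node q fun l => .leaf (.inr (.inr l)))
    rfl).perm.symm.nd ?_
  rw [← hs]
  exact catL_nd

end

/-! ### Tensor products with factors from `A`, `X` and `Y` -/

section
variable {C : Type v} {M : Type u} [Category.{v} M] [MonoidalCategory M] [SymmetricCategory M]
open Profile

/-- The colored objects `A`, `Y` and `X`, as one object: `A` and `Y` have the labels `some false`
and `some true`, and `X` has the label `none`. -/
def triObj (A X Y : C → M) : C × Option Bool → M
  | (d, none) => X d
  | (d, some b) => side (A d) (Y d) b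

variable {A X Y : C → M} (f : ∀ d, X d ⟶ A d) (i : ∀ d, X d ⟶ Y d)

/-- The map that changes the label `none` to another one. -/
def triMap (d : C) : (m m' : Option Bool) → (m = none ∨ m = m') →
    (triObj A X Y (d, m) ⟶ triObj A X Y (d, m'))
  | none, none, _ => 𝟙 (X d)
  | none, some false, _ => f d
  | none, some true, _ => i d
  | some _, _, h => eqToHom (congrArg (fun m => triObj A X Y (d, m)) (h.resolve_left nofun))

theorem triMap_comp (d : C) (m m' : Option Bool) (b : Bool) (h : m = none ∨ m = m')
    (h' : m' = none ∨ m' = some b) (h'' : m = none ∨ m = some b) :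
    triMap f i d m m' h ≫ triMap f i d m' (some b) h' = triMap f i d m (some b) h'' := by
  rcases m with _ | a
  · rcases m' with _ | b'
    · exact Category.id_comp _
    · obtain rfl : b' = b := Option.some.inj (h'.resolve_left nofun)
      exact Category.comp_id _
  · obtain rfl : some a = m' := h.resolve_left nofun
    exact Category.id_comp _

theorem triMap_cast {d d' : C} {m m' : Option Bool} {l l' : Option Bool} (e : (d, m) = (d', m'))
    (e' : (d, l) = (d', l')) (h : m = none ∨ m = l) (h' : m' = none ∨ m' = l') :
    eqToHom (congrArg (triObj A X Y) e) ≫ triMap f i d' m' l' h' =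
      triMap f i d m l h ≫ eqToHom (congrArg (triObj A X Y) e') := by
  cases e
  cases e'
  exact (Category.id_comp _).trans (Category.comp_id _).symm

/-- The tensor product over a profile labelled in `Option Bool`. -/
abbrev triT (A X Y : C → M) (ρ : Profile C) (m : Fin ρ.len → Option Bool) : M :=
  bigT ρ.len fun k => triObj A X Y (ρ.col k, m k)

/-- The map of tensor products over a profile that changes labels `none`. -/
abbrev triTMap (ρ : Profile C) (m m' : Fin ρ.len → Option Bool)
    (h : ∀ k, m k = none ∨ m k = m' k) : triT A X Y ρ m ⟶ triT A X Y ρ m' :=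
  bigTMap ρ.len fun k => triMap f i (ρ.col k) (m k) (m' k) (h k)

/-- A profile with labels. -/
abbrev Profile.lab (ρ : Profile C) (l : Fin ρ.len → Bool) : Profile (C × Bool) :=
  ⟨ρ.len, fun k => (ρ.col k, l k)⟩

/-- The labels of `(κ, c, c, …, c)` with the factor `X` at the first `c`. -/
abbrev headOpt {n q : ℕ} : Fin n ⊕ Fin (q + 1) → Option Bool :=
  Sum.elim (fun _ => some false) (Fin.cons none fun _ => some true)

variable (A X Y) in
/-- The isomorphism from `A^κ ⊗ (X_c ⊗ (Y_c ⊗ ⋯ ⊗ Y_c))` to a tensor product in another order. -/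
def triSort {κ ρ : Profile C} {q : ℕ} {c : C} {m : Fin ρ.len → Option Bool}
    (g : (⟨κ.len + (q + 1), fun k => (Sum.elim κ.col (fun _ => c) (finSumFinEquiv.symm k),
      headOpt (finSumFinEquiv.symm k))⟩ : Profile (C × Option Bool)) ⟶
        ⟨ρ.len, fun k => (ρ.col k, m k)⟩) :
    pw A κ ⊗ (X c ⊗ bigT q fun _ => Y c) ⟶ triT A X Y ρ m :=
  catT (fun s : Fin κ.len ⊕ Fin (q + 1) => triObj A X Y (Sum.elim κ.col (fun _ => c) s, headOpt s))
    ≫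
    pwMap (triObj A X Y) g

instance triSort_isIso {κ ρ : Profile C} {q : ℕ} {c : C} {m : Fin ρ.len → Option Bool}
    (g : (⟨κ.len + (q + 1), fun k => (Sum.elim κ.col (fun _ => c) (finSumFinEquiv.symm k),
      headOpt (finSumFinEquiv.symm k))⟩ : Profile (C × Option Bool)) ⟶
        ⟨ρ.len, fun k => (ρ.col k, m k)⟩) : IsIso (triSort A X Y g) := by
  have h1 : IsIso (catT (fun s => triObj A X Y (Sum.elim κ.col (fun _ => c) s,
    (headOpt s : Option Bool)) : Fin κ.len ⊕ Fin (q + 1) → M)) :=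
    can_isIso _ ((P_cat .leaf).comp (catNd _ _))
  exact IsIso.comp_isIso' h1 inferInstance

/-- Changing the label of the factor `X` commutes with sorting. -/
theorem triSort_map {κ ρ : Profile C} {q : ℕ} {c : C} {m : Fin ρ.len → Option Bool}
    (g : (⟨κ.len + (q + 1), fun k => (Sum.elim κ.col (fun _ => c) (finSumFinEquiv.symm k),
      headOpt (finSumFinEquiv.symm k))⟩ : Profile (C × Option Bool)) ⟶
        ⟨ρ.len, fun k => (ρ.col k, m k)⟩) (l : Fin ρ.len → Bool)
    (h : ∀ k, m k = none ∨ m k = some (l k)) (b : Fin (q + 1) → Bool)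
    (hb : ∀ j, (headOpt (n := κ.len) (.inr j) : Option Bool) = none ∨
      (headOpt (n := κ.len) (.inr j) : Option Bool) = some (b j))
    (g' : labApp κ ⟨q + 1, fun k => (c, b k)⟩ ⟶ ρ.lab l) (hg : g'.σ = g.σ) :
    triSort A X Y g ≫ triTMap f i ρ m (fun k => some (l k)) h =
      (pw A κ ◁ bigTMap (q + 1) fun j => triMap f i c (headOpt (n := κ.len) (.inr j))
        (some (b j)) (hb j)) ≫ labCat A Y κ ⟨q + 1, fun k => (c, b k)⟩ ≫
          pwMap (twoObj A Y) g' := by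
  have hs : ∀ s : Fin κ.len ⊕ Fin (q + 1), (headOpt s : Option Bool) = none ∨
      (headOpt s : Option Bool) = some (labSum b s) := by
    rintro (k | j)
    · exact .inr rfl
    · exact hb j
  have h1 := catT_nat fun s : Fin κ.len ⊕ Fin (q + 1) =>
    triMap f i (Sum.elim κ.col (fun _ => c) s) (headOpt s) (some (labSum b s)) (hs s)
  have h0 : (bigTMap κ.len fun k => triMap f i (κ.col k) (some false) (some false) (.inr rfl)) =
    𝟙 (pw A κ) := bigTMap_id _ _
  have h1 := (congrArg (fun z => (z ⊗ₘ bigTMap (q + 1) fun j => triMap f i c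
    (headOpt (n := κ.len) (.inr j)) (some (b j)) (hb j)) ≫
      labCat A Y κ ⟨q + 1, fun k => (c, b k)⟩) h0.symm).trans h1
  rw [id_tensorHom] at h1
  refine (Category.assoc _ _ _).trans (Eq.trans ?_ ((congrArg (fun z => z ≫ pwMap (twoObj A Y) g')
    h1.symm).trans (Category.assoc _ _ _)))
  refine (congrArg (fun z => _ ≫ z) ?_).trans (Category.assoc _ _ _).symm
  refine (reindex_post _ _ _).trans (Eq.trans ?_ (reindex_pre _ _ _).symm)
  obtain ⟨σ', hσ'⟩ := g'
  subst hg
  refine congrArg (reindex g.σ) (funext fun k => ?_)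
  exact triMap_cast f i (g.col_σ k).symm (Prod.ext (congrArg Prod.fst (hσ' k)).symm
    (congrArg some (congrArg Prod.snd (hσ' k)).symm)) (hs _) (h _)

end

/-! ### Changing the label of a factor `X` -/

section
variable {M : Type u} [Category.{v} M] [MonoidalCategory M]

theorem labGen_flip_aux {Z Z1 Z' a T' X X' R Q L L' D V K : M} {p : Z ⟶ Z'} {s : Z ⟶ Z1}
    {p' : Z1 ⟶ Z'}
    (hp : p = s ≫ p') {r : X' ⟶ R} {pc : a ⊗ R ⟶ T'} {lc : T' ⊗ Q ⟶ L} {m1 : L ⟶ L'} {m0 : L' ⟶ D}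
    {m' : L ⟶ D} (hm : m' = m1 ≫ m0) {lh : a ⊗ (X' ⊗ Q) ⟶ L'}
    (hc : (((a ◁ r) ≫ pc) ▷ Q) ≫ lc ≫ m1 = (α_ _ _ _).hom ≫ lh) {φ : Z' ⊗ D ⟶ K}
    {e : (Z1 ⊗ T') ⊗ Q ⟶ K} (hg : (p' ⊗ₘ (lc ≫ m')) ≫ φ = (α_ _ _ _).inv ≫ e) (g : X ⟶ X')
    (ψ : K ⟶ V) :
    (p ⊗ₘ ((a ◁ (g ⊗ₘ 𝟙 Q)) ≫ lh ≫ m0)) ≫ φ ≫ ψ =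
      (α_ _ _ _).inv ≫ ((α_ _ _ _).inv ≫ ((α_ _ _ _).hom ▷ _) ≫
        ((s ⊗ₘ ((a ◁ (g ≫ r)) ≫ pc)) ▷ Q)) ≫ e ≫ ψ := by
  have e1 : (a ◁ (g ⊗ₘ 𝟙 Q)) ≫ lh ≫ m0 =
      ((α_ a X Q).inv ≫ (((a ◁ (g ≫ r)) ≫ pc) ▷ Q)) ≫ (lc ≫ m') := by
    have : lh = (α_ _ _ _).inv ≫ (((a ◁ r) ≫ pc) ▷ Q) ≫ lc ≫ m1 := by
      rw [hc, Iso.inv_hom_id_assoc]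
    rw [this, hm]
    simp
  have e2 : s ⊗ₘ ((α_ a X Q).inv ≫ (((a ◁ (g ≫ r)) ≫ pc) ▷ Q)) =
      (Z ◁ (α_ a X Q).inv) ≫ (α_ _ _ _).inv ≫ ((s ⊗ₘ ((a ◁ (g ≫ r)) ≫ pc)) ▷ Q) ≫ (α_ _ _ _).hom :=
        by
    rw [← tensorHom_id (s ⊗ₘ _), associator_naturality, Iso.inv_hom_id_assoc, ← id_tensorHom Z,
      tensorHom_comp_tensorHom, Category.id_comp, tensorHom_id]
  rw [e1, hp, ← tensorHom_comp_tensorHom, Category.assoc, reassoc_of% hg, e2]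
  simp

theorem labGen_flip_aux' {Z Z' a X X' Q P D V K : M} {p : Z ⟶ Z'} {l : a ⊗ (X' ⊗ Q) ⟶ P} {m : P ⟶ D}
    {φ : Z' ⊗ D ⟶ K} {e : (Z ⊗ a) ⊗ (X' ⊗ Q) ⟶ K} (hg : (p ⊗ₘ (l ≫ m)) ≫ φ = (α_ _ _ _).inv ≫ e)
    (g : X ⟶ X') (ψ : K ⟶ V) :
    (p ⊗ₘ ((a ◁ (g ⊗ₘ 𝟙 Q)) ≫ l ≫ m)) ≫ φ ≫ ψ =
      (α_ _ _ _).inv ≫ (_ ◁ (g ⊗ₘ 𝟙 Q)) ≫ e ≫ ψ := by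
  have : p ⊗ₘ ((a ◁ (g ⊗ₘ 𝟙 Q)) ≫ l ≫ m) = (Z ◁ (a ◁ (g ⊗ₘ 𝟙 Q))) ≫ (p ⊗ₘ (l ≫ m)) := by
    rw [← id_tensorHom Z, tensorHom_comp_tensorHom, Category.id_comp]
  rw [this, Category.assoc, reassoc_of% hg]
  simp

theorem tensor_whisker_aux {Z Z' W B D V : M} (p : Z ⟶ Z') (E : W ⟶ B) (t : B ⟶ D) {x : W ⟶ D}
    (h : E ≫ t = x) (φ : Z' ⊗ D ⟶ V) : (p ⊗ₘ E) ≫ (Z' ◁ t) ≫ φ = (p ⊗ₘ x) ≫ φ := by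
  rw [← h, ← id_tensorHom, tensorHom_comp_tensorHom_assoc, Category.comp_id]

end

section
variable {C : Type v} {M : Type u} [Category.{v} M] [MonoidalCategory M] [SymmetricCategory M]
  [MonoidalClosed M] [HasColimits M]
open Profile

namespace CellAttachment
variable {O : Operad C M} {c : C} (D : CellAttachment O c)

/-- The map `X ⟶ A` that corresponds to `f`. -/
def fX (d : C) : D.X d ⟶ D.A.A d := O.unit D.X d ≫ D.f.f d

/-- The labels `l`, with the label at `j` replaced by `none`. -/
abbrev optAt {n : ℕ} (l : Fin n → Bool) (j : Fin n) : Fin n → Option Bool :=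
  fun k => if k = j then none else some (l k)

theorem optAt_le {n : ℕ} (l : Fin n → Bool) (j : Fin n) (k : Fin n) :
    optAt l j k = none ∨ optAt l j k = some (l k) := by
  by_cases h : k = j
  · exact .inl (if_pos h)
  · exact .inr (if_neg h)

theorem optAt_le_update {n : ℕ} (l : Fin n → Bool) (j : Fin n) (k : Fin n) :
    optAt l j k = none ∨ optAt l j k = some (Function.update l j false k) := by
  by_cases h : k = j
  · exact .inl (if_pos h)
  · exact .inr ((if_neg h).trans (congrArg some (Function.update_of_ne h _ _).symm))

theorem flip_labels {n q N : ℕ} (σ : Fin (n + (q + 1)) ≃ Fin N) (l : Fin N → Bool) (j : Fin N)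
    (hl : ∀ k, l (σ k) = labSum (fun _ => true) (finSumFinEquiv.symm k))
    (hj : σ (finSumFinEquiv (.inr 0)) = j) (k : Fin (n + (q + 1))) :
    (headOpt (finSumFinEquiv.symm k) : Option Bool) = optAt l j (σ k) ∧
      labSum (Fin.cons false fun _ => true) (finSumFinEquiv.symm k) =
        Function.update l j false (σ k) := by
  obtain ⟨s, rfl⟩ := finSumFinEquiv.surjective k
  have hl := hl (finSumFinEquiv s)
  rw [Equiv.symm_apply_apply] at hl ⊢
  have hne : s ≠ .inr 0 → σ (finSumFinEquiv s) ≠ j :=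
    fun hs h => hs (finSumFinEquiv.injective (σ.injective (h.trans hj.symm)))
  rcases s with k | k
  · have := hne nofun
    rw [optAt, if_neg this, Function.update_of_ne this, hl]
    exact ⟨rfl, rfl⟩
  · revert hl hne
    refine Fin.cases (fun _ _ => ?_) (fun k hl hne => ?_) k
    · rw [hj, optAt, if_pos rfl, Function.update_self]
      exact ⟨rfl, rfl⟩
    · have := hne fun h => Fin.succ_ne_zero k (Sum.inr_injective h)
      rw [optAt, if_neg this, Function.update_of_ne this, hl]
      exact ⟨rfl, rfl⟩

/-- One factor `X`, mapped to `A` or to `Y`. -/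
theorem labGen_flip (d : C) {N : M} {q : ℕ} {ψ0 : O.cell D.A D.Y d q c ⟶ N}
    {ψ1 : O.cell D.A D.Y d (q + 1) c ⟶ N}
    (hψ : ∀ a, D.attach d a q ≫ O.envGen D.A (D.Y c) d (a.append (single c)) q c ≫ ψ0 =
      (_ ◁ (D.i c ⊗ₘ 𝟙 _)) ≫ O.envGen D.A (D.Y c) d a (q + 1) c ≫ ψ1)
    (ρ : Profile C) (l : Fin ρ.len → Bool) (j : Fin ρ.len) (hj : l j = true)
    (h0 : (ρ.lab (Function.update l j false)).cnt = q) (h1 : (ρ.lab l).cnt = q + 1) :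
    ((O.obj d).obj (op ρ) ◁ triTMap D.fX D.i ρ (optAt l j)
        (fun k => some (Function.update l j false k)) (optAt_le_update l j)) ≫
        O.labGen D.A D.initialY d (ρ.lab (Function.update l j false)) q h0 ≫ ψ0 =
      ((O.obj d).obj (op ρ) ◁ triTMap D.fX D.i ρ (optAt l j) (fun k => some (l k))
        (optAt_le l j)) ≫ O.labGen D.A D.initialY d (ρ.lab l) (q + 1) h1 ≫ ψ1 := by
  by_cases hr : ∀ k, ((ρ.lab l).col k).2 = true → ((ρ.lab l).col k).1 = c
  · have hcard : Fintype.card {k // ((ρ.lab l).col k).2 = true} = q + 1 := by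
      rw [Fintype.card_subtype]
      exact h1
    -- The sorting is chosen so that the entry `j` comes first among the entries labelled by `true`.
    let e0 : Fin (q + 1) ≃ {k // ((ρ.lab l).col k).2 = true} :=
      (finCongr hcard.symm).trans (Fintype.equivFin _).symm
    let e : Fin (q + 1) ≃ {k // ((ρ.lab l).col k).2 = true} :=
      e0.trans (Equiv.swap (e0 0) ⟨j, hj⟩)
    have he : (e 0).1 = j := congrArg Subtype.val (Equiv.swap_apply_left (e0 0) _)
    obtain ⟨κ, f, hf⟩ := exists_sorted hr e
    have hf0 : f.σ (finSumFinEquiv (.inr (0 : Fin (q + 1)))) = j :=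
      (hf (0 : Fin (q + 1))).trans he
    have hk := flip_labels f.σ l j (fun k => congrArg Prod.snd (f.col_σ k)) hf0
    have hcol : ∀ k : Fin (κ.len + (q + 1)), ρ.col (f.σ k) =
        Sum.elim κ.col (fun _ => c) (finSumFinEquiv.symm k) :=
      fun k => congrArg Prod.fst (f.col_σ k)
    let g : (⟨κ.len + (q + 1), fun k => (Sum.elim κ.col (fun _ => c) (finSumFinEquiv.symm k),
      headOpt (finSumFinEquiv.symm k))⟩ : Profile (C × Option Bool)) ⟶
        ⟨ρ.len, fun k => (ρ.col k, optAt l j k)⟩ :=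
      Profile.Hom.mk f.σ fun k => Prod.ext (hcol k) (hk k).1.symm
    let f0 : labApp κ (headLab q c false) ⟶ ρ.lab (Function.update l j false) :=
      Profile.Hom.mk f.σ fun k => Prod.ext (hcol k) (hk k).2.symm
    -- Both sides are now maps out of a tensor product with `X` in the first place, where they are
    -- compared by `hψ`.
    have t0 := triSort_map D.fX D.i g (Function.update l j false) (optAt_le_update l j)
      (Fin.cons false fun _ => true) (Fin.cases (.inl rfl) fun _ => .inr rfl) f0 rfl
    have t1 := triSort_map D.fX D.i g l (optAt_le l j) (fun _ => true)
      (Fin.cases (.inl rfl) fun _ => .inr rfl) f rfl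
    have b0 : (bigTMap (q + 1) fun k => triMap D.fX D.i c (headOpt (n := κ.len) (.inr k))
        (some ((Fin.cons false fun _ => true : Fin (q + 1) → Bool) k))
          (Fin.cases (.inl rfl) (fun _ => .inr rfl) k)) =
        (D.fX c ⊗ₘ 𝟙 (bigT q fun _ => D.Y c)) :=
      congrArg (fun z => D.fX c ⊗ₘ z) (bigTMap_id q fun _ => D.Y c)
    have b1 : (bigTMap (q + 1) fun k => triMap D.fX D.i c (headOpt (n := κ.len) (.inr k))
        (some true) (Fin.cases (.inl rfl) (fun _ => .inr rfl) k)) =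
        (D.i c ⊗ₘ 𝟙 (bigT q fun _ => D.Y c)) :=
      congrArg (fun z => D.i c ⊗ₘ z) (bigTMap_id q fun _ => D.Y c)
    have t0 := t0.trans (congrArg (fun z => (pw D.A.A κ ◁ z) ≫ labCat D.A.A D.Y κ
      (headLab q c false) ≫ pwMap (twoObj D.A.A D.Y) f0) b0)
    have t1 := t1.trans (congrArg (fun z => (pw D.A.A κ ◁ z) ≫ labCat D.A.A D.Y κ
      (rep (q + 1) (c, true)) ≫ pwMap (twoObj D.A.A D.Y) f) b1)
    let p : (O.obj d).obj (op (κ.append (rep (q + 1) c))) ⟶ (O.obj d).obj (op ρ) :=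
      (O.obj d).map (underMap (Groupoid.inv f)).op
    have hp : IsIso p := (inferInstance : IsIso ((O.obj d).map (underMap (Groupoid.inv f)).op))
    have hE : IsIso (p ⊗ₘ triSort D.A.A D.X D.Y g) := inferInstance
    refine (cancel_epi (p ⊗ₘ triSort D.A.A D.X D.Y g)).1 ?_
    refine (tensor_whisker_aux p _ _ t0 _).trans (Eq.trans ?_ (tensor_whisker_aux p _ _ t1 _).symm)
    have s0 := O.sort_labGen D.A D.initialY d (ρ.lab (Function.update l j false)) q h0
      (shiftLab κ q c ≫ f0)
    have s1 := O.sort_labGen D.A D.initialY d (ρ.lab l) (q + 1) h1 f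
    have hp' : p = (O.obj d).map (shiftRep κ q c).op ≫
        (O.obj d).map (underMap (Groupoid.inv (shiftLab κ q c ≫ f0))).op := by
      refine Eq.trans (op_congr (O.obj d) (g := underMap (Groupoid.inv (shiftLab κ q c ≫ f0)) ≫
        shiftRep κ q c) (hom_ext fun k => ?_)) ((O.obj d).map_comp (shiftRep κ q c).op
          (underMap (Groupoid.inv (shiftLab κ q c ≫ f0))).op)
      exact ((shiftRep κ q c).σ.apply_symm_apply _).symm
    refine (labGen_flip_aux hp' (pwMap_comp _ _ _) (labCat_shift D.A.A D.Y κ q c) s0 (D.fX c)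
      ψ0).trans
      (Eq.trans ?_ (labGen_flip_aux' s1 (D.i c) ψ1).symm)
    exact congrArg (fun z => (α_ _ _ _).inv ≫ z) (hψ κ)
  -- If some entry labelled by `true` has a color other than `c`, its factor `X` or `Y` is initial.
  · push Not at hr
    obtain ⟨k, h1, h2⟩ := hr
    have h3 : Nonempty (IsInitial (triObj D.A.A D.X D.Y (ρ.col k, optAt l j k))) := by
      by_cases h : k = j
      · rw [optAt, if_pos h]
        exact D.initialX _ h2
      · rw [optAt, if_neg h, show l k = true from h1]
        exact D.initialY _ h2
    obtain ⟨i⟩ := isInitial_tensor_left ((O.obj d).obj (op ρ)) (isInitial_bigT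
      (X := fun k => triObj D.A.A D.X D.Y (ρ.col k, optAt l j k)) ρ.len k h3)
    exact i.hom_ext _ _

end CellAttachment
end

/-! ### Cocells -/

section
variable {C : Type v} {M : Type u} [Category.{v} M] [MonoidalCategory M] [SymmetricCategory M]
  [MonoidalClosed M] [HasColimits M]
open Profile

theorem Profile.cnt_update (ρ : Profile C) (l : Fin ρ.len → Bool) (j : Fin ρ.len)
    (hj : l j = true) : (ρ.lab l).cnt = (ρ.lab (Function.update l j false)).cnt + 1 := by
  classical
  have e : (Finset.univ.filter fun k => Function.update l j false k = true) =
      (Finset.univ.filter fun k => l k = true).erase j := by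
    ext k
    by_cases h : k = j
    · subst h
      simp
    · simp [h]
  have hm : j ∈ Finset.univ.filter fun k => l k = true := by simpa using hj
  refine (Finset.card_erase_add_one hm).symm.trans ?_
  rw [← e]
  rfl

namespace CellAttachment
variable {O : Operad C M} {c : C} (D : CellAttachment O c)

/-- A cocell on `N` consists of maps to `N` from the objects
`O_A(d; c, …, c) ⊗_{Σ_q} (Y_c ⊗ ⋯ ⊗ Y_c)`, for the numbers `q` in an initial segment `dom`, such
that it does not matter whether a factor `X_c` is mapped to `A_c` or to `Y_c`. It is total if `dom`
holds for all `q`. -/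
structure Cocell (d : C) (N : M) where
  dom : ℕ → Prop
  down {q : ℕ} : dom (q + 1) → dom q
  map (q : ℕ) (h : dom q) : O.cell D.A D.Y d q c ⟶ N
  rel (q : ℕ) (h : dom (q + 1)) (a : Profile C) :
    D.attach d a q ≫ O.envGen D.A (D.Y c) d (a.append (single c)) q c ≫ map q (down h) =
      (_ ◁ (D.i c ⊗ₘ 𝟙 (bigT q fun _ => D.Y c))) ≫ O.envGen D.A (D.Y c) d a (q + 1) c ≫
        map (q + 1) h

namespace Cocell
variable {D} {d : C} {N : M} (E : D.Cocell d N)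

/-- The map given on a labelled profile. -/
def val (r : Profile (C × Bool)) (h : E.dom r.cnt) :
    (O.obj d).obj (op r.under) ⊗ pw (twoObj D.A.A D.Y) r ⟶ N :=
  O.labGen D.A D.initialY d r r.cnt rfl ≫ E.map r.cnt h

theorem val_eq (r : Profile (C × Bool)) (h : E.dom r.cnt) (q : ℕ) (hq : r.cnt = q) :
    E.val r h = O.labGen D.A D.initialY d r q hq ≫ E.map q (hq ▸ h) := by
  subst hq
  rfl

theorem val_perm {r r' : Profile (C × Bool)} (g : r ⟶ r') (h : E.dom r.cnt) (h' : E.dom r'.cnt) :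
    ((O.obj d).map (underMap (Groupoid.inv g)).op ⊗ₘ pwMap (twoObj D.A.A D.Y) g) ≫ E.val r' h' =
      E.val r h := by
  rw [E.val_eq r' h' r.cnt (cnt_congr g).symm, ← Category.assoc, O.labGen_perm]
  rfl

theorem val_sorted {κ : Profile C} {q : ℕ} {r : Profile (C × Bool)} (f : sorted κ q c ⟶ r)
    (h : E.dom r.cnt) (hq : E.dom q) :
    sortMap D.A.A D.Y (O.obj d) f ≫ E.val r h =
      (α_ _ _ _).inv ≫ O.envGen D.A (D.Y c) d κ q c ≫ E.map q hq := by
  rw [E.val_eq r h q ((cnt_congr f).symm.trans (cnt_sorted κ q c)), ← Category.assoc,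
    O.sort_labGen, Category.assoc]

theorem comp_right_aux {x y z y' z' V W : M} {f : x ⟶ y} {g : y ⟶ z} {φ : z ⟶ V} {f' : x ⟶ y'}
    {g' : y' ⟶ z'} {φ' : z' ⟶ V} (h : f ≫ g ≫ φ = f' ≫ g' ≫ φ') (m : V ⟶ W) :
    f ≫ g ≫ φ ≫ m = f' ≫ g' ≫ φ' ≫ m := by
  simp only [← Category.assoc] at h ⊢
  rw [h]

/-- The value of a cocell on labelled profiles satisfies the relation that defines `O_A`. -/
theorem val_rel (a : Profile C) (b : Fin a.len → Profile C) (r : Profile (C × Bool))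
    (h : E.dom (labApp a r).cnt) (h' : E.dom (labApp (concat b) r).cnt) :
    ((O.obj d).obj (op (a.append r.under)) ◁ ((bigTMap a.len fun i =>
        tι (O.obj (a.col i)) (pwF D.A.A) (b i) ≫ D.A.a (a.col i)) ▷
          pw (twoObj D.A.A D.Y) r)) ≫ (_ ◁ labCat D.A.A D.Y a r) ≫ E.val (labApp a r) h =
    ((α_ _ _ _).inv ≫ (shufP _ _ D.A.A b ▷ pw (twoObj D.A.A D.Y) r) ≫ (α_ _ _ _).hom) ≫
      (O.shiftAct d r.under a b ⊗ₘ labCat D.A.A D.Y (concat b) r) ≫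
        E.val (labApp (concat b) r) h' := by
  rw [E.val_eq _ h' (labApp a r).cnt ((cnt_labApp _ r).trans (cnt_labApp _ r).symm)]
  exact comp_right_aux (O.labGen_rel D.A D.initialY d a b r (labApp a r).cnt
    (cnt_labApp a r).symm rfl ((cnt_labApp _ r).trans (cnt_labApp _ r).symm)) _

/-- A factor `X` may be mapped to `A` or to `Y`. -/
theorem val_flip (ρ : Profile C) (l : Fin ρ.len → Bool) (j : Fin ρ.len) (hj : l j = true)
    (h0 : E.dom (ρ.lab (Function.update l j false)).cnt) (h1 : E.dom (ρ.lab l).cnt) :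
    ((O.obj d).obj (op ρ) ◁ triTMap D.fX D.i ρ (optAt l j)
        (fun k => some (Function.update l j false k)) (optAt_le_update l j)) ≫
        E.val (ρ.lab (Function.update l j false)) h0 =
      ((O.obj d).obj (op ρ) ◁ triTMap D.fX D.i ρ (optAt l j) (fun k => some (l k))
        (optAt_le l j)) ≫ E.val (ρ.lab l) h1 := by
  have hc := cnt_update ρ l j hj
  rw [E.val_eq _ h1 _ hc]
  exact D.labGen_flip d (E.rel _ (hc ▸ h1)) ρ l j hj rfl hc

theorem whisker_comp_aux {Z x y z V : M} {f : x ⟶ y} {g : y ⟶ z} {h : x ⟶ z} (e : f ≫ g = h)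
    (φ : Z ⊗ z ⟶ V) : (Z ◁ h) ≫ φ = (Z ◁ f) ≫ (Z ◁ g) ≫ φ := by
  rw [← e, MonoidalCategory.whiskerLeft_comp, Category.assoc]

/-- All factors `X` may be mapped to `A`: they are moved one at a time, by induction on the number
of entries labelled by `true`. Moving a factor to `A` decreases this number, so that the domain of
the cocell is not left. -/
theorem val_tri_base (ρ : Profile C) (m : Fin ρ.len → Option Bool) : ∀ (q : ℕ)
    (l : Fin ρ.len → Bool) (_ : (ρ.lab l).cnt = q) (h : ∀ k, m k = none ∨ m k = some (l k))
    (hd : E.dom (ρ.lab l).cnt) (h0 : ∀ k, m k = none ∨ m k = some ((m k).getD false)),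
    ∃ hd0 : E.dom (ρ.lab fun k => (m k).getD false).cnt,
    ((O.obj d).obj (op ρ) ◁ triTMap D.fX D.i ρ m (fun k => some (l k)) h) ≫ E.val (ρ.lab l) hd =
      ((O.obj d).obj (op ρ) ◁ triTMap D.fX D.i ρ m (fun k => some ((m k).getD false)) h0) ≫
        E.val (ρ.lab fun k => (m k).getD false) hd0 := by
  intro q
  induction q with
  | zero =>
    intro l hq h hd h0
    have : l = fun k => (m k).getD false := by
      funext k
      rcases h k with hk | hk
      · rw [hk]
        by_contra hl
        have hl : l k = true := by simpa using hl
        have hc := cnt_update ρ l k hl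
        omega
      · rw [hk]
        rfl
    subst this
    exact ⟨hd, rfl⟩
  | succ q ih =>
    intro l hq h hd h0
    by_cases hl : l = fun k => (m k).getD false
    · subst hl
      exact ⟨hd, rfl⟩
    · obtain ⟨j, hj⟩ := Function.ne_iff.1 hl
      have hm : m j = none := by
        rcases h j with hk | hk
        · exact hk
        · rw [hk] at hj
          exact absurd rfl hj
      have hl : l j = true := by simpa [hm] using hj
      have hc := cnt_update ρ l j hl
      have hd1 : E.dom (ρ.lab (Function.update l j false)).cnt := E.down (hc ▸ hd)
      have h1 : ∀ k, m k = none ∨ m k = some (Function.update l j false k) := fun k => by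
        by_cases hk : k = j
        · exact .inl (hk ▸ hm)
        · rw [Function.update_of_ne hk]
          exact h k
      have h2 : ∀ k, m k = none ∨ m k = optAt l j k := fun k => by
        by_cases hk : k = j
        · exact .inl (hk ▸ hm)
        · rw [optAt, if_neg hk]
          exact h k
      obtain ⟨hd0, ih⟩ := ih (Function.update l j false) (by omega) h1 hd1 h0
      refine ⟨hd0, Eq.trans ?_ ih⟩
      have e1 : triTMap D.fX D.i ρ m (optAt l j) h2 ≫ triTMap D.fX D.i ρ (optAt l j)
          (fun k => some (l k)) (optAt_le l j) = triTMap D.fX D.i ρ m (fun k => some (l k)) h :=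
        (bigTMap_comp _ _ _).trans (congrArg (bigTMap ρ.len) (funext fun k =>
          triMap_comp D.fX D.i _ _ _ _ _ _ _))
      have e2 : triTMap D.fX D.i ρ m (optAt l j) h2 ≫ triTMap D.fX D.i ρ (optAt l j)
          (fun k => some (Function.update l j false k)) (optAt_le_update l j) =
            triTMap D.fX D.i ρ m (fun k => some (Function.update l j false k)) h1 :=
        (bigTMap_comp _ _ _).trans (congrArg (bigTMap ρ.len) (funext fun k =>
          triMap_comp D.fX D.i _ _ _ _ _ _ _))
      refine (whisker_comp_aux e1 (E.val (ρ.lab l) hd)).trans (Eq.trans ?_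
        (whisker_comp_aux e2 (E.val (ρ.lab (Function.update l j false)) hd1)).symm)
      exact congrArg (fun z => _ ≫ z) (E.val_flip ρ l j hl hd1 hd).symm

/-- Every factor `X` may be mapped to `A` or to `Y`. -/
theorem val_tri (ρ : Profile C) (m : Fin ρ.len → Option Bool) (l l' : Fin ρ.len → Bool)
    (h : ∀ k, m k = none ∨ m k = some (l k)) (h' : ∀ k, m k = none ∨ m k = some (l' k))
    (hd : E.dom (ρ.lab l).cnt) (hd' : E.dom (ρ.lab l').cnt) :
    ((O.obj d).obj (op ρ) ◁ triTMap D.fX D.i ρ m (fun k => some (l k)) h) ≫ E.val (ρ.lab l) hd =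
      ((O.obj d).obj (op ρ) ◁ triTMap D.fX D.i ρ m (fun k => some (l' k)) h') ≫
        E.val (ρ.lab l') hd' := by
  have h0 : ∀ k, m k = none ∨ m k = some ((m k).getD false) := fun k => by
    rcases m k with _ | b
    · exact .inl rfl
    · exact .inr rfl
  obtain ⟨h1, e1⟩ := E.val_tri_base ρ m _ l rfl h hd h0
  obtain ⟨h2, e2⟩ := E.val_tri_base ρ m _ l' rfl h' hd' h0
  exact e1.trans e2.symm

end Cocell
end CellAttachment
end

/-! ### Maps out of `O_A(d; κ)` -/

section
variable {M : Type u} [Category.{v} M] [MonoidalCategory M] [SymmetricCategory M] [MonoidalClosed M]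

/-- Currying in the second factor. -/
def rcurry {A V N : M} (f : A ⊗ V ⟶ N) : A ⟶ (ihom V).obj N :=
  MonoidalClosed.curry ((β_ V A).hom ≫ f)

theorem rcurry_nat {A A' V N : M} (g : A' ⟶ A) (f : A ⊗ V ⟶ N) :
    rcurry ((g ▷ V) ≫ f) = g ≫ rcurry f := by
  rw [rcurry, rcurry, ← MonoidalClosed.curry_natural_left,
    BraidedCategory.braiding_naturality_right_assoc]

theorem rcurry_injective {A V N : M} {f g : A ⊗ V ⟶ N} (h : rcurry f = rcurry g) : f = g :=
  (cancel_epi (β_ V A).hom).1 (MonoidalClosed.curry_injective h)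

theorem rcurry_surjective {A V N : M} (g : A ⟶ (ihom V).obj N) :
    ∃ f : A ⊗ V ⟶ N, rcurry f = g :=
  ⟨(β_ V A).inv ≫ MonoidalClosed.uncurry g, by
    rw [rcurry, Iso.hom_inv_id_assoc, MonoidalClosed.curry_uncurry]⟩

end

section
variable {C : Type v} {M : Type u} [Category.{v} M] [MonoidalCategory M] [SymmetricCategory M]
  [MonoidalClosed M] [HasColimits M]
open Profile

namespace Operad
variable (O : Operad C M) (A : O.monad.Algebra)

theorem env_ext {d : C} {κ : Profile C} {V N : M} {f g : (O.env A d).obj (op κ) ⊗ V ⟶ N}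
    (h : ∀ a, (O.envι A d a κ ▷ V) ≫ f = (O.envι A d a κ ▷ V) ≫ g) : f = g := by
  refine rcurry_injective ?_
  have key : ∀ a, tι (O.shift d κ) (pwF A.A) a ≫ coequalizer.π (O.env0 A d κ) (O.env1 A d κ) ≫
      rcurry f = tι (O.shift d κ) (pwF A.A) a ≫ coequalizer.π (O.env0 A d κ) (O.env1 A d κ) ≫
      rcurry g := fun a =>
    (Category.assoc _ _ _).symm.trans (((rcurry_nat (O.envι A d a κ) f).symm.trans
      ((congrArg rcurry (h a)).trans (rcurry_nat (O.envι A d a κ) g))).trans (Category.assoc _ _ _))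
  exact coequalizer.hom_ext (t_ext key)

theorem env_desc_aux {W x y z V V' N : M} {s : x ⟶ y} {p : y ⟶ z} {u : x ⟶ z} {t : W ⊗ y ⟶ V}
    {e : V ⟶ V'} {i : W ⊗ z ⟶ V'} {δ : V' ⟶ N} {φ : W ⊗ z ⟶ N} (h1 : t ≫ e = (W ◁ p) ≫ i)
    (hδ : i ≫ δ = φ) (h2 : s ≫ p = u) : (W ◁ s) ≫ t ≫ e ≫ δ = (W ◁ u) ≫ φ := by
  rw [reassoc_of% h1, hδ, ← h2, MonoidalCategory.whiskerLeft_comp, Category.assoc]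

/-- Maps out of `O_A(d; κ) ⊗ V` are given by maps out of `O(d; a, κ) ⊗ A^a ⊗ V` that are compatible
with permutations of `a` and with the action of `O` on `A`. -/
theorem env_desc {d : C} {κ : Profile C} {V N : M}
    (φ : ∀ a, ((O.obj d).obj (op (a.append κ)) ⊗ pw A.A a) ⊗ V ⟶ N)
    (hw : ∀ {a a' : Profile C} (g : a ⟶ a'),
      (((O.obj d).map (appendMap g (𝟙 κ)).op ▷ pw A.A a) ▷ V) ≫ φ a =
        ((_ ◁ pwMap A.A g) ▷ V) ≫ φ a')
    (hr : ∀ (a : Profile C) (b : Fin a.len → Profile C),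
      ((_ ◁ bigTMap a.len fun i => tι (O.obj (a.col i)) (pwF A.A) (b i) ≫ A.a (a.col i)) ▷ V) ≫
        φ a = ((shufP _ _ A.A b ≫ (O.shiftAct d κ a b ▷ pw A.A (concat b))) ▷ V) ≫
          φ (concat b)) :
    ∃ φ' : (O.env A d).obj (op κ) ⊗ V ⟶ N, ∀ a, (O.envι A d a κ ▷ V) ≫ φ' = φ a := by
  let δ : O.envT A.A d κ ⟶ (ihom V).obj N := tdesc (O.shift d κ) (pwF A.A) (fun a => rcurry (φ a))
    fun g => (rcurry_nat _ _).symm.trans ((congrArg rcurry (hw g)).trans (rcurry_nat _ _))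
  have hδ : ∀ a, tι (O.shift d κ) (pwF A.A) a ≫ δ = rcurry (φ a) := fun a => tι_desc _ _ _ _ _
  have hc : O.env0 A d κ ≫ δ = O.env1 A d κ ≫ δ := by
    refine RightAct.ext2 A.A fun a b => ?_
    have e0 := (O.shiftRight d κ).gen_spec A.A a b
    have e1 := ι_circMap (O.shift d κ) A.a a
    have l := (rcurry_nat _ _).symm.trans ((congrArg rcurry (hr a b)).trans (rcurry_nat _ _))
    have e2 : bigTMap a.len (fun i => tι (O.obj (a.col i)) (pwF A.A) (b i)) ≫ pwTrans A.a a =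
      bigTMap a.len fun i => tι (O.obj (a.col i)) (pwF A.A) (b i) ≫ A.a (a.col i) :=
      bigTMap_comp _ _ _
    have r0 := congrArg (fun z => z ≫ δ) e0
    have r1 := env_desc_aux e1 (hδ a) e2
    simp only [Category.assoc, RightAct.gen, hδ] at r0
    refine r0.trans (Eq.trans ?_ r1.symm)
    exact (Category.assoc _ _ _).symm.trans l.symm
  obtain ⟨φ', hφ⟩ := rcurry_surjective (coequalizer.desc (f := O.env0 A d κ) (g := O.env1 A d κ)
    δ hc)
  refine ⟨φ', fun a => rcurry_injective ?_⟩
  have e3 := coequalizer.π_desc (f := O.env0 A d κ) (g := O.env1 A d κ) δ hc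
  refine (rcurry_nat _ _).trans ((congrArg (fun z => O.envι A d a κ ≫ z) hφ).trans ?_)
  exact (Category.assoc _ _ _).trans ((congrArg (fun z => tι (O.shift d κ) (pwF A.A) a ≫ z)
    e3).trans (hδ a))

end Operad
end

/-! ### Cocells on the vertices of the cube -/

section
variable {M : Type u} [Category.{v} M] [MonoidalCategory M]

theorem vertGen_perm_aux {Z Z' x x' V V' P P' L L' N : M} {p : Z' ⟶ Z} {m : L ⟶ L'} {f : x ⟶ x'}
    {s : V ⟶ V'} {s' : P ⟶ P'} {χ : V ⟶ P} {χ' : V' ⟶ P'} {l : x ⊗ P ⟶ L} {l' : x' ⊗ P' ⟶ L'}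
    {v : Z ⊗ L ⟶ N} {v' : Z' ⊗ L' ⟶ N} (hv : (p ▷ L) ≫ v = (Z' ◁ m) ≫ v')
    (hl : (f ⊗ₘ s') ≫ l' = l ≫ m) (hχ : s ≫ χ' = χ ≫ s') :
    ((p ▷ x) ▷ V) ≫ (α_ _ _ _).hom ≫ (Z ◁ ((x ◁ χ) ≫ l)) ≫ v =
      ((Z' ◁ f) ⊗ₘ s) ≫ (α_ _ _ _).hom ≫ (Z' ◁ ((x' ◁ χ') ≫ l')) ≫ v' := by
  have e : (f ⊗ₘ s) ≫ (x' ◁ χ') ≫ l' = (x ◁ χ) ≫ l ≫ m := by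
    rw [← id_tensorHom, tensorHom_comp_tensorHom_assoc, hχ, Category.comp_id, ← hl,
      ← id_tensorHom, tensorHom_comp_tensorHom_assoc, Category.id_comp]
  have e1 : ((Z' ◁ f) ⊗ₘ s) ≫ (α_ _ _ _).hom = (α_ _ _ _).hom ≫ (Z' ◁ (f ⊗ₘ s)) := by
    rw [← id_tensorHom, associator_naturality, id_tensorHom]
  have e2 : ((p ▷ x) ▷ V) ≫ (α_ _ _ _).hom = (α_ _ _ _).hom ≫ (p ▷ (x ⊗ V)) := by simp
  rw [reassoc_of% e1, ← MonoidalCategory.whiskerLeft_comp_assoc, e, reassoc_of% e2,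
    ← whisker_exchange_assoc, hv]
  simp only [MonoidalCategory.whiskerLeft_comp, Category.assoc]

theorem vertGen_rel_aux {Z S B K L V P A1 A2 A3 N : M} {act : S ⟶ A1} {χ : V ⟶ P}
    {l : A1 ⊗ P ⟶ A2} {v : Z ⊗ A2 ⟶ N} {s : Z ⊗ S ⟶ (Z ⊗ B) ⊗ K} {t : Z ⊗ B ⟶ L}
    {l' : K ⊗ P ⟶ A3} {v' : L ⊗ A3 ⟶ N}
    (h : (Z ◁ (act ▷ P)) ≫ (Z ◁ l) ≫ v =
      ((α_ _ _ _).inv ≫ (s ▷ P) ≫ (α_ _ _ _).hom) ≫ (t ⊗ₘ l') ≫ v') :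
    ((Z ◁ act) ▷ V) ≫ (α_ _ _ _).hom ≫ (Z ◁ ((A1 ◁ χ) ≫ l)) ≫ v =
      ((s ≫ (t ▷ K)) ▷ V) ≫ (α_ _ _ _).hom ≫ (L ◁ ((K ◁ χ) ≫ l')) ≫ v' := by
  have e1 : ((Z ◁ act) ▷ V) ≫ (α_ _ _ _).hom ≫ (Z ◁ (A1 ◁ χ)) =
      (α_ _ _ _).hom ≫ (Z ◁ (S ◁ χ)) ≫ (Z ◁ (act ▷ P)) := by
    rw [associator_naturality_middle_assoc, ← MonoidalCategory.whiskerLeft_comp,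
      ← MonoidalCategory.whiskerLeft_comp, whisker_exchange]
  have e2 : ((s ≫ (t ▷ K)) ▷ V) ≫ (α_ _ _ _).hom ≫ (L ◁ (K ◁ χ)) =
      (α_ _ _ _).hom ≫ (Z ◁ (S ◁ χ)) ≫ ((α_ _ _ _).inv ≫ (s ▷ P) ≫ (α_ _ _ _).hom) ≫
        (t ▷ (K ⊗ P)) := by
    rw [← associator_naturality_right, ← whisker_exchange_assoc,
      ← associator_naturality_right_assoc, comp_whiskerRight]
    simp only [Category.assoc, Iso.hom_inv_id_assoc]
    rw [← associator_naturality_left]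
  rw [MonoidalCategory.whiskerLeft_comp, MonoidalCategory.whiskerLeft_comp, Category.assoc,
    Category.assoc, reassoc_of% e1, reassoc_of% e2, h, MonoidalCategory.tensorHom_def]
  simp only [Category.assoc]

end

section
variable {C : Type v} {M : Type u} [Category.{v} M] [MonoidalCategory M] [SymmetricCategory M]
  [MonoidalClosed M] [HasColimits M]
open Profile

/-- The profile `(c, …, c)` with labels. -/
abbrev Profile.repLab {n : ℕ} (c : C) (ε : Fin n → Bool) : Profile (C × Bool) :=
  ⟨n, fun k => (c, ε k)⟩

theorem Profile.repLab_cnt {n : ℕ} (a : Profile C) (c : C) (ε : Fin n → Bool) :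
    (labApp a (repLab c ε)).cnt = (Finset.univ.filter fun k => ε k = true).card :=
  (cnt_labApp _ _).trans rfl

namespace CellAttachment
variable {O : Operad C M} {c : C} (D : CellAttachment O c)

/-- The map `X_c ⟶ A_c`, or the identity of `Y_c`. -/
def sideA : (b : Bool) → (side (D.X c) (D.Y c) b ⟶ twoObj D.A.A D.Y (c, b))
  | false => D.fX c
  | true => 𝟙 (D.Y c)

/-- The map from a vertex of the cube given by `X_c ⟶ A_c`. -/
abbrev vertA {n : ℕ} (ε : Fin n → Bool) :
    vert (D.X c) (D.Y c) ε ⟶ pw (twoObj D.A.A D.Y) (repLab c ε) :=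
  bigTMap n fun k => D.sideA (ε k)

/-- The label `none` for `X` and `some true` for `Y`. -/
def optOf : Bool → Option Bool
  | false => none
  | true => some true

/-- The factor of a vertex of the cube as a factor with the label `none` or `some true`. -/
def sideTri : (b : Bool) → (side (D.X c) (D.Y c) b ⟶ triObj D.A.A D.X D.Y (c, optOf b))
  | false => 𝟙 (D.X c)
  | true => 𝟙 (D.Y c)

theorem sideTri_map : ∀ {b b' : Bool} (h : b ≤ b') (h' : optOf b = none ∨ optOf b = some b'),
    D.sideTri b ≫ triMap D.fX D.i c (optOf b) (some b') h' =
      sideMap (D.i c) h ≫ D.sideA b'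
  | false, false, _, _ => rfl
  | false, true, _, _ => (Category.id_comp _).trans (Category.comp_id _).symm
  | true, true, _, _ => rfl
  | true, false, h, _ => absurd h (by decide)

namespace Cocell
variable {D} {d : C} {N : M} (E : D.Cocell d N)

theorem val_balanced {r r' : Profile (C × Bool)} (g : r ⟶ r') (h : E.dom r.cnt)
    (h' : E.dom r'.cnt) :
    ((O.obj d).map (underMap g).op ▷ pw (twoObj D.A.A D.Y) r) ≫ E.val r h =
      ((O.obj d).obj (op r'.under) ◁ pwMap (twoObj D.A.A D.Y) g) ≫ E.val r' h' :=
  (bal_iff (tensDiag_inv (O.obj d) (underMap g)).1 (tensDiag_inv (O.obj d) (underMap g)).2).1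
    (E.val_perm g h h')

/-- The map out of `O(d; a, c, …, c) ⊗ A^a ⊗ V`, for a vertex `V` of the cube. -/
def vertGen {n : ℕ} (ε : Fin n → Bool) (a : Profile C) (h : E.dom (labApp a (repLab c ε)).cnt) :
    ((O.obj d).obj (op (a.append (rep n c))) ⊗ pw D.A.A a) ⊗ vert (D.X c) (D.Y c) ε ⟶ N :=
  (α_ _ _ _).hom ≫ (_ ◁ ((pw D.A.A a ◁ D.vertA ε) ≫ labCat D.A.A D.Y a (repLab c ε))) ≫
    E.val (labApp a (repLab c ε)) h

theorem vertGen_perm {n : ℕ} {ε ε' : Fin n → Bool} {a a' : Profile C} (g : a ⟶ a')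
    (σ : repLab c ε ⟶ repLab c ε') (h : E.dom (labApp a (repLab c ε)).cnt)
    (h' : E.dom (labApp a' (repLab c ε')).cnt)
    {s : vert (D.X c) (D.Y c) ε ⟶ vert (D.X c) (D.Y c) ε'}
    (hs : s ≫ D.vertA ε' = D.vertA ε ≫ pwMap (twoObj D.A.A D.Y) σ) :
    (((O.obj d).map (appendMap g (underMap σ)).op ▷ pw D.A.A a) ▷ _) ≫ E.vertGen ε a h =
      ((_ ◁ pwMap D.A.A g) ⊗ₘ s) ≫ E.vertGen ε' a' h' :=
  vertGen_perm_aux (E.val_balanced (labAppMap g σ) h h') (labCat_perm D.A.A D.Y g σ) hs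

theorem vertGen_rel {n : ℕ} (ε : Fin n → Bool) (a : Profile C) (b : Fin a.len → Profile C)
    (h : E.dom (labApp a (repLab c ε)).cnt) (h' : E.dom (labApp (concat b) (repLab c ε)).cnt) :
    ((_ ◁ bigTMap a.len fun i => tι (O.obj (a.col i)) (pwF D.A.A) (b i) ≫ D.A.a (a.col i)) ▷
        _) ≫ E.vertGen ε a h =
      ((shufP _ _ D.A.A b ≫ (O.shiftAct d (rep n c) a b ▷ pw D.A.A (concat b))) ▷ _) ≫
        E.vertGen ε (concat b) h' :=
  vertGen_rel_aux (E.val_rel a b (repLab c ε) h h')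

theorem vertGen_cube_aux {Z x V V' P P' T L L' N : M} {s : V ⟶ V'} {χ : V ⟶ P} {χ' : V' ⟶ P'}
    {l : x ⊗ P ⟶ L} {l' : x ⊗ P' ⟶ L'} {v : Z ⊗ L ⟶ N} {v' : Z ⊗ L' ⟶ N} {τ : x ⊗ V ⟶ T}
    {t : T ⟶ L} {t' : T ⟶ L'} (h : (x ◁ χ) ≫ l = τ ≫ t) (h' : (x ◁ (s ≫ χ')) ≫ l' = τ ≫ t')
    (hv : (Z ◁ t) ≫ v = (Z ◁ t') ≫ v') :
    ((Z ⊗ x) ◁ s) ≫ (α_ _ _ _).hom ≫ (Z ◁ ((x ◁ χ') ≫ l')) ≫ v' =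
      (α_ _ _ _).hom ≫ (Z ◁ ((x ◁ χ) ≫ l)) ≫ v := by
  rw [h, MonoidalCategory.whiskerLeft_comp_assoc Z τ t, hv, associator_naturality_right_assoc,
    ← MonoidalCategory.whiskerLeft_comp_assoc Z (x ◁ s), ← Category.assoc (x ◁ s),
    ← MonoidalCategory.whiskerLeft_comp x s, h', MonoidalCategory.whiskerLeft_comp_assoc]

theorem catT_left_aux {x V V' V'' L T : M} {s : V ⟶ V'} {t : V' ⟶ V''} {st : V ⟶ V''}
    {l : x ⊗ V'' ⟶ L} {k : x ⊗ V' ⟶ T} {z : T ⟶ L} (hst : s ≫ t = st)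
    (h : (x ◁ t) ≫ l = k ≫ z) : (x ◁ st) ≫ l = ((x ◁ s) ≫ k) ≫ z := by
  rw [← hst, MonoidalCategory.whiskerLeft_comp, Category.assoc, h, Category.assoc]

theorem catT_left (A : C → M) (a : Profile C) {X Y : C → M} {n : ℕ} {V : Fin n → M}
    {m : Fin n → Option Bool} {b : Fin n → Bool} (f : ∀ d, X d ⟶ A d) (i : ∀ d, X d ⟶ Y d)
    (s : ∀ k, V k ⟶ triObj A X Y (c, m k)) (h : ∀ k, m k = none ∨ m k = some (b k))
    (h' : ∀ s : Fin a.len ⊕ Fin n, (Sum.elim (fun _ => some false) m s : Option Bool) = none ∨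
      (Sum.elim (fun _ => some false) m s : Option Bool) = some (labSum b s)) :
    (pw A a ◁ (bigTMap n fun k => s k ≫ triMap f i c (m k) (some (b k)) (h k))) ≫
        labCat A Y a (repLab c b) =
      ((pw A a ◁ bigTMap n s) ≫ catT (fun s : Fin a.len ⊕ Fin n => triObj A X Y
        (Sum.elim a.col (fun _ => c) s, (Sum.elim (fun _ => some false) m s : Option Bool)))) ≫
      bigTMap (a.len + n) (fun k => triMap f i (Sum.elim a.col (fun _ => c) (finSumFinEquiv.symm k))
        (Sum.elim (fun _ => some false) m (finSumFinEquiv.symm k))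
        (some (labSum b (finSumFinEquiv.symm k))) (h' _)) := by
  have h1 := catT_nat fun s : Fin a.len ⊕ Fin n => triMap f i (Sum.elim a.col (fun _ => c) s)
    (Sum.elim (fun _ => some false) m s) (some (labSum b s)) (h' s)
  have h0 : (bigTMap a.len fun k => triMap f i (a.col k) (some false) (some false) (.inr rfl)) =
    𝟙 (pw A a) := bigTMap_id _ _
  have h1 := (congrArg (fun z => (z ⊗ₘ bigTMap n fun j => triMap f i c (m j) (some (b j)) (h j)) ≫
      labCat A Y a (repLab c b)) h0.symm).trans h1
  rw [id_tensorHom] at h1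
  exact catT_left_aux (bigTMap_comp _ _ _) h1

/-- The maps on the vertices are compatible with the edges of the cube: an edge maps a factor `X` to
`Y`, and by `val_tri` it may be mapped to `A` instead. -/
theorem vertGen_cube {n : ℕ} {ε ε' : Fin n → Bool} (hε : ∀ k, ε k ≤ ε' k) (a : Profile C)
    (h : E.dom (labApp a (repLab c ε)).cnt) (h' : E.dom (labApp a (repLab c ε')).cnt) :
    (_ ◁ bigTMap n fun k => sideMap (D.i c) (hε k)) ≫ E.vertGen ε' a h' = E.vertGen ε a h := by
  have h1 : ∀ k, optOf (ε k) = none ∨ optOf (ε k) = some (ε k) := fun k => by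
    rcases ε k with _ | _
    · exact .inl rfl
    · exact .inr rfl
  have h2 : ∀ k, optOf (ε k) = none ∨ optOf (ε k) = some (ε' k) := fun k => by
    rcases h1 k with h | h
    · exact .inl h
    · have := hε k
      revert this h
      rcases ε k with _ | _ <;> rcases ε' k with _ | _ <;> simp [optOf]
  have h3 : ∀ {b : Fin n → Bool} (_ : ∀ k, optOf (ε k) = none ∨ optOf (ε k) = some (b k))
      (s : Fin a.len ⊕ Fin n),
      (Sum.elim (fun _ => some false) (fun k => optOf (ε k)) s : Option Bool) = none ∨
      (Sum.elim (fun _ => some false) (fun k => optOf (ε k)) s : Option Bool) =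
        some (labSum b s) := by
    rintro b hb (k | k)
    · exact .inr rfl
    · exact hb k
  have e1 := catT_left D.A.A a D.fX D.i (fun k => D.sideTri (ε k)) h1 (h3 h1)
  have e2 := catT_left D.A.A a D.fX D.i (fun k => D.sideTri (ε k)) h2 (h3 h2)
  have r1 : (bigTMap n fun k => D.sideTri (ε k) ≫ triMap D.fX D.i c (optOf (ε k)) (some (ε k))
      (h1 k)) = D.vertA ε := congrArg (bigTMap n) (funext fun k =>
    (D.sideTri_map le_rfl (h1 k)).trans ((congrArg (fun z => z ≫ D.sideA (ε k))
      (sideMap_id _ _)).trans (Category.id_comp _)))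
  have r2 : (bigTMap n fun k => D.sideTri (ε k) ≫ triMap D.fX D.i c (optOf (ε k)) (some (ε' k))
      (h2 k)) = (bigTMap n fun k => sideMap (D.i c) (hε k)) ≫ D.vertA ε' :=
    (congrArg (bigTMap n) (funext fun k => D.sideTri_map (hε k) (h2 k))).trans
      (bigTMap_comp _ _ _).symm
  rw [r1] at e1
  rw [r2] at e2
  exact vertGen_cube_aux e1 e2 (E.val_tri (a.append (rep n c))
    (fun k => Sum.elim (fun _ => some false) (fun k => optOf (ε k)) (finSumFinEquiv.symm k))
    (fun k => labSum ε (finSumFinEquiv.symm k)) (fun k => labSum ε' (finSumFinEquiv.symm k))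
    (fun k => h3 h1 _) (fun k => h3 h2 _) h h')

end Cocell
end CellAttachment
end

/-! ### The map out of `O_A(d; c, …, c) ⊗ Q` given by a cocell -/

section
variable {M : Type u} [Category.{v} M] [MonoidalCategory M] [SymmetricCategory M] [MonoidalClosed M]
  [HasColimits M]

theorem whisker_cube_ext {X Y E N : M} {i : X ⟶ Y} {n q : ℕ} {f g : E ⊗ colimit (cubeF i n q) ⟶ N}
    (h : ∀ ε, (E ◁ cubeι i ε) ≫ f = (E ◁ cubeι i ε) ≫ g) : f = g := by
  refine MonoidalClosed.curry_injective (cube_ext i fun ε => ?_)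
  rw [← MonoidalClosed.curry_natural_left, ← MonoidalClosed.curry_natural_left, h]

theorem whisker_cube_desc {X Y E N : M} (i : X ⟶ Y) {n q : ℕ}
    (φ : ∀ ε : Cube n q, E ⊗ vert X Y ε.1 ⟶ N)
    (h : ∀ {ε ε' : Cube n q} (h : ε ≤ ε'), (E ◁ bigTMap n fun k => sideMap i (h k)) ≫ φ ε' = φ ε) :
    ∃ ψ : E ⊗ colimit (cubeF i n q) ⟶ N, ∀ ε, (E ◁ cubeι i ε) ≫ ψ = φ ε := by
  refine ⟨MonoidalClosed.uncurry (cubeDesc i (fun ε => MonoidalClosed.curry (φ ε)) fun hε => ?_),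
    fun ε => ?_⟩
  · rw [← MonoidalClosed.curry_natural_left, h]
  · rw [← MonoidalClosed.uncurry_natural_left, cubeι_desc, MonoidalClosed.uncurry_curry]

end

section
variable {C : Type v} {M : Type u} [Category.{v} M] [MonoidalCategory M] [SymmetricCategory M]
  [MonoidalClosed M] [HasColimits M]
open Profile

/-- The permutation of `(c, …, c)` that carries the labels of a vertex of the cube to those of the
permuted vertex. -/
def Profile.repLabPerm {n q : ℕ} (c : C) (σ : Fin n ≃ Fin n) (ε : Cube n q) :
    repLab c ε.1 ⟶ repLab c (ε.perm σ).1 :=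
  Hom.mk σ fun k => congrArg (fun l => (c, ε.1 l)) (σ.symm_apply_apply k)

namespace CellAttachment
variable {O : Operad C M} {c : C} (D : CellAttachment O c)

theorem sideA_cast {b b' : Bool} (e : b = b') :
    eqToHom (congrArg (side (D.X c) (D.Y c)) e) ≫ D.sideA b' =
      D.sideA b ≫ eqToHom (congrArg (fun b => twoObj D.A.A D.Y (c, b)) e) := by
  subst e
  exact (Category.id_comp _).trans (Category.comp_id _).symm

theorem vertA_perm {n q : ℕ} (σ : Fin n ≃ Fin n) (ε : Cube n q) :
    cubePerm (D.X c) (D.Y c) σ ε ≫ D.vertA (ε.perm σ).1 =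
      D.vertA ε.1 ≫ pwMap (twoObj D.A.A D.Y) (repLabPerm c σ ε) := by
  refine (reindex_post (F := fun k => side (D.X c) (D.Y c) ((ε.perm σ).1 k)) σ _ _).trans
    (Eq.trans ?_ (reindex_pre (F := fun k => twoObj D.A.A D.Y (c, (ε.perm σ).1 k)) σ _ _).symm)
  exact congrArg (reindex σ) (funext fun k =>
    D.sideA_cast (congrArg ε.1 (σ.symm_apply_apply k).symm))

namespace Cocell
variable {D} {d : C} {N : M} (E : D.Cocell d N)

theorem perm_left_aux {W U V E E' S N : M} {p : U ⟶ E} {p' : W ⟶ E'} {m : E ⟶ E'} {w : U ⟶ W}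
    {s : V ⟶ S} {φ : E' ⊗ V ⟶ N} {ψ : E ⊗ S ⟶ N} {v : W ⊗ V ⟶ N} {v' : U ⊗ S ⟶ N}
    (hp : p ≫ m = w ≫ p') (hφ : (p' ▷ V) ≫ φ = v) (hψ : (p ▷ S) ≫ ψ = v')
    (h : (w ▷ V) ≫ v = (U ◁ s) ≫ v') :
    (p ▷ V) ≫ (m ▷ V) ≫ φ = (p ▷ V) ≫ (E ◁ s) ≫ ψ := by
  rw [← comp_whiskerRight_assoc, hp, comp_whiskerRight_assoc, hφ, h, ← whisker_exchange_assoc, hψ]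

theorem perm_cube_aux {E E' V V' Q N : M} {m : E ⟶ E'} {ι : V ⟶ Q} {ι' : V' ⟶ Q} {s : V ⟶ V'}
    {a : Q ⟶ Q} {ψ : E' ⊗ Q ⟶ N} {ψ' : E ⊗ Q ⟶ N} {φ : E' ⊗ V ⟶ N} {φ' : E ⊗ V' ⟶ N}
    (ha : ι ≫ a = s ≫ ι') (hφ : (E' ◁ ι) ≫ ψ = φ) (hφ' : (E ◁ ι') ≫ ψ' = φ')
    (h : (m ▷ V) ≫ φ = (E ◁ s) ≫ φ') :
    (E ◁ ι) ≫ (m ▷ Q) ≫ ψ = (E ◁ ι) ≫ (E ◁ a) ≫ ψ' := by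
  rw [whisker_exchange_assoc, hφ, h, ← MonoidalCategory.whiskerLeft_comp_assoc, ha,
    MonoidalCategory.whiskerLeft_comp_assoc, hφ']

theorem desc_gen_aux {U V E Q T N : M} {p : U ⟶ E} {ι : V ⟶ Q} {τ : E ⊗ Q ⟶ T} {F : T ⟶ N}
    {ψ : E ⊗ Q ⟶ N} {φ : E ⊗ V ⟶ N} {v : U ⊗ V ⟶ N} (hF : τ ≫ F = ψ) (hψ : (E ◁ ι) ≫ ψ = φ)
    (hφ : (p ▷ V) ≫ φ = v) : (p ⊗ₘ ι) ≫ τ ≫ F = v := by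
  rw [hF, MonoidalCategory.tensorHom_def, Category.assoc, hψ, hφ]

/-- The maps `vertGen` define a map out of `O_A(d; c, …, c) ⊗_{Σ_n} Q^n_q`. -/
theorem exists_desc (n q : ℕ)
    (hE : ∀ (ε : Cube n q) (a : Profile C), E.dom (labApp a (repLab c ε.1)).cnt) :
    ∃ F : tensorOver (O.envRep D.A d n c) (Q (D.i c) n q) ⟶ N, ∀ (a : Profile C) (ε : Cube n q),
      (O.envι D.A d a (rep n c) ⊗ₘ cubeι (D.i c) ε) ≫
        tι (O.envRep D.A d n c) (Q (D.i c) n q) (BSym.pt n) ≫ F = E.vertGen ε.1 a (hE ε a) := by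
  -- First the factor `A^a` is divided out, for each vertex, then the vertices are glued, and
  -- finally the action of `Σ_n` is divided out.
  have h1 : ∀ ε : Cube n q, ∃ φ : (O.env D.A d).obj (op (rep n c)) ⊗ vert (D.X c) (D.Y c) ε.1 ⟶ N,
      ∀ a, (O.envι D.A d a (rep n c) ▷ _) ≫ φ = E.vertGen ε.1 a (hE ε a) := fun ε =>
    O.env_desc D.A (fun a => E.vertGen ε.1 a (hE ε a))
      (fun {a a'} g => by
        have := E.vertGen_perm g (𝟙 (repLab c ε.1)) (hE ε a) (hE ε a')
          (s := 𝟙 _) (by rw [pwMap_id]; exact (Category.id_comp _).trans (Category.comp_id _).symm)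
        rw [tensorHom_id] at this
        exact this)
      (fun a b => E.vertGen_rel ε.1 a b (hE ε a) (hE ε (concat b)))
  choose φ hφ using h1
  obtain ⟨ψ, hψ⟩ := whisker_cube_desc (D.i c) φ (fun {ε ε'} h => O.env_ext D.A fun a => by
    rw [← whisker_exchange_assoc, hφ, hφ]
    exact E.vertGen_cube h a (hE ε a) (hE ε' a))
  refine ⟨tdesc (O.envRep D.A d n c) (Q (D.i c) n q) (fun _ => ψ) (fun {x y} σ => ?_),
    fun a ε => ?_⟩
  · refine whisker_cube_ext fun ε => ?_
    refine perm_cube_aux (ι_cubeAct (D.i c) (σ : Equiv.Perm (Fin n)) ε) (hψ ε)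
      (hψ (ε.perm (σ : Equiv.Perm (Fin n)))) (O.env_ext D.A fun a => ?_)
    refine perm_left_aux (O.envι_map D.A d a (Operad.repMap (σ : Equiv.Perm (Fin n)) c)) (hφ ε a)
      (hφ (ε.perm (σ : Equiv.Perm (Fin n))) a) ?_
    have := E.vertGen_perm (𝟙 a) (repLabPerm c (σ : Equiv.Perm (Fin n)) ε) (hE ε a)
      (hE (ε.perm (σ : Equiv.Perm (Fin n))) a) (D.vertA_perm _ ε)
    rw [pwMap_id, MonoidalCategory.whiskerLeft_id, id_tensorHom] at this
    exact this
  · exact desc_gen_aux (tι_desc (O.envRep D.A d n c) (Q (D.i c) n q) _ _ _) (hψ ε) (hφ ε a)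

end Cocell
end CellAttachment
end

section
variable {M : Type u} [Category.{v} M] [MonoidalCategory M]

theorem vertGen_head_aux {Z x V P D N : M} {χ χ' : V ⟶ P} {l : x ⊗ P ⟶ D} {v : Z ⊗ D ⟶ N}
    {w : (Z ⊗ x) ⊗ V ⟶ N} (hχ : χ = χ')
    (h : (𝟙 Z ⊗ₘ ((x ◁ χ') ≫ l ≫ 𝟙 D)) ≫ v = (α_ _ _ _).inv ≫ w) :
    (α_ _ _ _).hom ≫ (Z ◁ ((x ◁ χ) ≫ l)) ≫ v = w := by
  rw [Category.comp_id, id_tensorHom] at h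
  rw [hχ, h, Iso.hom_inv_id_assoc]

theorem vertGen_full_aux {Z x V D K N : M} {χ : V ⟶ V} {l : x ⊗ V ⟶ D} {φ : Z ⊗ D ⟶ K}
    {w : (Z ⊗ x) ⊗ V ⟶ K} (hχ : χ = 𝟙 V) (h : (Z ◁ l) ≫ φ = (α_ _ _ _).inv ≫ w) (ψ : K ⟶ N) :
    (α_ _ _ _).hom ≫ (Z ◁ ((x ◁ χ) ≫ l)) ≫ φ ≫ ψ = w ≫ ψ := by
  rw [hχ, MonoidalCategory.whiskerLeft_id, Category.id_comp, reassoc_of% h, Iso.hom_inv_id_assoc]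

theorem vertGen_comp_aux {x y z K N N' : M} (f : x ⟶ y) (g : y ⟶ z) (φ : z ⟶ K) {m : K ⟶ N}
    {θ : N ⟶ N'} {m' : K ⟶ N'} (h : m ≫ θ = m') : (f ≫ g ≫ φ ≫ m) ≫ θ = f ≫ g ≫ φ ≫ m' := by
  rw [← h]
  simp only [Category.assoc]

theorem gen_comp_aux {U E V Q Y T T' N : M} {p : U ⟶ E} {ι : V ⟶ Q} {τ : E ⊗ Q ⟶ T} {t : T ⟶ T'}
    {k : Q ⟶ Y} {τ' : E ⊗ Y ⟶ T'} {s : V ⟶ Y} {e : U ⊗ Y ⟶ T'} {w : T' ⟶ N}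
    (ht : τ ≫ t = (𝟙 E ⊗ₘ k) ≫ τ') (hs : ι ≫ k = s) (he : e = (p ▷ Y) ≫ τ') :
    (p ⊗ₘ ι) ≫ τ ≫ t ≫ w = (U ◁ s) ≫ e ≫ w := by
  rw [reassoc_of% ht, tensorHom_comp_tensorHom_assoc, Category.comp_id, hs,
    MonoidalCategory.tensorHom_def', he, Category.assoc, Category.assoc]

end

section
variable {M : Type u} [Category.{v} M] [MonoidalCategory M] {X Y : M} (i : X ⟶ Y)

theorem sideMap_true : ∀ {b : Bool} (h : b ≤ true), sideMap i h = sideTo i b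
  | false, _ => rfl
  | true, _ => rfl

theorem cubeι_to [SymmetricCategory M] [HasColimits M] {n q : ℕ} (ε : Cube n q) :
    cubeι i ε ≫ cubeTo i n q = bigTMap n fun k => sideTo i (ε.1 k) := cubeι_desc _ _ _ _

end

section
variable {C : Type v} {M : Type u} [Category.{v} M] [MonoidalCategory M] [SymmetricCategory M]
  [MonoidalClosed M] [HasColimits M]
open Profile

theorem Operad.gen_ext (O : Operad C M) (A : O.monad.Algebra) {d c : C} {n q : ℕ} {X Y N : M}
    {i : X ⟶ Y} {f g : tensorOver (O.envRep A d n c) (Q i n q) ⟶ N}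
    (h : ∀ (a : Profile C) (ε : Cube n q), (O.envι A d a (rep n c) ⊗ₘ cubeι i ε) ≫
        tι (O.envRep A d n c) (Q i n q) (BSym.pt n) ≫ f =
      (O.envι A d a (rep n c) ⊗ₘ cubeι i ε) ≫
        tι (O.envRep A d n c) (Q i n q) (BSym.pt n) ≫ g) : f = g := by
  refine t_ext fun _ => whisker_cube_ext fun ε => O.env_ext A fun a => ?_
  have h := h a ε
  rw [MonoidalCategory.tensorHom_def, Category.assoc, Category.assoc] at h
  exact h

theorem Operad.envGen_ext (O : Operad C M) (A : O.monad.Algebra) {d c : C} {n : ℕ} {Y N : M}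
    {f g : tensorOver (O.envRep A d n c) (powF Y n) ⟶ N}
    (h : ∀ a : Profile C, O.envGen A Y d a n c ≫ f = O.envGen A Y d a n c ≫ g) : f = g := by
  refine t_ext fun _ => O.env_ext A fun a => ?_
  exact (Category.assoc _ _ _).symm.trans ((h a).trans (Category.assoc _ _ _))

namespace CellAttachment
variable {O : Operad C M} {c : C} (D : CellAttachment O c)

namespace Cocell
variable {D} {d : C} {N : M} (E : D.Cocell d N)

/-- On the vertex `X ⊗ Y ⊗ ⋯ ⊗ Y` the map is given by `X_c ⟶ A_c`. -/
theorem vertGen_head (a : Profile C) (t : ℕ)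
    (h : E.dom (labApp a (repLab c (Fin.cons false fun _ => true : Fin (t + 1) → Bool))).cnt)
    (ht : E.dom t) :
    E.vertGen (Fin.cons false fun _ => true : Fin (t + 1) → Bool) a h =
      D.attach d a t ≫ O.envGen D.A (D.Y c) d (a.append (single c)) t c ≫ E.map t ht := by
  have hq : (labApp a (headLab t c false)).cnt = t :=
    (cnt_congr (shiftLab a t c)).symm.trans (cnt_sorted (a.append (single c)) t c)
  have s0 := O.sort_labGen D.A D.initialY d (labApp a (headLab t c false)) t hq (shiftLab a t c)
  have b0 : D.vertA (Fin.cons false fun _ => true : Fin (t + 1) → Bool) =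
      (D.fX c ⊗ₘ 𝟙 (bigT t fun _ => D.Y c)) :=
    congrArg (fun z => D.fX c ⊗ₘ z) (bigTMap_id t fun _ => D.Y c)
  have hp : 𝟙 ((O.obj d).obj (op (a.append (rep (t + 1) c)))) = (O.obj d).map (shiftRep a t c).op ≫
        (O.obj d).map (underMap (Groupoid.inv (shiftLab a t c))).op := by
    refine Eq.trans ((O.obj d).map_id _).symm (Eq.trans (op_congr (O.obj d)
      (g := underMap (Groupoid.inv (shiftLab a t c)) ≫ shiftRep a t c) (hom_ext fun k => ?_))
        ((O.obj d).map_comp (shiftRep a t c).op (underMap (Groupoid.inv (shiftLab a t c))).op))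
    exact ((shiftRep a t c).σ.apply_symm_apply _).symm
  have key := labGen_flip_aux hp (Category.comp_id _).symm (labCat_shift D.A.A D.Y a t c)
    s0 (D.fX c)
    (E.map t ht)
  rw [vertGen, E.val_eq _ h t hq]
  exact vertGen_head_aux b0 key

theorem vertGen_full (a : Profile C) (n : ℕ)
    (h : E.dom (labApp a (repLab c fun _ : Fin n => true)).cnt) (hn : E.dom n) :
    E.vertGen (fun _ : Fin n => true) a h = O.envGen D.A (D.Y c) d a n c ≫ E.map n hn := by
  have s0 := O.labGen_sorted D.A D.initialY d a n (cnt_sorted a n c)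
  rw [vertGen, E.val_eq _ h n (cnt_sorted a n c)]
  exact vertGen_full_aux (bigTMap_id n fun _ => D.Y c) s0 _

theorem vertGen_comp {N' : M} (E' : D.Cocell d N') (θ : N ⟶ N')
    (hθ : ∀ q h h', E.map q h ≫ θ = E'.map q h') {n : ℕ} (ε : Fin n → Bool) (a : Profile C)
    (h : E.dom (labApp a (repLab c ε)).cnt) (h' : E'.dom (labApp a (repLab c ε)).cnt) :
    E.vertGen ε a h ≫ θ = E'.vertGen ε a h' :=
  vertGen_comp_aux _ _ _ (hθ _ _ h')

/-- If `θ` carries the cocell `E` to a cocell `E'` that is defined up to `n`, then it carries the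
map out of `O_A(d; c, …, c) ⊗ Q` given by `E` to the corner map followed by `E'.map n`. -/
theorem desc_comp {N' : M} (E' : D.Cocell d N') (θ : N ⟶ N')
    (hθ : ∀ q h h', E.map q h ≫ θ = E'.map q h') {n q : ℕ}
    (hE : ∀ (ε : Cube n q) (a : Profile C), E.dom (labApp a (repLab c ε.1)).cnt)
    (hE' : ∀ q, q ≤ n → E'.dom q)
    {F : tensorOver (O.envRep D.A d n c) (Q (D.i c) n q) ⟶ N}
    (hF : ∀ (a : Profile C) (ε : Cube n q), (O.envι D.A d a (rep n c) ⊗ₘ cubeι (D.i c) ε) ≫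
        tι (O.envRep D.A d n c) (Q (D.i c) n q) (BSym.pt n) ≫ F = E.vertGen ε.1 a (hE ε a)) :
    F ≫ θ = tmap (𝟙 (O.envRep D.A d n c)) (corner (D.i c) n q) ≫ E'.map n (hE' n le_rfl) := by
  have hd : ∀ (ε : Fin n → Bool) (a : Profile C), E'.dom (labApp a (repLab c ε)).cnt :=
    fun ε a => hE' _ ((repLab_cnt a c ε).trans_le ((Finset.card_le_univ _).trans_eq (by simp)))
  refine O.gen_ext D.A fun a ε => ?_
  have hle : ∀ k, ε.1 k ≤ (fun _ : Fin n => true) k := fun k => Bool.le_true _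
  have h1 := (E'.vertGen_cube hle a (hd _ _) (hd _ _)).symm
  rw [E'.vertGen_full a n _ (hE' n le_rfl)] at h1
  have h2 := (Category.assoc _ _ _).symm.trans ((Category.assoc _ _ _).symm.trans
    ((congrArg (fun z => z ≫ θ) ((Category.assoc _ _ _).trans (hF a ε))).trans
      (E.vertGen_comp E' θ hθ ε.1 a _ (hd _ _))))
  refine h2.trans (h1.trans (Eq.symm (gen_comp_aux (s := bigTMap n fun k => sideMap (D.i c) (hle k))
    (tι_map (𝟙 (O.envRep D.A d n c)) (corner (D.i c) n q) (BSym.pt n)) ?_ rfl)))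
  exact (cubeι_to (D.i c) ε).trans (congrArg (bigTMap n) (funext fun k =>
    (sideMap_true (D.i c) (hle k)).symm))

end Cocell
end CellAttachment
end

/-! ### Functoriality of `O_A` and the action on an algebra -/

section
variable {C : Type v} {M : Type u} [Category.{v} M] [MonoidalCategory M] [SymmetricCategory M]
  [MonoidalClosed M] [HasColimits M]
open Profile

theorem pwCat_perm (X : C → M) {a a' b b' : Profile C} (f : a ⟶ a') (g : b ⟶ b') :
    (pwMap X f ⊗ₘ pwMap X g) ≫ pwCat X a' b' = pwCat X a b ≫ pwMap X (appendMap f g) := by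
  have e : ∀ s, Sum.elim a.col b.col s = Sum.elim a'.col b'.col (Equiv.sumCongr f.σ g.σ s) := by
    rintro (i | j)
    · exact (f.col_σ i).symm
    · exact (g.col_σ j).symm
  have h := catT_reindex (G' := fun s => X (Sum.elim a'.col b'.col s)) f.σ g.σ
    fun s => eqToHom (congrArg X (e s))
  simp only [eqToHom_trans] at h
  exact h

theorem pwCat_nat {X Y : C → M} (g : ∀ c, X c ⟶ Y c) (a b : Profile C) :
    (pwTrans g a ⊗ₘ pwTrans g b) ≫ pwCat Y a b = pwCat X a b ≫ pwTrans g (a.append b) :=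
  catT_nat fun s => g (Sum.elim a.col b.col s)

/-- `Y ⊗ ⋯ ⊗ Y` is natural in `Y`. -/
def powMap {Y Y' : M} (y : Y ⟶ Y') (t : ℕ) : powF Y t ⟶ powF Y' t where
  app _ := bigTMap t fun _ => y
  naturality _ _ σ := (permT_nat (σ : Equiv.Perm (Fin t)) fun _ => y).symm

/-- The functors `Y ⊗ ⋯ ⊗ Y` with no factors are the same. -/
def powZero (Y Y' : M) : powF Y 0 ⟶ powF Y' 0 where
  app _ := 𝟙 (𝟙_ M)
  naturality _ _ σ := by
    obtain rfl : σ = (Equiv.refl (Fin 0) : Equiv.Perm (Fin 0)) :=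
      Subsingleton.elim (α := Equiv.Perm (Fin 0)) _ _
    have h : ∀ Z : M, (powF Z 0).map (X := BSym.pt 0) (Y := BSym.pt 0)
      (Equiv.refl (Fin 0) : Equiv.Perm (Fin 0)) = 𝟙 (𝟙_ M) := fun Z => permT_refl _
    exact (congrArg (fun z => z ≫ 𝟙 (𝟙_ M)) (h Y)).trans
      (congrArg (fun z => 𝟙 (𝟙_ M) ≫ z) (h Y')).symm

namespace Operad
variable (O : Operad C M) {A B : O.monad.Algebra} (φ : A ⟶ B)

theorem hom_act (d : C) : circMap (O.obj d) φ.f ≫ B.a d = A.a d ≫ φ.f d := congrFun φ.h d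

theorem env0_nat (d : C) (κ : Profile C) :
    O.env0 A d κ ≫ circMap (O.shift d κ) φ.f =
      circMap (O.shift d κ) (fun c => circMap (O.obj c) φ.f) ≫ O.env0 B d κ :=
  ((O.shiftRight d κ).map_nat φ.f).symm

theorem env1_nat (d : C) (κ : Profile C) :
    O.env1 A d κ ≫ circMap (O.shift d κ) φ.f =
      circMap (O.shift d κ) (fun c => circMap (O.obj c) φ.f) ≫ O.env1 B d κ :=
  (circMap_comp _ _ _).symm.trans ((congrArg (circMap (O.shift d κ)) (funext fun c =>
    (O.hom_act φ c).symm)).trans (circMap_comp _ _ _))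

theorem envApp_aux {V V' W W' L : M} {e0 e1 : V ⟶ W} {e0' e1' : V' ⟶ W'} {g : V ⟶ V'} {h : W ⟶ W'}
    {π : W' ⟶ L} (h0 : e0 ≫ h = g ≫ e0') (h1 : e1 ≫ h = g ≫ e1') (hπ : e0' ≫ π = e1' ≫ π) :
    e0 ≫ h ≫ π = e1 ≫ h ≫ π := by
  rw [reassoc_of% h0, hπ, reassoc_of% h1]

/-- The map `O_A(d; κ) ⟶ O_B(d; κ)` given by a morphism of algebras. -/
def envApp (d : C) (κ : Profile C) : (O.env A d).obj (op κ) ⟶ (O.env B d).obj (op κ) :=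
  coequalizer.desc (f := O.env0 A d κ) (g := O.env1 A d κ)
    (circMap (O.shift d κ) φ.f ≫ coequalizer.π (O.env0 B d κ) (O.env1 B d κ))
    (envApp_aux (O.env0_nat φ d κ) (O.env1_nat φ d κ) (coequalizer.condition _ _))

theorem comp_square_left_aux {x y z y' w w' : M} {i : x ⟶ y} {p : y ⟶ z} {e : z ⟶ w} {c : y ⟶ y'}
    {p' : y' ⟶ w}
    {t : x ⟶ w'} {i' : w' ⟶ y'} (h : p ≫ e = c ≫ p') (h' : i ≫ c = t ≫ i') :
    (i ≫ p) ≫ e = t ≫ i' ≫ p' := by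
  rw [Category.assoc, h, reassoc_of% h']

theorem envι_app (d : C) (a κ : Profile C) :
    O.envι A d a κ ≫ O.envApp φ d κ = (_ ◁ pwTrans φ.f a) ≫ O.envι B d a κ :=
  comp_square_left_aux (coequalizer.π_desc (f := O.env0 A d κ) (g := O.env1 A d κ) _ _)
    (ι_circMap (O.shift d κ) φ.f a)

theorem env_hom_ext {d : C} {κ : Profile C} {N : M} {f g : (O.env A d).obj (op κ) ⟶ N}
    (h : ∀ a, O.envι A d a κ ≫ f = O.envι A d a κ ≫ g) : f = g :=
  coequalizer.hom_ext (t_ext fun a => (Category.assoc _ _ _).symm.trans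
    ((h a).trans (Category.assoc _ _ _)))

theorem envMap_aux {x y Z Z' E E0 E' E0' : M} {p : Z ⟶ Z'} {t : x ⟶ y} {i : Z ⊗ x ⟶ E}
    {m : E ⟶ E0} {i0 : Z' ⊗ x ⟶ E0} {α : E0 ⟶ E0'} {i0' : Z' ⊗ y ⟶ E0'} {i' : Z ⊗ y ⟶ E'}
    {α' : E ⟶ E'} {m' : E' ⟶ E0'} (h1 : i ≫ m = (p ▷ x) ≫ i0) (h2 : i0 ≫ α = (Z' ◁ t) ≫ i0')
    (h3 : i ≫ α' = (Z ◁ t) ≫ i') (h4 : i' ≫ m' = (p ▷ y) ≫ i0') :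
    i ≫ m ≫ α = i ≫ α' ≫ m' := by
  rw [reassoc_of% h1, h2, reassoc_of% h3, h4, whisker_exchange_assoc]

/-- A morphism of algebras gives a map of the objects `O_A(d; c)`, with the actions of
permutations. -/
def envMap (d : C) : O.env A d ⟶ O.env B d where
  app κ := O.envApp φ d κ.unop
  naturality κ κ' h := O.env_hom_ext fun a =>
    envMap_aux (O.envι_map A d a h.unop) (O.envι_app φ d a κ'.unop) (O.envι_app φ d a κ.unop)
      (O.envι_map B d a h.unop)

/-- The map of the objects `O_A(d; c, …, c)` given by a morphism of algebras. -/
abbrev envRepMap (d : C) (t : ℕ) (c : C) : O.envRep A d t c ⟶ O.envRep B d t c :=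
  Functor.whiskerLeft (repF t c).op (O.envMap φ d)

theorem envGen_map_aux {U U' E E' V V' T T' : M} {i : U ⟶ E} {α : E ⟶ E'} {u : U ⟶ U'}
    {i' : U' ⟶ E'}
    {τ : E ⊗ V ⟶ T} {m : T ⟶ T'} {y : V ⟶ V'} {τ' : E' ⊗ V' ⟶ T'} (h : τ ≫ m = (α ⊗ₘ y) ≫ τ')
    (hi : i ≫ α = u ≫ i') : ((i ▷ V) ≫ τ) ≫ m = (u ⊗ₘ y) ≫ (i' ▷ V') ≫ τ' := by
  rw [Category.assoc, h, ← tensorHom_id, ← tensorHom_id, tensorHom_comp_tensorHom_assoc,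
    tensorHom_comp_tensorHom_assoc, hi, Category.id_comp, Category.comp_id]

theorem envGen_map {Y Y' : M} (d : C) (a : Profile C) (t : ℕ) (c : C)
    (y : powF Y t ⟶ powF Y' t) :
    O.envGen A Y d a t c ≫ tmap (O.envRepMap φ d t c) y =
      ((_ ◁ pwTrans φ.f a) ⊗ₘ y.app (BSym.pt t)) ≫ O.envGen B Y' d a t c :=
  envGen_map_aux (tι_map (O.envRepMap φ d t c) y (BSym.pt t)) (O.envι_app φ d a (rep t c))

variable (B)

theorem actRep_rel_aux {W S a κ T V Z B' W' V' N : M} {act : S ⟶ a} {c : a ⊗ κ ⟶ T} {i : W ⊗ T ⟶ V}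
    {s : W ⊗ S ⟶ Z ⊗ B'} {w : Z ⟶ W'} {c' : B' ⊗ κ ⟶ V'} {i' : W' ⊗ V' ⟶ V} {β : V ⟶ N}
    (h : (W ◁ (act ▷ κ)) ≫ (W ◁ c) ≫ i ≫ β =
      ((α_ _ _ _).inv ≫ (s ▷ κ) ≫ (α_ _ _ _).hom) ≫ (w ⊗ₘ c') ≫ i' ≫ β) :
    ((W ◁ act) ▷ κ) ≫ (α_ _ _ _).hom ≫ (W ◁ c) ≫ i ≫ β =
      ((s ≫ (w ▷ B')) ▷ κ) ≫ (α_ _ _ _).hom ≫ (W' ◁ c') ≫ i' ≫ β := by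
  rw [associator_naturality_middle_assoc, h, MonoidalCategory.tensorHom_def]
  simp

/-- The action on `(B^a, B^κ)`, where the elements of `B^a` are results of operations. -/
theorem act_rel (d : C) (a κ : Profile C) (b : Fin a.len → Profile C) :
    ((O.obj d).obj (op (a.append κ)) ◁ ((bigTMap a.len fun i =>
        tι (O.obj (a.col i)) (pwF B.A) (b i) ≫ B.a (a.col i)) ▷ pw B.A κ)) ≫
      (_ ◁ pwCat B.A a κ) ≫ tι (O.obj d) (pwF B.A) (a.append κ) ≫ B.a d =
    ((α_ _ _ _).inv ≫ (shufP _ _ B.A b ▷ pw B.A κ) ≫ (α_ _ _ _).hom) ≫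
      (O.shiftAct d κ a b ⊗ₘ pwCat B.A (concat b) κ) ≫
        tι (O.obj d) (pwF B.A) ((concat b).append κ) ≫ B.a d := by
  have h0 := (O.self d).map_pad B.A a κ b
  have hact : (bigTMap a.len fun i => tι (O.obj (a.col i)) (pwF B.A) (b i) ≫ B.a (a.col i)) =
      bigTMap a.len (fun i => tι (O.obj (a.col i)) (pwF B.A) (b i)) ≫ pwTrans B.a a :=
    (bigTMap_comp _ _ _).symm
  have hu : pwTrans (O.unit B.A) κ ≫ pwTrans B.a κ = 𝟙 (pw B.A κ) :=
    (bigTMap_comp _ _ _).trans ((congrArg (bigTMap κ.len) (funext fun j =>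
      O.unit_act B (κ.col j))).trans (bigTMap_id _ _))
  have hc := pwCat_nat B.a a κ
  have h1 := ι_circMap (O.obj d) B.a (a.append κ)
  have hπ : (O.self d).map B.A ≫ B.a d = circMap (O.obj d) B.a ≫ B.a d := congrFun B.assoc d
  have h := envι_rel_aux hact hu hc h1 hπ (h0.trans (Category.assoc _ _ _).symm)
  exact h.trans (Category.assoc _ _ _)

theorem act_w (d : C) {a b : Profile C} (g : a ⟶ b) :
    ((O.obj d).map g.op ▷ pw B.A a) ≫ tι (O.obj d) (pwF B.A) a ≫ B.a d =
      (_ ◁ pwMap B.A g) ≫ tι (O.obj d) (pwF B.A) b ≫ B.a d :=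
  (Category.assoc _ _ _).symm.trans ((congrArg (fun z => z ≫ B.a d)
    (tι_w (O.obj d) (pwF B.A) g)).trans (Category.assoc _ _ _))

theorem actRep_perm_aux {Z Z' x x' V V' L L' N : M} {p : Z' ⟶ Z} {m : L ⟶ L'} {f : x ⟶ x'}
    {s : V ⟶ V'} {l : x ⊗ V ⟶ L} {l' : x' ⊗ V' ⟶ L'}
    {v : Z ⊗ L ⟶ N} {v' : Z' ⊗ L' ⟶ N} (hv : (p ▷ L) ≫ v = (Z' ◁ m) ≫ v')
    (hl : (f ⊗ₘ s) ≫ l' = l ≫ m) :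
    ((p ▷ x) ▷ V) ≫ (α_ _ _ _).hom ≫ (Z ◁ l) ≫ v =
      ((Z' ◁ f) ⊗ₘ s) ≫ (α_ _ _ _).hom ≫ (Z' ◁ l') ≫ v' := by
  have h := vertGen_perm_aux (s := s) (χ := 𝟙 V) (χ' := 𝟙 V') hv hl
    ((Category.comp_id _).trans (Category.id_comp _).symm)
  rw [MonoidalCategory.whiskerLeft_id, MonoidalCategory.whiskerLeft_id, Category.id_comp,
    Category.id_comp] at h
  exact h

theorem actRep_perm (d : C) {a a' : Profile C} (g : a ⟶ a') {t : ℕ} (c : C)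
    (π : Equiv.Perm (Fin t)) :
    (((O.obj d).map (appendMap g (repMap π c)).op ▷ pw B.A a) ▷ bigT t fun _ => B.A c) ≫
        O.actRep B d a t c =
      ((_ ◁ pwMap B.A g) ⊗ₘ permT π fun _ => B.A c) ≫ O.actRep B d a' t c := by
  have h : pwMap B.A (repMap π c) = permT π fun _ => B.A c :=
    (congrArg (fun z => z ≫ permT π fun _ => B.A c) (bigTMap_id t fun _ => B.A c)).trans
      (Category.id_comp _)
  exact actRep_perm_aux (O.act_w B d (appendMap g (repMap π c)))
    ((congrArg (fun z => (pwMap B.A g ⊗ₘ z) ≫ pwCat B.A a' (rep t c)) h.symm).trans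
      (pwCat_perm B.A g (repMap π c)))

/-- The action of `O` on `B` as a map out of `O_B(d; c, …, c) ⊗_{Σ_t} (B_c ⊗ ⋯ ⊗ B_c)`. -/
theorem exists_act (d : C) (t : ℕ) (c : C) :
    ∃ ζ : tensorOver (O.envRep B d t c) (powF (B.A c) t) ⟶ B.A d,
      ∀ a, O.envGen B (B.A c) d a t c ≫ ζ = O.actRep B d a t c := by
  obtain ⟨ψ, hψ⟩ := O.env_desc B (fun a => O.actRep B d a t c)
    (fun {a a'} g => by
      have := O.actRep_perm B d g c (Equiv.refl (Fin t))
      rw [permT_refl, tensorHom_id] at this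
      exact this)
    (fun a b => actRep_rel_aux (O.act_rel B d a (rep t c) b))
  refine ⟨tdesc (O.envRep B d t c) (powF (B.A c) t) (fun _ => ψ) (fun {x y} σ => ?_), fun a => ?_⟩
  · refine O.env_ext B fun a => ?_
    have := O.actRep_perm B d (𝟙 a) c (σ : Equiv.Perm (Fin t))
    rw [pwMap_id, MonoidalCategory.whiskerLeft_id, id_tensorHom] at this
    exact CellAttachment.Cocell.perm_left_aux (O.envι_map B d a (repMap
      (σ : Equiv.Perm (Fin t)) c)) (hψ a) (hψ a) this
  · exact (Category.assoc _ _ _).trans ((congrArg (fun z => _ ≫ z)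
      (tι_desc (O.envRep B d t c) (powF (B.A c) t) _ _ _)).trans (hψ a))

end Operad
end

/-! ### The cocell of the pushout -/

section
variable {M : Type u} [Category.{v} M] [MonoidalCategory M]

theorem actRep_shift_aux {Z Z' x X Q y L L' N : M} {s : Z' ⟶ Z} {l0 : x ⊗ X ⟶ y} {l1 : y ⊗ Q ⟶ L}
    {m : L ⟶ L'} {l' : x ⊗ (X ⊗ Q) ⟶ L'} {v : Z ⊗ L ⟶ N} {v' : Z' ⊗ L' ⟶ N}
    (hl : (l0 ▷ Q) ≫ l1 ≫ m = (α_ _ _ _).hom ≫ l') (hv : (s ▷ L) ≫ v = (Z' ◁ m) ≫ v') :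
    ((α_ _ _ _).inv ≫ ((α_ _ _ _).hom ▷ Q) ≫ ((s ⊗ₘ l0) ▷ Q)) ≫ (α_ _ _ _).hom ≫ (Z ◁ l1) ≫ v =
      (α_ _ _ _).hom ≫ (Z' ◁ l') ≫ v' := by
  have h1 : l' = (α_ _ _ _).inv ≫ (l0 ▷ Q) ≫ l1 ≫ m := by rw [hl, Iso.inv_hom_id_assoc]
  rw [h1, MonoidalCategory.tensorHom_def']
  simp only [MonoidalCategory.whiskerLeft_comp, Category.assoc, comp_whiskerRight]
  rw [← hv, whisker_exchange_assoc, associator_naturality_left_assoc]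
  simp

theorem attach_nat_aux {Z Z' x x' X X' R P Q Q' y y' : M} {s : Z' ⟶ Z} {r : X' ⟶ R}
    {l : x ⊗ R ⟶ y} {u : y ⟶ y'} {t : x ⟶ x'} {j : X' ⟶ P} {l' : x' ⊗ P ⟶ y'}
    (h : ((x ◁ r) ≫ l) ≫ u = (t ⊗ₘ j) ≫ l') (f : X ⟶ X') (w : Q ⟶ Q') :
    ((α_ _ _ _).inv ≫ ((α_ _ _ _).hom ▷ Q) ≫ ((s ⊗ₘ ((x ◁ (f ≫ r)) ≫ l)) ▷ Q)) ≫
        ((Z ◁ u) ⊗ₘ w) =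
      ((Z' ◁ t) ⊗ₘ ((f ≫ j) ⊗ₘ w)) ≫
        ((α_ _ _ _).inv ≫ ((α_ _ _ _).hom ▷ Q') ≫ ((s ⊗ₘ l') ▷ Q')) := by
  have h1 : (s ⊗ₘ ((x ◁ (f ≫ r)) ≫ l)) ≫ (Z ◁ u) = (Z' ◁ (t ⊗ₘ (f ≫ j))) ≫ (s ⊗ₘ l') := by
    have h3 : ((x ◁ (f ≫ r)) ≫ l) ≫ u = (t ⊗ₘ (f ≫ j)) ≫ l' := by
      rw [MonoidalCategory.whiskerLeft_comp, Category.assoc, Category.assoc,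
        ← Category.assoc (x ◁ r), h, ← id_tensorHom,
        tensorHom_comp_tensorHom_assoc, Category.id_comp]
    rw [← id_tensorHom Z, ← id_tensorHom Z', tensorHom_comp_tensorHom, tensorHom_comp_tensorHom,
      Category.comp_id, Category.id_comp, h3]
  have h2 : ((Z' ◁ t) ⊗ₘ (f ≫ j)) ≫ (α_ _ _ _).hom = (α_ _ _ _).hom ≫ (Z' ◁ (t ⊗ₘ (f ≫ j))) := by
    rw [← id_tensorHom, ← id_tensorHom, associator_naturality]
  rw [associator_inv_naturality_assoc, ← tensorHom_id, ← tensorHom_id, ← tensorHom_id,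
    ← tensorHom_id]
  simp only [Category.assoc, tensorHom_comp_tensorHom, Category.id_comp, Category.comp_id]
  rw [h1, reassoc_of% h2]

theorem single_nat_aux {x x' X X' y y' : M} {l : x ⊗ (X ⊗ 𝟙_ M) ⟶ y} {u : y ⟶ y'} {t : x ⟶ x'}
    {j : X ⟶ X'} {l' : x' ⊗ (X' ⊗ 𝟙_ M) ⟶ y'} (h : (t ⊗ₘ (j ⊗ₘ 𝟙 (𝟙_ M))) ≫ l' = l ≫ u) :
    ((x ◁ (ρ_ X).inv) ≫ l) ≫ u = (t ⊗ₘ j) ≫ (x' ◁ (ρ_ X').inv) ≫ l' := by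
  rw [Category.assoc, ← h, ← id_tensorHom, ← id_tensorHom, tensorHom_comp_tensorHom_assoc,
    tensorHom_comp_tensorHom_assoc, Category.id_comp, Category.comp_id, tensorHom_id,
    rightUnitor_inv_naturality]

theorem tensor_head_aux {U U' X Y P Q Q' : M} {g : X ⟶ Y} {k : Y ⟶ P} {h : X ⟶ P} (e : g ≫ k = h)
    (t : U ⟶ U') (w : Q ⟶ Q') : (U ◁ (g ⊗ₘ 𝟙 Q)) ≫ (t ⊗ₘ (k ⊗ₘ w)) = t ⊗ₘ (h ⊗ₘ w) := by
  rw [← id_tensorHom, tensorHom_comp_tensorHom, tensorHom_comp_tensorHom, Category.id_comp,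
    Category.id_comp, e]

end

section
variable {C : Type v} {Λ : Type} {M : Type u} [Category.{v} M] [MonoidalCategory M]
  [SymmetricCategory M]
open Profile

/-- The tensor product, over a labelled profile, of maps to objects that do not depend on the
labels. -/
def pwUnder {F : C × Λ → M} {G : C → M} (θ : ∀ p, F p ⟶ G p.1) (r : Profile (C × Λ)) :
    pw F r ⟶ pw G r.under := bigTMap r.len fun k => θ (r.col k)

theorem pwUnder_cast {F : C × Λ → M} {G : C → M} (θ : ∀ p, F p ⟶ G p.1) {p p' : C × Λ}
    (h : p = p') : eqToHom (congrArg F h) ≫ θ p' = θ p ≫ eqToHom (congrArg (fun p => G p.1) h) := by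
  subst h
  simp

theorem pwUnder_perm {F : C × Λ → M} {G : C → M} (θ : ∀ p, F p ⟶ G p.1) {r r' : Profile (C × Λ)}
    (g : r ⟶ r') : pwMap F g ≫ pwUnder θ r' = pwUnder θ r ≫ pwMap G (underMap g) := by
  refine (reindex_post _ _ _).trans (Eq.trans ?_ (reindex_pre _ _ _).symm)
  exact congrArg (reindex g.σ) (funext fun k => pwUnder_cast θ (g.col_σ k).symm)

/-- Maps out of `A` and `Y`, as one map. -/
def fold {A Y G : C → M} (f : ∀ d, A d ⟶ G d) (g : ∀ d, Y d ⟶ G d) :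
    ∀ p : C × Bool, twoObj A Y p ⟶ G p.1
  | (d, false) => f d
  | (d, true) => g d

theorem labCat_under {A Y G : C → M} (f : ∀ d, A d ⟶ G d) (g : ∀ d, Y d ⟶ G d) (a : Profile C)
    (r : Profile (C × Bool)) :
    (pwTrans f a ⊗ₘ pwUnder (fold f g) r) ≫ catT (fun s => G (Sum.elim a.col r.under.col s)) =
      labCat A Y a r ≫ pwUnder (fold f g) (labApp a r) :=
  catT_nat fun s => fold f g (Sum.elim a.col r.under.col s, labSum (fun j => (r.col j).2) s)

end

section
variable {C : Type v} {M : Type u} [Category.{v} M] [MonoidalCategory M] [SymmetricCategory M]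
  [MonoidalClosed M] [HasColimits M]
open Profile

theorem pwCat_shift_aux {a X S Q T L L' D K : M} {r : X ⟶ S} {pc : a ⊗ S ⟶ T} {lc : T ⊗ Q ⟶ L}
    {m : L ⟶ L'} {lh : a ⊗ (X ⊗ Q) ⟶ L'} (hc : (((a ◁ r) ≫ pc) ▷ Q) ≫ lc ≫ m = (α_ _ _ _).hom ≫ lh)
    {u : L' ⟶ K} {u' : L ⟶ D} {m' : D ⟶ K} {pT : T ⊗ Q ⟶ D} {ph : a ⊗ (X ⊗ Q) ⟶ K}
    (h1 : m ≫ u = u' ≫ m') (h2 : pT = lc ≫ u') (h3 : ph = lh ≫ u) :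
    (((a ◁ r) ≫ pc) ▷ Q) ≫ pT ≫ m' = (α_ _ _ _).hom ≫ ph := by
  rw [h2, h3, Category.assoc, ← h1, reassoc_of% hc]

theorem pwCat_shift (X : C → M) (a : Profile C) (q : ℕ) (c : C) :
    (((pw X a ◁ (ρ_ (X c)).inv) ≫ pwCat X a (single c)) ▷ bigT q fun _ => X c) ≫
        pwCat X (a.append (single c)) (rep q c) ≫ pwMap X (shiftRep a q c) =
      (α_ _ _ _).hom ≫ pwCat X a (rep (q + 1) c) := by
  have hf : ∀ b : Profile C, pwTrans (fun d => 𝟙 (X d)) b = 𝟙 (pw X b) := fun b => bigTMap_id _ _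
  have e1 := labCat_under (fun d => 𝟙 (X d)) (fun d => 𝟙 (X d)) (a.append (single c))
    (rep q (c, true))
  have e2 := labCat_under (fun d => 𝟙 (X d)) (fun d => 𝟙 (X d)) a (headLab q c false)
  have u1 : pwUnder (fold (fun d => 𝟙 (X d)) (fun d => 𝟙 (X d))) (rep q (c, true)) =
      𝟙 (bigT q fun _ => X c) := bigTMap_id _ _
  have u2 : pwUnder (fold (fun d => 𝟙 (X d)) (fun d => 𝟙 (X d))) (headLab q c false) =
      𝟙 (bigT (q + 1) fun _ => X c) :=
    (congrArg (fun z => 𝟙 (X c) ⊗ₘ z) (bigTMap_id q fun _ => X c)).trans (id_tensorHom_id _ _)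
  rw [hf, u1] at e1
  rw [hf, u2] at e2
  have e1 := ((congrArg (fun z => z ≫ pwCat X (a.append (single c)) (rep q c))
    (id_tensorHom_id _ _)).trans (Category.id_comp _)).symm.trans e1
  have e2 := ((congrArg (fun z => z ≫ pwCat X a (rep (q + 1) c))
    (id_tensorHom_id _ _)).trans (Category.id_comp _)).symm.trans e2
  exact pwCat_shift_aux (labCat_shift X X a q c) (pwUnder_perm _ (shiftLab a q c)) e1 e2

namespace Operad
variable (O : Operad C M) (B : O.monad.Algebra)

theorem actRep_shift (d : C) (a : Profile C) (t : ℕ) (c : C) :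
    ((α_ _ _ _).inv ≫ ((α_ _ _ _).hom ▷ _) ≫
      (((O.obj d).map (shiftRep a t c).op ⊗ₘ
        ((pw B.A a ◁ (ρ_ (B.A c)).inv) ≫ pwCat B.A a (single c))) ▷ _)) ≫
        O.actRep B d (a.append (single c)) t c = O.actRep B d a (t + 1) c :=
  actRep_shift_aux (pwCat_shift B.A a t c) (O.act_w B d (shiftRep a t c))

end Operad

namespace CellAttachment
variable {O : Operad C M} {c : C} (D : CellAttachment O c)

/-- The map `Y ⟶ P` that corresponds to `g`. -/
def gY (d : C) : D.Y d ⟶ D.P.A d := O.unit D.Y d ≫ D.g.f d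

theorem i_gY (d : C) : D.i d ≫ D.gY d = D.fX d ≫ D.j.f d := by
  have h : (O.monad.free.map D.i).f d ≫ D.g.f d = D.f.f d ≫ D.j.f d :=
    congrFun (congrArg Monad.Algebra.Hom.f D.isPushout.w) d
  have h1 : D.i d ≫ O.unit D.Y d = O.unit D.X d ≫ (O.monad.free.map D.i).f d := O.unit_nat D.i d
  refine (Category.assoc _ _ _).symm.trans ((congrArg (fun z => z ≫ D.g.f d) h1).trans ?_)
  exact (Category.assoc _ _ _).trans ((congrArg (fun z => O.unit D.X d ≫ z) h).trans
    (Category.assoc _ _ _).symm)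

theorem target_rel_aux {x y z z' V T T' N : M} {at' : x ⟶ y} {e : y ⟶ T} {p : T ⟶ N} {k : y ⟶ V}
    {r : V ⟶ N} {s : x ⟶ z} {e' : z ⟶ T'} {p' : T' ⟶ N} {k' : z ⟶ z'} {r' : z' ⟶ N} {S : z' ⟶ V}
    {k'' : x ⟶ z'} (h1 : e ≫ p = k ≫ r) (h2 : e' ≫ p' = k' ≫ r') (h3 : S ≫ r = r')
    (h4 : at' ≫ k = k'' ≫ S) (h5 : s ≫ k' = k'') : at' ≫ e ≫ p = s ≫ e' ≫ p' := by
  rw [h1, h2, reassoc_of% h4, h3, reassoc_of% h5]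

/-- The map to `P` from `O_A(d; c, …, c) ⊗_{Σ_q} (Y_c ⊗ ⋯ ⊗ Y_c)`. -/
def targetMap (d : C) (q : ℕ) : O.cell D.A D.Y d q c ⟶ D.P.A d :=
  tmap (O.envRepMap D.j d q c) (powMap D.gc q) ≫ (O.exists_act D.P d q c).choose

theorem envGen_target (d : C) (a : Profile C) (q : ℕ) :
    O.envGen D.A (D.Y c) d a q c ≫ D.targetMap d q =
      ((_ ◁ pwTrans D.j.f a) ⊗ₘ bigTMap q fun _ => D.gc) ≫ O.actRep D.P d a q c :=
  (Category.assoc _ _ _).symm.trans ((congrArg (fun z => z ≫ _)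
    (O.envGen_map D.j d a q c (powMap D.gc q))).trans ((Category.assoc _ _ _).trans
      (congrArg (fun z => _ ≫ z) ((O.exists_act D.P d q c).choose_spec a))))

/-- The action of `O` on `P` gives maps from all the objects
`O_A(d; c, …, c) ⊗_{Σ_q} (Y_c ⊗ ⋯ ⊗ Y_c)` to `P`. -/
def target (d : C) : D.Cocell d (D.P.A d) where
  dom _ := True
  down _ := trivial
  map q _ := D.targetMap d q
  rel q _ a := target_rel_aux (D.envGen_target d _ q) (D.envGen_target d a (q + 1))
    (O.actRep_shift D.P d a q c) (attach_nat_aux (single_nat_aux (pwCat_nat D.j.f a (single c)))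
      D.fc _) (tensor_head_aux (D.i_gY c) _ _)

theorem target_val_aux {Z Z' x x' V V' L L' D K K' N : M} {p : Z' ⟶ Z} {l : x ⊗ V ⟶ L} {m : L ⟶ L'}
    {u' : L' ⟶ K'} {u : L ⟶ K} {m' : K ⟶ K'} {v' : Z ⊗ K' ⟶ N} {v : Z' ⊗ K ⟶ N}
    (hm : m ≫ u' = u ≫ m') (hv : (p ⊗ₘ m') ≫ v' = v) {t : x ⟶ x'} {w : V ⟶ V'}
    {l' : x' ⊗ V' ⟶ K} (hl : (t ⊗ₘ w) ≫ l' = l ≫ u) {φ : Z ⊗ L' ⟶ D} {ψ : D ⟶ N}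
    {e : (Z' ⊗ x) ⊗ V ⟶ D} (hs : (p ⊗ₘ (l ≫ m)) ≫ φ = (α_ _ _ _).inv ≫ e)
    (he : e ≫ ψ = ((Z' ◁ t) ⊗ₘ w) ≫ (α_ _ _ _).hom ≫ (Z' ◁ l') ≫ v) :
    (p ⊗ₘ (l ≫ m)) ≫ φ ≫ ψ = (p ⊗ₘ (l ≫ m)) ≫ (Z ◁ u') ≫ v' := by
  have h1 : (p ⊗ₘ (l ≫ m)) ≫ (Z ◁ u') = (Z' ◁ (t ⊗ₘ w)) ≫ (Z' ◁ l') ≫ (p ⊗ₘ m') := by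
    rw [← id_tensorHom Z, ← id_tensorHom Z', ← id_tensorHom Z', tensorHom_comp_tensorHom,
      tensorHom_comp_tensorHom, tensorHom_comp_tensorHom, Category.assoc, hm, reassoc_of% hl]
    simp
  have h2 : ((Z' ◁ t) ⊗ₘ w) ≫ (α_ _ _ _).hom = (α_ _ _ _).hom ≫ (Z' ◁ (t ⊗ₘ w)) := by
    rw [← id_tensorHom, ← id_tensorHom, associator_naturality]
  rw [reassoc_of% hs, he, reassoc_of% h1, hv, reassoc_of% h2, Iso.inv_hom_id_assoc]

/-- On a labelled profile, the map to `P` is given by `j` and `g` and the action of `O`. -/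
theorem target_val (d : C) (r : Profile (C × Bool)) (h : (D.target d).dom r.cnt) :
    (D.target d).val r h = ((O.obj d).obj (op r.under) ◁ pwUnder (fold D.j.f D.gY) r) ≫
      tι (O.obj d) (pwF D.P.A) r.under ≫ D.P.a d := by
  refine sort_ext D.A.A D.Y D.initialY (O.obj d) rfl fun κ f => ?_
  exact target_val_aux (pwUnder_perm (fold D.j.f D.gY) f)
    ((bal_iff (tensDiag_inv (O.obj d) (underMap f)).1 (tensDiag_inv (O.obj d) (underMap f)).2).2
      (O.act_w D.P d (underMap f)))
    (labCat_under D.j.f D.gY κ (rep r.cnt (c, true)))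
    (O.sort_labGen D.A D.initialY d r r.cnt rfl f) (D.envGen_target d κ r.cnt)

end CellAttachment
end

/-! ### Reflexive coequalizers and tensor products -/

section
variable {M : Type u} [Category.{v} M] [MonoidalCategory M] [SymmetricCategory M] [MonoidalClosed M]

/-- Currying in the factors other than the middle one. -/
def mcurry {Z X V N : M} (f : (Z ⊗ X) ⊗ V ⟶ N) : X ⟶ (ihom Z).obj ((ihom V).obj N) :=
  MonoidalClosed.curry (rcurry f)

theorem mcurry_nat {Z X X' V N : M} (g : X' ⟶ X) (f : (Z ⊗ X) ⊗ V ⟶ N) :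
    mcurry (((Z ◁ g) ▷ V) ≫ f) = g ≫ mcurry f := by
  rw [mcurry, rcurry_nat, MonoidalClosed.curry_natural_left, mcurry]

theorem mcurry_injective {Z X V N : M} {f g : (Z ⊗ X) ⊗ V ⟶ N} (h : mcurry f = mcurry g) : f = g :=
  rcurry_injective (MonoidalClosed.curry_injective h)

theorem mcurry_surjective {Z X V N : M} (g : X ⟶ (ihom Z).obj ((ihom V).obj N)) :
    ∃ f : (Z ⊗ X) ⊗ V ⟶ N, mcurry f = g := by
  obtain ⟨f, hf⟩ := rcurry_surjective (MonoidalClosed.uncurry g)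
  exact ⟨f, by rw [mcurry, hf, MonoidalClosed.curry_uncurry]⟩

theorem middle_assoc {Z X X' V V' N : M} (g : X ⟶ X') (h : V ⟶ V') (ψ : (Z ⊗ X') ⊗ V' ⟶ N) :
    (Z ◁ (g ⊗ₘ h)) ≫ (α_ _ _ _).inv ≫ ψ =
      (α_ _ _ _).inv ≫ ((Z ⊗ X) ◁ h) ≫ ((Z ◁ g) ▷ V') ≫ ψ := by
  rw [MonoidalCategory.tensorHom_def']
  simp

theorem middle_assoc_hom {Z X X' V V' N : M} (g : X ⟶ X') (h : V ⟶ V')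
    (φ : Z ⊗ (X' ⊗ V') ⟶ N) :
    (Z ◁ (g ⊗ₘ h)) ≫ φ =
      (α_ _ _ _).inv ≫ ((Z ⊗ X) ◁ h) ≫ ((Z ◁ g) ▷ V') ≫ (α_ _ _ _).hom ≫ φ := by
  rw [← middle_assoc, Iso.inv_hom_id_assoc]

theorem middle_desc_aux {Z X X' V V' N : M} {g : X ⟶ X'} {h : V ⟶ V'}
    {θ : (Z ⊗ X') ⊗ V' ⟶ N} {ψ : (Z ⊗ X) ⊗ V' ⟶ N} {φ : Z ⊗ (X ⊗ V) ⟶ N}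
    (h1 : ((Z ◁ g) ▷ V') ≫ θ = ψ) (h2 : ((Z ⊗ X) ◁ h) ≫ ψ = (α_ _ _ _).hom ≫ φ) :
    (Z ◁ (g ⊗ₘ h)) ≫ (α_ _ _ _).inv ≫ θ = φ := by
  rw [middle_assoc, h1, h2, Iso.inv_hom_id_assoc]

section
variable {Λ : Type} [HasCoproducts.{0} M]

/-- Maps out of a tensor product of coproducts are determined by the summands. -/
theorem bigT_sigma_ext : ∀ (n : ℕ) {F : Fin n → Λ → M} {Z N : M}
    {φ ψ : Z ⊗ bigT n (fun k => ∐ F k) ⟶ N}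
    (_ : ∀ l : Fin n → Λ, (Z ◁ bigTMap n fun k => Sigma.ι (F k) (l k)) ≫ φ =
      (Z ◁ bigTMap n fun k => Sigma.ι (F k) (l k)) ≫ ψ), φ = ψ
  | 0, F, Z, N, φ, ψ, h => by
    have e : (Z ◁ bigTMap 0 fun k => Sigma.ι (F k) (k.elim0 : Λ)) = 𝟙 _ :=
      MonoidalCategory.whiskerLeft_id _ _
    have := h fun k => k.elim0
    exact (Category.id_comp _).symm.trans ((congrArg (fun z => z ≫ φ) e.symm).trans
      (this.trans ((congrArg (fun z => z ≫ ψ) e).trans (Category.id_comp _))))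
  | n + 1, F, Z, N, φ, ψ, h => by
    refine (cancel_epi (α_ Z (∐ F 0) (bigT n fun k => ∐ F k.succ)).hom).1 ?_
    refine mcurry_injective (Sigma.hom_ext _ _ fun b => ?_)
    rw [← mcurry_nat, ← mcurry_nat]
    refine congrArg mcurry (bigT_sigma_ext n fun l => ?_)
    have := h (Fin.cons b l)
    refine (cancel_epi (α_ Z (F 0 b) _).inv).1 ?_
    exact (middle_assoc_hom _ _ _).symm.trans (this.trans (middle_assoc_hom _ _ _))

/-- Maps out of a tensor product of coproducts are given by maps out of the summands. -/
theorem bigT_sigma_desc : ∀ (n : ℕ) {F : Fin n → Λ → M} {Z N : M}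
    (φ : ∀ l : Fin n → Λ, Z ⊗ bigT n (fun k => F k (l k)) ⟶ N),
    ∃ ψ : Z ⊗ bigT n (fun k => ∐ F k) ⟶ N,
      ∀ l, (Z ◁ bigTMap n fun k => Sigma.ι (F k) (l k)) ≫ ψ = φ l
  | 0, F, Z, N, φ => ⟨φ fun k => k.elim0, fun l => by
      obtain rfl : l = fun k => k.elim0 := Subsingleton.elim _ _
      exact (congrArg (fun z => z ≫ _) (MonoidalCategory.whiskerLeft_id Z (𝟙_ M))).trans
        (Category.id_comp _)⟩
  | n + 1, F, Z, N, φ => by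
    have h : ∀ b, ∃ ψ : (Z ⊗ F 0 b) ⊗ bigT n (fun k => ∐ F k.succ) ⟶ N, ∀ l : Fin n → Λ,
        ((Z ⊗ F 0 b) ◁ bigTMap n fun k => Sigma.ι (F k.succ) (l k)) ≫ ψ =
          (α_ Z (F 0 b) (bigT n fun k => F k.succ (l k))).hom ≫ φ (Fin.cons b l) :=
      fun b => bigT_sigma_desc n fun l => (α_ Z (F 0 b) (bigT n fun k => F k.succ (l k))).hom ≫
        φ (Fin.cons b l)
    choose ψ hψ using h
    obtain ⟨θ, hθ⟩ := mcurry_surjective (Sigma.desc fun b => mcurry (ψ b))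
    have hθ' : ∀ b, ((Z ◁ Sigma.ι (F 0) b) ▷ _) ≫ θ = ψ b := fun b =>
      mcurry_injective (by rw [mcurry_nat, hθ, Sigma.ι_desc])
    refine ⟨(α_ _ _ _).inv ≫ θ, fun l => ?_⟩
    obtain ⟨b, l, rfl⟩ : ∃ b l', l = Fin.cons b l' := ⟨_, _, (Fin.cons_self_tail l).symm⟩
    exact middle_desc_aux (hθ' b) (hψ b l)

end

section
variable {n : ℕ}

/-- A coequalizer diagram with a common section of the two parallel maps. -/
structure ReflexiveCoeq {R S Q : M} (u v : R ⟶ S) (q : S ⟶ Q) : Prop where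
  exists_section : ∃ s : S ⟶ R, s ≫ u = 𝟙 S ∧ s ≫ v = 𝟙 S
  ext {N : M} {f g : Q ⟶ N} : q ≫ f = q ≫ g → f = g
  desc {N : M} (z : S ⟶ N) : u ≫ z = v ≫ z → ∃ y, q ≫ y = z

/-- The tensor product of the quotient maps is an epimorphism, also after tensoring with `Z`. -/
theorem bigT_reflexive_ext : ∀ (n : ℕ) {R S Q : Fin n → M} {u v : ∀ k, R k ⟶ S k}
    {q : ∀ k, S k ⟶ Q k} (_ : ∀ k, ReflexiveCoeq (u k) (v k) (q k)) {Z N : M}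
    {f g : Z ⊗ bigT n Q ⟶ N} (_ : (Z ◁ bigTMap n q) ≫ f = (Z ◁ bigTMap n q) ≫ g), f = g
  | 0, R, S, Q, u, v, q, _, Z, N, f, g, h => by
    have e : (Z ◁ bigTMap 0 q) = 𝟙 _ := MonoidalCategory.whiskerLeft_id _ _
    exact (Category.id_comp _).symm.trans ((congrArg (fun z => z ≫ f) e.symm).trans
      (h.trans ((congrArg (fun z => z ≫ g) e).trans (Category.id_comp _))))
  | n + 1, R, S, Q, u, v, q, hq, Z, N, f, g, h => by
    refine (cancel_epi (α_ Z (Q 0) (bigT n fun k => Q k.succ)).hom).1 ?_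
    refine mcurry_injective ((hq 0).ext ?_)
    rw [← mcurry_nat, ← mcurry_nat]
    refine congrArg mcurry (bigT_reflexive_ext n (fun k => hq k.succ) ?_)
    refine (cancel_epi (α_ Z (S 0) _).inv).1 ?_
    exact (middle_assoc_hom _ _ _).symm.trans (h.trans (middle_assoc_hom _ _ _))

theorem reflexive_tensor_right {Z R S R' S' N : M} {u v : R ⟶ S} {u' v' : R' ⟶ S'} {s : S ⟶ R}
    (hs : s ≫ u = 𝟙 S ∧ s ≫ v = 𝟙 S) {φ : Z ⊗ (S ⊗ S') ⟶ N}
    (h : (Z ◁ (u ⊗ₘ u')) ≫ φ = (Z ◁ (v ⊗ₘ v')) ≫ φ) :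
    ((Z ⊗ S) ◁ u') ≫ (α_ _ _ _).hom ≫ φ = ((Z ⊗ S) ◁ v') ≫ (α_ _ _ _).hom ≫ φ := by
  have h := congrArg (fun z => (α_ _ _ _).hom ≫ (Z ◁ (s ▷ R')) ≫ z) h
  rw [← MonoidalCategory.whiskerLeft_comp_assoc, ← MonoidalCategory.whiskerLeft_comp_assoc,
    ← tensorHom_id, tensorHom_comp_tensorHom, tensorHom_comp_tensorHom, hs.1, hs.2,
    Category.id_comp, Category.id_comp, id_tensorHom, id_tensorHom] at h
  simpa using h

theorem reflexive_tensor_left {Z R S R' S' N : M} {u v : R ⟶ S} {u' v' : R' ⟶ S'} {s : S' ⟶ R'}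
    (hs : s ≫ u' = 𝟙 S' ∧ s ≫ v' = 𝟙 S') {φ : Z ⊗ (S ⊗ S') ⟶ N}
    (h : (Z ◁ (u ⊗ₘ u')) ≫ φ = (Z ◁ (v ⊗ₘ v')) ≫ φ) :
    ((Z ◁ u) ▷ S') ≫ (α_ _ _ _).hom ≫ φ = ((Z ◁ v) ▷ S') ≫ (α_ _ _ _).hom ≫ φ := by
  have h := congrArg (fun z => (α_ _ _ _).hom ≫ (Z ◁ (R ◁ s)) ≫ z) h
  rw [← MonoidalCategory.whiskerLeft_comp_assoc, ← MonoidalCategory.whiskerLeft_comp_assoc,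
    ← id_tensorHom R, tensorHom_comp_tensorHom, tensorHom_comp_tensorHom, hs.1, hs.2,
    Category.id_comp, Category.id_comp, tensorHom_id, tensorHom_id] at h
  simpa using h

theorem bigT_section (n : ℕ) {R S Q : Fin n → M} {u v : ∀ k, R k ⟶ S k}
    {q : ∀ k, S k ⟶ Q k} (h : ∀ k, ReflexiveCoeq (u k) (v k) (q k)) :
    ∃ s : bigT n S ⟶ bigT n R, s ≫ bigTMap n u = 𝟙 _ ∧ s ≫ bigTMap n v = 𝟙 _ := by
  choose s hs using fun k => (h k).exists_section
  refine ⟨bigTMap n s, ?_, ?_⟩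
  · rw [bigTMap_comp, ← bigTMap_id]
    exact congrArg (bigTMap n) (funext fun k => (hs k).1)
  · rw [bigTMap_comp, ← bigTMap_id]
    exact congrArg (bigTMap n) (funext fun k => (hs k).2)

/-- The tensor product of finitely many objects preserves reflexive coequalizers. -/
theorem bigT_reflexive_desc : ∀ (n : ℕ) {R S Q : Fin n → M} {u v : ∀ k, R k ⟶ S k}
    {q : ∀ k, S k ⟶ Q k} (_ : ∀ k, ReflexiveCoeq (u k) (v k) (q k)) {Z N : M}
    (φ : Z ⊗ bigT n S ⟶ N) (_ : (Z ◁ bigTMap n u) ≫ φ = (Z ◁ bigTMap n v) ≫ φ),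
    ∃ ψ : Z ⊗ bigT n Q ⟶ N, (Z ◁ bigTMap n q) ≫ ψ = φ
  | 0, R, S, Q, u, v, q, _, Z, N, φ, h => ⟨φ, by
      have e : (Z ◁ bigTMap 0 q) = 𝟙 _ := MonoidalCategory.whiskerLeft_id _ _
      exact (congrArg (fun z => z ≫ φ) e).trans (Category.id_comp _)⟩
  | n + 1, R, S, Q, u, v, q, hq, Z, N, φ, h => by
    obtain ⟨s0, hs0⟩ := (hq 0).exists_section
    obtain ⟨s, hs⟩ := bigT_section n fun k => hq k.succ
    -- The sections allow one to treat the first factor and the remaining ones separately: the map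
    -- descends in the latter by induction, then in the former.
    obtain ⟨ψ, hψ⟩ := bigT_reflexive_desc n (fun k => hq k.succ) _ (reflexive_tensor_right hs0 h)
    have h2 := reflexive_tensor_left hs h
    rw [← hψ] at h2
    have h3 : ((Z ◁ u 0) ▷ _) ≫ ψ = ((Z ◁ v 0) ▷ _) ≫ ψ := by
      refine bigT_reflexive_ext n (fun k => hq k.succ) ?_
      rw [whisker_exchange_assoc, whisker_exchange_assoc]
      exact h2
    have h4 : u 0 ≫ mcurry ψ = v 0 ≫ mcurry ψ := by rw [← mcurry_nat, ← mcurry_nat, h3]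
    obtain ⟨y, hy⟩ := (hq 0).desc _ h4
    obtain ⟨θ, hθ⟩ := mcurry_surjective y
    have hθ' : ((Z ◁ q 0) ▷ _) ≫ θ = ψ := mcurry_injective (by rw [mcurry_nat, hθ, hy])
    exact ⟨(α_ _ _ _).inv ≫ θ, middle_desc_aux hθ' hψ⟩

end

end

/-! ### Pushouts along free maps of algebras over a monad -/

section
variable {𝒞 : Type u} [Category.{v} 𝒞] (T : Monad 𝒞)

/-- The unit of a monad, as a map out of the object itself. -/
def unitMap (X : 𝒞) : X ⟶ T.obj X := T.η.app X

/-- The multiplication of a monad, as a map out of the iterated image. -/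
def mulMap (X : 𝒞) : T.obj (T.obj X) ⟶ T.obj X := T.μ.app X

variable {T}

theorem unitMap_nat {X Y : 𝒞} (f : X ⟶ Y) : unitMap T X ≫ T.map f = f ≫ unitMap T Y :=
  (T.η.naturality f).symm

theorem mulMap_nat {X Y : 𝒞} (f : X ⟶ Y) :
    T.map (T.map f) ≫ mulMap T Y = mulMap T X ≫ T.map f := T.μ.naturality f

theorem unit_mulMap (X : 𝒞) : unitMap T (T.obj X) ≫ mulMap T X = 𝟙 (T.obj X) := T.left_unit X

theorem map_unit_mulMap (X : 𝒞) : T.map (unitMap T X) ≫ mulMap T X = 𝟙 (T.obj X) := T.right_unit X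

theorem mulMap_assoc (X : 𝒞) :
    T.map (mulMap T X) ≫ mulMap T X = mulMap T (T.obj X) ≫ mulMap T X := T.assoc X

theorem unitMap_alg (B : T.Algebra) : unitMap T B.A ≫ B.a = 𝟙 B.A := B.unit

theorem mulMap_alg (B : T.Algebra) : T.map B.a ≫ B.a = mulMap T B.A ≫ B.a := B.assoc.symm

/-- The structure map of an algebra on a quotient of a free algebra that is preserved by the
monad. -/
theorem exists_quotient_algebra {R W Q : 𝒞} {u v : R ⟶ T.obj W} {m : T.obj R ⟶ R}
    (hu : T.map u ≫ mulMap T W = m ≫ u) (hv : T.map v ≫ mulMap T W = m ≫ v) (q : T.obj W ⟶ Q)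
    (w : u ≫ q = v ≫ q) (_ : Epi q) (_ : Epi (T.map q)) (_ : Epi (T.map (T.map q)))
    (desc : ∀ z : T.obj (T.obj W) ⟶ Q, T.map u ≫ z = T.map v ≫ z → ∃ y, T.map q ≫ y = z) :
    ∃ R : T.Algebra, ∃ e : R.A = Q, ∃ k : T.obj W ⟶ R.A, k ≫ eqToHom e = q ∧
      T.map k ≫ R.a = mulMap T W ≫ k := by
  -- The structure map is the factorization of the multiplication of `T W`; the axioms are checked
  -- after the epimorphisms `q` and `T (T q)`.
  obtain ⟨a, ha⟩ := desc (mulMap T W ≫ q) (by rw [reassoc_of% hu, reassoc_of% hv, w])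
  have h1 : unitMap T Q ≫ a = 𝟙 Q := by
    rw [← cancel_epi q, ← reassoc_of% unitMap_nat, ha, reassoc_of% unit_mulMap, Category.comp_id]
  have h2 : mulMap T Q ≫ a = T.map a ≫ a := by
    rw [← cancel_epi (T.map (T.map q)), reassoc_of% mulMap_nat, ha, ← reassoc_of% mulMap_assoc,
      ← T.map_comp_assoc, ha, T.map_comp_assoc, ha]
  exact ⟨⟨Q, a, h1, h2⟩, rfl, q, Category.comp_id _, ha⟩

/-- An algebra map out of a free algebra is determined by its restriction to the generators. -/
theorem free_ext {X : 𝒞} {B : T.Algebra} {f g : T.obj X ⟶ B.A}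
    (hf : T.map f ≫ B.a = mulMap T X ≫ f) (hg : T.map g ≫ B.a = mulMap T X ≫ g)
    (h : unitMap T X ≫ f = unitMap T X ≫ g) : f = g := by
  have e : ∀ k : T.obj X ⟶ B.A, T.map k ≫ B.a = mulMap T X ≫ k →
      T.map (unitMap T X ≫ k) ≫ B.a = k := fun k hk => by
    rw [T.map_comp, Category.assoc, hk, reassoc_of% map_unit_mulMap]
  rw [← e f hf, h, e g hg]

theorem free_hom {X : 𝒞} {B : T.Algebra} (x : X ⟶ B.A) :
    T.map (T.map x ≫ B.a) ≫ B.a = mulMap T X ≫ T.map x ≫ B.a := by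
  rw [T.map_comp, Category.assoc, mulMap_alg, reassoc_of% mulMap_nat]

theorem unit_free {X : 𝒞} {B : T.Algebra} (x : X ⟶ B.A) : unitMap T X ≫ T.map x ≫ B.a = x := by
  rw [reassoc_of% unitMap_nat, unitMap_alg, Category.comp_id]

/-- The form of `pushout_quotient` in which maps out of free algebras are replaced by maps out of
their generators. -/
theorem pushout_quotient_aux {X Y W S Q : 𝒞} {A P : T.Algebra} {i : X ⟶ Y} {f : X ⟶ A.A}
    {g : Y ⟶ P.A} {j : A ⟶ P} (hw : i ≫ g = f ≫ j.f)
    (hdesc : ∀ (R : T.Algebra) (y : Y ⟶ R.A) (k : A ⟶ R), i ≫ y = f ≫ k.f →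
      ∃ κ : P ⟶ R, j.f ≫ κ.f = k.f ∧ g ≫ κ.f = y)
    (hext : ∀ (k : P.A ⟶ P.A), T.map k ≫ P.a = P.a ≫ k → j.f ≫ k = j.f → g ≫ k = g → k = 𝟙 P.A)
    {inA : A.A ⟶ W} {inY : Y ⟶ W} {π₀ : W ⟶ P.A} (hA : inA ≫ π₀ = j.f) (hY : inY ≫ π₀ = g)
    (W_ext : ∀ {Z : 𝒞} {h k : W ⟶ Z}, inA ≫ h = inA ≫ k → inY ≫ h = inY ≫ k → h = k)
    {sA : T.obj A.A ⟶ S} {sX : X ⟶ S} {sY : Y ⟶ S}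
    (S_ext : ∀ {Z : 𝒞} {h k : S ⟶ Z}, sA ≫ h = sA ≫ k → sX ≫ h = sX ≫ k → sY ≫ h = sY ≫ k → h = k)
    {u₀ : S ⟶ T.obj W} {v₀ : S ⟶ W} (uA : sA ≫ u₀ = T.map inA)
    (uX : sX ≫ u₀ = f ≫ inA ≫ unitMap T W) (uY : sY ≫ u₀ = inY ≫ unitMap T W)
    (vA : sA ≫ v₀ = A.a ≫ inA) (vX : sX ≫ v₀ = i ≫ inY) (vY : sY ≫ v₀ = inY)
    {q : T.obj W ⟶ Q} (w : (T.map u₀ ≫ mulMap T W) ≫ q = T.map v₀ ≫ q)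
    (e₀ : Epi q) (e₁ : Epi (T.map q)) (e₂ : Epi (T.map (T.map q)))
    (desc : ∀ z : T.obj W ⟶ P.A, (T.map u₀ ≫ mulMap T W) ≫ z = T.map v₀ ≫ z → ∃ y, q ≫ y = z)
    (descT : ∀ z : T.obj (T.obj W) ⟶ Q, T.map (T.map u₀ ≫ mulMap T W) ≫ z =
      T.map (T.map v₀) ≫ z → ∃ y, T.map q ≫ y = z) :
    ∃ (κ : P.A ⟶ Q) (l : Q ⟶ P.A), q ≫ l = T.map π₀ ≫ P.a ∧ κ ≫ l = 𝟙 _ ∧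
      (T.map π₀ ≫ P.a) ≫ κ = q := by
  obtain ⟨R, rfl, k, hk, hkR⟩ := exists_quotient_algebra (m := mulMap T S)
    (by rw [T.map_comp, Category.assoc, mulMap_assoc, reassoc_of% mulMap_nat])
    (mulMap_nat v₀) q w e₀ e₁ e₂ descT
  obtain rfl : k = q := (Category.comp_id _).symm.trans hk
  have w' : u₀ ≫ k = v₀ ≫ unitMap T W ≫ k := by
    have h := congrArg (fun z => unitMap T S ≫ z) w
    simp only [Category.assoc] at h
    rwa [reassoc_of% unitMap_nat, reassoc_of% unitMap_nat, reassoc_of% unit_mulMap] at h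
  have hκA : T.map (inA ≫ unitMap T W ≫ k) ≫ R.a = A.a ≫ inA ≫ unitMap T W ≫ k := by
    rw [T.map_comp, T.map_comp, Category.assoc, Category.assoc, hkR, reassoc_of% map_unit_mulMap,
      ← uA,
      Category.assoc, w', reassoc_of% vA]
  -- The quotient `Q` is an algebra `R`, and `A` and `Y` map to it compatibly, which gives `κ`.
  obtain ⟨κ, κj, κg⟩ := hdesc R (inY ≫ unitMap T W ≫ k) ⟨_, hκA⟩
    (by rw [← reassoc_of% vX, ← w', reassoc_of% uX])
  have κj : j.f ≫ κ.f = inA ≫ unitMap T W ≫ k := κj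
  have hπ : unitMap T W ≫ T.map π₀ ≫ P.a = π₀ := unit_free π₀
  have h1 : (T.map u₀ ≫ mulMap T W) ≫ T.map π₀ ≫ P.a = T.map v₀ ≫ T.map π₀ ≫ P.a := by
    rw [Category.assoc, ← free_hom π₀, ← T.map_comp_assoc, ← T.map_comp_assoc]
    refine congrArg (fun z => T.map z ≫ P.a) (S_ext ?_ ?_ ?_)
    · rw [reassoc_of% uA, reassoc_of% vA, hA, ← T.map_comp_assoc, hA, j.h]
    · rw [reassoc_of% uX, reassoc_of% vX, hπ, hA, hY, hw]
    · rw [reassoc_of% uY, reassoc_of% vY, hπ]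
  -- Conversely, the free algebra on `W` maps to `P`, compatibly with the relations.
  obtain ⟨l, hl⟩ := desc _ h1
  have hlR : T.map l ≫ P.a = R.a ≫ l := by
    rw [← cancel_epi (T.map k), ← T.map_comp_assoc, hl, free_hom, reassoc_of% hkR, hl]
  refine ⟨κ.f, l, hl, hext _ ?_ ?_ ?_, ?_⟩
  · rw [T.map_comp, Category.assoc, hlR, κ.h_assoc]
  · rw [reassoc_of% κj, hl, hπ, hA]
  · rw [reassoc_of% κg, hl, hπ, hY]
  · refine free_ext ?_ hkR ?_
    · rw [T.map_comp, Category.assoc, κ.h, ← Category.assoc, free_hom, Category.assoc,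
        Category.assoc]
    · rw [← Category.assoc, hπ]
      refine W_ext ?_ ?_
      · rw [reassoc_of% hA, κj]
      · rw [reassoc_of% hY, κg]

/-- A pushout of algebras along a map of free algebras is a quotient of the free algebra on the
coproduct `W` of `A` and `Y`, by relations indexed by the coproduct `S` of `T A`, `X` and `Y`. -/
theorem pushout_quotient {X Y W S Q : 𝒞} {A P : T.Algebra} {i : X ⟶ Y} {f : T.free.obj X ⟶ A}
    {g : T.free.obj Y ⟶ P} {j : A ⟶ P} (hP : IsPushout (T.free.map i) f g j)
    {f₀ : X ⟶ A.A} (hf : unitMap T X ≫ f.f = f₀) {g₀ : Y ⟶ P.A} (hg : unitMap T Y ≫ g.f = g₀)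
    {inA : A.A ⟶ W} {inY : Y ⟶ W} {π₀ : W ⟶ P.A} (hA : inA ≫ π₀ = j.f) (hY : inY ≫ π₀ = g₀)
    (W_ext : ∀ {Z : 𝒞} {h k : W ⟶ Z}, inA ≫ h = inA ≫ k → inY ≫ h = inY ≫ k → h = k)
    {sA : T.obj A.A ⟶ S} {sX : X ⟶ S} {sY : Y ⟶ S}
    (S_ext : ∀ {Z : 𝒞} {h k : S ⟶ Z}, sA ≫ h = sA ≫ k → sX ≫ h = sX ≫ k → sY ≫ h = sY ≫ k → h = k)
    {u₀ : S ⟶ T.obj W} {v₀ : S ⟶ W} (uA : sA ≫ u₀ = T.map inA)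
    (uX : sX ≫ u₀ = f₀ ≫ inA ≫ unitMap T W) (uY : sY ≫ u₀ = inY ≫ unitMap T W)
    (vA : sA ≫ v₀ = A.a ≫ inA) (vX : sX ≫ v₀ = i ≫ inY) (vY : sY ≫ v₀ = inY)
    {q : T.obj W ⟶ Q} (w : (T.map u₀ ≫ mulMap T W) ≫ q = T.map v₀ ≫ q)
    (e₀ : Epi q) (e₁ : Epi (T.map q)) (e₂ : Epi (T.map (T.map q)))
    (desc : ∀ z : T.obj W ⟶ P.A, (T.map u₀ ≫ mulMap T W) ≫ z = T.map v₀ ≫ z → ∃ y, q ≫ y = z)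
    (descT : ∀ z : T.obj (T.obj W) ⟶ Q, T.map (T.map u₀ ≫ mulMap T W) ≫ z =
      T.map (T.map v₀) ≫ z → ∃ y, T.map q ≫ y = z) :
    ∃ (κ : P.A ⟶ Q) (l : Q ⟶ P.A), q ≫ l = T.map π₀ ≫ P.a ∧ κ ≫ l = 𝟙 _ ∧
      (T.map π₀ ≫ P.a) ≫ κ = q := by
  subst hf hg
  refine pushout_quotient_aux ?_ ?_ ?_ hA hY W_ext S_ext uA uX uY vA vX vY w e₀ e₁ e₂ desc descT
  · have h : T.map i ≫ g.f = f.f ≫ j.f := congrArg Monad.Algebra.Hom.f hP.w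
    exact ((Category.assoc _ _ _).symm.trans ((congrArg (fun z => z ≫ g.f) (unitMap_nat i)).trans
      (Category.assoc _ _ _))).symm.trans ((congrArg (fun z => unitMap T X ≫ z) h).trans
      (Category.assoc _ _ _).symm)
  · intro R y k h
    have hc : T.free.map i ≫ (⟨T.map y ≫ R.a, free_hom y⟩ : T.free.obj Y ⟶ R) = f ≫ k := by
      apply Monad.Algebra.Hom.ext
      refine free_ext (f := T.map i ≫ T.map y ≫ R.a) (g := f.f ≫ k.f) ?_ (f ≫ k).h ?_
      · rw [← T.map_comp_assoc, free_hom]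
      · rw [← T.map_comp_assoc, unit_free, h]
        exact Category.assoc _ _ _
    refine ⟨hP.desc _ _ hc, congrArg Monad.Algebra.Hom.f (hP.inr_desc _ _ hc), ?_⟩
    have e := congrArg (fun z => unitMap T Y ≫ Monad.Algebra.Hom.f z) (hP.inl_desc _ _ hc)
    exact (Category.assoc _ _ _).trans (e.trans (unit_free y))
  · intro k hk hj hg
    have e : (⟨k, hk⟩ : P ⟶ P) = 𝟙 P := by
      refine hP.hom_ext ?_ ?_
      · apply Monad.Algebra.Hom.ext
        exact free_ext (g ≫ (⟨k, hk⟩ : P ⟶ P)).h (g ≫ 𝟙 P).h ((Category.assoc _ _ _).symm.trans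
          (hg.trans (congrArg (fun z => unitMap T Y ≫ z) (Category.comp_id g.f).symm)))
      · apply Monad.Algebra.Hom.ext
        exact hj.trans (Category.comp_id _).symm
    exact congrArg Monad.Algebra.Hom.f e

end

section
variable {C : Type v} {M : Type u} [Category.{v} M] [MonoidalCategory M] [SymmetricCategory M]
  [MonoidalClosed M] [HasColimits M]
open Profile

/-- The functor `W ∘ -` preserves reflexive coequalizers. -/
theorem ReflexiveCoeq.circ {R S Q : C → M} {u v : ∀ d, R d ⟶ S d} {q : ∀ d, S d ⟶ Q d}
    (h : ∀ d, ReflexiveCoeq (u d) (v d) (q d)) (W : (Profile C)ᵒᵖ ⥤ M) :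
    ReflexiveCoeq (circMap W u) (circMap W v) (circMap W q) where
  exists_section := by
    choose s hs using fun d => (h d).exists_section
    refine ⟨circMap W s, ?_, ?_⟩
    · rw [← circMap_comp, ← circMap_id]
      exact congrArg (circMap W) (funext fun d => (hs d).1)
    · rw [← circMap_comp, ← circMap_id]
      exact congrArg (circMap W) (funext fun d => (hs d).2)
  ext {N f g} e := t_ext fun a => bigT_reflexive_ext a.len (fun k => h (a.col k)) (by
    have e := congrArg (fun z => tι W (pwF S) a ≫ z) e
    simp only [← Category.assoc, ι_circMap] at e
    simpa only [Category.assoc] using e)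
  desc {N} z e := by
    have h1 : ∀ a : Profile C, ∃ ψ : W.obj (op a) ⊗ pw Q a ⟶ N,
        (W.obj (op a) ◁ pwTrans q a) ≫ ψ = tι W (pwF S) a ≫ z := fun a =>
      bigT_reflexive_desc a.len (fun k => h (a.col k)) _ (by
        have e := congrArg (fun z => tι W (pwF R) a ≫ z) e
        simp only [← Category.assoc, ι_circMap] at e
        simpa only [Category.assoc] using e)
    choose ψ hψ using h1
    refine ⟨tdesc W (pwF Q) ψ fun {a b} g => ?_, t_ext fun a => ?_⟩
    · refine bigT_reflexive_ext a.len (fun k => h (a.col k)) ?_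
      have e1 : (W.obj (op b) ◁ pwTrans q a) ≫ (W.obj (op b) ◁ pwMap Q g) ≫ ψ b =
          (W.obj (op b) ◁ pwMap S g) ≫ tι W (pwF S) b ≫ z := by
        rw [← MonoidalCategory.whiskerLeft_comp_assoc, ← pwTrans_nat,
          MonoidalCategory.whiskerLeft_comp_assoc, hψ]
      refine Eq.trans ?_ e1.symm
      refine (whisker_exchange_assoc _ _ _).trans ?_
      rw [hψ]
      exact (Category.assoc _ _ _).symm.trans ((congrArg (fun k => k ≫ z)
        (tι_w W (pwF S) g)).trans (Category.assoc _ _ _))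
    · rw [← Category.assoc, ι_circMap, Category.assoc, tι_desc, hψ]

end

/-! ### Cocells and iterated free algebras -/

section
variable {M : Type u} [Category.{v} M] [MonoidalCategory M]

theorem free_val_act_aux {Z B B' K K' R R' R'' L L' T' T N V V' Z1 Z2 L2 L2' : M} {τ : B ⟶ K}
    {Tf : K ⟶ K'} {f' : B ⟶ B'} {τ' : B' ⟶ K'} (hτ : τ ≫ Tf = f' ≫ τ') {g : R ⟶ R'}
    {η : R' ⟶ R''} {θ : R ⟶ R''} (hθ : θ = g ≫ η) {l : K ⊗ R ⟶ L} {U : L ⟶ L'}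
    {k : K' ⊗ R'' ⟶ L'} (hU : (Tf ⊗ₘ θ) ≫ k = l ≫ U) {φ : Z ⊗ L' ⟶ T'} {μ : T' ⟶ T}
    {s' : Z ⊗ B' ⟶ Z1 ⊗ V'} {a : Z1 ⟶ Z2} {k2 : V' ⊗ R' ⟶ L2'} {ψ : Z2 ⊗ L2' ⟶ T}
    (hp : (Z ◁ (τ' ⊗ₘ η)) ≫ (Z ◁ k) ≫ φ ≫ μ =
      ((α_ _ _ _).inv ≫ (s' ▷ R') ≫ (α_ _ _ _).hom) ≫ (a ⊗ₘ k2) ≫ ψ)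
    {s : Z ⊗ B ⟶ Z1 ⊗ V} {f2 : V ⟶ V'} (hs : (Z ◁ f') ≫ s' = s ≫ (Z1 ◁ f2))
    {l2 : V ⊗ R ⟶ L2} {U2 : L2 ⟶ L2'} (h2 : (f2 ⊗ₘ g) ≫ k2 = l2 ≫ U2) {z : T ⟶ N}
    {v : Z2 ⊗ L2 ⟶ N} (hz : (Z2 ◁ U2) ≫ ψ ≫ z = v) :
    (Z ◁ (τ ▷ R)) ≫ (Z ◁ l) ≫ (Z ◁ U) ≫ φ ≫ μ ≫ z =
      ((α_ _ _ _).inv ≫ (s ▷ R) ≫ (α_ _ _ _).hom) ≫ (a ⊗ₘ l2) ≫ v := by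
  have e1 : (Z ◁ (τ ▷ R)) ≫ (Z ◁ l) ≫ (Z ◁ U) =
      (Z ◁ (f' ⊗ₘ g)) ≫ (Z ◁ (τ' ⊗ₘ η)) ≫ (Z ◁ k) := by
    rw [← MonoidalCategory.whiskerLeft_comp, ← MonoidalCategory.whiskerLeft_comp,
      ← MonoidalCategory.whiskerLeft_comp, ← MonoidalCategory.whiskerLeft_comp, ← hU,
      ← tensorHom_id, tensorHom_comp_tensorHom_assoc, tensorHom_comp_tensorHom_assoc, hτ, hθ,
      Category.id_comp]
  have e2 : (Z ◁ (f' ⊗ₘ g)) ≫ (α_ _ _ _).inv ≫ (s' ▷ R') ≫ (α_ _ _ _).hom =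
      ((α_ _ _ _).inv ≫ (s ▷ R) ≫ (α_ _ _ _).hom) ≫ (Z1 ◁ (f2 ⊗ₘ g)) := by
    rw [← id_tensorHom, associator_inv_naturality_assoc, id_tensorHom, ← tensorHom_id s',
      tensorHom_comp_tensorHom_assoc, hs, Category.comp_id, Category.assoc, Category.assoc,
      ← id_tensorHom Z1 (f2 ⊗ₘ g), ← associator_naturality, ← tensorHom_id s,
      tensorHom_comp_tensorHom_assoc, id_tensorHom, Category.id_comp]
  have e3 : (Z1 ◁ (f2 ⊗ₘ g)) ≫ (a ⊗ₘ k2) = (a ⊗ₘ l2) ≫ (Z2 ◁ U2) := by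
    rw [← id_tensorHom, ← id_tensorHom, tensorHom_comp_tensorHom, tensorHom_comp_tensorHom, h2,
      Category.id_comp, Category.comp_id]
  have hp := congrArg (fun y => (Z ◁ (f' ⊗ₘ g)) ≫ y ≫ z) hp
  simp only [Category.assoc] at hp e1 e2 ⊢
  rw [reassoc_of% e1, hp, reassoc_of% e2, reassoc_of% e3, hz]

theorem free_val_sort_aux {Z Z' L X X' Y Y' N : M} {p : Z' ⟶ Z} {l : L ⟶ X'} {m : X' ⟶ X}
    {U : X ⟶ Y}
    {U' : X' ⟶ Y'} {m' : Y' ⟶ Y} (hU : m ≫ U = U' ≫ m') {φ : Z ⊗ Y ⟶ N} {φ' : Z' ⊗ Y' ⟶ N}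
    (hφ : (p ⊗ₘ m') ≫ φ = φ') :
    (p ⊗ₘ (l ≫ m)) ≫ (Z ◁ U) ≫ φ = (Z' ◁ l) ≫ (Z' ◁ U') ≫ φ' := by
  rw [← hφ, ← id_tensorHom, ← id_tensorHom, ← id_tensorHom, tensorHom_comp_tensorHom_assoc,
    tensorHom_comp_tensorHom_assoc, tensorHom_comp_tensorHom_assoc, Category.assoc, hU]
  simp

theorem free_val_base_aux {Z K K' R L L' N : M} {w : K ⟶ K'} {l' : K' ⊗ R ⟶ L'} {l : K ⊗ R ⟶ L}
    {G : L ⟶ L'} {w2 : R ⟶ R} (h2 : w2 = 𝟙 R) (h : (w ⊗ₘ w2) ≫ l' = l ≫ G) {B : M} {τ : B ⟶ K}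
    (φ : Z ⊗ L' ⟶ N) : (Z ◁ (τ ▷ R)) ≫ (Z ◁ l) ≫ (Z ◁ G) ≫ φ =
      (Z ◁ ((τ ≫ w) ▷ R)) ≫ (Z ◁ l') ≫ φ := by
  subst h2
  rw [tensorHom_id] at h
  rw [← MonoidalCategory.whiskerLeft_comp_assoc Z l G, ← h]
  simp

end

section
variable {C : Type v} {M : Type u} [Category.{v} M] [MonoidalCategory M] [SymmetricCategory M]
  [MonoidalClosed M] [HasColimits M]
open Profile

theorem middle_pw_ext {O : Operad C M} {X : C → M} {κ : Profile C} {Z R V : M}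
    {f g : Z ⊗ (pw (O.app X) κ ⊗ R) ⟶ V}
    (h : ∀ b : Fin κ.len → Profile C,
      (Z ◁ ((bigTMap κ.len fun i => tι (O.obj (κ.col i)) (pwF X) (b i)) ▷ R)) ≫ f =
      (Z ◁ ((bigTMap κ.len fun i => tι (O.obj (κ.col i)) (pwF X) (b i)) ▷ R)) ≫ g) : f = g := by
  refine (cancel_epi (α_ Z (pw (O.app X) κ) R).hom).1 (rcurry_injective
    (RightAct.pw_ext X fun b => ?_))
  rw [← rcurry_nat, ← rcurry_nat, associator_naturality_middle_assoc,
    associator_naturality_middle_assoc, h]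

namespace CellAttachment
variable {O : Operad C M} {c : C} {D : CellAttachment O c}

namespace Cocell
variable {d : C} {N : M} (E : D.Cocell d N) (hE : ∀ q, E.dom q)

/-- The case of a sorted profile of `free_val`, where it follows from the relation `val_rel`. -/
theorem free_val_append {W : C → M} {f : ∀ d, D.A.A d ⟶ W d} {g : ∀ d, D.Y d ⟶ W d}
    {z : O.app W d ⟶ N} (hz : ∀ r, ((O.obj d).obj (op r.under) ◁ pwUnder (fold f g) r) ≫
      tι (O.obj d) (pwF W) r.under ≫ z = E.val r (hE _)) (κ : Profile C) (q : ℕ) :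
    (_ ◁ labCat (O.app D.A.A) D.Y κ (rep q (c, true))) ≫
      (_ ◁ pwUnder (fold (A := O.app D.A.A) (fun d => circMap (O.obj d) f)
        fun d => g d ≫ O.unit W d) (sorted κ q c)) ≫
        tι (O.obj d) (pwF (O.app W)) (sorted κ q c).under ≫ (O.self d).map W ≫ z =
    (_ ◁ labCat (O.app D.A.A) D.Y κ (rep q (c, true))) ≫
      (_ ◁ pwTrans (twoMap (A := O.app D.A.A) (fun d => D.A.a d) fun d => 𝟙 (D.Y d))
        (sorted κ q c)) ≫ E.val (sorted κ q c) (hE _) := by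
  refine middle_pw_ext fun b => ?_
  have e1 := E.val_rel κ b (rep q (c, true)) (hE _) (hE _)
  have t1 : (bigTMap κ.len fun i => tι (O.obj (κ.col i)) (pwF D.A.A) (b i)) ≫
      pwTrans (fun d => circMap (O.obj d) f) κ =
      (bigTMap κ.len fun i => (O.obj (κ.col i)).obj (op (b i)) ◁ pwTrans f (b i)) ≫
        bigTMap κ.len fun i => tι (O.obj (κ.col i)) (pwF W) (b i) :=
    (bigTMap_comp _ _ _).trans (Eq.trans (congrArg (bigTMap κ.len) (funext fun i =>
      ι_circMap _ _ _)) (bigTMap_comp _ _ _).symm)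
  have t2 := labCat_under (A := O.app D.A.A) (fun d => circMap (O.obj d) f)
    (fun d => g d ≫ O.unit W d) κ (rep q (c, true))
  have t3 : pwUnder (fold (A := O.app D.A.A) (fun d => circMap (O.obj d) f)
      fun d => g d ≫ O.unit W d) (rep q (c, true)) =
      pwUnder (fold f g) (rep q (c, true)) ≫ pwTrans (O.unit W) (rep q c) :=
    (bigTMap_comp _ _ _).symm
  have t4 := shufP_nat (b := b) (𝟙 ((O.obj d).obj (op (κ.append (rep q c)))))
    (fun i => 𝟙 ((O.obj (κ.col i)).obj (op (b i)))) f
  simp only [bigTMap_id, id_tensorHom, MonoidalCategory.whiskerLeft_id] at t4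
  have t5 := (O.self d).map_pad W κ (rep q c) b
  refine (free_val_act_aux t1 t3 t2 t5 t4 (labCat_under f g (concat b) (rep q (c, true)))
    (hz (sorted (concat b) q c))).trans (e1.symm.trans ?_)
  refine Eq.symm ((free_val_base_aux (bigTMap_id _ _) (labCat_nat (A := O.app D.A.A)
    (fun d => D.A.a d) (fun d => 𝟙 (D.Y d)) κ (rep q (c, true))) _).trans ?_)
  exact congrArg (fun y => (_ ◁ (y ▷ _)) ≫ _) (bigTMap_comp _ _ _)

/-- On `O ∘ A`, the map out of `O ∘ W` given by a cocell `E` satisfies the relation given by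
the action of `O` on `A`. -/
theorem free_val {W : C → M} {f : ∀ d, D.A.A d ⟶ W d} {g : ∀ d, D.Y d ⟶ W d}
    {z : O.app W d ⟶ N} (hz : ∀ r, ((O.obj d).obj (op r.under) ◁ pwUnder (fold f g) r) ≫
      tι (O.obj d) (pwF W) r.under ≫ z = E.val r (hE _)) (r : Profile (C × Bool)) :
    (_ ◁ pwUnder (fold (A := O.app D.A.A) (fun d => circMap (O.obj d) f)
        fun d => g d ≫ O.unit W d) r) ≫
        tι (O.obj d) (pwF (O.app W)) r.under ≫ (O.self d).map W ≫ z =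
      (_ ◁ pwTrans (twoMap (A := O.app D.A.A) (fun d => D.A.a d) fun d => 𝟙 (D.Y d)) r) ≫
        E.val r (hE _) := by
  refine sort_ext (O.app D.A.A) D.Y D.initialY (O.obj d) rfl fun κ s => ?_
  have h1 := (bal_iff (tensDiag_inv (O.obj d) (underMap s)).1
    (tensDiag_inv (O.obj d) (underMap s)).2 (q := tι (O.obj d) (pwF (O.app W)) r.under)).2
    (tι_w (O.obj d) (pwF (O.app W)) (underMap s))
  have h2 := (Category.assoc _ _ _).symm.trans
    (congrArg (fun y => y ≫ (O.self d).map W ≫ z) h1)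
  refine (free_val_sort_aux (pwUnder_perm _ s) h2).trans (Eq.trans ?_
    (free_val_sort_aux (pwTrans_nat _ s) (E.val_perm s (hE _) (hE _))).symm)
  exact E.free_val_append hE hz κ r.cnt

end Cocell
end CellAttachment
end

/-! ### Generators and relations for the pushout -/

section
variable {C : Type v} {M : Type u} [Category.{v} M] [MonoidalCategory M] [SymmetricCategory M]
  [MonoidalClosed M] [HasColimits M]
open Profile

/-- Finite coproducts exist in a category with all colimits. -/
theorem hasCoproducts_zero : HasCoproducts.{0} M := fun _ =>
  (hasColimitsOfSizeShrink.{0, 0, v, v} M).1 _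

attribute [local instance] hasCoproducts_zero

namespace CellAttachment
variable {O : Operad C M} {c : C} (D : CellAttachment O c)

/-- The coproduct of `A` and `Y`. -/
def gens (d : C) : M := ∐ fun b : Bool => twoObj D.A.A D.Y (d, b)

/-- The inclusions of the summands. -/
def gensι (p : C × Bool) : twoObj D.A.A D.Y p ⟶ D.gens p.1 :=
  Sigma.ι (fun b : Bool => twoObj D.A.A D.Y (p.1, b)) p.2

/-- The inclusion of `A`. -/
def inA (d : C) : D.A.A d ⟶ D.gens d := D.gensι (d, false)

/-- The inclusion of `Y`. -/
def inY (d : C) : D.Y d ⟶ D.gens d := D.gensι (d, true)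

theorem fold_in : fold D.inA D.inY = D.gensι := by
  funext ⟨d, b⟩
  cases b <;> rfl

theorem gens_ext {d : C} {Z : M} {h k : D.gens d ⟶ Z} (hA : D.inA d ≫ h = D.inA d ≫ k)
    (hY : D.inY d ≫ h = D.inY d ≫ k) : h = k := by
  refine Sigma.hom_ext _ _ fun b => ?_
  cases b
  · exact hA
  · exact hY

/-- The map out of the coproduct of `A` and `Y` given by maps out of `A` and `Y`. -/
def gensDesc {G : C → M} (f : ∀ d, D.A.A d ⟶ G d) (g : ∀ d, D.Y d ⟶ G d) (d : C) :
    D.gens d ⟶ G d := Sigma.desc fun b => fold f g (d, b)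

theorem gensι_desc {G : C → M} (f : ∀ d, D.A.A d ⟶ G d) (g : ∀ d, D.Y d ⟶ G d) (p : C × Bool) :
    D.gensι p ≫ D.gensDesc f g p.1 = fold f g p := Sigma.ι_desc _ _

theorem inA_desc {G : C → M} (f : ∀ d, D.A.A d ⟶ G d) (g : ∀ d, D.Y d ⟶ G d) (d : C) :
    D.inA d ≫ D.gensDesc f g d = f d := D.gensι_desc f g (d, false)

theorem inY_desc {G : C → M} (f : ∀ d, D.A.A d ⟶ G d) (g : ∀ d, D.Y d ⟶ G d) (d : C) :
    D.inY d ≫ D.gensDesc f g d = g d := D.gensι_desc f g (d, true)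

/-- The coproduct of `O ∘ A`, `X` and `Y`. -/
def rels (d : C) : M := ∐ fun m : Option Bool => triObj (O.app D.A.A) D.X D.Y (d, m)

/-- The inclusions of the summands. -/
def relsι (p : C × Option Bool) : triObj (O.app D.A.A) D.X D.Y p ⟶ D.rels p.1 :=
  Sigma.ι (fun m : Option Bool => triObj (O.app D.A.A) D.X D.Y (p.1, m)) p.2

/-- The inclusion of `O ∘ A`. -/
def inOA (d : C) : O.app D.A.A d ⟶ D.rels d := D.relsι (d, some false)

/-- The inclusion of `X`. -/
def inRX (d : C) : D.X d ⟶ D.rels d := D.relsι (d, none)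

/-- The inclusion of `Y`, which carries a trivial relation. -/
def inRY (d : C) : D.Y d ⟶ D.rels d := D.relsι (d, some true)

theorem rels_ext {d : C} {Z : M} {h k : D.rels d ⟶ Z} (hA : D.inOA d ≫ h = D.inOA d ≫ k)
    (hX : D.inRX d ≫ h = D.inRX d ≫ k) (hY : D.inRY d ≫ h = D.inRY d ≫ k) : h = k := by
  refine Sigma.hom_ext _ _ fun m => ?_
  rcases m with _ | _ | _
  · exact hX
  · exact hA
  · exact hY

/-- Maps out of `O ∘ A`, `X` and `Y`, as one map. -/
def fold3 {A X Y G : C → M} (f : ∀ d, A d ⟶ G d) (h : ∀ d, X d ⟶ G d) (g : ∀ d, Y d ⟶ G d) :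
    ∀ p : C × Option Bool, triObj A X Y p ⟶ G p.1
  | (d, none) => h d
  | (d, some false) => f d
  | (d, some true) => g d

/-- The map out of the coproduct of `O ∘ A`, `X` and `Y` given by maps on the summands. -/
def relsDesc {G : C → M} (f : ∀ d, O.app D.A.A d ⟶ G d) (h : ∀ d, D.X d ⟶ G d)
    (g : ∀ d, D.Y d ⟶ G d) (d : C) : D.rels d ⟶ G d := Sigma.desc fun m => fold3 f h g (d, m)

theorem relsι_desc {G : C → M} (f : ∀ d, O.app D.A.A d ⟶ G d) (h : ∀ d, D.X d ⟶ G d)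
    (g : ∀ d, D.Y d ⟶ G d) (p : C × Option Bool) :
    D.relsι p ≫ D.relsDesc f h g p.1 = fold3 f h g p := Sigma.ι_desc _ _

/-- The first of the two maps that give the relations. An operation on elements of `A` is the formal
one, `X` is sent to `A` by `f`, and `Y` to itself. -/
def relL (d : C) : D.rels d ⟶ O.app D.gens d :=
  D.relsDesc (fun d => circMap (O.obj d) D.inA) (fun d => D.fX d ≫ D.inA d ≫ O.unit D.gens d)
    (fun d => D.inY d ≫ O.unit D.gens d) d

/-- The second of the two maps that give the relations. An operation on elements of `A` is
evaluated in `A`, `X` is sent to `Y` by `i`, and `Y` to itself. -/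
def relR (d : C) : D.rels d ⟶ D.gens d :=
  D.relsDesc (fun d => D.A.a d ≫ D.inA d) (fun d => D.i d ≫ D.inY d) D.inY d

/-- The map of free algebras that extends `relL`. -/
def freeL (d : C) : O.app D.rels d ⟶ O.app D.gens d :=
  circMap (O.obj d) D.relL ≫ (O.self d).map D.gens

/-- The map of free algebras that extends `relR`. -/
def freeR (d : C) : O.app D.rels d ⟶ O.app D.gens d := circMap (O.obj d) D.relR

/-- A common section of `freeL` and `freeR`, given by the unit on `A` and by the summand `Y` of the
relations. -/
theorem free_section (d : C) :
    ∃ s : O.app D.gens d ⟶ O.app D.rels d, s ≫ D.freeL d = 𝟙 _ ∧ s ≫ D.freeR d = 𝟙 _ := by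
  let s₀ : ∀ d, D.gens d ⟶ D.rels d := D.gensDesc (fun d => O.unit D.A.A d ≫ D.inOA d) D.inRY
  have h1 : ∀ d, s₀ d ≫ D.relL d = O.unit D.gens d := fun d => by
    refine D.gens_ext ?_ ?_
    · rw [← Category.assoc, D.inA_desc, Category.assoc]
      exact (congrArg (fun z => O.unit D.A.A d ≫ z) (D.relsι_desc _ _ _ (d, some false))).trans
        (O.unit_nat D.inA d).symm
    · rw [← Category.assoc, D.inY_desc]
      exact D.relsι_desc _ _ _ (d, some true)
  have h2 : ∀ d, s₀ d ≫ D.relR d = 𝟙 (D.gens d) := fun d => by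
    refine D.gens_ext ?_ ?_
    · rw [← Category.assoc, D.inA_desc, Category.assoc, Category.comp_id]
      refine (congrArg (fun z => O.unit D.A.A d ≫ z) (D.relsι_desc _ _ _ (d, some false))).trans ?_
      refine (Category.assoc _ _ _).symm.trans ?_
      exact (congrArg (fun z => z ≫ D.inA d) (congrFun D.A.unit d)).trans (Category.id_comp _)
    · rw [← Category.assoc, D.inY_desc, Category.comp_id]
      exact D.relsι_desc _ _ _ (d, some true)
  refine ⟨circMap (O.obj d) s₀, ?_, ?_⟩
  · refine (Category.assoc _ _ _).symm.trans ?_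
    rw [← circMap_comp]
    refine (congrArg (fun z => circMap (O.obj d) z ≫ _) (funext h1)).trans ?_
    exact congrFun (O.monad.right_unit D.gens) d
  · refine (circMap_comp _ _ _).symm.trans ?_
    refine (congrArg (circMap (O.obj d)) (funext h2)).trans ?_
    exact circMap_id _ _

/-- The map to `P` from the free algebra on the coproduct of `A` and `Y`. -/
def freeP (d : C) : O.app D.gens d ⟶ D.P.A d :=
  circMap (O.obj d) (D.gensDesc D.j.f D.gY) ≫ D.P.a d

theorem reflexive_coequalizer (d : C) :
    ReflexiveCoeq (D.freeL d) (D.freeR d) (coequalizer.π (D.freeL d) (D.freeR d)) where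
  exists_section := D.free_section d
  ext h := coequalizer.hom_ext h
  desc z h := ⟨coequalizer.desc z h, coequalizer.π_desc z h⟩

theorem epi_of_ext {A B : C → M} (q : A ⟶ B)
    (h : ∀ d {N : M} {f g : B d ⟶ N}, q d ≫ f = q d ≫ g → f = g) : Epi q :=
  ⟨fun _ _ e => funext fun d => h d (congrFun e d)⟩

/-- The pushout is, in every color, the reflexive coequalizer of the relations. -/
theorem reflexive_free (d : C) : ReflexiveCoeq (D.freeL d) (D.freeR d) (D.freeP d) := by
  let q : O.app D.gens ⟶ fun d => coequalizer (D.freeL d) (D.freeR d) :=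
    fun d => coequalizer.π (D.freeL d) (D.freeR d)
  have h0 : ∀ d, ReflexiveCoeq (D.freeL d) (D.freeR d) (q d) := D.reflexive_coequalizer
  have h1 : ∀ d, ReflexiveCoeq (circMap (O.obj d) D.freeL) (circMap (O.obj d) D.freeR)
      (circMap (O.obj d) q) := fun d => ReflexiveCoeq.circ h0 (O.obj d)
  have h2 := fun d => ReflexiveCoeq.circ h1 (O.obj d)
  have h := pushout_quotient (T := O.monad) D.isPushout (f₀ := D.fX) rfl (g₀ := D.gY) rfl
    (inA := D.inA) (inY := D.inY) (π₀ := D.gensDesc D.j.f D.gY) (funext (D.inA_desc D.j.f D.gY))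
    (funext (D.inY_desc D.j.f D.gY))
    (fun h k => funext fun d => D.gens_ext (congrFun h d) (congrFun k d))
    (sA := D.inOA) (sX := D.inRX) (sY := D.inRY)
    (fun h k l => funext fun d => D.rels_ext (congrFun h d) (congrFun k d) (congrFun l d))
    (u₀ := D.relL) (v₀ := D.relR)
    (funext fun d => D.relsι_desc _ _ _ (d, some false))
    (funext fun d => D.relsι_desc _ _ _ (d, none))
    (funext fun d => D.relsι_desc _ _ _ (d, some true))
    (funext fun d => D.relsι_desc _ _ _ (d, some false))
    (funext fun d => D.relsι_desc _ _ _ (d, none))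
    (funext fun d => D.relsι_desc _ _ _ (d, some true))
    (q := q) (funext fun d => coequalizer.condition (D.freeL d) (D.freeR d))
    (epi_of_ext q fun d => (h0 d).ext) (epi_of_ext _ fun d => (h1 d).ext)
    (epi_of_ext _ fun d => (h2 d).ext)
    (fun z e => by
      choose y hy using fun d => (h0 d).desc (z d) (congrFun e d)
      exact ⟨y, funext hy⟩)
    (fun z e => by
      choose y hy using fun d => (h1 d).desc (z d) (congrFun e d)
      exact ⟨y, funext hy⟩)
  -- `κ` and `l` identify `P` with the coequalizer.
  obtain ⟨κ, l, e1, e2, e3⟩ := h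
  have e1 : ∀ d, q d ≫ l d = D.freeP d := fun d => congrFun e1 d
  have e2 : ∀ d, κ d ≫ l d = 𝟙 (D.P.A d) := fun d => congrFun e2 d
  have e3 : ∀ d, D.freeP d ≫ κ d = q d := fun d => congrFun e3 d
  refine ⟨D.free_section d, fun {N f g} e => ?_, fun {N} z e => ?_⟩
  · rw [← e1, Category.assoc, Category.assoc] at e
    rw [← Category.id_comp f, ← Category.id_comp g, ← e2, Category.assoc, Category.assoc,
      (h0 d).ext e]
  · obtain ⟨y, hy⟩ := (h0 d).desc z e
    exact ⟨κ d ≫ y, by rw [reassoc_of% e3, hy]⟩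

end CellAttachment
end

/-! ### The universal property of the pushout -/

section
variable {M : Type u} [Category.{v} M] [MonoidalCategory M]

theorem whisker_comp_assoc {Z x y z V : M} {f : x ⟶ y} {g : y ⟶ z} {h : x ⟶ z} (e : f ≫ g = h)
    (φ : Z ⊗ z ⟶ V) : (Z ◁ f) ≫ (Z ◁ g) ≫ φ = (Z ◁ h) ≫ φ := by
  rw [← e, MonoidalCategory.whiskerLeft_comp, Category.assoc]

theorem whisker_comp_trans {Z S R O' T V : M} {f : S ⟶ R} {g : S ⟶ T} {t : R ⟶ T} (e : f ≫ t = g)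
    {ι : Z ⊗ R ⟶ O'} {F : O' ⟶ V} {φ : Z ⊗ T ⟶ V} (h : ι ≫ F = (Z ◁ t) ≫ φ) :
    (Z ◁ f) ≫ ι ≫ F = (Z ◁ g) ≫ φ := by
  rw [h, whisker_comp_assoc e]

theorem whisker_square_aux {Z S R R' T V : M} {a : S ⟶ R} {b : R ⟶ T} {a' : S ⟶ R'} {b' : R' ⟶ T}
    (e : a ≫ b = a' ≫ b') (φ : Z ⊗ T ⟶ V) : (Z ◁ a) ≫ (Z ◁ b) ≫ φ = (Z ◁ a') ≫ (Z ◁ b') ≫ φ := by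
  rw [whisker_comp_assoc e, ← whisker_comp_assoc rfl]

end

section
variable {C : Type v} {M : Type u} [Category.{v} M] [MonoidalCategory M] [SymmetricCategory M]
  [MonoidalClosed M] [HasColimits M]
open Profile

attribute [local instance] hasCoproducts_zero

/-- A map of profiles with a labelling of the source, as a map of labelled profiles. -/
def Profile.labMap {a b : Profile C} (g : a ⟶ b) (l : Fin a.len → Bool) :
    a.lab l ⟶ b.lab fun k => l (g.σ.symm k) :=
  Hom.mk g.σ fun k => Prod.ext (g.col_σ k) (congrArg l (g.σ.symm_apply_apply k))

namespace CellAttachment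
variable {O : Operad C M} {c : C} {D : CellAttachment O c}

namespace Cocell
variable {d : C} {N : M} (E : D.Cocell d N) (hE : ∀ q, E.dom q)

theorem exists_gens_aux {Z' Z X X' V V' N : M} {p : Z' ⟶ Z} {ι : X ⟶ V} {ι' : X' ⟶ V'}
    {m : V ⟶ V'} {m' : X ⟶ X'} (hm : m' ≫ ι' = ι ≫ m) {φ : Z ⊗ V ⟶ N} {φ' : Z' ⊗ V' ⟶ N}
    {ψ : Z ⊗ X ⟶ N} {ψ' : Z' ⊗ X' ⟶ N} (h : (Z ◁ ι) ≫ φ = ψ) (h' : (Z' ◁ ι') ≫ φ' = ψ')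
    (hψ : (p ▷ X) ≫ ψ = (Z' ◁ m') ≫ ψ') :
    (Z' ◁ ι) ≫ (p ▷ V) ≫ φ = (Z' ◁ ι) ≫ (Z' ◁ m) ≫ φ' := by
  rw [whisker_exchange_assoc, h, hψ, ← h', whisker_comp_assoc hm, ← whisker_comp_assoc rfl]

/-- A total cocell gives a map out of the free algebra on the coproduct of `A` and `Y`. -/
theorem exists_gens : ∃ z : O.app D.gens d ⟶ N, ∀ r : Profile (C × Bool),
    ((O.obj d).obj (op r.under) ◁ pwUnder (fold D.inA D.inY) r) ≫
      tι (O.obj d) (pwF D.gens) r.under ≫ z = E.val r (hE _) := by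
  have h : ∀ a : Profile C, ∃ φ : (O.obj d).obj (op a) ⊗ pw D.gens a ⟶ N,
      ∀ l : Fin a.len → Bool, (_ ◁ pwUnder (fold D.inA D.inY) (a.lab l)) ≫ φ =
        E.val (a.lab l) (hE _) := fun a => by
    rw [D.fold_in]
    exact bigT_sigma_desc a.len (F := fun k b => twoObj D.A.A D.Y (a.col k, b))
      (Z := (O.obj d).obj (op a)) fun l => E.val (a.lab l) (hE _)
  choose φ hφ using h
  refine ⟨tdesc (O.obj d) (pwF D.gens) φ fun {a b} g => ?_, fun r => ?_⟩
  · refine bigT_sigma_ext a.len (F := fun k b => twoObj D.A.A D.Y (a.col k, b)) fun l => ?_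
    have e := pwUnder_perm (fold D.inA D.inY) (labMap g l)
    have h := exists_gens_aux e (hφ a l) (hφ b _) (E.val_balanced (labMap g l) (hE _) (hE _))
    rw [D.fold_in] at h
    exact h
  · exact (congrArg (fun y => (_ ◁ pwUnder (fold D.inA D.inY) r) ≫ y)
      (tι_desc (O.obj d) (pwF D.gens) φ _ r.under)).trans (hφ r.under fun k => (r.col k).2)

variable (D) in
/-- The map `relL` before the inclusion of `A` and `Y`: the summand `X` is sent to the free algebra
on `A`. -/
def triLeft : ∀ p : C × Option Bool, triObj (O.app D.A.A) D.X D.Y p ⟶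
    twoObj (O.app D.A.A) D.Y (p.1, p.2.getD false)
  | (d, none) => D.fX d ≫ O.unit D.A.A d
  | (_, some false) => 𝟙 _
  | (_, some true) => 𝟙 _

variable (D) in
/-- The action of `O` on `A`, on the summand `O ∘ A`. -/
def triAct : ∀ p : C × Option Bool,
    triObj (O.app D.A.A) D.X D.Y p ⟶ triObj D.A.A D.X D.Y p
  | (_, none) => 𝟙 _
  | (d, some false) => D.A.a d
  | (_, some true) => 𝟙 _

variable (D) in
theorem triLeft_relL : ∀ p : C × Option Bool,
    D.relsι p ≫ D.relL p.1 = triLeft D p ≫ fold (A := O.app D.A.A)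
      (fun d => circMap (O.obj d) D.inA) (fun d => D.inY d ≫ O.unit D.gens d)
        (p.1, p.2.getD false)
  | (d, none) => (D.relsι_desc _ _ _ (d, none)).trans
      ((congrArg (fun z => D.fX d ≫ z) (O.unit_nat D.inA d)).trans (Category.assoc _ _ _).symm)
  | (d, some false) => (D.relsι_desc _ _ _ (d, some false)).trans (Category.id_comp _).symm
  | (d, some true) => (D.relsι_desc _ _ _ (d, some true)).trans (Category.id_comp _).symm

variable (D) in
theorem triAct_relR : ∀ p : C × Option Bool,
    D.relsι p ≫ D.relR p.1 = (triAct D p ≫ triMap D.fX D.i p.1 p.2 (some (p.2.getD true))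
      (by rcases p.2 with _ | b; exacts [.inl rfl, .inr rfl])) ≫
        fold D.inA D.inY (p.1, p.2.getD true)
  | (d, none) => (D.relsι_desc _ _ _ (d, none)).trans
      (congrArg (fun z => z ≫ D.inY d) (Category.id_comp (D.i d)).symm)
  | (d, some false) => (D.relsι_desc _ _ _ (d, some false)).trans
      (congrArg (fun z => z ≫ D.inA d) (Category.comp_id (D.A.a d)).symm)
  | (d, some true) => (D.relsι_desc _ _ _ (d, some true)).trans
      ((Category.id_comp _).symm.trans
        (congrArg (fun z => z ≫ D.inY d) (Category.comp_id (𝟙 (D.Y d))).symm))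

variable (D) in
theorem triLeft_act : ∀ p : C × Option Bool,
    triLeft D p ≫ twoMap (A := O.app D.A.A) (fun d => D.A.a d) (fun d => 𝟙 (D.Y d))
      (p.1, p.2.getD false) = triAct D p ≫ triMap D.fX D.i p.1 p.2 (some (p.2.getD false))
        (by rcases p.2 with _ | b; exacts [.inl rfl, .inr rfl])
  | (d, none) => (Category.assoc _ _ _).trans ((congrArg (fun z => D.fX d ≫ z)
      (congrFun D.A.unit d)).trans ((Category.comp_id _).trans (Category.id_comp _).symm))
  | (_, some false) => (Category.id_comp _).trans (Category.comp_id _).symm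
  | (_, some true) => rfl

/-- The map out of the free algebra given by a cocell is compatible with the relations of the
pushout: on the summand `O ∘ A` this is the relation of `O_A` (`free_val`), on the summand `X` it is
the compatibility of the cocell with `X_c ⟶ A_c` and `X_c ⟶ Y_c` (`val_tri`). -/
theorem gens_rel {z : O.app D.gens d ⟶ N} (hz : ∀ r : Profile (C × Bool),
    ((O.obj d).obj (op r.under) ◁ pwUnder (fold D.inA D.inY) r) ≫
      tι (O.obj d) (pwF D.gens) r.under ≫ z = E.val r (hE _)) :
    D.freeL d ≫ z = D.freeR d ≫ z := by
  refine t_ext fun a => ?_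
  refine bigT_sigma_ext a.len
    (F := fun k m => triObj (O.app D.A.A) D.X D.Y (a.col k, m)) fun m => ?_
  have hL : tι (O.obj d) (pwF D.rels) a ≫ D.freeL d ≫ z = (_ ◁ pwTrans D.relL a) ≫
      tι (O.obj d) (pwF (O.app D.gens)) a ≫ (O.self d).map D.gens ≫ z := by
    rw [freeL, Category.assoc, ← Category.assoc, ι_circMap, Category.assoc]
  have hR : tι (O.obj d) (pwF D.rels) a ≫ D.freeR d ≫ z = (_ ◁ pwTrans D.relR a) ≫
      tι (O.obj d) (pwF D.gens) a ≫ z := by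
    rw [freeR, ← Category.assoc, ι_circMap, Category.assoc]
  have h0 : ∀ (b : Bool) k, m k = none ∨ m k = some ((m k).getD b) := fun b k => by
    rcases m k with _ | b
    · exact .inl rfl
    · exact .inr rfl
  -- The factors `X` are sent to `A` by `relL`, and to `Y` by `relR`.
  let l : Bool → Fin a.len → Bool := fun b k => (m k).getD b
  have eL : (bigTMap a.len fun k => D.relsι (a.col k, m k)) ≫ pwTrans D.relL a =
      (bigTMap a.len fun k => triLeft D (a.col k, m k)) ≫
        pwUnder (fold (A := O.app D.A.A) (fun d => circMap (O.obj d) D.inA)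
          fun d => D.inY d ≫ O.unit D.gens d) (a.lab (l false)) :=
    (bigTMap_comp _ _ _).trans ((congrArg (bigTMap a.len) (funext fun k =>
      triLeft_relL D (a.col k, m k))).trans (bigTMap_comp _ _ _).symm)
  have eR : (bigTMap a.len fun k => D.relsι (a.col k, m k)) ≫ pwTrans D.relR a =
      ((bigTMap a.len fun k => triAct D (a.col k, m k)) ≫
        triTMap D.fX D.i a m (fun k => some (l true k)) (h0 true)) ≫
          pwUnder (fold D.inA D.inY) (a.lab (l true)) :=
    (bigTMap_comp _ _ _).trans ((congrArg (bigTMap a.len) (funext fun k =>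
      triAct_relR D (a.col k, m k))).trans ((bigTMap_comp _ _ _).symm.trans
        (congrArg (fun y => y ≫ pwUnder (fold D.inA D.inY) (a.lab (l true)))
          (bigTMap_comp _ _ _).symm)))
  have eM : (bigTMap a.len fun k => triLeft D (a.col k, m k)) ≫
      pwTrans (twoMap (A := O.app D.A.A) (fun d => D.A.a d) fun d => 𝟙 (D.Y d))
        (a.lab (l false)) =
      (bigTMap a.len fun k => triAct D (a.col k, m k)) ≫
        triTMap D.fX D.i a m (fun k => some (l false k)) (h0 false) :=
    (bigTMap_comp _ _ _).trans ((congrArg (bigTMap a.len) (funext fun k =>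
      triLeft_act D (a.col k, m k))).trans (bigTMap_comp _ _ _).symm)
  refine (whisker_comp_trans eL hL).trans (Eq.trans ?_ (whisker_comp_trans eR hR).symm)
  refine (whisker_comp_assoc rfl _).symm.trans ?_
  refine (congrArg (fun y => (_ ◁ _) ≫ y) (E.free_val hE hz (a.lab (l false)))).trans ?_
  refine (whisker_square_aux eM _).trans ?_
  refine Eq.trans ?_ (whisker_comp_assoc rfl _)
  refine Eq.trans ?_ (congrArg (fun y => (_ ◁ _) ≫ y) (hz (a.lab (l true)))).symm
  refine Eq.trans ?_ (whisker_comp_assoc rfl _)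
  exact congrArg (fun y => (_ ◁ _) ≫ y)
    (E.val_tri a m (l false) (l true) (h0 false) (h0 true) (hE _) (hE _))

/-- The map to `P` from the free algebra, on a labelled profile. -/
theorem freeP_val (r : Profile (C × Bool)) :
    ((O.obj d).obj (op r.under) ◁ pwUnder (fold D.inA D.inY) r) ≫
      tι (O.obj d) (pwF D.gens) r.under ≫ D.freeP d = (D.target d).val r trivial := by
  have e : pwUnder (fold D.inA D.inY) r ≫ pwTrans (D.gensDesc D.j.f D.gY) r.under =
      pwUnder (fold D.j.f D.gY) r :=
    (bigTMap_comp _ _ _).trans (congrArg (bigTMap r.len) (funext fun k => by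
      rw [D.fold_in]; exact D.gensι_desc _ _ (r.col k)))
  refine (whisker_comp_trans e ?_).trans (D.target_val d r trivial).symm
  exact (Category.assoc _ _ _).symm.trans ((congrArg (fun y => y ≫ D.P.a d)
    (ι_circMap (O.obj d) (D.gensDesc D.j.f D.gY) r.under)).trans (Category.assoc _ _ _))

theorem map_eq_of_val {E' : D.Cocell d N} (hE' : ∀ q, E'.dom q) {N' : M} {θ : N ⟶ N'}
    {E'' : D.Cocell d N'} (hE'' : ∀ q, E''.dom q)
    (h : ∀ r, E'.val r (hE' _) ≫ θ = E''.val r (hE'' _)) (q : ℕ) :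
    E'.map q (hE' q) ≫ θ = E''.map q (hE'' q) := by
  refine O.envGen_ext D.A fun a => ?_
  have e1 := E'.val_sorted (𝟙 (sorted a q c)) (hE' _) (hE' q)
  have e2 := E''.val_sorted (𝟙 (sorted a q c)) (hE'' _) (hE'' q)
  rw [← h] at e2
  have e1 := congrArg (fun y => y ≫ θ) e1
  have e3 := (Category.assoc _ _ _).symm.trans e1
  have e4 := e3.symm.trans e2
  refine (cancel_epi (α_ _ _ _).inv).1 ?_
  simpa only [Category.assoc] using e4

/-- A total cocell on `N` is the same as a map from the pushout to `N`: existence. -/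
theorem exists_of_target : ∃ θ : D.P.A d ⟶ N, ∀ q, D.targetMap d q ≫ θ = E.map q (hE q) := by
  obtain ⟨z, hz⟩ := E.exists_gens hE
  obtain ⟨θ, hθ⟩ := (D.reflexive_free d).desc z (E.gens_rel hE hz)
  refine ⟨θ, fun q => map_eq_of_val (E' := D.target d) (fun _ => trivial) hE (fun r => ?_) q⟩
  rw [← freeP_val, ← hz, ← hθ, Category.assoc, Category.assoc]

variable (D) in
/-- A map out of the pushout is determined by its composites with the maps of the cells. -/
theorem target_hom_ext {θ θ' : D.P.A d ⟶ N}
    (h : ∀ q, D.targetMap d q ≫ θ = D.targetMap d q ≫ θ') : θ = θ' := by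
  refine (D.reflexive_free d).ext (t_ext fun a => ?_)
  refine bigT_sigma_ext a.len (F := fun k b => twoObj D.A.A D.Y (a.col k, b)) fun l => ?_
  have e := freeP_val (D := D) (d := d) (a.lab l)
  rw [D.fold_in] at e
  have e' : ∀ θ : D.P.A d ⟶ N, (_ ◁ pwUnder D.gensι (a.lab l)) ≫
      tι (O.obj d) (pwF D.gens) a ≫ D.freeP d ≫ θ =
      O.labGen D.A D.initialY d (a.lab l) _ rfl ≫ D.targetMap d (a.lab l).cnt ≫ θ := fun θ => by
    have e := congrArg (fun y => y ≫ θ) e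
    simp only [Category.assoc] at e
    refine e.trans ?_
    exact Category.assoc _ _ _
  exact (e' θ).trans ((congrArg (fun y => _ ≫ y) (h _)).trans (e' θ').symm)

end Cocell
end CellAttachment
end

/-! ### The stages of the filtration -/

section
variable {C : Type v} {M : Type u} [Category.{v} M] [MonoidalCategory M] [SymmetricCategory M]
open Profile

instance pwCat_isIso (X : C → M) (a b : Profile C) : IsIso (pwCat X a b) :=
  can_isIso _ ((P_cat .leaf).comp (catNd a.len b.len))

/-- The profile `(a, ∅)` is `a`. -/
def Profile.appendNil (a : Profile C) (c : C) : a.append (rep 0 c) ⟶ a :=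
  Hom.mk (finCongr (Nat.add_zero a.len)) fun k => (((append_rep a 0 c k).1 k.2).trans rfl).symm

theorem actRep_nat_aux {Z x x' V V' L L' N N' : M} {l : x ⊗ V ⟶ L} {u : L ⟶ L'} {f : x ⟶ x'}
    {g : V ⟶ V'} {l' : x' ⊗ V' ⟶ L'} (hl : (f ⊗ₘ g) ≫ l' = l ≫ u) {φ : Z ⊗ L ⟶ N} {m : N ⟶ N'}
    {φ' : Z ⊗ L' ⟶ N'} (h : φ ≫ m = (Z ◁ u) ≫ φ') :
    ((α_ _ _ _).hom ≫ (Z ◁ l) ≫ φ) ≫ m =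
      ((Z ◁ f) ⊗ₘ g) ≫ (α_ _ _ _).hom ≫ (Z ◁ l') ≫ φ' := by
  have e : (Z ◁ l) ≫ (Z ◁ u) = (Z ◁ (f ⊗ₘ g)) ≫ (Z ◁ l') := by
    rw [← MonoidalCategory.whiskerLeft_comp, ← MonoidalCategory.whiskerLeft_comp, hl]
  rw [Category.assoc, Category.assoc, h, reassoc_of% e, ← id_tensorHom Z f,
    associator_naturality_assoc, id_tensorHom]

end

section
variable {C : Type v} {M : Type u} [Category.{v} M] [MonoidalCategory M] [SymmetricCategory M]
  [MonoidalClosed M] [HasColimits M]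
open Profile

namespace Operad
variable (O : Operad C M)

theorem actRep_nat {A B : O.monad.Algebra} (φ : A ⟶ B) (d : C) (a : Profile C) (t : ℕ) (c : C) :
    O.actRep A d a t c ≫ φ.f d =
      ((_ ◁ pwTrans φ.f a) ⊗ₘ bigTMap t fun _ => φ.f c) ≫ O.actRep B d a t c := by
  refine actRep_nat_aux (pwCat_nat φ.f a (rep t c)) ?_
  have h1 := ι_circMap (O.obj d) φ.f (a.append (rep t c))
  refine (Category.assoc _ _ _).trans ((congrArg (fun z => tι (O.obj d) (pwF A.A) _ ≫ z)
    (O.hom_act φ d).symm).trans ?_)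
  exact (Category.assoc _ _ _).symm.trans ((congrArg (fun z => z ≫ B.a d) h1).trans
    (Category.assoc _ _ _))

theorem act_ext_aux {Z Z' x x' V V' N N' : M} {l : x ⊗ V ⟶ x'} (_ : IsIso l) {p : Z ⟶ Z'}
    {m : x' ⟶ V'} (_ : IsIso m) {τ : Z' ⊗ x' ⟶ N} {τ' : Z ⊗ V' ⟶ N} (hw : (p ▷ x') ≫ τ = (Z ◁ m) ≫
      τ')
    {f g : N ⟶ N'} (h : ((α_ _ _ _).hom ≫ (Z' ◁ l) ≫ τ) ≫ f = ((α_ _ _ _).hom ≫ (Z' ◁ l) ≫ τ) ≫ g) :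
    τ' ≫ f = τ' ≫ g := by
  simp only [Category.assoc] at h
  have h := (cancel_epi _).1 ((cancel_epi _).1 h)
  rw [← cancel_epi (Z ◁ m), ← Category.assoc, ← hw, ← Category.assoc, ← hw, Category.assoc,
    Category.assoc, h]

/-- Every map out of an algebra is determined by its composites with the action maps: the action of
the unit of the operad is the identity. -/
theorem act_ext (A : O.monad.Algebra) {d : C} (c : C) {V : M} {f g : A.A d ⟶ V}
    (h : ∀ a, O.actRep A d a 0 c ≫ f = O.actRep A d a 0 c ≫ g) : f = g := by
  have h1 : A.a d ≫ f = A.a d ≫ g := by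
    refine t_ext fun a => ?_
    have h1 := act_ext_aux (pwCat_isIso A.A a (rep 0 c)) (pwMap_isIso A.A (appendNil a c))
      (O.act_w A d (appendNil a c)) (h a)
    exact (Category.assoc _ _ _).symm.trans (h1.trans (Category.assoc _ _ _))
  have hu : O.unit A.A d ≫ A.a d = 𝟙 (A.A d) := congrFun A.unit d
  have h2 := congrArg (fun z => O.unit A.A d ≫ z) h1
  exact (Category.id_comp f).symm.trans ((congrArg (fun z => z ≫ f) hu.symm).trans
    ((Category.assoc _ _ _).trans (h2.trans ((Category.assoc _ _ _).symm.trans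
      ((congrArg (fun z => z ≫ g) hu).trans (Category.id_comp g))))))

/-- The action on `A` as a map out of `O_A(d; ) ⊗ 𝟙`. With no factors, the tensor power of `Y` is
that of `A_c`. -/
theorem exists_act_zero (A : O.monad.Algebra) (Y : M) (d c : C) :
    ∃ ζ : tensorOver (O.envRep A d 0 c) (powF Y 0) ⟶ A.A d,
      ∀ a, O.envGen A Y d a 0 c ≫ ζ = O.actRep A d a 0 c := by
  obtain ⟨ζ, hζ⟩ := O.exists_act A d 0 c
  refine ⟨tmap (𝟙 _) (powZero Y (A.A c)) ≫ ζ, fun a => ?_⟩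
  have h := (tι_map (𝟙 (O.envRep A d 0 c)) (powZero Y (A.A c)) (BSym.pt 0)).trans
    (congrArg (fun z => z ≫ tι (O.envRep A d 0 c) (powF (A.A c) 0) (BSym.pt 0))
      (id_tensorHom_id _ _))
  have h := h.trans (Category.id_comp _)
  refine Eq.trans ?_ (hζ a)
  refine (Category.assoc _ _ _).trans ((congrArg (fun z => _ ≫ z)
    ((Category.assoc _ _ _).symm.trans (congrArg (fun z => z ≫ ζ) h))).trans
      (Category.assoc _ _ _).symm)

end Operad

namespace CellAttachment
variable {O : Operad C M} {c : C} (D : CellAttachment O c)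

/-- The number of factors `Y` is at most `q` on the vertices of the cube in `Q^n_q`. -/
theorem cube_cnt {n q : ℕ} (ε : Cube n q) (a : Profile C) : (labApp a (repLab c ε.1)).cnt ≤ q :=
  (repLab_cnt a c ε.1).trans_le ε.2

/-- The stage `(A_t)_d` of the filtration, with its maps from the objects
`O_A(d; c, …, c) ⊗_{Σ_q} (Y_c ⊗ ⋯ ⊗ Y_c)`, for `q ≤ t`, and its map to `P`. -/
structure Stage (d : C) (t : ℕ) where
  N : M
  map (q : ℕ) (h : q ≤ t) : O.cell D.A D.Y d q c ⟶ N
  rel (q : ℕ) (h : q + 1 ≤ t) (a : Profile C) :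
    D.attach d a q ≫ O.envGen D.A (D.Y c) d (a.append (single c)) q c ≫
        map q ((Nat.le_succ q).trans h) =
      (_ ◁ (D.i c ⊗ₘ 𝟙 (bigT q fun _ => D.Y c))) ≫ O.envGen D.A (D.Y c) d a (q + 1) c ≫
        map (q + 1) h
  incl : N ⟶ D.P.A d
  map_incl (q : ℕ) (h : q ≤ t) : map q h ≫ incl = D.targetMap d q

namespace Stage
variable {D} {d : C} {t : ℕ} (S : D.Stage d t)

/-- The maps of a stage, as a cocell with domain `q ≤ t`. -/
def cocell : D.Cocell d S.N where
  dom q := q ≤ t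
  down h := (Nat.le_succ _).trans h
  map := S.map
  rel := S.rel

theorem exists_fstar : ∃ F : tensorOver (O.envRep D.A d (t + 1) c) (Q (D.i c) (t + 1) t) ⟶ S.N,
    ∀ (a : Profile C) (ε : Cube (t + 1) t), (O.envι D.A d a (rep (t + 1) c) ⊗ₘ cubeι (D.i c) ε) ≫
      tι (O.envRep D.A d (t + 1) c) (Q (D.i c) (t + 1) t) (BSym.pt (t + 1)) ≫ F =
        S.cocell.vertGen ε.1 a (cube_cnt ε a) := S.cocell.exists_desc (t + 1) t fun ε a =>
          cube_cnt ε a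

/-- The map `f_*` to a stage. -/
def fstar : tensorOver (O.envRep D.A d (t + 1) c) (Q (D.i c) (t + 1) t) ⟶ S.N :=
  S.exists_fstar.choose

theorem fstar_spec (a : Profile C) (ε : Cube (t + 1) t) :
    (O.envι D.A d a (rep (t + 1) c) ⊗ₘ cubeι (D.i c) ε) ≫
      tι (O.envRep D.A d (t + 1) c) (Q (D.i c) (t + 1) t) (BSym.pt (t + 1)) ≫ S.fstar =
        S.cocell.vertGen ε.1 a (cube_cnt ε a) := S.exists_fstar.choose_spec a ε

theorem fstar_gen (a : Profile C) :
    (O.envι D.A d a (rep (t + 1) c) ⊗ₘ cubeVert (D.i c) t) ≫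
        tι (O.envRep D.A d (t + 1) c) (Q (D.i c) (t + 1) t) (BSym.pt (t + 1)) ≫ S.fstar =
      D.attach d a t ≫ O.envGen D.A (D.Y c) d (a.append (single c)) t c ≫ S.map t le_rfl :=
  (S.fstar_spec a _).trans (S.cocell.vertGen_head a t _ le_rfl)

/-- The square that defines the map from the next stage to `P` commutes, because the cocell of `P`
is total. -/
theorem fstar_incl : S.fstar ≫ S.incl =
    tmap (𝟙 (O.envRep D.A d (t + 1) c)) (corner (D.i c) (t + 1) t) ≫ D.targetMap d (t + 1) :=
  S.cocell.desc_comp (D.target d) S.incl (fun q h _ => S.map_incl q h) (fun ε a => cube_cnt ε a)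
    (fun _ _ => trivial) S.fstar_spec

variable (D) in
theorem cubeVert_to (t : ℕ) :
    cubeVert (D.i c) t ≫ cubeTo (D.i c) (t + 1) t = (D.i c ⊗ₘ 𝟙 (bigT t fun _ => D.Y c)) :=
  (cubeι_to (D.i c) _).trans (congrArg (fun z => D.i c ⊗ₘ z) (bigTMap_id t fun _ => D.Y c))

variable (D) in
/-- The generators of the corner map. -/
theorem corner_gen (d : C) (t : ℕ) (a : Profile C) {N : M}
    (w : O.cell D.A D.Y d (t + 1) c ⟶ N) :
    (O.envι D.A d a (rep (t + 1) c) ⊗ₘ cubeVert (D.i c) t) ≫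
        tι (O.envRep D.A d (t + 1) c) (Q (D.i c) (t + 1) t) (BSym.pt (t + 1)) ≫
          tmap (𝟙 (O.envRep D.A d (t + 1) c)) (corner (D.i c) (t + 1) t) ≫ w =
      (_ ◁ (D.i c ⊗ₘ 𝟙 (bigT t fun _ => D.Y c))) ≫ O.envGen D.A (D.Y c) d a (t + 1) c ≫ w :=
  gen_comp_aux
    (tι_map (𝟙 (O.envRep D.A d (t + 1) c)) (corner (D.i c) (t + 1) t) (BSym.pt (t + 1)))
    (cubeVert_to D t) rfl

/-- The next stage, as an object. -/
abbrev succN : M :=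
  pushout S.fstar (tmap (𝟙 (O.envRep D.A d (t + 1) c)) (corner (D.i c) (t + 1) t))

/-- The inclusion of a stage in the next one. -/
def toNext : S.N ⟶ S.succN := pushout.inl _ _

/-- The new map to the next stage. -/
def newMap : O.cell D.A D.Y d (t + 1) c ⟶ S.succN := pushout.inr _ _

theorem isPushout : IsPushout S.fstar
    (tmap (𝟙 (O.envRep D.A d (t + 1) c)) (corner (D.i c) (t + 1) t)) S.toNext S.newMap :=
  IsPushout.of_hasPushout _ _

/-- The maps from the cells to the next stage: `newMap` for `q = t + 1`, and the old ones for
`q ≤ t`. -/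
def succMap (q : ℕ) (h : q ≤ t + 1) : O.cell D.A D.Y d q c ⟶ S.succN :=
  if hq : q ≤ t then S.map q hq ≫ S.toNext
  else eqToHom (congrArg (fun q => O.cell D.A D.Y d q c) (show q = t + 1 by omega)) ≫ S.newMap

theorem succMap_le (q : ℕ) (h : q ≤ t + 1) (hq : q ≤ t) :
    S.succMap q h = S.map q hq ≫ S.toNext := dif_pos hq

theorem succMap_self : S.succMap (t + 1) le_rfl = S.newMap := by
  rw [succMap, dif_neg (by omega), eqToHom_refl, Category.id_comp]

/-- The next stage. -/
def succ : D.Stage d (t + 1) where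
  N := S.succN
  map := S.succMap
  rel q h a := by
    by_cases hq : q + 1 ≤ t
    · rw [S.succMap_le q _ (by omega), S.succMap_le (q + 1) h hq]
      exact Cocell.comp_right_aux (S.rel q hq a) S.toNext
    · obtain rfl : q = t := by omega
      rw [S.succMap_le q _ le_rfl, S.succMap_self]
      -- The new relation is the commutativity of the pushout square on the vertex `X ⊗ Y ⊗ ⋯ ⊗ Y`.
      refine Eq.trans ?_ (corner_gen D d q a S.newMap)
      rw [← S.isPushout.w]
      exact (Cocell.comp_right_aux (S.fstar_gen a) S.toNext).symm
  incl := S.isPushout.desc S.incl (D.targetMap d (t + 1)) S.fstar_incl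
  map_incl q h := by
    by_cases hq : q ≤ t
    · rw [S.succMap_le q h hq, Category.assoc, S.isPushout.inl_desc, S.map_incl]
    · obtain rfl : q = t + 1 := by omega
      rw [S.succMap_self, S.isPushout.inr_desc]

theorem toNext_incl : S.toNext ≫ S.succ.incl = S.incl := S.isPushout.inl_desc _ _ _

variable (D) in
/-- The stage `A_d`. -/
def zero (d : C) : D.Stage d 0 where
  N := D.A.A d
  map
    | 0, _ => (O.exists_act_zero D.A (D.Y c) d c).choose
    | q + 1, h => absurd h (Nat.not_succ_le_zero q)
  rel q h := absurd h (Nat.not_succ_le_zero q)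
  incl := D.j.f d
  map_incl
    | 0, _ => by
      refine O.envGen_ext D.A fun a => ?_
      rw [D.envGen_target]
      refine (Category.assoc _ _ _).symm.trans ((congrArg (fun z => z ≫ D.j.f d)
        ((O.exists_act_zero D.A (D.Y c) d c).choose_spec a)).trans ?_)
      exact O.actRep_nat D.j d a 0 c
    | q + 1, h => absurd h (Nat.not_succ_le_zero q)

end Stage

/-- The stages of the filtration. -/
def stage (d : C) : ∀ t, D.Stage d t
  | 0 => Stage.zero D d
  | t + 1 => (stage d t).succ

end CellAttachment
end

/-! ### The colimit of the stages -/

section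
variable {C : Type v} {M : Type u} [Category.{v} M] [MonoidalCategory M] [SymmetricCategory M]
  [MonoidalClosed M] [HasColimits M]
open Profile

namespace CellAttachment
variable {O : Operad C M} {c : C} (D : CellAttachment O c)

theorem comp_square_aux {x y z z' y' V V' W : M} {f : x ⟶ y} {g : y ⟶ z} {φ : z ⟶ V} {m : V ⟶ V'}
    {f' : x ⟶ z'} {g' : z' ⟶ y'} {φ' : y' ⟶ V'} (h : f ≫ g ≫ φ ≫ m = f' ≫ g' ≫ φ') {k : V ⟶ W}
    {k' : V' ⟶ W} (hk : m ≫ k' = k) : f ≫ g ≫ φ ≫ k = f' ≫ g' ≫ φ' ≫ k' := by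
  rw [← hk]
  simp only [← Category.assoc] at h ⊢
  rw [h]

/-- A sequence of objects over `P` that is generated by cells has `P` as its colimit: a cocone on
the sequence restricts to a total cocell. -/
theorem tower_desc {N : ℕ → C → M} (step : ∀ t d, N t d ⟶ N (t + 1) d)
    (incl : ∀ t d, N t d ⟶ D.P.A d) (ξ : ∀ t d, O.cell D.A D.Y d t c ⟶ N t d)
    (hs : ∀ t d, step t d ≫ incl (t + 1) d = incl t d)
    (hξ : ∀ t d, ξ t d ≫ incl t d = D.targetMap d t)
    (rel : ∀ t d a, D.attach d a t ≫ O.envGen D.A (D.Y c) d (a.append (single c)) t c ≫ ξ t d ≫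
        step t d = (_ ◁ (D.i c ⊗ₘ 𝟙 (bigT t fun _ => D.Y c))) ≫
          O.envGen D.A (D.Y c) d a (t + 1) c ≫ ξ (t + 1) d)
    (ext0 : ∀ d {V : M} {f g : N 0 d ⟶ V}, ξ 0 d ≫ f = ξ 0 d ≫ g → f = g)
    (extS : ∀ t d {V : M} {f g : N (t + 1) d ⟶ V}, step t d ≫ f = step t d ≫ g →
      ξ (t + 1) d ≫ f = ξ (t + 1) d ≫ g → f = g)
    (d : C) {V : M} (x : ∀ t, N t d ⟶ V) (hx : ∀ t, step t d ≫ x (t + 1) = x t) :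
    ∃ θ : D.P.A d ⟶ V, (∀ t, incl t d ≫ θ = x t) ∧ ∀ θ', (∀ t, incl t d ≫ θ' = x t) → θ' = θ := by
  let E : D.Cocell d V :=
    { dom := fun _ => True
      down := fun _ => trivial
      map := fun q _ => ξ q d ≫ x q
      rel := fun q _ a => comp_square_aux (rel q d a) (hx q) }
  obtain ⟨θ, hθ⟩ := E.exists_of_target fun _ => trivial
  have hθ : ∀ q, D.targetMap d q ≫ θ = ξ q d ≫ x q := hθ
  have h1 : ∀ t, ξ t d ≫ incl t d ≫ θ = ξ t d ≫ x t := fun t => by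
    rw [← Category.assoc, hξ, hθ]
  refine ⟨θ, fun t => ?_, fun θ' h => Cocell.target_hom_ext D fun q => ?_⟩
  · induction t with
    | zero => exact ext0 d (h1 0)
    | succ t ih => exact extS t d (by rw [← Category.assoc, hs, ih, hx]) (h1 (t + 1))
  · rw [hθ, ← hξ, Category.assoc, h]

/-- The objects of the filtration after `A`. -/
def next (t : ℕ) (d : C) : M := (D.stage d (t + 1)).N

/-- The maps of the sequence. The case distinction is needed because `stages` is defined by cases.
-/
def filtStep : ∀ t d, stages D.A.A D.next t d ⟶ stages D.A.A D.next (t + 1) d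
  | 0, d => (D.stage d 0).toNext
  | t + 1, d => (D.stage d (t + 1)).toNext

/-- The maps from the cells to the stages. -/
def filtξ : ∀ t d, O.cell D.A D.Y d t c ⟶ stages D.A.A D.next t d
  | 0, d => (D.stage d 0).map 0 le_rfl
  | t + 1, d => (D.stage d (t + 1)).map (t + 1) le_rfl

/-- The attaching maps. -/
def filtStar : ∀ t d, tensorOver (O.envRep D.A d (t + 1) c) (Q (D.i c) (t + 1) t) ⟶
    stages D.A.A D.next t d
  | 0, d => (D.stage d 0).fstar
  | t + 1, d => (D.stage d (t + 1)).fstar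

/-- The maps from the stages to `P`. -/
def filtIncl : ∀ t d, stages D.A.A D.next t d ⟶ D.P.A d
  | 0, d => (D.stage d 0).incl
  | t + 1, d => (D.stage d (t + 1)).incl

theorem filt_isPushout : ∀ t d, IsPushout (D.filtStar t d)
    (tmap (𝟙 (O.envRep D.A d (t + 1) c)) (corner (D.i c) (t + 1) t)) (D.filtStep t d)
      (D.filtξ (t + 1) d)
  | 0, d => by
    have h := (D.stage d 0).isPushout
    rw [← Stage.succMap_self] at h
    exact h
  | t + 1, d => by
    have h := (D.stage d (t + 1)).isPushout
    rw [← Stage.succMap_self] at h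
    exact h

theorem filt_star_gen : ∀ (t : ℕ) (d : C) (a : Profile C),
    (O.envι D.A d a (rep (t + 1) c) ⊗ₘ cubeVert (D.i c) t) ≫
        tι (O.envRep D.A d (t + 1) c) (Q (D.i c) (t + 1) t) (BSym.pt (t + 1)) ≫ D.filtStar t d =
      D.attach d a t ≫ O.envGen D.A (D.Y c) d (a.append (single c)) t c ≫ D.filtξ t d
  | 0, d, a => (D.stage d 0).fstar_gen a
  | t + 1, d, a => (D.stage d (t + 1)).fstar_gen a

theorem filt_step_incl : ∀ t d, D.filtStep t d ≫ D.filtIncl (t + 1) d = D.filtIncl t d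
  | 0, d => (D.stage d 0).toNext_incl
  | t + 1, d => (D.stage d (t + 1)).toNext_incl

theorem filt_ξ_incl : ∀ t d, D.filtξ t d ≫ D.filtIncl t d = D.targetMap d t
  | 0, d => (D.stage d 0).map_incl 0 le_rfl
  | t + 1, d => (D.stage d (t + 1)).map_incl (t + 1) le_rfl

theorem filt_ξ_zero (d : C) (a : Profile C) :
    O.envGen D.A (D.Y c) d a 0 c ≫ D.filtξ 0 d = O.actRep D.A d a 0 c :=
  (O.exists_act_zero D.A (D.Y c) d c).choose_spec a

/-- The relations between the maps on cells that come from a square as in a filtration. -/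
theorem rel_of_square {d : C} {t : ℕ} {N N' : M}
    {F : tensorOver (O.envRep D.A d (t + 1) c) (Q (D.i c) (t + 1) t) ⟶ N} {s : N ⟶ N'}
    {ξ : O.cell D.A D.Y d t c ⟶ N} {ξ' : O.cell D.A D.Y d (t + 1) c ⟶ N'}
    (w : F ≫ s = tmap (𝟙 (O.envRep D.A d (t + 1) c)) (corner (D.i c) (t + 1) t) ≫ ξ')
    {a : Profile C} (h : (O.envι D.A d a (rep (t + 1) c) ⊗ₘ cubeVert (D.i c) t) ≫
        tι (O.envRep D.A d (t + 1) c) (Q (D.i c) (t + 1) t) (BSym.pt (t + 1)) ≫ F =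
      D.attach d a t ≫ O.envGen D.A (D.Y c) d (a.append (single c)) t c ≫ ξ) :
    D.attach d a t ≫ O.envGen D.A (D.Y c) d (a.append (single c)) t c ≫ ξ ≫ s =
      (_ ◁ (D.i c ⊗ₘ 𝟙 (bigT t fun _ => D.Y c))) ≫ O.envGen D.A (D.Y c) d a (t + 1) c ≫ ξ' := by
  refine Eq.trans ?_ (Stage.corner_gen D d t a ξ')
  rw [← w]
  exact (Cocell.comp_right_aux h s).symm

theorem filt_ext_zero (d : C) {ξ : O.cell D.A D.Y d 0 c ⟶ D.A.A d}
    (h : ∀ a, O.envGen D.A (D.Y c) d a 0 c ≫ ξ = O.actRep D.A d a 0 c) {V : M} {f g : D.A.A d ⟶ V}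
    (e : ξ ≫ f = ξ ≫ g) : f = g := by
  refine O.act_ext D.A c fun a => ?_
  rw [← h]
  exact (Category.assoc _ _ _).trans ((congrArg (fun z => _ ≫ z) e).trans
    (Category.assoc _ _ _).symm)

theorem filt_desc (d : C) {V : M} (x : ∀ t, stages D.A.A D.next t d ⟶ V)
    (hx : ∀ t, D.filtStep t d ≫ x (t + 1) = x t) :
    ∃ θ : D.P.A d ⟶ V, (∀ t, D.filtIncl t d ≫ θ = x t) ∧
      ∀ θ', (∀ t, D.filtIncl t d ≫ θ' = x t) → θ' = θ :=
  D.tower_desc D.filtStep D.filtIncl D.filtξ D.filt_step_incl D.filt_ξ_incl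
    (fun t d a => D.rel_of_square (D.filt_isPushout t d).w (D.filt_star_gen t d a))
    (fun d => D.filt_ext_zero d (D.filt_ξ_zero d))
    (fun t d => (D.filt_isPushout t d).hom_ext) d x hx

/-- The filtration of the pushout. -/
def filtration : D.Filtration where
  next := D.next
  step := D.filtStep
  ξ := D.filtξ
  fstar := D.filtStar
  isPushout := D.filt_isPushout
  ξ_zero := D.filt_ξ_zero
  fstar_gen := D.filt_star_gen
  incl := D.filtIncl
  step_incl t := funext (D.filt_step_incl t)
  incl_zero := rfl
  ξ_incl t d a := by
    rw [D.filt_ξ_incl, D.envGen_target]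
  isColimit :=
    have hw (s : Cocone (Functor.ofSequence (X := stages D.A.A D.next) D.filtStep)) (t : ℕ) (d : C)
      :
        D.filtStep t d ≫ s.ι.app (t + 1) d = s.ι.app t d := by
      have h := s.w (homOfLE (Nat.le_succ t))
      rw [Functor.ofSequence_map_homOfLE_succ] at h
      exact congrFun h d
    { desc := fun s d => (D.filt_desc d (fun t => s.ι.app t d) fun t => hw s t d).choose
      fac := fun s t => funext fun d =>
        (D.filt_desc d (fun t => s.ι.app t d) fun t => hw s t d).choose_spec.1 t
      uniq := fun s m hm => funext fun d =>
        (D.filt_desc d (fun t => s.ι.app t d) fun t => hw s t d).choose_spec.2 (m d)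
          fun t => congrFun (hm t) d }

end CellAttachment
end

/-! ### Maps on cells -/

section
variable {M : Type u} [Category.{v} M] [MonoidalCategory M]

theorem head_gen_aux {U E V V0 Q T : M} {p : U ⟶ E} {ι : V ⟶ Q} {m : V ⟶ V0} {ι0 : V0 ⟶ Q}
    {a : Q ⟶ Q} (hι : ι = m ≫ ι0 ≫ a) {τ : E ⊗ Q ⟶ T} {e : E ⟶ E} (hw : (e ▷ Q) ≫ τ = (E ◁ a) ≫ τ)
    {u : U ⟶ U} (hp : p ≫ e = u ≫ p) : (p ⊗ₘ ι) ≫ τ = (u ⊗ₘ m) ≫ (p ⊗ₘ ι0) ≫ τ := by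
  have h : (p ⊗ₘ ι) = (p ⊗ₘ (m ≫ ι0)) ≫ (E ◁ a) := by
    rw [← id_tensorHom, tensorHom_comp_tensorHom, Category.comp_id, Category.assoc, hι]
  rw [h, Category.assoc, ← hw, ← tensorHom_id, tensorHom_comp_tensorHom_assoc,
    tensorHom_comp_tensorHom_assoc, hp, Category.comp_id]

theorem attach_pre_aux {Z Z' x X R Q y : M} {s : Z' ⟶ Z} {r : X ⟶ R} {l : x ⊗ R ⟶ y} {W : M}
    (f : W ⟶ X) :
    (α_ _ _ _).inv ≫ ((α_ _ _ _).hom ▷ Q) ≫ ((s ⊗ₘ ((x ◁ (f ≫ r)) ≫ l)) ▷ Q) =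
      ((Z' ⊗ x) ◁ (f ▷ Q)) ≫
        (α_ _ _ _).inv ≫ ((α_ _ _ _).hom ▷ Q) ≫ ((s ⊗ₘ ((x ◁ r) ≫ l)) ▷ Q) := by
  have h : (s ⊗ₘ ((x ◁ (f ≫ r)) ≫ l)) = (Z' ◁ (x ◁ f)) ≫ (s ⊗ₘ ((x ◁ r) ≫ l)) := by
    rw [← id_tensorHom Z', tensorHom_comp_tensorHom, Category.id_comp,
      MonoidalCategory.whiskerLeft_comp, Category.assoc]
  rw [h]
  simp

theorem attach_hom_aux {Z Z' x x' X X' R R' P' Q Q' y y' : M} {s : Z' ⟶ Z} {r : P' ⟶ R}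
    {l : x ⊗ R ⟶ y} {u : y ⟶ y'} {t : x ⟶ x'} {r' : R' ⟶ X'} {l' : x' ⊗ X' ⟶ y'} {j : P' ⟶ R'}
    (h : ((x ◁ r) ≫ l) ≫ u = (t ⊗ₘ j) ≫ (x' ◁ r') ≫ l') {f : X ⟶ P'} {P : M} {k : X ⟶ P}
    {f' : P ⟶ R'} (hk : f ≫ j = k ≫ f') (w : Q ⟶ Q') :
    ((α_ _ _ _).inv ≫ ((α_ _ _ _).hom ▷ Q) ≫ ((s ⊗ₘ ((x ◁ (f ≫ r)) ≫ l)) ▷ Q)) ≫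
        ((Z ◁ u) ⊗ₘ w) =
      ((Z' ◁ t) ⊗ₘ (k ⊗ₘ w)) ≫
        ((α_ _ _ _).inv ≫ ((α_ _ _ _).hom ▷ Q') ≫ ((s ⊗ₘ ((x' ◁ (f' ≫ r')) ≫ l')) ▷ Q')) := by
  have e : ((Z' ◁ t) ⊗ₘ ((k ≫ f') ⊗ₘ w)) = ((Z' ◁ t) ⊗ₘ (k ⊗ₘ w)) ≫ ((Z' ⊗ x') ◁ (f' ▷ Q')) := by
    rw [← id_tensorHom (Z' ⊗ x'), tensorHom_comp_tensorHom, Category.comp_id, ← tensorHom_id,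
      tensorHom_comp_tensorHom, Category.comp_id]
  rw [attach_nat_aux h, hk, e, attach_pre_aux f', Category.assoc]

theorem naturality_square_aux {x y z z' V V' W T T' N : M} {at' : x ⟶ y} {e : y ⟶ V}
    {T1 : V ⟶ V'} {k : y ⟶ z} {e' : z ⟶ V'} (h1 : e ≫ T1 = k ≫ e') {k2 : x ⟶ z'} {at2 : z' ⟶ z}
    (h2 : at' ≫ k = k2 ≫ at2) {r : V' ⟶ N} {s' : z' ⟶ W} {g' : W ⟶ T'} {r' : T' ⟶ N}
    (h3 : at2 ≫ e' ≫ r = s' ≫ g' ≫ r') {w : M} {s : x ⟶ w} {g : w ⟶ T} {T2 : T ⟶ T'} {k3 : w ⟶ W}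
    (h4 : g ≫ T2 = k3 ≫ g') (h5 : s ≫ k3 = k2 ≫ s') :
    at' ≫ e ≫ T1 ≫ r = s ≫ g ≫ T2 ≫ r' := by
  rw [reassoc_of% h1, reassoc_of% h2, h3, reassoc_of% h4, reassoc_of% h5]

theorem tensor_square_aux {U U' X X' Y Y' Q Q' : M} {i : X ⟶ Y} {y : Y ⟶ Y'} {k : X ⟶ X'}
    {i' : X' ⟶ Y'} (e : i ≫ y = k ≫ i') (t : U ⟶ U') (w : Q ⟶ Q') :
    (U ◁ (i ⊗ₘ 𝟙 Q)) ≫ (t ⊗ₘ (y ⊗ₘ w)) = (t ⊗ₘ (k ⊗ₘ w)) ≫ (U' ◁ (i' ⊗ₘ 𝟙 Q')) := by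
  rw [tensor_head_aux e, ← id_tensorHom U', tensorHom_comp_tensorHom, tensorHom_comp_tensorHom,
    Category.comp_id, Category.comp_id]

end

section
variable {C : Type v} {M : Type u} [Category.{v} M] [MonoidalCategory M] [SymmetricCategory M]
  [MonoidalClosed M] [HasColimits M]
open Profile

/-- The vertex `X ⊗ Y ⊗ ⋯ ⊗ Y`. -/
def headCube (t : ℕ) : Cube (t + 1) t := ⟨Fin.cons false fun _ => true, by
  rw [Fin.univ_succ, Finset.filter_cons, if_neg (by simp)]
  refine (Finset.card_filter_le _ _).trans ?_
  simp⟩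

theorem exists_le_headCube {t : ℕ} (ε : Cube (t + 1) t) :
    ∃ σ : Equiv.Perm (Fin (t + 1)), ε.perm σ ≤ headCube t := by
  have h : ∃ k, ε.1 k = false := by
    by_contra h
    have h : (Finset.univ.filter fun k => ε.1 k = true) = Finset.univ :=
      Finset.filter_true_of_mem fun k _ => by
        by_contra hk
        exact h ⟨k, by simpa using hk⟩
    have h2 : (Finset.univ.filter fun k => ε.1 k = true).card ≤ t := ε.2
    rw [h] at h2
    simp at h2
  obtain ⟨k, hk⟩ := h
  -- A vertex of `Q^{t+1}_t` has a factor `X`, which is moved to the first place.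
  refine ⟨Equiv.swap 0 k, fun l => ?_⟩
  refine Fin.cases ?_ (fun l => Bool.le_true _) l
  change ε.1 ((Equiv.swap 0 k).symm 0) ≤ false
  rw [Equiv.symm_swap, Equiv.swap_apply_left, hk]

/-- Up to a permutation, every vertex of `Q^{t+1}_t` maps to the vertex `X ⊗ Y ⊗ ⋯ ⊗ Y`. -/
theorem exists_cubeι_eq {X Y : M} (i : X ⟶ Y) {t : ℕ} (ε : Cube (t + 1) t) :
    ∃ (τ : Equiv.Perm (Fin (t + 1))) (m : vert X Y ε.1 ⟶ X ⊗ bigT t fun _ => Y),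
      cubeι i ε = m ≫ cubeVert i t ≫ cubeAct i τ := by
  obtain ⟨σ, h⟩ := exists_le_headCube ε
  refine ⟨σ.symm, cubePerm X Y σ ε ≫ bigTMap (t + 1) fun k => sideMap i (h k), ?_⟩
  have h1 : (bigTMap (t + 1) fun k => sideMap i (h k)) ≫ cubeVert i t = cubeι i (ε.perm σ) :=
    cubeι_w i h
  have h2 : cubeAct (q := t) i σ ≫ cubeAct i σ.symm = 𝟙 _ :=
    (cubeAct_comp i σ σ.symm).symm.trans ((congrArg (cubeAct i) (Equiv.self_trans_symm σ)).trans
      (cubeAct_refl i (t + 1) t))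
  have h3 := (Category.assoc _ _ _).symm.trans
    (congrArg (fun z => z ≫ cubeAct i σ.symm) (ι_cubeAct i σ ε))
  refine ((Category.comp_id _).symm.trans (congrArg (fun z => cubeι i ε ≫ z) h2.symm)).trans
    (h3.trans ?_)
  rw [← h1]
  exact (Category.assoc _ _ _).trans ((congrArg (fun z => _ ≫ z) (Category.assoc _ _ _)).trans
    (Category.assoc _ _ _).symm)

/-- Maps out of `O_A(d; c, …, c) ⊗_{Σ_{t+1}} Q^{t+1}_t` are determined by the vertex
`X ⊗ Y ⊗ ⋯ ⊗ Y`. -/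
theorem Operad.head_ext (O : Operad C M) (A : O.monad.Algebra) {d c : C} {t : ℕ} {X Y N : M}
    {i : X ⟶ Y} {f g : tensorOver (O.envRep A d (t + 1) c) (Q i (t + 1) t) ⟶ N}
    (h : ∀ a : Profile C, (O.envι A d a (rep (t + 1) c) ⊗ₘ cubeVert i t) ≫
        tι (O.envRep A d (t + 1) c) (Q i (t + 1) t) (BSym.pt (t + 1)) ≫ f =
      (O.envι A d a (rep (t + 1) c) ⊗ₘ cubeVert i t) ≫
        tι (O.envRep A d (t + 1) c) (Q i (t + 1) t) (BSym.pt (t + 1)) ≫ g) : f = g := by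
  refine O.gen_ext A fun a ε => ?_
  obtain ⟨τ, m, hm⟩ := exists_cubeι_eq i ε
  have e := head_gen_aux hm (tι_w (O.envRep A d (t + 1) c) (Q i (t + 1) t)
    (a := BSym.pt (t + 1)) (b := BSym.pt (t + 1)) τ) (O.envι_map A d a (Operad.repMap τ c))
  have e' : ∀ f : tensorOver (O.envRep A d (t + 1) c) (Q i (t + 1) t) ⟶ N,
      (O.envι A d a (rep (t + 1) c) ⊗ₘ cubeι i ε) ≫
        tι (O.envRep A d (t + 1) c) (Q i (t + 1) t) (BSym.pt (t + 1)) ≫ f =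
      (((O.obj d).map (appendMap (𝟙 a) (Operad.repMap τ c)).op ▷ pw A.A a) ⊗ₘ m) ≫
        (O.envι A d a (rep (t + 1) c) ⊗ₘ cubeVert i t) ≫
          tι (O.envRep A d (t + 1) c) (Q i (t + 1) t) (BSym.pt (t + 1)) ≫ f := fun f =>
    (Category.assoc _ _ _).symm.trans ((congrArg (fun z => z ≫ f) e).trans
      ((Category.assoc _ _ _).trans (congrArg (fun z => _ ≫ z) (Category.assoc _ _ _))))
  exact (e' f).trans ((congrArg (fun z => _ ≫ z) (h a)).trans (e' g).symm)

namespace CellAttachment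
variable {O : Operad C M} {c : C} {D D' : CellAttachment O c} (h : D.Hom D')

theorem Hom.fc_α : D.fc ≫ h.α.f c = h.x c ≫ D'.fc := by
  have h1 : D.f.f c ≫ h.α.f c = circMap (O.obj c) h.x ≫ D'.f.f c :=
    congrFun (congrArg Monad.Algebra.Hom.f h.f_α) c
  have h2 := O.unit_nat h.x c
  refine (Category.assoc _ _ _).trans ((congrArg (fun z => O.unit D.X c ≫ z) h1).trans ?_)
  exact (Category.assoc _ _ _).symm.trans ((congrArg (fun z => z ≫ D'.f.f c) h2.symm).trans
    (Category.assoc _ _ _))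

theorem Hom.attach_nat (d : C) (a : Profile C) (t : ℕ) :
    D.attach d a t ≫ ((_ ◁ pwTrans h.α.f (a.append (single c))) ⊗ₘ bigTMap t fun _ => h.y c) =
      ((_ ◁ pwTrans h.α.f a) ⊗ₘ (h.x c ⊗ₘ bigTMap t fun _ => h.y c)) ≫ D'.attach d a t :=
  attach_hom_aux (single_nat_aux (pwCat_nat h.α.f a (single c))) h.fc_α _

/-- The map between the cells of two pushouts. -/
def Hom.cellMap (d : C) (t : ℕ) : O.cell D.A D.Y d t c ⟶ O.cell D'.A D'.Y d t c :=
  tmap (O.envRepMap h.α d t c) (powMap (h.y c) t)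

theorem Hom.envGen_cellMap (d : C) (a : Profile C) (t : ℕ) :
    O.envGen D.A (D.Y c) d a t c ≫ h.cellMap d t =
      ((_ ◁ pwTrans h.α.f a) ⊗ₘ bigTMap t fun _ => h.y c) ≫ O.envGen D'.A (D'.Y c) d a t c :=
  O.envGen_map h.α d a t c (powMap (h.y c) t)

namespace Filtration
variable (F : D.Filtration) (F' : D'.Filtration)

/-- A map of stages that is compatible with the cells extends to the next stages. -/
theorem step_compat {t : ℕ} {d : C} {φ : F.stage t d ⟶ F'.stage t d}
    (hφ : F.ξ t d ≫ φ = h.cellMap d t ≫ F'.ξ t d) :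
    F.fstar t d ≫ φ ≫ F'.step t d =
      tmap (𝟙 (O.envRep D.A d (t + 1) c)) (corner (D.i c) (t + 1) t) ≫
        h.cellMap d (t + 1) ≫ F'.ξ (t + 1) d := by
  refine O.head_ext D.A fun a => ?_
  have e1 := Cocell.comp_right_aux (F.fstar_gen t d a) (φ ≫ F'.step t d)
  have e2 : F.ξ t d ≫ φ ≫ F'.step t d = h.cellMap d t ≫ F'.ξ t d ≫ F'.step t d := by
    rw [← Category.assoc, hφ, Category.assoc]
  rw [e2] at e1
  refine e1.trans (Eq.trans ?_ (Stage.corner_gen D d t a _).symm)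
  exact naturality_square_aux (h.envGen_cellMap d _ t) (h.attach_nat d a t)
    (D'.rel_of_square (F'.isPushout t d).w (F'.fstar_gen t d a)) (h.envGen_cellMap d a (t + 1))
    (tensor_square_aux (congrFun h.i_y c) _ _)

end Filtration
end CellAttachment
end

/-! ### Naturality of the filtration -/

section
variable {M : Type u} [Category.{v} M] [MonoidalCategory M]

theorem tensor_comp_aux {Z x x' x'' V V' V'' y y' N : M} {f : x ⟶ x'} {f' : x' ⟶ x''} {g : V ⟶ V'}
    {g' : V' ⟶ V''} {k : x ⟶ y} {k' : y ⟶ x''} {l : V ⟶ y'} {l' : y' ⟶ V''} (h : f ≫ f' = k ≫ k')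
    (h' : g ≫ g' = l ≫ l') (φ : (Z ⊗ x'') ⊗ V'' ⟶ N) :
    ((Z ◁ f) ⊗ₘ g) ≫ ((Z ◁ f') ⊗ₘ g') ≫ φ = ((Z ◁ k) ⊗ₘ l) ≫ ((Z ◁ k') ⊗ₘ l') ≫ φ := by
  rw [tensorHom_comp_tensorHom_assoc, tensorHom_comp_tensorHom_assoc,
    ← MonoidalCategory.whiskerLeft_comp, ← MonoidalCategory.whiskerLeft_comp, h, h']

end

section
variable {C : Type v} {M : Type u} [Category.{v} M] [MonoidalCategory M] [SymmetricCategory M]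
  [MonoidalClosed M] [HasColimits M]
open Profile

namespace CellAttachment
variable {O : Operad C M} {c : C} {D D' : CellAttachment O c} (h : D.Hom D')

theorem Hom.gc_p : D.gc ≫ h.p.f c = h.y c ≫ D'.gc := by
  have h1 : D.g.f c ≫ h.p.f c = circMap (O.obj c) h.y ≫ D'.g.f c :=
    congrFun (congrArg Monad.Algebra.Hom.f h.g_p) c
  have h2 := O.unit_nat h.y c
  refine (Category.assoc _ _ _).trans ((congrArg (fun z => O.unit D.Y c ≫ z) h1).trans ?_)
  exact (Category.assoc _ _ _).symm.trans ((congrArg (fun z => z ≫ D'.g.f c) h2.symm).trans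
    (Category.assoc _ _ _))

theorem Hom.j_p' (d : C) : D.j.f d ≫ h.p.f d = h.α.f d ≫ D'.j.f d :=
  congrFun (congrArg Monad.Algebra.Hom.f h.j_p) d

theorem Hom.targetMap_p (d : C) (t : ℕ) :
    D.targetMap d t ≫ h.p.f d = h.cellMap d t ≫ D'.targetMap d t := by
  refine O.envGen_ext D.A fun a => ?_
  have e1 := (Category.assoc _ _ _).symm.trans
    (congrArg (fun z => z ≫ h.p.f d) (D.envGen_target d a t))
  have e2 := (Category.assoc _ _ _).symm.trans
    (congrArg (fun z => z ≫ D'.targetMap d t) (h.envGen_cellMap d a t))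
  refine e1.trans (Eq.trans ?_ e2.symm)
  rw [Category.assoc, Category.assoc, O.actRep_nat h.p, D'.envGen_target]
  refine tensor_comp_aux ?_ ?_ _
  · exact (bigTMap_comp _ _ _).trans ((congrArg (bigTMap a.len) (funext fun k =>
      h.j_p' (a.col k))).trans (bigTMap_comp _ _ _).symm)
  · exact (bigTMap_comp _ _ _).trans ((congrArg (bigTMap t) (funext fun _ =>
      h.gc_p)).trans (bigTMap_comp _ _ _).symm)

namespace Filtration
variable (F : D.Filtration) (F' : D'.Filtration)

theorem ξ_incl_eq (t : ℕ) (d : C) : F.ξ t d ≫ F.incl t d = D.targetMap d t :=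
  O.envGen_ext D.A fun a => (F.ξ_incl t d a).trans (D.envGen_target d a t).symm

theorem zero_compat (d : C) : F.ξ 0 d ≫ h.α.f d = h.cellMap d 0 ≫ F'.ξ 0 d := by
  refine O.envGen_ext D.A fun a => ?_
  have e1 := (Category.assoc _ _ _).symm.trans
    (congrArg (fun z => z ≫ h.α.f d) (F.ξ_zero d a))
  have e2 := (Category.assoc _ _ _).symm.trans
    (congrArg (fun z => z ≫ F'.ξ 0 d) (h.envGen_cellMap d a 0))
  refine e1.trans (Eq.trans ?_ e2.symm)
  refine (O.actRep_nat h.α d a 0 c).trans (Eq.trans ?_ (Category.assoc _ _ _).symm)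
  exact congrArg (fun z => _ ≫ z) (F'.ξ_zero d a).symm

/-- The map between the stages of two filtrations. -/
def mapStage (d : C) : ∀ t, { φ : F.stage t d ⟶ F'.stage t d //
    F.ξ t d ≫ φ = h.cellMap d t ≫ F'.ξ t d }
  | 0 => ⟨h.α.f d, zero_compat h F F' d⟩
  | t + 1 => ⟨(F.isPushout t d).desc ((mapStage d t).1 ≫ F'.step t d)
      (h.cellMap d (t + 1) ≫ F'.ξ (t + 1) d) (step_compat h F F' (mapStage d t).2),
      (F.isPushout t d).inr_desc _ _ _⟩

theorem step_mapStage (d : C) (t : ℕ) :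
    F.step t d ≫ (mapStage h F F' d (t + 1)).1 = (mapStage h F F' d t).1 ≫ F'.step t d :=
  (F.isPushout t d).inl_desc _ _ _

theorem mapStage_incl (d : C) : ∀ t,
    F.incl t d ≫ h.p.f d = (mapStage h F F' d t).1 ≫ F'.incl t d
  | 0 => (congrArg (fun z => z ≫ h.p.f d) (congrFun F.incl_zero d)).trans ((h.j_p' d).trans
      (congrArg (fun z => h.α.f d ≫ z) (congrFun F'.incl_zero d).symm))
  | t + 1 => by
    have s : F.step t d ≫ F.incl (t + 1) d = F.incl t d := congrFun (F.step_incl t) d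
    have s' : F'.step t d ≫ F'.incl (t + 1) d = F'.incl t d := congrFun (F'.step_incl t) d
    refine (F.isPushout t d).hom_ext ?_ ?_
    · rw [reassoc_of% s, mapStage_incl d t, ← Category.assoc, step_mapStage, Category.assoc, s']
    · rw [← Category.assoc, F.ξ_incl_eq, h.targetMap_p, ← Category.assoc,
        (mapStage h F F' d (t + 1)).2, Category.assoc, F'.ξ_incl_eq]

theorem hom_unique {φ ψ : ∀ t, F.stage t ⟶ F'.stage t} (h0 : φ 0 = ψ 0)
    (hφ : ∀ t, F.step t ≫ φ (t + 1) = φ t ≫ F'.step t)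
    (hψ : ∀ t, F.step t ≫ ψ (t + 1) = ψ t ≫ F'.step t)
    (hξ : ∀ (t : ℕ) (d : C) (a : Profile C), O.envGen D.A (D.Y c) d a t c ≫ F.ξ t d ≫ φ t d =
      O.envGen D.A (D.Y c) d a t c ≫ F.ξ t d ≫ ψ t d) : φ = ψ := by
  funext t
  induction t with
  | zero => exact h0
  | succ t ih =>
    funext d
    have e : F.step t d ≫ φ (t + 1) d = φ t d ≫ F'.step t d := congrFun (hφ t) d
    have e' : F.step t d ≫ ψ (t + 1) d = ψ t d ≫ F'.step t d := congrFun (hψ t) d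
    refine (F.isPushout t d).hom_ext ?_ (O.envGen_ext D.A fun a => hξ (t + 1) d a)
    rw [e, e', ih]

end Filtration
end CellAttachment
end
end
end ColoredOperads

theorem mainTheorem11 {C : Type v} {M : Type u} [Category.{v} M] [MonoidalCategory M]
    [SymmetricCategory M] [MonoidalClosed M] [HasLimits M] [HasColimits M] (O : Operad C M)
    (c : C) :
    (∀ D : CellAttachment O c, Nonempty D.Filtration) ∧
    ∀ (D D' : CellAttachment O c) (h : D.Hom D') (F : D.Filtration) (F' : D'.Filtration),
      ∃! φ : ∀ t, F.stage t ⟶ F'.stage t,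
        φ 0 = h.α.f ∧
        (∀ t, F.step t ≫ φ (t + 1) = φ t ≫ F'.step t) ∧
        (∀ (t : ℕ) (d : C) (a : Profile C),
          O.envGen D.A (D.Y c) d a t c ≫ F.ξ t d ≫ φ t d =
            ((_ ◁ pwTrans h.α.f a) ⊗ₘ bigTMap t fun _ => h.y c) ≫
              O.envGen D'.A (D'.Y c) d a t c ≫ F'.ξ t d) ∧
        ∀ t, F.incl t ≫ h.p.f = φ t ≫ F'.incl t := by
  refine ⟨fun D => ⟨D.filtration⟩, fun D D' h F F' => ?_⟩
  refine ⟨fun t d => (CellAttachment.Filtration.mapStage h F F' d t).1,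
    ⟨rfl, fun t => funext fun d => CellAttachment.Filtration.step_mapStage h F F' d t,
      fun t d a => ?_, fun t => funext fun d =>
        CellAttachment.Filtration.mapStage_incl h F F' d t⟩, ?_⟩
  · rw [(CellAttachment.Filtration.mapStage h F F' d t).2, ← Category.assoc,
      h.envGen_cellMap, Category.assoc]
  · rintro ψ ⟨h0, h1, h2, -⟩
    refine CellAttachment.Filtration.hom_unique F F' h0 h1
      (fun t => funext fun d => CellAttachment.Filtration.step_mapStage h F F' d t) fun t d a => ?_
    rw [h2, (CellAttachment.Filtration.mapStage h F F' d t).2, ← Category.assoc, ← h.envGen_cellMap,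
      Category.assoc]
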